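/- **Conventions.** Let $G$ be a (finite-dimensional, real) Lie group with Lie algebra $\mathfrak g$ (bracket of left-invariant vector fields), equipped with a nondegenerate $\mathrm{ad}$-invariant symmetric bilinear form $\langle\cdot,\cdot\rangle$, used to identify $\mathfrak g^*\cong\mathfrak g$; let $(e_i),(e^i)$ be dual bases, $\theta^L$ the left Maurer–Cartan form, $\xi^L,\xi^R$ the left and right invariant vector fields, and $\phi(\alpha,\beta,\gamma)=\tfrac12\langle\alpha,[\beta,\gamma]\rangle$. The Schouten bracket extends the Lie bracket of vector fields and $[X,f]=Xf$ by $[P,Q\wedge R]=[P,Q]\wedge R+(-1)^{(p-1)q}Q\wedge[P,R]$, and $\beta(\pi^\sharp\alpha)=\pi(\alpha,\beta)$. Manifolds are smooth, finite-dimensional, Hausdorff, second countable and without boundary. A *Hamiltonian quasi-Poisson $\mathfrak g$-manifold* is $(M,\rho,\pi,\Phi)$, where $\rho:\mathfrak g\to\mathfrak X(M)$ is a Lie algebra homomorphism, $\pi$ is a bivector field with $[\pi,\rho(\xi)]=0$ for $\xi\in\mathfrak g$ and $[\pi,\pi]=\rho(\phi)$, and $\Phi:M\to G$ is smooth, equivariant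 ($\Phi_*\rho(\xi)=\xi^L-\xi^R$ along $\Phi$), and satisfies $\pi^\sharp(\Phi^*a)=\rho(\Phi^*(b^*a))$ for all $a\in\Omega^1(G)$, where $b(\xi)=\tfrac12(\xi^L+\xi^R)$. Morphisms are smooth maps that preserve $\rho$, $\pi$ and $\Phi$. Write $\rho^*:T^*M\to\mathfrak g^*\cong\mathfrak g$ for the transpose of $\rho$ and $i(\xi)=\Phi^*\langle\xi,\theta^L\rangle\in\Omega^1(M)$. The *fusion product* $M_1\circledast M_2$ is $M_1\times M_2$ with the diagonal action, the bivector field $\pi_1+\pi_2+\tfrac12\sum_i\rho_1(e^i)\wedge\rho_2(e_i)$ and the moment map $(x_1,x_2)\mapsto\Phi_2(x_2)\Phi_1(x_1)$. The bundle $T^*M$ carries the anchor $\pi^\sharp+\tfrac12\rho\circ\rho^*$ and the bracket $$[\alpha,\beta]=d\,\pi(\alpha,\beta)+\iota_{\pi^\sharp\alpha}d\beta-\iota_{\pi^\sharp\beta}d\alpha+\tfrac12\sum_i\big(\alpha(\rho(e^i))\mathcal L_{\rho(e_i)}\beta-\beta(\rho(e^i))\mathcal L_{\rho(e_i)}\alpha\big).$$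 A *comorphism* from a Lie algebroid $A\to M$ to a Lie algebroid $A'\to M'$ is a smooth map $\varphi:M\to M'$ with a vector bundle map $\varphi^*A'\to A$ over $M$ that intertwines the anchors via $T\varphi$ and induces a bracket-preserving map $\Gamma(A')\to\Gamma(A)$ (equivalently, a morphism of Gerstenhaber algebras $\Gamma(\bigwedge A')\to\Gamma(\bigwedge A)$). Lie algebroids and comorphisms are a monoidal category under the direct product $A\oplus B\to M\times N$. **Proposition.** Fusion is a well-defined monoidal structure on the category of Hamiltonian quasi-Poisson $\mathfrak g$-manifolds (the unit is a point with $\Phi=1$), direct product is a well-defined monoidal structure on the category of Lie algebroids and comorphisms, and $M\mapsto T^*M$, $f\mapsto f^*$, is a functor from the former category to the latter. For Hamiltonian quasi-Poisson $\mathfrak g$-manifolds $M_1,M_2$, the map $$J:T^*M_1\oplus T^*M_2\to T^*(M_1\circledast M_2),\qquad(\alpha,\beta)\mapsto\big(\alpha,\;\beta-i_2(\rho_1^*\alpha)\big)$$ is an isomorphism of Lie algebroids over $\mathrm{id}_{M_1\times M_2}$. Moreover $J$, viewed as a comorphism $T^*(M_1\circledast M_2)\to T^*M_1\oplus T^*M_2$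 over the identity, is natural in $M_1,M_2$ and is the structure isomorphism of a strong monoidal structure on the functor $M\mapsto T^*M$. -/

import Mathlib

open Bundle VectorField CategoryTheory
open scoped Manifold ContDiff Bundle

universe u

set_option linter.unusedSectionVars false

noncomputable section

namespace QuasiPoisson

/-! ### Smooth manifolds -/

/-- A finite-dimensional, Hausdorff, second countable smooth manifold without boundary. -/
structure SmoothManifold where
  carrier : Type u
  E : Type u
  H : Type u
  [normedAddCommGroup : NormedAddCommGroup E]
  [normedSpace : NormedSpace ℝ E]
  [finiteDimensional : FiniteDimensional ℝ E]
  [topologicalSpaceH : TopologicalSpace H]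
  [topologicalSpace : TopologicalSpace carrier]
  [t2Space : T2Space carrier]
  [secondCountable : SecondCountableTopology carrier]
  [chartedSpace : ChartedSpace H carrier]
  model : ModelWithCorners ℝ E H
  [boundaryless : model.Boundaryless]
  [isManifold : IsManifold model ∞ carrier]

attribute [instance] SmoothManifold.normedAddCommGroup SmoothManifold.normedSpace
  SmoothManifold.finiteDimensional SmoothManifold.topologicalSpaceH
  SmoothManifold.topologicalSpace SmoothManifold.t2Space SmoothManifold.secondCountable
  SmoothManifold.chartedSpace SmoothManifold.boundaryless SmoothManifold.isManifold

namespace SmoothManifold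

/-- The tangent space at a point. -/
abbrev T (M : SmoothManifold.{u}) (x : M.carrier) : Type u := TangentSpace M.model x

/-- The cotangent space at a point. (The constant bundle `Trivial M ℝ` is the real line.) -/
abbrev Cot (M : SmoothManifold.{u}) (x : M.carrier) : Type u :=
  TangentSpace M.model x →L[ℝ] Bundle.Trivial M.carrier ℝ x

/-- Smooth maps between manifolds. -/
abbrev Smooth (M N : SmoothManifold.{u}) (f : M.carrier → N.carrier) : Prop :=
  ContMDiff M.model N.model ∞ f

/-- Smooth real functions. -/
abbrev SmoothFun (M : SmoothManifold.{u}) (f : M.carrier → ℝ) : Prop :=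
  ContMDiff M.model 𝓘(ℝ, ℝ) ∞ f

/-- Smooth vector fields. -/
def SmoothVF (M : SmoothManifold.{u}) (X : ∀ x, M.T x) : Prop :=
  ContMDiff M.model (M.model.prod 𝓘(ℝ, M.E)) ∞ (fun x => TotalSpace.mk' M.E x (X x))

/-- Smooth one-forms, i.e. smooth sections of the cotangent bundle. -/
def SmoothForm (M : SmoothManifold.{u}) (α : ∀ x, M.Cot x) : Prop :=
  ContMDiff M.model (M.model.prod 𝓘(ℝ, M.E →L[ℝ] ℝ)) ∞
    (fun x => TotalSpace.mk' (M.E →L[ℝ] ℝ) x (α x))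

/-- The differential at `x` of a map between manifolds. -/
abbrev D (M N : SmoothManifold.{u}) (f : M.carrier → N.carrier) (x : M.carrier) :
    M.T x →L[ℝ] N.T (f x) := mfderiv M.model N.model f x

/-- The differential of a real function, a one-form. -/
def d (M : SmoothManifold.{u}) (f : M.carrier → ℝ) (x : M.carrier) : M.Cot x :=
  mvfderiv M.model f x

theorem D_comp {M N P : SmoothManifold.{u}} {f : M.carrier → N.carrier}
    {g : N.carrier → P.carrier} (hg : N.Smooth P g) (hf : M.Smooth N f) (x : M.carrier) :
    M.D P (fun x => g (f x)) x = (N.D P g (f x)).comp (M.D N f x) :=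
  mfderiv_comp x (hg.mdifferentiableAt (by simp)) (hf.mdifferentiableAt (by simp))

/-- The pullback of covectors along a map. -/
def pullCot (M N : SmoothManifold.{u}) (f : M.carrier → N.carrier) (x : M.carrier) :
    N.Cot (f x) →ₗ[ℝ] M.Cot x where
  toFun a := show M.T x →L[ℝ] ℝ from (show N.T (f x) →L[ℝ] ℝ from a).comp (M.D N f x)
  map_add' _ _ := rfl
  map_smul' _ _ := rfl

theorem pullCot_id (M : SmoothManifold.{u}) (x : M.carrier) (a : M.Cot x) :
    M.pullCot M (fun x => x) x a = a := by
  have h : M.D M (fun x => x) x = ContinuousLinearMap.id ℝ (M.T x) := mfderiv_id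
  change (show M.T x →L[ℝ] ℝ from a).comp (M.D M (fun x => x) x) = a
  rw [h]; rfl

theorem pullCot_comp {M N P : SmoothManifold.{u}} {f : M.carrier → N.carrier}
    {g : N.carrier → P.carrier} (hg : N.Smooth P g) (hf : M.Smooth N f) (x : M.carrier)
    (a : P.Cot (g (f x))) :
    M.pullCot P (fun x => g (f x)) x a = M.pullCot N f x (N.pullCot P g (f x) a) := by
  change (show P.T (g (f x)) →L[ℝ] ℝ from a).comp (M.D P (fun x => g (f x)) x) = _
  rw [D_comp hg hf]
  rfl

/-- The identification of `T_x M` with the model vector space given by the preferred chart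
at `x`. -/
def chartAtL (M : SmoothManifold.{u}) (x : M.carrier) : M.T x →L[ℝ] M.E :=
  (trivializationAt M.E (TangentSpace M.model) x).continuousLinearMapAt ℝ x

/-- The covector field `α` near `x`, written in the coordinates given by the preferred chart
at `x`; it takes values in the dual of the model vector space. -/
def formInChart (M : SmoothManifold.{u}) (α : ∀ x, M.Cot x) (x y : M.carrier) : M.E →L[ℝ] ℝ :=
  (show TangentSpace M.model y →L[ℝ] ℝ from α y).comp
    ((trivializationAt M.E (TangentSpace M.model) x).symmL ℝ y)

/-- `ι_v dα` at `x`, for a one-form `α` and `v ∈ T_x M`, where `dα = ∑ ∂_j α_i dx^j ∧ dx^i` is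
computed in the preferred chart at `x`. -/
def contrD (M : SmoothManifold.{u}) (α : ∀ x, M.Cot x) (x : M.carrier) (v : M.T x) : M.Cot x :=
  let Dα : M.T x →L[ℝ] (M.E →L[ℝ] ℝ) := mvfderiv M.model (M.formInChart α x) x
  (show M.T x →L[ℝ] ℝ from
    (Dα v).comp (M.chartAtL x) - (ContinuousLinearMap.apply ℝ ℝ (M.chartAtL x v)).comp Dα)

/-- The Lie derivative `L_X α = ι_X dα + d (α(X))` of a one-form. -/
def lieD (M : SmoothManifold.{u}) (X : ∀ x, M.T x) (α : ∀ x, M.Cot x) (x : M.carrier) : M.Cot x :=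
  M.contrD α x (X x) + M.d (fun y => α y (X y)) x

/-- The product manifold. -/
abbrev prod (M N : SmoothManifold.{u}) : SmoothManifold.{u} where
  carrier := M.carrier × N.carrier
  E := M.E × N.E
  H := ModelProd M.H N.H
  model := M.model.prod N.model

/-- The one-point manifold. -/
abbrev point : SmoothManifold.{u} where
  carrier := PUnit
  E := PUnit
  H := PUnit
  model := 𝓘(ℝ, PUnit)

end SmoothManifold

/-! ### Lie algebroids and comorphisms -/

/-- A smooth real vector bundle of finite rank `V → base`, with an anchor and a bracket of
sections. The bracket is written as an operation on all set-theoretic sections; only its values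
on smooth sections are ever used. -/
structure AlgebroidData where
  base : SmoothManifold.{u}
  F : Type u
  [normedAddCommGroup : NormedAddCommGroup F]
  [normedSpace : NormedSpace ℝ F]
  [finiteDimensional : FiniteDimensional ℝ F]
  V : base.carrier → Type u
  [addCommGroup : ∀ x, AddCommGroup (V x)]
  [module : ∀ x, Module ℝ (V x)]
  [topologicalSpaceV : ∀ x, TopologicalSpace (V x)]
  [topologicalSpaceTotal : TopologicalSpace (TotalSpace F V)]
  [fiberBundle : FiberBundle F V]
  [vectorBundle : VectorBundle ℝ F V]
  [smoothBundle : ContMDiffVectorBundle ∞ F V base.model]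
  anchor : ∀ x, V x →ₗ[ℝ] base.T x
  bracket : (∀ x, V x) → (∀ x, V x) → ∀ x, V x

attribute [instance] AlgebroidData.normedAddCommGroup AlgebroidData.normedSpace
  AlgebroidData.finiteDimensional AlgebroidData.addCommGroup AlgebroidData.module
  AlgebroidData.topologicalSpaceV AlgebroidData.topologicalSpaceTotal
  AlgebroidData.fiberBundle AlgebroidData.vectorBundle AlgebroidData.smoothBundle

namespace AlgebroidData

/-- Smooth sections of the vector bundle. -/
def SmoothSection (A : AlgebroidData.{u}) (σ : ∀ x, A.V x) : Prop :=
  ContMDiff A.base.model (A.base.model.prod 𝓘(ℝ, A.F)) ∞ (fun x => TotalSpace.mk' A.F x (σ x))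

/-- The Lie algebroid axioms. (Homogeneity of the bracket under real scalars is the Leibniz rule
for constant functions.) -/
structure IsLieAlgebroid (A : AlgebroidData.{u}) : Prop where
  anchor_smooth : ∀ σ, A.SmoothSection σ → A.base.SmoothVF (fun x => A.anchor x (σ x))
  bracket_smooth : ∀ σ τ, A.SmoothSection σ → A.SmoothSection τ →
    A.SmoothSection (A.bracket σ τ)
  bracket_add : ∀ σ τ υ, A.SmoothSection σ → A.SmoothSection τ → A.SmoothSection υ →
    A.bracket σ (τ + υ) = A.bracket σ τ + A.bracket σ υ
  bracket_skew : ∀ σ τ, A.SmoothSection σ → A.SmoothSection τ →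
    A.bracket σ τ = - A.bracket τ σ
  jacobi : ∀ σ τ υ, A.SmoothSection σ → A.SmoothSection τ → A.SmoothSection υ →
    A.bracket σ (A.bracket τ υ) =
      A.bracket (A.bracket σ τ) υ + A.bracket τ (A.bracket σ υ)
  leibniz : ∀ (f : A.base.carrier → ℝ) (σ τ), A.base.SmoothFun f → A.SmoothSection σ →
    A.SmoothSection τ → ∀ x, A.bracket σ (fun y => f y • τ y) x =
      f x • A.bracket σ τ x + (A.base.d f x (A.anchor x (σ x)) : ℝ) • τ x
  anchor_bracket : ∀ σ τ, A.SmoothSection σ → A.SmoothSection τ → ∀ x,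
    A.anchor x (A.bracket σ τ x) =
      mlieBracket A.base.model (fun y => A.anchor y (σ y)) (fun y => A.anchor y (τ y)) x

/-- The derivative at `y`, in the direction `w`, of a map `s` from a manifold to a single fibre
`V_x` of a vector bundle. (The finite-dimensional vector space `V_x` is identified with the
standard fibre by a linear isomorphism; the result does not depend on it.) -/
def fibreDeriv (A : AlgebroidData.{u}) (N : SmoothManifold.{u}) (x : A.base.carrier)
    (s : N.carrier → A.V x) (y : N.carrier) (w : N.T y) : A.V x :=
  (trivializationAt A.F A.V x).symm x
    (mvfderiv N.model (fun y' => (trivializationAt A.F A.V x).continuousLinearMapAt ℝ x (s y')) y w)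

end AlgebroidData

/-- A fibrewise linear map `φ^* A' → A` over the base of `A`, where `φ` maps the base of `A` to
the base of `A'`. -/
@[ext]
structure BundleComorphism (A A' : AlgebroidData.{u}) where
  base : A.base.carrier → A'.base.carrier
  fib : ∀ x, A'.V (base x) →ₗ[ℝ] A.V x

namespace BundleComorphism

/-- The induced map from sections of `A'` to sections of `A`. -/
def pull {A A' : AlgebroidData.{u}} (Ψ : BundleComorphism A A') (σ : ∀ y, A'.V y) :
    ∀ x, A.V x := fun x => Ψ.fib x (σ (Ψ.base x))

/-- Comorphisms of Lie algebroids from `A` to `A'`: the map on sections is a morphism for the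
brackets and the anchors are related by the base map, so that it extends to a morphism
`Γ(⋀A') → Γ(⋀A)` of Gerstenhaber algebras. -/
structure IsComorphism {A A' : AlgebroidData.{u}} (Ψ : BundleComorphism A A') : Prop where
  base_smooth : A.base.Smooth A'.base Ψ.base
  pull_smooth : ∀ σ, A'.SmoothSection σ → A.SmoothSection (Ψ.pull σ)
  anchor : ∀ x (v : A'.V (Ψ.base x)),
    A.base.D A'.base Ψ.base x (A.anchor x (Ψ.fib x v)) = A'.anchor (Ψ.base x) v
  bracket : ∀ σ τ, A'.SmoothSection σ → A'.SmoothSection τ →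
    Ψ.pull (A'.bracket σ τ) = A.bracket (Ψ.pull σ) (Ψ.pull τ)

/-- The identity. -/
def id (A : AlgebroidData.{u}) : BundleComorphism A A where
  base x := x
  fib _ := LinearMap.id

/-- Composition. -/
def comp {A B C : AlgebroidData.{u}} (Ψ : BundleComorphism A B) (Χ : BundleComorphism B C) :
    BundleComorphism A C where
  base x := Χ.base (Ψ.base x)
  fib x := Ψ.fib x ∘ₗ Χ.fib (Ψ.base x)

theorem isComorphism_id (A : AlgebroidData.{u}) : (id A).IsComorphism where
  base_smooth := contMDiff_id
  pull_smooth _ h := h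
  anchor x v := by
    change mfderiv A.base.model A.base.model (fun x => x) x (A.anchor x v) = A.anchor x v
    rw [show (fun x : A.base.carrier => x) = _root_.id from rfl, mfderiv_id]
    rfl
  bracket _ _ _ _ := rfl

theorem IsComorphism.comp {A B C : AlgebroidData.{u}} {Ψ : BundleComorphism A B}
    {Χ : BundleComorphism B C} (hΨ : Ψ.IsComorphism) (hΧ : Χ.IsComorphism) :
    (Ψ.comp Χ).IsComorphism where
  base_smooth := hΧ.base_smooth.comp hΨ.base_smooth
  pull_smooth σ h := hΨ.pull_smooth _ (hΧ.pull_smooth σ h)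
  anchor x v := by
    have h : mfderiv A.base.model C.base.model (Χ.base ∘ Ψ.base) x =
        (mfderiv B.base.model C.base.model Χ.base (Ψ.base x)).comp
          (mfderiv A.base.model B.base.model Ψ.base x) :=
      mfderiv_comp x (hΧ.base_smooth.mdifferentiableAt (by simp))
        (hΨ.base_smooth.mdifferentiableAt (by simp))
    change mfderiv A.base.model C.base.model (Χ.base ∘ Ψ.base) x
      (A.anchor x (Ψ.fib x (Χ.fib (Ψ.base x) v))) = _
    rw [h]
    exact (congrArg _ (hΨ.anchor x (Χ.fib (Ψ.base x) v))).trans (hΧ.anchor (Ψ.base x) v)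
  bracket σ τ hσ hτ := by
    have h₁ := hΧ.bracket σ τ hσ hτ
    have h₂ := hΨ.bracket _ _ (hΧ.pull_smooth σ hσ) (hΧ.pull_smooth τ hτ)
    rw [← h₁] at h₂
    exact h₂

end BundleComorphism

/-- Lie algebroids. -/
structure LieAlgebroid where
  data : AlgebroidData.{u}
  isLie : data.IsLieAlgebroid

/-- Comorphisms of Lie algebroids. -/
@[ext]
structure Comorphism (A A' : LieAlgebroid.{u}) where
  toBundle : BundleComorphism A.data A'.data
  isComorphism : toBundle.IsComorphism

/-- The category of Lie algebroids and comorphisms. -/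
instance : Category LieAlgebroid.{u} where
  Hom := Comorphism
  id A := ⟨BundleComorphism.id A.data, BundleComorphism.isComorphism_id A.data⟩
  comp Ψ Χ := ⟨Ψ.toBundle.comp Χ.toBundle, Ψ.isComorphism.comp Χ.isComorphism⟩

/-! ### Direct products of Lie algebroids -/

namespace AlgebroidData

/-- The direct product of Lie algebroids, on the exterior direct sum `pr₁^* A ⊕ pr₂^* B` over the
product of the bases, with the sum of the anchors. The bracket is the one that restricts to the
brackets of `A` and `B` on sections pulled back from the factors, for which sections pulled back
from different factors commute. -/
def prod (A B : AlgebroidData.{u}) : AlgebroidData.{u} where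
  base := A.base.prod B.base
  F := A.F × B.F
  V := (((ContMDiffMap.fst : C^∞⟮A.base.model.prod B.base.model,
      A.base.carrier × B.base.carrier; A.base.model, A.base.carrier⟯) :
      A.base.carrier × B.base.carrier → A.base.carrier) *ᵖ A.V) ×ᵇ
    (((ContMDiffMap.snd : C^∞⟮A.base.model.prod B.base.model,
      A.base.carrier × B.base.carrier; B.base.model, B.base.carrier⟯) :
      A.base.carrier × B.base.carrier → B.base.carrier) *ᵖ B.V)
  addCommGroup p := inferInstanceAs (AddCommGroup (A.V p.1 × B.V p.2))
  module p := inferInstanceAs (Module ℝ (A.V p.1 × B.V p.2))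
  anchor p :=
    ((A.base.D (A.base.prod B.base) (fun x => (x, p.2)) p.1).toLinearMap ∘ₗ A.anchor p.1).coprod
      ((B.base.D (A.base.prod B.base) (fun y => (p.1, y)) p.2).toLinearMap ∘ₗ B.anchor p.2)
  bracket σ τ p :=
    (A.bracket (fun x => (σ (x, p.2)).1) (fun x => (τ (x, p.2)).1) p.1
        + A.fibreDeriv B.base p.1 (fun y => (τ (p.1, y)).1) p.2 (B.anchor p.2 (σ p).2)
        - A.fibreDeriv B.base p.1 (fun y => (σ (p.1, y)).1) p.2 (B.anchor p.2 (τ p).2),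
      B.bracket (fun y => (σ (p.1, y)).2) (fun y => (τ (p.1, y)).2) p.2
        + B.fibreDeriv A.base p.2 (fun x => (τ (x, p.2)).2) p.1 (A.anchor p.1 (σ p).1)
        - B.fibreDeriv A.base p.2 (fun x => (σ (x, p.2)).2) p.1 (A.anchor p.1 (τ p).1))

end AlgebroidData

namespace AlgebroidData

/-- The zero Lie algebroid over the point. -/
abbrev unit : AlgebroidData.{u} where
  base := SmoothManifold.point
  F := PUnit
  V := Bundle.Trivial PUnit PUnit
  anchor _ := 0
  bracket _ _ _ := PUnit.unit

end AlgebroidData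

namespace BundleComorphism

variable {A A' B B' : AlgebroidData.{u}}

/-- The product of two fibrewise linear maps. -/
def prodMap (Ψ : BundleComorphism A A') (Χ : BundleComorphism B B') :
    BundleComorphism (A.prod B) (A'.prod B') where
  base p := (Ψ.base p.1, Χ.base p.2)
  fib p := LinearMap.prodMap (M := A'.V (Ψ.base p.1)) (M₂ := B'.V (Χ.base p.2)) (M₃ := A.V p.1)
    (M₄ := B.V p.2) (Ψ.fib p.1) (Χ.fib p.2)

/-- Reassociation of products. -/
def assocHom (A B C : AlgebroidData.{u}) :
    BundleComorphism ((A.prod B).prod C) (A.prod (B.prod C)) where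
  base p := (p.1.1, (p.1.2, p.2))
  fib p := (LinearEquiv.prodAssoc ℝ (A.V p.1.1) (B.V p.1.2) (C.V p.2)).symm.toLinearMap

/-- Inverse reassociation of products. -/
def assocInv (A B C : AlgebroidData.{u}) :
    BundleComorphism (A.prod (B.prod C)) ((A.prod B).prod C) where
  base p := ((p.1, p.2.1), p.2.2)
  fib p := (LinearEquiv.prodAssoc ℝ (A.V p.1) (B.V p.2.1) (C.V p.2.2)).toLinearMap

/-- Removal of the unit on the left. -/
def leftHom (A : AlgebroidData.{u}) :
    BundleComorphism (AlgebroidData.unit.prod A) A where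
  base p := p.2
  fib p := LinearMap.inr ℝ PUnit.{u+1} (A.V p.2)

/-- Insertion of the unit on the left. -/
def leftInv (A : AlgebroidData.{u}) :
    BundleComorphism A (AlgebroidData.unit.prod A) where
  base x := (PUnit.unit, x)
  fib x := LinearMap.snd ℝ PUnit.{u+1} (A.V x)

/-- Removal of the unit on the right. -/
def rightHom (A : AlgebroidData.{u}) :
    BundleComorphism (A.prod AlgebroidData.unit) A where
  base p := p.1
  fib p := LinearMap.inl ℝ (A.V p.1) PUnit.{u+1}

/-- Insertion of the unit on the right. -/
def rightInv (A : AlgebroidData.{u}) :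
    BundleComorphism A (A.prod AlgebroidData.unit) where
  base x := (x, PUnit.unit)
  fib x := LinearMap.fst ℝ (A.V x) PUnit.{u+1}

end BundleComorphism

/-- The direct product is well defined on Lie algebroids and comorphisms. -/
structure ProductWellDefined : Prop where
  prod : ∀ A B : LieAlgebroid.{u}, (A.data.prod B.data).IsLieAlgebroid
  unit : AlgebroidData.unit.{u}.IsLieAlgebroid
  prodMap : ∀ {A A' B B' : LieAlgebroid.{u}} (Ψ : A ⟶ A') (Χ : B ⟶ B'),
    (Ψ.toBundle.prodMap Χ.toBundle).IsComorphism
  assocHom : ∀ A B C : LieAlgebroid.{u},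
    (BundleComorphism.assocHom A.data B.data C.data).IsComorphism
  assocInv : ∀ A B C : LieAlgebroid.{u},
    (BundleComorphism.assocInv A.data B.data C.data).IsComorphism
  leftHom : ∀ A : LieAlgebroid.{u}, (BundleComorphism.leftHom A.data).IsComorphism
  leftInv : ∀ A : LieAlgebroid.{u}, (BundleComorphism.leftInv A.data).IsComorphism
  rightHom : ∀ A : LieAlgebroid.{u}, (BundleComorphism.rightHom A.data).IsComorphism
  rightInv : ∀ A : LieAlgebroid.{u}, (BundleComorphism.rightInv A.data).IsComorphism

/-- The monoidal structure on Lie algebroids and comorphisms given by direct products. -/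
abbrev productMonoidal (h : ProductWellDefined.{u}) : MonoidalCategory LieAlgebroid.{u} :=
  letI : MonoidalCategoryStruct LieAlgebroid.{u} :=
    { tensorObj := fun A B => ⟨A.data.prod B.data, h.prod A B⟩
      tensorUnit := ⟨AlgebroidData.unit, h.unit⟩
      tensorHom := fun Ψ Χ => ⟨Ψ.toBundle.prodMap Χ.toBundle, h.prodMap Ψ Χ⟩
      whiskerLeft := fun A _ _ Χ => ⟨(𝟙 A : A ⟶ A).toBundle.prodMap Χ.toBundle, h.prodMap (𝟙 A) Χ⟩
      whiskerRight := fun Ψ B => ⟨Ψ.toBundle.prodMap (𝟙 B : B ⟶ B).toBundle, h.prodMap Ψ (𝟙 B)⟩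
      associator := fun A B C =>
        { hom := ⟨BundleComorphism.assocHom A.data B.data C.data, h.assocHom A B C⟩
          inv := ⟨BundleComorphism.assocInv A.data B.data C.data, h.assocInv A B C⟩
          hom_inv_id := rfl
          inv_hom_id := rfl }
      leftUnitor := fun A =>
        { hom := ⟨BundleComorphism.leftHom A.data, h.leftHom A⟩
          inv := ⟨BundleComorphism.leftInv A.data, h.leftInv A⟩
          hom_inv_id := rfl
          inv_hom_id := rfl }
      rightUnitor := fun A =>
        { hom := ⟨BundleComorphism.rightHom A.data, h.rightHom A⟩
          inv := ⟨BundleComorphism.rightInv A.data, h.rightInv A⟩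
          hom_inv_id := rfl
          inv_hom_id := rfl } }
  MonoidalCategory.ofTensorHom
    (id_tensorHom_id := fun _ _ => rfl)
    (id_tensorHom := fun _ _ _ _ => rfl)
    (tensorHom_id := fun _ _ => rfl)
    (tensorHom_comp_tensorHom := fun _ _ _ _ => rfl)
    (associator_naturality := fun _ _ _ => rfl)
    (leftUnitor_naturality := fun _ => rfl)
    (rightUnitor_naturality := fun _ => rfl)
    (pentagon := fun _ _ _ _ => rfl)
    (triangle := fun _ _ => rfl)

/-- An isomorphism `Λ : A → B` of Lie algebroids over a diffeomorphism `φ` of their bases. -/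
structure IsLieAlgebroidIso {A B : AlgebroidData.{u}}
    (φ : A.base.carrier ≃ₘ^∞⟮A.base.model, B.base.model⟯ B.base.carrier)
    (Λ : ∀ x, A.V x →ₗ[ℝ] B.V (φ x)) : Prop where
  bijective : ∀ x, Function.Bijective (Λ x)
  smooth : ∀ σ τ, (∀ x, Λ x (σ x) = τ (φ x)) → (A.SmoothSection σ ↔ B.SmoothSection τ)
  anchor : ∀ x v, A.base.D B.base φ x (A.anchor x v) = B.anchor (φ x) (Λ x v)
  bracket : ∀ σ₁ σ₂ τ₁ τ₂, A.SmoothSection σ₁ → A.SmoothSection σ₂ →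
    (∀ x, Λ x (σ₁ x) = τ₁ (φ x)) → (∀ x, Λ x (σ₂ x) = τ₂ (φ x)) →
    ∀ x, Λ x (A.bracket σ₁ σ₂ x) = B.bracket τ₁ τ₂ (φ x)

/-! ### Hamiltonian quasi-Poisson manifolds -/

section LieGroup

variable {EG : Type*} [NormedAddCommGroup EG] [NormedSpace ℝ EG] [FiniteDimensional ℝ EG]
  {HG : Type*} [TopologicalSpace HG] {IG : ModelWithCorners ℝ EG HG}
  {G : Type*} [TopologicalSpace G] [ChartedSpace HG G] [Group G]

/-- The right-invariant vector field `ξ^R`. (The left-invariant one is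
`mulInvariantVectorField ξ`.) -/
def rightInvariantVectorField (ξ : GroupLieAlgebra IG G) (g : G) : TangentSpace IG g :=
  mfderiv IG IG (fun h : G => h * g) (1 : G) ξ

/-- Left translation from the Lie algebra to the tangent space at `g`. -/
def leftTranslation (g : G) : GroupLieAlgebra IG G →L[ℝ] TangentSpace IG g :=
  mfderiv IG IG (fun h : G => g * h) (1 : G)

/-- The left Maurer-Cartan form, characterized by `θ^L(ξ^L) = ξ`. -/
def thetaL (g : G) : TangentSpace IG g →L[ℝ] GroupLieAlgebra IG G :=
  (leftTranslation (IG := IG) g).inverse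

variable (IG G) in
/-- A nondegenerate invariant symmetric bilinear form (of any signature) on the Lie algebra. -/
structure InvariantForm where
  form : LinearMap.BilinForm ℝ (GroupLieAlgebra IG G)
  symm : form.IsSymm
  nondegenerate : form.Nondegenerate
  invariant : ∀ ξ η ζ, form ⁅ξ, η⁆ ζ = form ξ ⁅η, ζ⁆

/-- The identification `𝔤^* ≅ 𝔤` given by the form. -/
def InvariantForm.sharp (B : InvariantForm IG G) :
    Module.Dual ℝ (GroupLieAlgebra IG G) →ₗ[ℝ] GroupLieAlgebra IG G :=
  haveI : FiniteDimensional ℝ (GroupLieAlgebra IG G) := inferInstanceAs (FiniteDimensional ℝ EG)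
  (LinearMap.BilinForm.toDual B.form B.nondegenerate).symm.toLinearMap

/-- The continuous linear form `⟨ξ, ·⟩`. -/
def InvariantForm.flat (B : InvariantForm IG G) :
    GroupLieAlgebra IG G →ₗ[ℝ] (GroupLieAlgebra IG G →L[ℝ] ℝ) :=
  haveI : FiniteDimensional ℝ (GroupLieAlgebra IG G) := inferInstanceAs (FiniteDimensional ℝ EG)
  haveI : T2Space (GroupLieAlgebra IG G) := inferInstanceAs (T2Space EG)
  (LinearMap.toContinuousLinearMap :
    (GroupLieAlgebra IG G →ₗ[ℝ] ℝ) ≃ₗ[ℝ] (GroupLieAlgebra IG G →L[ℝ] ℝ)).toLinearMap ∘ₗ B.form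

/-- The linear form `ξ ↦ a (½ (ξ^L(g) + ξ^R(g)))` on the Lie algebra, for a covector `a` at `g`. -/
def bStar (g : G) (a : TangentSpace IG g →L[ℝ] ℝ) : Module.Dual ℝ (GroupLieAlgebra IG G) :=
  (a.comp ((2⁻¹ : ℝ) • (leftTranslation (IG := IG) g +
    (show GroupLieAlgebra IG G →L[ℝ] TangentSpace IG g from
      mfderiv IG IG (fun h : G => h * g) (1 : G))))).toLinearMap

variable (IG G) in
/-- A manifold with a linear family `ρ` of vector fields indexed by the Lie algebra of `G`,
a contravariant two-tensor field `π` and a map `Φ` to `G`. The tensor `π` is recorded through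
`π^♯ : T^*M → TM`, where `β(π^♯ α) = π(α, β)`. -/
structure HamData where
  mfd : SmoothManifold.{u}
  action : GroupLieAlgebra IG G →ₗ[ℝ] (∀ x, mfd.T x)
  piSharp : ∀ x, mfd.Cot x →ₗ[ℝ] mfd.T x
  moment : mfd.carrier → G

namespace HamData

variable (M : HamData.{u} IG G) (B : InvariantForm IG G)

/-- The function `π(α, β)`. -/
def pi (α β : ∀ x, M.mfd.Cot x) (x : M.mfd.carrier) : ℝ := β x (M.piSharp x (α x))

/-- The function `{f, g} = π(df, dg)`. -/
def poisson (f g : M.mfd.carrier → ℝ) (x : M.mfd.carrier) : ℝ := M.pi (M.mfd.d f) (M.mfd.d g) x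

/-- The derivative of a function along the vector field `ρ(ξ)`. -/
def act (ξ : GroupLieAlgebra IG G) (f : M.mfd.carrier → ℝ) (x : M.mfd.carrier) : ℝ :=
  M.mfd.d f x (M.action ξ x)

/-- `ρ` at the point `x`. -/
def actionAt (x : M.mfd.carrier) : GroupLieAlgebra IG G →ₗ[ℝ] M.mfd.T x :=
  LinearMap.proj x ∘ₗ M.action

/-- The transpose `ρ^* : T^*M → 𝔤^* ≅ 𝔤` of `ρ`. In terms of dual bases,
`ρ^* α = ∑ α(ρ(e^i)) e_i`. -/
def rhoStar (x : M.mfd.carrier) : M.mfd.Cot x →ₗ[ℝ] GroupLieAlgebra IG G :=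
  B.sharp ∘ₗ (
    { toFun := fun α => (show M.mfd.T x →L[ℝ] ℝ from α).toLinearMap ∘ₗ M.actionAt x
      map_add' := fun _ _ => rfl
      map_smul' := fun _ _ => rfl } :
      M.mfd.Cot x →ₗ[ℝ] Module.Dual ℝ (GroupLieAlgebra IG G))

/-- The differential of the moment map. -/
def dMoment (x : M.mfd.carrier) : M.mfd.T x →L[ℝ] TangentSpace IG (M.moment x) :=
  mfderiv M.mfd.model IG M.moment x

/-- Hamiltonian quasi-Poisson `𝔤`-manifolds. -/
structure IsHamiltonian : Prop where
  /-- `ρ` is an action of the Lie algebra. -/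
  action_smooth : ∀ ξ, M.mfd.SmoothVF (M.action ξ)
  action_bracket : ∀ ξ η x,
    M.action ⁅ξ, η⁆ x = mlieBracket M.mfd.model (M.action ξ) (M.action η) x
  /-- `π` is a smooth bivector field. -/
  pi_smooth : ∀ α, M.mfd.SmoothForm α → M.mfd.SmoothVF (fun x => M.piSharp x (α x))
  pi_skew : ∀ (x) (α β : M.mfd.Cot x), (β (M.piSharp x α) : ℝ) = - α (M.piSharp x β)
  /-- `[π, ρ(ξ)] = 0`, i.e. `π` is invariant. -/
  pi_invariant : ∀ (ξ) (f g : M.mfd.carrier → ℝ), M.mfd.SmoothFun f → M.mfd.SmoothFun g → ∀ x,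
    M.act ξ (M.poisson f g) x = M.poisson (M.act ξ f) g x + M.poisson f (M.act ξ g) x
  /-- `[π, π] = ρ(φ)` with `φ(α, β, γ) = ½ α([β^♯, γ^♯])`, evaluated on differentials of functions.
  For the Schouten bracket that extends the Lie bracket of vector fields and `[X, f] = X f` by the
  rule `[P, Q ∧ R] = [P, Q] ∧ R + (-1)^{(p - 1) q} Q ∧ [P, R]` one has
  `[π, π](df, dg, dh) = -2 ({{f, g}, h} + {{g, h}, f} + {{h, f}, g})`. -/
  pi_pi : ∀ f g h : M.mfd.carrier → ℝ, M.mfd.SmoothFun f → M.mfd.SmoothFun g →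
    M.mfd.SmoothFun h → ∀ x,
    -2 * (M.poisson (M.poisson f g) h x + M.poisson (M.poisson g h) f x
        + M.poisson (M.poisson h f) g x) =
      1 / 2 * (M.mfd.d f x
        (M.action ⁅M.rhoStar B x (M.mfd.d g x), M.rhoStar B x (M.mfd.d h x)⁆ x) : ℝ)
  /-- `Φ` is smooth and equivariant for the conjugation action `ξ ↦ ξ^L - ξ^R` on `G`. -/
  moment_smooth : ContMDiff M.mfd.model IG ∞ M.moment
  moment_equivariant : ∀ ξ x, M.dMoment x (M.action ξ x) =
    mulInvariantVectorField ξ (M.moment x) - rightInvariantVectorField ξ (M.moment x)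
  /-- `π^♯(Φ^* a) = ρ(Φ^*(b^* a))`, where `b(ξ) = ½ (ξ^L + ξ^R)`. -/
  moment_map : ∀ (x) (a : TangentSpace IG (M.moment x) →L[ℝ] ℝ),
    M.piSharp x (a.comp (M.dMoment x)) = M.action (B.sharp (bStar (M.moment x) a)) x

/-- The one-forms `i(ξ) = Φ^* ⟨ξ, θ^L⟩`, at the point `x`. -/
def iForm (x : M.mfd.carrier) : GroupLieAlgebra IG G →ₗ[ℝ] M.mfd.Cot x where
  toFun ξ := show M.mfd.T x →L[ℝ] ℝ from
    (B.flat ξ).comp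
      ((thetaL (M.moment x)).comp (M.dMoment x))
  map_add' ξ η := by rw [map_add]; rfl
  map_smul' c ξ := by rw [map_smul]; rfl

/-- The Lie algebroid `T^*M`: the anchor is `π^♯ + ½ ρ ∘ ρ^*` and the bracket is
`[α, β] = d(π(α, β)) + ι_{π^♯ α} dβ - ι_{π^♯ β} dα
  + ½ ∑ (α(ρ(e^i)) L_{ρ(e_i)} β - β(ρ(e^i)) L_{ρ(e_i)} α)`. -/
def cotangent : AlgebroidData.{u} where
  base := M.mfd
  F := M.mfd.E →L[ℝ] ℝ
  V := M.mfd.Cot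
  anchor x := M.piSharp x + (2⁻¹ : ℝ) • (M.actionAt x ∘ₗ M.rhoStar B x)
  bracket α β x :=
    M.mfd.d (M.pi α β) x + M.mfd.contrD β x (M.piSharp x (α x))
      - M.mfd.contrD α x (M.piSharp x (β x))
      + (2⁻¹ : ℝ) • (M.mfd.lieD (M.action (M.rhoStar B x (α x))) β x
          - M.mfd.lieD (M.action (M.rhoStar B x (β x))) α x)

/-- The structure on the product `M ⊛ N` of two Hamiltonian quasi-Poisson manifolds: the diagonal
action, the bivector field `π_M + π_N + ½ ∑ ρ_M(e^i) ∧ ρ_N(e_i)`, and the moment map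
`(x, y) ↦ Φ_N(y) Φ_M(x)`. (For this sign of the fusion term and the conventions of `IsHamiltonian`,
this order of the product is the one for which the moment map condition is inherited.) -/
def fusion (N : HamData.{u} IG G) : HamData.{u} IG G where
  mfd := M.mfd.prod N.mfd
  action :=
    { toFun := fun ξ p => M.mfd.D (M.mfd.prod N.mfd) (fun x => (x, p.2)) p.1 (M.action ξ p.1)
        + N.mfd.D (M.mfd.prod N.mfd) (fun y => (p.1, y)) p.2 (N.action ξ p.2)
      map_add' := fun ξ η => by
        funext p
        simp only [map_add, Pi.add_apply]
        exact add_add_add_comm _ _ _ _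
      map_smul' := fun c ξ => by
        funext p
        simp only [map_smul, Pi.smul_apply, RingHom.id_apply]
        exact (smul_add c _ _).symm }
  piSharp p :=
    let ι₁ := M.mfd.D (M.mfd.prod N.mfd) (fun x => (x, p.2)) p.1
    let ι₂ := N.mfd.D (M.mfd.prod N.mfd) (fun y => (p.1, y)) p.2
    let r₁ := M.mfd.pullCot (M.mfd.prod N.mfd) (fun x => (x, p.2)) p.1
    let r₂ := N.mfd.pullCot (M.mfd.prod N.mfd) (fun y => (p.1, y)) p.2
    ι₁.toLinearMap ∘ₗ
        (M.piSharp p.1 ∘ₗ r₁ - (2⁻¹ : ℝ) • (M.actionAt p.1 ∘ₗ N.rhoStar B p.2 ∘ₗ r₂))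
      + ι₂.toLinearMap ∘ₗ
        (N.piSharp p.2 ∘ₗ r₂ + (2⁻¹ : ℝ) • (N.actionAt p.2 ∘ₗ M.rhoStar B p.1 ∘ₗ r₁))
  moment p := N.moment p.2 * M.moment p.1

/-- The one-point Hamiltonian quasi-Poisson manifold. -/
def point : HamData.{u} IG G where
  mfd := SmoothManifold.point
  action := 0
  piSharp _ := 0
  moment _ := 1

variable {M} in
/-- Morphisms of Hamiltonian quasi-Poisson manifolds: smooth maps that preserve the bivector
fields, the actions and the moment maps. -/
structure IsMorphism {N : HamData.{u} IG G} (f : M.mfd.carrier → N.mfd.carrier) : Prop where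
  smooth : M.mfd.Smooth N.mfd f
  pi : ∀ x (α : N.mfd.Cot (f x)),
    M.mfd.D N.mfd f x (M.piSharp x (M.mfd.pullCot N.mfd f x α)) = N.piSharp (f x) α
  action : ∀ ξ x, M.mfd.D N.mfd f x (M.action ξ x) = N.action ξ (f x)
  moment : ∀ x, N.moment (f x) = M.moment x

theorem isMorphism_id : IsMorphism (M := M) (N := M) (fun x => x) where
  smooth := contMDiff_id
  pi x α := by
    have h : M.mfd.D M.mfd (fun x => x) x = ContinuousLinearMap.id ℝ (M.mfd.T x) := mfderiv_id
    rw [M.mfd.pullCot_id x α, h]; rfl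
  action ξ x := by
    have h : M.mfd.D M.mfd (fun x => x) x = ContinuousLinearMap.id ℝ (M.mfd.T x) := mfderiv_id
    rw [h]; rfl
  moment _ := rfl

variable {M} in
theorem IsMorphism.comp {N P : HamData.{u} IG G} {f : M.mfd.carrier → N.mfd.carrier}
    {g : N.mfd.carrier → P.mfd.carrier} (hf : IsMorphism f) (hg : IsMorphism g) :
    IsMorphism (M := M) (N := P) (fun x => g (f x)) where
  smooth := hg.smooth.comp hf.smooth
  pi x α := by
    have h := SmoothManifold.D_comp hg.smooth hf.smooth x
    have h' := SmoothManifold.pullCot_comp hg.smooth hf.smooth x α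
    rw [h, h']
    exact (congrArg _ (hf.pi x _)).trans (hg.pi (f x) α)
  action ξ x := by
    have h := SmoothManifold.D_comp hg.smooth hf.smooth x
    rw [h]
    exact (congrArg _ (hf.action ξ x)).trans (hg.action ξ (f x))
  moment x := (hg.moment (f x)).trans (hf.moment x)

end HamData

/-- Hamiltonian quasi-Poisson manifolds, for a given group and a given invariant form. -/
structure HamQPoisson (B : InvariantForm IG G) where
  data : HamData.{u} IG G
  isHamiltonian : data.IsHamiltonian B

/-- Morphisms of Hamiltonian quasi-Poisson manifolds. -/
@[ext]
structure HamMorphism {B : InvariantForm IG G} (M N : HamQPoisson.{u} B) where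
  toFun : M.data.mfd.carrier → N.data.mfd.carrier
  isMorphism : HamData.IsMorphism toFun

/-- The category of Hamiltonian quasi-Poisson manifolds. -/
instance (B : InvariantForm IG G) : Category (HamQPoisson.{u} B) where
  Hom := HamMorphism
  id M := ⟨fun x => x, M.data.isMorphism_id⟩
  comp f g := ⟨fun x => g.toFun (f.toFun x), f.isMorphism.comp g.isMorphism⟩

/-- Fusion is well defined on Hamiltonian quasi-Poisson manifolds and their morphisms. -/
structure FusionWellDefined (B : InvariantForm IG G) : Prop where
  fusion : ∀ M N : HamQPoisson.{u} B, (M.data.fusion B N.data).IsHamiltonian B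
  point : (HamData.point.{u} : HamData IG G).IsHamiltonian B
  map : ∀ {M M' N N' : HamQPoisson.{u} B} (f : M ⟶ M') (g : N ⟶ N'),
    HamData.IsMorphism (M := M.data.fusion B N.data) (N := M'.data.fusion B N'.data)
      (fun p => (f.toFun p.1, g.toFun p.2))
  assocHom : ∀ M N P : HamQPoisson.{u} B,
    HamData.IsMorphism (M := (M.data.fusion B N.data).fusion B P.data)
      (N := M.data.fusion B (N.data.fusion B P.data)) (fun p => (p.1.1, (p.1.2, p.2)))
  assocInv : ∀ M N P : HamQPoisson.{u} B,
    HamData.IsMorphism (M := M.data.fusion B (N.data.fusion B P.data))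
      (N := (M.data.fusion B N.data).fusion B P.data) (fun p => ((p.1, p.2.1), p.2.2))
  leftHom : ∀ M : HamQPoisson.{u} B,
    HamData.IsMorphism (M := HamData.point.fusion B M.data) (N := M.data) (fun p => p.2)
  leftInv : ∀ M : HamQPoisson.{u} B,
    HamData.IsMorphism (M := M.data) (N := HamData.point.fusion B M.data)
      (fun x => (PUnit.unit, x))
  rightHom : ∀ M : HamQPoisson.{u} B,
    HamData.IsMorphism (M := M.data.fusion B HamData.point) (N := M.data) (fun p => p.1)
  rightInv : ∀ M : HamQPoisson.{u} B,
    HamData.IsMorphism (M := M.data) (N := M.data.fusion B HamData.point)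
      (fun x => (x, PUnit.unit))

/-- The monoidal structure on Hamiltonian quasi-Poisson manifolds given by fusion. -/
abbrev fusionMonoidal {B : InvariantForm IG G} (h : FusionWellDefined.{u} B) :
    MonoidalCategory (HamQPoisson.{u} B) :=
  letI : MonoidalCategoryStruct (HamQPoisson.{u} B) :=
    { tensorObj := fun M N => ⟨M.data.fusion B N.data, h.fusion M N⟩
      tensorUnit := ⟨HamData.point, h.point⟩
      tensorHom := fun f g => ⟨fun p => (f.toFun p.1, g.toFun p.2), h.map f g⟩
      whiskerLeft := fun M _ _ g => ⟨fun p => (p.1, g.toFun p.2), h.map (𝟙 M) g⟩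
      whiskerRight := fun f N => ⟨fun p => (f.toFun p.1, p.2), h.map f (𝟙 N)⟩
      associator := fun M N P =>
        { hom := ⟨fun p => (p.1.1, (p.1.2, p.2)), h.assocHom M N P⟩
          inv := ⟨fun p => ((p.1, p.2.1), p.2.2), h.assocInv M N P⟩
          hom_inv_id := rfl
          inv_hom_id := rfl }
      leftUnitor := fun M =>
        { hom := ⟨fun p => p.2, h.leftHom M⟩
          inv := ⟨fun x => (PUnit.unit, x), h.leftInv M⟩
          hom_inv_id := rfl
          inv_hom_id := rfl }
      rightUnitor := fun M =>
        { hom := ⟨fun p => p.1, h.rightHom M⟩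
          inv := ⟨fun x => (x, PUnit.unit), h.rightInv M⟩
          hom_inv_id := rfl
          inv_hom_id := rfl } }
  MonoidalCategory.ofTensorHom
    (id_tensorHom_id := fun _ _ => rfl)
    (id_tensorHom := fun _ _ _ _ => rfl)
    (tensorHom_id := fun _ _ => rfl)
    (tensorHom_comp_tensorHom := fun _ _ _ _ => rfl)
    (associator_naturality := fun _ _ _ => rfl)
    (leftUnitor_naturality := fun _ => rfl)
    (rightUnitor_naturality := fun _ => rfl)
    (pentagon := fun _ _ _ _ => rfl)
    (triangle := fun _ _ => rfl)

/-! ### The functor `M ↦ T^*M` and the map `J` -/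

/-- The pullback of covectors along a map, as a map of cotangent bundles. -/
def cotangentMap {B : InvariantForm IG G} {M N : HamData.{u} IG G}
    (f : M.mfd.carrier → N.mfd.carrier) :
    BundleComorphism (M.cotangent B) (N.cotangent B) where
  base := f
  fib x := M.mfd.pullCot N.mfd f x

/-- `M ↦ T^*M` is well defined: `T^*M` is a Lie algebroid, and morphisms induce comorphisms. -/
structure CotangentWellDefined (B : InvariantForm IG G) : Prop where
  obj : ∀ M : HamQPoisson.{u} B, (M.data.cotangent B).IsLieAlgebroid
  map : ∀ {M N : HamQPoisson.{u} B} (f : M ⟶ N), (cotangentMap (B := B) f.toFun).IsComorphism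

/-- The functor `M ↦ T^*M` from Hamiltonian quasi-Poisson manifolds to Lie algebroids and
comorphisms. -/
def cotangentFunctor {B : InvariantForm IG G} (h : CotangentWellDefined.{u} B) :
    HamQPoisson.{u} B ⥤ LieAlgebroid.{u} where
  obj M := ⟨M.data.cotangent B, h.obj M⟩
  map f := ⟨cotangentMap f.toFun, h.map f⟩
  map_id M := by
    apply Comorphism.ext
    apply BundleComorphism.ext (by rfl)
    apply heq_of_eq
    funext x
    ext1 α
    exact M.data.mfd.pullCot_id x α
  map_comp {M N P} f g := by
    apply Comorphism.ext
    apply BundleComorphism.ext (by rfl)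
    apply heq_of_eq
    funext x
    ext1 α
    exact SmoothManifold.pullCot_comp g.isMorphism.smooth f.isMorphism.smooth x α

/-- The map `J : T^*M ⊕ T^*N → T^*(M ⊛ N)`, `(α, β) ↦ (α, β - i_N(ρ_M^* α))`. -/
def J (B : InvariantForm IG G) (M N : HamData.{u} IG G) (p : M.mfd.carrier × N.mfd.carrier) :
    M.mfd.Cot p.1 × N.mfd.Cot p.2 →ₗ[ℝ] (M.mfd.prod N.mfd).Cot p :=
    let α := LinearMap.fst ℝ (M.mfd.Cot p.1) (N.mfd.Cot p.2)
    let β := LinearMap.snd ℝ (M.mfd.Cot p.1) (N.mfd.Cot p.2)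
    (M.mfd.prod N.mfd).pullCot M.mfd Prod.fst p ∘ₗ α +
      (M.mfd.prod N.mfd).pullCot N.mfd Prod.snd p ∘ₗ
        (β - N.iForm B p.2 ∘ₗ M.rhoStar B p.1 ∘ₗ α)

end LieGroup
end QuasiPoisson
end

/-! Everything is reduced to identities between functions. An expression in sections that is linear
over functions vanishes as soon as it vanishes on local generators (`eq_zero_of_generatesSections`).
The defects in the Lie algebroid axioms and in the comorphism condition are of this kind once the
Leibniz rule holds and the anchors match (`isLieAlgebroid_of_generates`,
`isComorphism_of_generates`). For a direct product the generators are pairs of sections pulled back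
from the factors, on which all structure splits. For `T^*M` they are the exact forms.

On `T^*M` let `ham f g` be `{f, g} + ½⟨ρ^*df, ρ^*dg⟩`, the derivative of `g` along the anchor of
`df`. Then `[df, dg] = d(ham f g) - ∑ (ρ(e_i)g) d(ρ(e^i)f)`. The crucial identity is `ham_ham`,
which says that the anchor preserves these brackets. By `[π, π] = ρ(φ)` the Jacobiator of `{·,·}` is
`-¼⟨[ρ^*df, ρ^*dg], ρ^*dk⟩`, and the commutators produced by the terms `½ρ∘ρ^*` compensate exactly
this. The Jacobi identity on exact forms (`jacobi_d`) comes from differentiating the same identity.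

For a fusion product, the defects of invariance and of `[π, π] = ρ(φ)` are vector fields applied to
the last function. They can therefore be tested on functions pulled back from the factors, which
separate tangent vectors (`invariant_of_separating`, `jacobi_of_separating`). On mixed arguments the
terms linear in the cross bivector cancel by invariance of the bivector of one factor, and the
quadratic ones are commutators of fundamental vector fields, which give the mixed components of `φ`.
In the moment map condition (`fusion_moment_map`) the derivative of `k ↦ Φ_N k Φ_M` at `1` enters
through both factors and cancels.

The map `J` rests on three facts about the forms `i(ξ)`: the anchor of `i(ξ)` is `ρ(ξ)`, `[df, i(ξ)]
= -d(ρ(ξ)f)` and `[i(ζ), i(ξ)] = i([ζ, ξ])` (`cotAnchor_iForm`, `cotBracket_d_iForm`,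
`cotBracket_iForm_iForm`). They come from expanding `d(F∘Φ)` in the `i(e^i)` and from the
commutation of left- with right-invariant vector fields. On `M ⊛ N` the form `pr₁^*df` acts on forms
pulled back from `N` exactly as `i_N(ρ_M^*df)` does (`fusionBracket_fst_snd`). Subtracting that form
gives a lift of `df` that commutes with all forms from `N`, and brackets of lifts are lifts of
brackets (`fusionBracket_lift_lift`) because `ρ^*` is a Lie algebroid morphism to `𝔤`. So `J`
preserves brackets, and it is invertible because it is triangular.

Naturality holds because morphisms preserve `ρ^*` and `i`. Associativity (`J_assoc`) follows from
the formula for `ρ^* ∘ J` and from the fact that `i(ξ)` on a fusion product is `J(i_M(ξ), i_N(ξ))`.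
-/

open scoped Topology

noncomputable section

namespace QuasiPoisson

/-! ### Cutoffs, local generation of sections, vector fields as derivations -/

section Manifold

variable {E : Type*} [NormedAddCommGroup E] [NormedSpace ℝ E] [FiniteDimensional ℝ E]
  {H : Type*} [TopologicalSpace H] {I : ModelWithCorners ℝ E H}
  {M : Type*} [TopologicalSpace M] [ChartedSpace H M] [T2Space M] [IsManifold I ∞ M]

variable (I) in
theorem exists_cutoff (x : M) {U : Set M} (hU : U ∈ 𝓝 x) :
    ∃ χ : M → ℝ, ContMDiff I 𝓘(ℝ, ℝ) ∞ χ ∧ χ =ᶠ[𝓝 x] 1 ∧ tsupport χ ⊆ U := by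
  obtain ⟨f, -, hf⟩ := (SmoothBumpFunction.nhds_basis_tsupport (I := I) x).mem_iff.1 hU
  exact ⟨f, f.contMDiff, f.eventuallyEq_one, hf⟩

theorem contMDiff_cutoff_smul {F : Type*} [NormedAddCommGroup F] [NormedSpace ℝ F]
    {χ : M → ℝ} (hχ : ContMDiff I 𝓘(ℝ, ℝ) ∞ χ) {c : M → F} {U : Set M} (hU : IsOpen U)
    (hc : ContMDiffOn I 𝓘(ℝ, F) ∞ c U) (hχU : tsupport χ ⊆ U) :
    ContMDiff I 𝓘(ℝ, F) ∞ (fun y => χ y • c y) := by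
  refine contMDiff_of_tsupport fun y hy => ?_
  have hy' : y ∈ U := hχU (tsupport_smul_subset_left χ c hy)
  exact hχ.contMDiffAt.smul (hc.contMDiffAt (hU.mem_nhds hy'))

section Bundle

variable {F : Type*} [NormedAddCommGroup F] [NormedSpace ℝ F] [FiniteDimensional ℝ F]
  {V : M → Type*} [∀ x, AddCommGroup (V x)] [∀ x, Module ℝ (V x)]
  [∀ x, TopologicalSpace (V x)] [TopologicalSpace (TotalSpace F V)] [FiberBundle F V]
  [VectorBundle ℝ F V] [ContMDiffVectorBundle ∞ F V I]

variable (I F) in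
/-- Every smooth section is, near any given point, a combination of elements of `S` with smooth
coefficients. -/
def GeneratesSections (S : Set (∀ x, V x)) : Prop :=
  ∀ σ : ∀ x, V x, ContMDiff I (I.prod 𝓘(ℝ, F)) ∞ (fun x => TotalSpace.mk' F x (σ x)) → ∀ x,
    ∃ (n : ℕ) (χ : M → ℝ) (u : Fin n → M → ℝ) (s : Fin n → ∀ x, V x),
      ContMDiff I 𝓘(ℝ, ℝ) ∞ χ ∧ χ =ᶠ[𝓝 x] 1 ∧ (∀ i, ContMDiff I 𝓘(ℝ, ℝ) ∞ (u i)) ∧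
      (∀ i, s i ∈ S) ∧ ∀ y, χ y • σ y = ∑ i, u i y • s i y

/-- Sections from `S` whose values at `x` form a basis remain a frame near `x`, since invertibility
of a matrix is an open condition. The coefficients of `σ` in this frame are smooth because inversion
is, and a cutoff makes them global. -/
theorem generatesSections_of_span {S : Set (∀ x, V x)}
    (hS : ∀ s ∈ S, ContMDiff I (I.prod 𝓘(ℝ, F)) ∞ (fun x => TotalSpace.mk' F x (s x)))
    (hspan : ∀ x, ⊤ ≤ Submodule.span ℝ ((fun s : ∀ x, V x => s x) '' S)) :
    GeneratesSections I F S := by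
  intro σ hσ x
  set e := trivializationAt F V x with he
  have hx : x ∈ e.baseSet := FiberBundle.mem_baseSet_trivializationAt' x
  obtain ⟨b, hbS, hbspan, hbind⟩ :=
    exists_linearIndependent ℝ ((fun s : ∀ x, V x => s x) '' S)
  have : FiniteDimensional ℝ (V x) :=
    (e.continuousLinearEquivAt ℝ x hx).toLinearEquiv.symm.finiteDimensional
  have hbfin : Finite b := hbind.finite
  have : Fintype b := Fintype.ofFinite b
  let n := Fintype.card b
  let B : Module.Basis (Fin n) ℝ (V x) := (Module.Basis.mk hbind (by
    rw [Subtype.range_coe, hbspan]; exact hspan x)).reindex (Fintype.equivFin b)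
  have hB : ∀ i, ∃ s ∈ S, s x = B i := by
    intro i
    obtain ⟨s, hs, h⟩ := hbS ((Fintype.equivFin b).symm i).2
    exact ⟨s, hs, by simpa [B] using h⟩
  choose s hsS hsB using hB
  -- `Φ` sends a tuple of vectors to the linear map with these columns. As `Φ` is continuous and
  -- linear, the matrix `T` of the sections in the trivialization is smooth.
  let Φ : (Fin n → F) →L[ℝ] ((Fin n → ℝ) →L[ℝ] F) := LinearMap.toContinuousLinearMap
    { toFun := fun v => LinearMap.toContinuousLinearMap (Fintype.linearCombination ℝ v)
      map_add' := fun v w => by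
        ext1 c
        simp [Fintype.linearCombination_apply, Finset.sum_add_distrib]
      map_smul' := fun c v => by
        ext1 d
        simp [Fintype.linearCombination_apply, Finset.smul_sum, smul_comm c] }
  have hΦ : ∀ v c, Φ v c = ∑ i, c i • v i := fun v c => by
    simp [Φ, Fintype.linearCombination_apply]
  let T : M → ((Fin n → ℝ) →L[ℝ] F) := fun y => Φ (fun i => (e ⟨y, s i y⟩).2)
  have hT : ContMDiffOn I 𝓘(ℝ, (Fin n → ℝ) →L[ℝ] F) ∞ T e.baseSet := by
    have h1 : ContMDiffOn I 𝓘(ℝ, Fin n → F) ∞ (fun y i => (e ⟨y, s i y⟩).2) e.baseSet := by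
      rw [contMDiffOn_pi_space]
      intro i
      exact (e.contMDiffOn_section_baseSet_iff).1 (hS _ (hsS i)).contMDiffOn
    exact Φ.contDiff.contMDiff.comp_contMDiffOn h1
  let inv : Set ((Fin n → ℝ) →L[ℝ] F) :=
    Set.range ((↑) : ((Fin n → ℝ) ≃L[ℝ] F) → ((Fin n → ℝ) →L[ℝ] F))
  have hinv : IsOpen inv := ContinuousLinearEquiv.isOpen
  let U := e.baseSet ∩ T ⁻¹' inv
  have hU : IsOpen U := hT.continuousOn.isOpen_inter_preimage e.open_baseSet hinv
  have hxU : x ∈ U := by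
    refine ⟨hx, (B.equivFun.symm.trans
      (e.continuousLinearEquivAt ℝ x hx).toLinearEquiv).toContinuousLinearEquiv, ?_⟩
    ext1 c
    simp only [T, hΦ, hsB]
    simp [Module.Basis.equivFun_symm_apply, map_sum]
  let c : M → (Fin n → ℝ) := fun y => (T y).inverse (e ⟨y, σ y⟩).2
  have hc : ContMDiffOn I 𝓘(ℝ, Fin n → ℝ) ∞ c U := by
    intro y hy
    have h1 : ContMDiffWithinAt I 𝓘(ℝ, F) ∞ (fun y => (e ⟨y, σ y⟩).2) U y :=
      ((e.contMDiffOn_section_baseSet_iff).1 hσ.contMDiffOn y hy.1).mono Set.inter_subset_left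
    have h2 : ContMDiffWithinAt I 𝓘(ℝ, F →L[ℝ] (Fin n → ℝ)) ∞
        (fun y => (T y).inverse) U y := by
      obtain ⟨f, hf⟩ := hy.2
      have h3 : ContDiffAt ℝ ∞ ContinuousLinearMap.inverse (T y) := by
        rw [← hf]; exact contDiffAt_map_inverse f
      exact h3.contMDiffAt.comp_contMDiffWithinAt y
        ((hT y hy.1).mono Set.inter_subset_left)
    exact h2.clm_apply h1
  obtain ⟨χ, hχ, hχ1, hχU⟩ := exists_cutoff I x (hU.mem_nhds hxU)
  have hu := contMDiff_cutoff_smul hχ hU hc hχU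
  refine ⟨n, χ, fun i y => (χ y • c y) i, s, hχ, hχ1, fun i => contMDiff_pi_space.1 hu i, hsS,
    fun y => ?_⟩
  by_cases hy : y ∈ U
  · have hTc : T y (c y) = (e ⟨y, σ y⟩).2 := by
      obtain ⟨f, hf⟩ := hy.2
      simp only [c]
      rw [← hf, ContinuousLinearMap.inverse_equiv]
      exact f.apply_symm_apply _
    have key : σ y = ∑ i, c y i • s i y := by
      apply (e.continuousLinearEquivAt ℝ y hy.1).injective
      rw [map_sum]
      simp only [map_smul]
      simp only [T, hΦ] at hTc
      simpa using hTc.symm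
    simp only [Pi.smul_apply, smul_eq_mul, mul_smul]
    rw [← Finset.smul_sum, ← key]
  -- Off `U` the formula for `c` means nothing, but there both sides carry the factor `χ y = 0`.
  · have : χ y = 0 := by
      by_contra h
      exact hy (hχU (subset_tsupport _ h))
    simp [this]

/-- A map on sections that is tensorial at `x` vanishes if it vanishes on generators. -/
theorem eq_zero_of_generatesSections {S : Set (∀ x, V x)} (hS : GeneratesSections I F S)
    (hSs : ∀ s ∈ S, ContMDiff I (I.prod 𝓘(ℝ, F)) ∞ (fun x => TotalSpace.mk' F x (s x)))
    {W : Type*} [AddCommGroup W] [Module ℝ W] (P : (∀ x, V x) → W) (x : M)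
    (hadd : ∀ σ τ : ∀ x, V x,
      ContMDiff I (I.prod 𝓘(ℝ, F)) ∞ (fun x => TotalSpace.mk' F x (σ x)) →
      ContMDiff I (I.prod 𝓘(ℝ, F)) ∞ (fun x => TotalSpace.mk' F x (τ x)) →
      P (σ + τ) = P σ + P τ)
    (hsmul : ∀ (f : M → ℝ) (σ : ∀ x, V x), ContMDiff I 𝓘(ℝ, ℝ) ∞ f →
      ContMDiff I (I.prod 𝓘(ℝ, F)) ∞ (fun x => TotalSpace.mk' F x (σ x)) →
      P (fun y => f y • σ y) = f x • P σ)
    (h0 : ∀ s ∈ S, P s = 0) (σ : ∀ x, V x)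
    (hσ : ContMDiff I (I.prod 𝓘(ℝ, F)) ∞ (fun x => TotalSpace.mk' F x (σ x))) : P σ = 0 := by
  obtain ⟨n, χ, u, s, hχ, hχ1, hu, hs, h⟩ := hS σ hσ x
  have hzero : P (fun _ => 0) = 0 := by
    have := hsmul (fun _ => 0) 0 contMDiff_const (contMDiff_zeroSection ℝ V)
    simpa using this
  have hsum : ∀ t : Finset (Fin n), P (fun y => ∑ i ∈ t, u i y • s i y) = 0 := by
    intro t
    induction t using Finset.induction_on with
    | empty => simpa using hzero
    | insert a t ha ih =>
      have h1 : (fun y => ∑ i ∈ insert a t, u i y • s i y) =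
          (fun y => u a y • s a y) + (fun y => ∑ i ∈ t, u i y • s i y) := by
        funext y; simp [Finset.sum_insert ha]
      rw [h1, hadd, hsmul _ _ (hu a) (hSs _ (hs a)), h0 _ (hs a), ih, smul_zero, add_zero]
      · exact (hu a).smul_section (hSs _ (hs a))
      · exact ContMDiff.sum_section fun i _ => (hu i).smul_section (hSs _ (hs i))
  -- As `χ x = 1`, replacing `σ` by `χσ`, which is globally a combination of generators, does not
  -- change the value of `P`.
  have h2 := hsmul χ σ hχ hσ
  rw [funext h, hsum, hχ1.eq_of_nhds, Pi.one_apply, one_smul] at h2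
  exact h2.symm

end Bundle

/-- A fibrewise linear map over a smooth map of the bases takes smooth sections to smooth sections
if it does so for generators. -/
theorem smooth_of_generatesSections
    {F : Type*} [NormedAddCommGroup F] [NormedSpace ℝ F] [FiniteDimensional ℝ F]
    {V : M → Type*} [∀ x, AddCommGroup (V x)] [∀ x, Module ℝ (V x)]
    [∀ x, TopologicalSpace (V x)] [TopologicalSpace (TotalSpace F V)] [FiberBundle F V]
    [VectorBundle ℝ F V] [ContMDiffVectorBundle ∞ F V I]
    {E' : Type*} [NormedAddCommGroup E'] [NormedSpace ℝ E']
    {H' : Type*} [TopologicalSpace H'] {I' : ModelWithCorners ℝ E' H'}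
    {M' : Type*} [TopologicalSpace M'] [ChartedSpace H' M']
    {F' : Type*} [NormedAddCommGroup F'] [NormedSpace ℝ F']
    {V' : M' → Type*} [∀ x, AddCommGroup (V' x)] [∀ x, Module ℝ (V' x)]
    [∀ x, TopologicalSpace (V' x)] [TopologicalSpace (TotalSpace F' V')] [FiberBundle F' V']
    [VectorBundle ℝ F' V'] [ContMDiffVectorBundle ∞ F' V' I']
    {S : Set (∀ x, V x)} (hS : GeneratesSections I F S)
    {φ : M' → M} (hφ : ContMDiff I' I ∞ φ) (Λ : ∀ y, V (φ y) →ₗ[ℝ] V' y)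
    (h : ∀ s ∈ S, ContMDiff I' (I'.prod 𝓘(ℝ, F')) ∞
      (fun y => TotalSpace.mk' F' y (Λ y (s (φ y)))))
    (σ : ∀ x, V x) (hσ : ContMDiff I (I.prod 𝓘(ℝ, F)) ∞ (fun x => TotalSpace.mk' F x (σ x))) :
    ContMDiff I' (I'.prod 𝓘(ℝ, F')) ∞ (fun y => TotalSpace.mk' F' y (Λ y (σ (φ y)))) := by
  intro y
  obtain ⟨n, χ, u, s, hχ, hχ1, hu, hs, heq⟩ := hS σ hσ (φ y)
  have h1 : ContMDiff I' (I'.prod 𝓘(ℝ, F')) ∞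
      (fun y => TotalSpace.mk' F' y (∑ i, u i (φ y) • Λ y (s i (φ y)))) :=
    ContMDiff.sum_section fun i _ => ((hu i).comp hφ).smul_section (h _ (hs i))
  refine (h1 y).congr_of_eventuallyEq ?_
  filter_upwards [hφ.continuous.continuousAt.eventually hχ1] with z hz
  have h2 : σ (φ z) = ∑ i, u i (φ z) • s i (φ z) := by
    rw [← heq, hz, Pi.one_apply, one_smul]
  rw [h2, map_sum]
  simp only [map_smul]

/-- A cutoff times the extension that is constant in the trivialization. The last clause keeps the
local form, so that such sections can serve as a local frame. -/
theorem exists_smooth_section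
    {F : Type*} [NormedAddCommGroup F] [NormedSpace ℝ F]
    {V : M → Type*} [∀ x, AddCommGroup (V x)] [∀ x, Module ℝ (V x)]
    [∀ x, TopologicalSpace (V x)] [TopologicalSpace (TotalSpace F V)] [FiberBundle F V]
    [VectorBundle ℝ F V] [ContMDiffVectorBundle ∞ F V I] (x : M) (v : V x) :
    ∃ σ : ∀ x, V x, ContMDiff I (I.prod 𝓘(ℝ, F)) ∞ (fun x => TotalSpace.mk' F x (σ x)) ∧
      σ x = v ∧ ∀ᶠ y in 𝓝 x, σ y = FiberBundle.extend F v y := by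
  obtain ⟨s, hs, hsv⟩ := FiberBundle.exists_contMDiffOn_extend (k := ∞) I F v
  obtain ⟨t, hts, hto, hxt⟩ := mem_nhds_iff.1 hs
  obtain ⟨χ, hχ, hχ1, hχt⟩ := exists_cutoff I x (hto.mem_nhds hxt)
  refine ⟨fun y => χ y • FiberBundle.extend F v y,
    ContMDiffOn.smul_section_of_tsupport hχ.contMDiffOn hto hχt (hsv.mono hts), ?_, ?_⟩
  · simp [hχ1.eq_of_nhds]
  · filter_upwards [hχ1] with y hy
    simp [hy]

/-- Take the function that is linear in the preferred chart, multiplied by a cutoff. This is why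
exact forms generate all one-forms and why functions detect tangent vectors. -/
theorem exists_smooth_mvfderiv (x : M) (a : TangentSpace I x →L[ℝ] ℝ) :
    ∃ f : M → ℝ, ContMDiff I 𝓘(ℝ, ℝ) ∞ f ∧ mvfderiv I f x = a := by
  obtain ⟨χ, hχ, hχ1, hχU⟩ := exists_cutoff I x (extChartAt_source_mem_nhds (I := I) x)
  obtain ⟨D, hD⟩ := isInvertible_mfderiv_extChartAt (I := I) (mem_extChartAt_source (I := I) x)
  let b : E →L[ℝ] ℝ := ContinuousLinearMap.comp (M₂ := TangentSpace I x) a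
    (show E →L[ℝ] TangentSpace I x from D.symm.toContinuousLinearMap)
  have hc : ContMDiffOn I 𝓘(ℝ, ℝ) ∞ (fun y => b (extChartAt I x y)) (extChartAt I x).source :=
    b.contDiff.contMDiff.comp_contMDiffOn (by
      have := contMDiffOn_extChartAt (I := I) (n := ∞) (x := x)
      rwa [← extChartAt_source (I := I)] at this)
  refine ⟨_, contMDiff_cutoff_smul hχ (isOpen_extChartAt_source x) hc hχU, ?_⟩
  have h1 : (fun y => χ y • b (extChartAt I x y)) =ᶠ[𝓝 x] (b ∘ extChartAt I x) := by
    filter_upwards [hχ1] with y hy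
    simp [hy]
  have h2 : mfderiv I 𝓘(ℝ, ℝ) (fun y => χ y • b (extChartAt I x y)) x =
      mfderiv I 𝓘(ℝ, ℝ) (b ∘ extChartAt I x) x := h1.mfderiv_eq
  have h3 : mfderiv I 𝓘(ℝ, ℝ) (b ∘ extChartAt I x) x =
      (mfderiv 𝓘(ℝ, E) 𝓘(ℝ, ℝ) b (extChartAt I x x)).comp
        (mfderiv I 𝓘(ℝ, E) (extChartAt I x) x) :=
    mfderiv_comp x (b.contDiff.contMDiff (n := ∞)|>.mdifferentiableAt (by simp))
      (mdifferentiableAt_extChartAt (mem_chart_source H x))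
  ext v
  change (mfderiv I 𝓘(ℝ, ℝ) (fun y => χ y • b (extChartAt I x y)) x v : ℝ) = a v
  rw [h2, h3, mfderiv_eq_fderiv, ContinuousLinearMap.fderiv, ← hD]
  exact congrArg a (D.symm_apply_apply v)

theorem eq_of_mvfderiv_eq {x : M} {v w : TangentSpace I x}
    (h : ∀ f : M → ℝ, ContMDiff I 𝓘(ℝ, ℝ) ∞ f → mvfderiv I f x v = mvfderiv I f x w) :
    v = w := by
  by_contra hne
  have : FiniteDimensional ℝ (TangentSpace I x) := inferInstanceAs (FiniteDimensional ℝ E)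
  obtain ⟨g, hg⟩ := SeparatingDual.exists_separating_of_ne (R := ℝ) (V := E) hne
  obtain ⟨f, hf, hfg⟩ := exists_smooth_mvfderiv x (show TangentSpace I x →L[ℝ] ℝ from g)
  apply hg
  have := h f hf
  rw [hfg] at this
  exact this

variable [I.Boundaryless]

theorem mvfderiv_eq_fderiv_extChartAt {F : Type*} [NormedAddCommGroup F] [NormedSpace ℝ F]
    {g : M → F} {x : M} (hg : MDifferentiableAt I 𝓘(ℝ, F) g x) :
    mvfderiv I g x = fderiv ℝ (g ∘ (extChartAt I x).symm) (extChartAt I x x) := by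
  rw [hg.mvfderiv, I.range_eq_univ, fderivWithin_univ]
  rfl

theorem mvfderiv_extChartAt_symm {f : M → ℝ} (hf : ContMDiff I 𝓘(ℝ, ℝ) ∞ f) (x : M) {z : E}
    (hz : z ∈ (extChartAt I x).target) :
    fderiv ℝ (f ∘ (extChartAt I x).symm) z =
      (mvfderiv I f ((extChartAt I x).symm z)).comp
        (mfderiv 𝓘(ℝ, E) I (extChartAt I x).symm z) := by
  have hψ : MDifferentiableAt 𝓘(ℝ, E) I (extChartAt I x).symm z := by
    have := mdifferentiableWithinAt_extChartAt_symm (I := I) hz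
    rwa [I.range_eq_univ, mdifferentiableWithinAt_univ] at this
  have h := mfderiv_comp z (hf.mdifferentiableAt (by simp)) hψ
  rw [mfderiv_eq_fderiv] at h
  exact h

/-- In the preferred chart, `X(Yf)` is a second derivative of `f` plus `df` applied to a derivative
of `Y`. The second derivative is symmetric, so the difference leaves only the coordinate formula of
the bracket. -/
theorem mvfderiv_mlieBracket {X Y : ∀ x : M, TangentSpace I x}
    (hX : ContMDiff I (I.prod 𝓘(ℝ, E)) ∞ (fun x => TotalSpace.mk' E x (X x)))
    (hY : ContMDiff I (I.prod 𝓘(ℝ, E)) ∞ (fun x => TotalSpace.mk' E x (Y x)))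
    {f : M → ℝ} (hf : ContMDiff I 𝓘(ℝ, ℝ) ∞ f)
    (hXf : ContMDiff I 𝓘(ℝ, ℝ) ∞ (fun y => mvfderiv I f y (X y)))
    (hYf : ContMDiff I 𝓘(ℝ, ℝ) ∞ (fun y => mvfderiv I f y (Y y))) (x : M) :
    mvfderiv I f x (mlieBracket I X Y x) =
      mvfderiv I (fun y => mvfderiv I f y (Y y)) x (X x) -
        mvfderiv I (fun y => mvfderiv I f y (X y)) x (Y x) := by
  set φ := extChartAt I x with hφ
  set p := φ x with hp
  let hat (X : ∀ x : M, TangentSpace I x) : E → E := mpullback 𝓘(ℝ, E) I φ.symm X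
  set f' : E → ℝ := f ∘ φ.symm with hf'
  have hpt : p ∈ φ.target := mem_extChartAt_target x
  have htn : φ.target ∈ 𝓝 p := extChartAt_target_mem_nhds x
  have hf'smooth : ContDiffAt ℝ ∞ f' p := by
    have h1 := contMDiffOn_extChartAt_symm (I := I) (n := ∞) x
    have h2 := (hf.comp_contMDiffOn h1).contMDiffAt htn
    exact h2.contDiffAt
  -- The tangent space at `x` is identified with `E` by the preferred chart at `x`, so pulling back
  -- to the chart changes nothing at the base point.
  have hid : mfderiv 𝓘(ℝ, E) I φ.symm p = ContinuousLinearMap.id ℝ E := by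
    have := mfderivWithin_range_extChartAt_symm (I := I) (x := x)
    rwa [I.range_eq_univ, mfderivWithin_univ] at this
  have hhat : ∀ X, hat X p = X x := by
    intro X
    simp only [hat, mpullback_apply, hid]
    rw [hp, extChartAt_to_inv x]
    exact congrArg (fun L : E →L[ℝ] E => L (X x)) (ContinuousLinearMap.inverse_id (R := ℝ) (M := E))
  have hloc : ∀ X : ∀ x : M, TangentSpace I x,
      ((fun y => mvfderiv I f y (X y)) ∘ φ.symm) =ᶠ[𝓝 p] fun z => fderiv ℝ f' z (hat X z) := by
    intro X
    filter_upwards [htn] with z hz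
    have hinv : (mfderiv 𝓘(ℝ, E) I φ.symm z).IsInvertible := by
      have := isInvertible_mfderivWithin_extChartAt_symm (I := I) hz
      rwa [I.range_eq_univ, mfderivWithin_univ] at this
    rw [mvfderiv_extChartAt_symm hf x hz]
    simp only [hat, mpullback_apply, Function.comp]
    exact congrArg _ (hinv.self_apply_inverse _).symm
  have hdiff : ∀ X : ∀ x : M, TangentSpace I x,
      ContMDiff I (I.prod 𝓘(ℝ, E)) ∞ (fun x => TotalSpace.mk' E x (X x)) →
      DifferentiableAt ℝ (hat X) p := by
    intro X hX
    have := ((hX.mdifferentiableAt (x := x) (by simp)).mdifferentiableWithinAt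
      (s := Set.univ)).differentiableWithinAt_mpullbackWithin_vectorField
    simp only [I.range_eq_univ, Set.preimage_univ, Set.inter_univ, mpullbackWithin_univ] at this
    exact this.differentiableAt Filter.univ_mem
  have key : ∀ X Y : ∀ x : M, TangentSpace I x,
      ContMDiff I (I.prod 𝓘(ℝ, E)) ∞ (fun x => TotalSpace.mk' E x (Y x)) →
      ContMDiff I 𝓘(ℝ, ℝ) ∞ (fun y => mvfderiv I f y (Y y)) →
      mvfderiv I (fun y => mvfderiv I f y (Y y)) x (X x) =
        fderiv ℝ (fderiv ℝ f') p (X x) (Y x) + fderiv ℝ f' p (fderiv ℝ (hat Y) p (X x)) := by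
    intro X Y hY hYf
    rw [mvfderiv_eq_fderiv_extChartAt (hYf.mdifferentiableAt (by simp)), (hloc Y).fderiv_eq]
    have h1 : DifferentiableAt ℝ (fderiv ℝ f') p :=
      (hf'smooth.fderiv_right (m := 1) (by norm_cast)).differentiableAt (by simp)
    rw [fderiv_clm_apply h1 (hdiff Y hY)]
    simp [hhat, add_comm]
    rfl
  have hbr : mlieBracket I X Y x = fderiv ℝ (hat Y) p (X x) - fderiv ℝ (hat X) p (Y x) := by
    let hatW (X : ∀ x : M, TangentSpace I x) : E → E :=
      mpullbackWithin 𝓘(ℝ, E) I φ.symm X (Set.range I)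
    have hW : ∀ X, hatW X = hat X := fun X => by
      simp only [hatW, hat, I.range_eq_univ, mpullbackWithin_univ]; rfl
    have h1 : mlieBracket I X Y x = (mfderiv I 𝓘(ℝ, E) φ x).inverse
        (lieBracketWithin (E := E) ℝ (hatW X) (hatW Y) (φ.symm ⁻¹' Set.univ ∩ Set.range I) p) := rfl
    have h2 : (mfderiv I 𝓘(ℝ, E) φ x).inverse = ContinuousLinearMap.id ℝ E := by
      rw [hφ, mfderiv_extChartAt_self]
      exact ContinuousLinearMap.inverse_id (R := ℝ) (M := E)
    have h3 : lieBracketWithin (E := E) ℝ (hatW X) (hatW Y)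
        (φ.symm ⁻¹' Set.univ ∩ Set.range I) p = lieBracket (E := E) ℝ (hat X) (hat Y) p := by
      rw [I.range_eq_univ, Set.preimage_univ, Set.inter_univ, lieBracketWithin_univ, hW, hW]
    rw [h1, h2, h3, lieBracket, hhat, hhat]
    rfl
  have hsymm : fderiv ℝ (fderiv ℝ f') p (X x) (Y x) = fderiv ℝ (fderiv ℝ f') p (Y x) (X x) :=
    (hf'smooth.isSymmSndFDerivAt (by simpa using ENat.LEInfty.out)) _ _
  rw [key X Y hY hYf, key Y X hX hXf, hsymm, hbr,
    mvfderiv_eq_fderiv_extChartAt (hf.mdifferentiableAt (by simp))]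
  rw [add_sub_add_left_eq_sub]
  exact map_sub _ _ _
end Manifold

/-! ### Calculus of functions, vector fields and one-forms. -/

namespace SmoothManifold
variable {M : SmoothManifold.{u}}

theorem d_apply_smooth {f : M.carrier → ℝ} (hf : M.SmoothFun f) {X : ∀ x, M.T x}
    (hX : M.SmoothVF X) : M.SmoothFun (fun x => M.d f x (X x)) := by
  have h1 : ContMDiff M.model.tangent (𝓘(ℝ, ℝ)).tangent ∞ (tangentMap M.model 𝓘(ℝ, ℝ) f) :=
    hf.contMDiff_tangentMap (m := ∞) (by simp)
  have h2 := (contMDiff_snd_tangentBundle_modelSpace ℝ 𝓘(ℝ, ℝ) (n := ∞)).comp (h1.comp hX)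
  exact h2

theorem form_apply_smooth {α : ∀ x, M.Cot x} (hα : M.SmoothForm α) {X : ∀ x, M.T x}
    (hX : M.SmoothVF X) : M.SmoothFun (fun x => (α x (X x) : ℝ)) := by
  have h := ContMDiff.clm_bundle_apply (𝕜 := ℝ) (n := ∞) (F₁ := M.E) (F₂ := ℝ)
    (E₁ := fun x => M.T x) (E₂ := Bundle.Trivial M.carrier ℝ) (b := fun x => x) hα hX
  intro x
  exact (contMDiffAt_section _).1 (h x)

/-- The coordinates of `α` near a point are its values on global vector fields that agree there with
the frame of the trivialization. -/
theorem smoothForm_of_apply {α : ∀ x, M.Cot x}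
    (h : ∀ X : ∀ x, M.T x, M.SmoothVF X → M.SmoothFun (fun x => (α x (X x) : ℝ))) :
    M.SmoothForm α := by
  intro x₀
  rw [contMDiffAt_hom_bundle]
  refine ⟨contMDiffAt_id, ?_⟩
  let b := Module.finBasis ℝ M.E
  set e := trivializationAt M.E (TangentSpace M.model) x₀ with he
  have hx₀ : x₀ ∈ e.baseSet := FiberBundle.mem_baseSet_trivializationAt' x₀
  choose Z hZ hZx hZe using fun i => exists_smooth_section (I := M.model) (F := M.E)
    (V := fun x : M.carrier => M.T x) x₀ (e.symm x₀ (b i))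
  have h1 : ContMDiffAt M.model 𝓘(ℝ, M.E →L[ℝ] ℝ) ∞ (fun y => ∑ i, (α y (Z i y) : ℝ) •
      (LinearMap.toContinuousLinearMap (b.coord i))) x₀ := by
    refine ContMDiffAt.sum fun i _ => ?_
    exact ((h (Z i) (hZ i)) x₀).smul contMDiffAt_const
  refine h1.congr_of_eventuallyEq ?_
  filter_upwards [Filter.eventually_all.2 hZe, e.open_baseSet.mem_nhds hx₀] with y hy hyb
  apply ContinuousLinearMap.coe_injective
  refine b.ext fun j => ?_
  have h3 : Z j y = e.symm y (b j) := by
    rw [hy j]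
    simp only [FiberBundle.extend]
    rw [e.apply_mk_symm hx₀]
  simp only [ContinuousLinearMap.inCoordinates, ContinuousLinearMap.coe_coe,
    ContinuousLinearMap.comp_apply]
  have h4 : (trivializationAt M.E (TangentSpace M.model) x₀).symmL ℝ y (b j) = Z j y :=
    (e.symmL_apply hyb _).trans h3.symm
  rw [h4]
  simp [Finsupp.single_apply]

theorem smoothForm_d {f : M.carrier → ℝ} (hf : M.SmoothFun f) : M.SmoothForm (M.d f) :=
  smoothForm_of_apply fun _ hX => d_apply_smooth hf hX

theorem SmoothFun.mdiff {f : M.carrier → ℝ} (hf : M.SmoothFun f) (x : M.carrier) :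
    MDifferentiableAt M.model 𝓘(ℝ, ℝ) f x := hf.mdifferentiableAt (by simp)

theorem d_add {f g : M.carrier → ℝ} (hf : M.SmoothFun f) (hg : M.SmoothFun g) (x : M.carrier) :
    M.d (fun y => f y + g y) x = M.d f x + M.d g x :=
  mvfderiv_fun_add (SmoothFun.mdiff hf x) (SmoothFun.mdiff hg x)

theorem d_sub {f g : M.carrier → ℝ} (hf : M.SmoothFun f) (hg : M.SmoothFun g) (x : M.carrier) :
    M.d (fun y => f y - g y) x = M.d f x - M.d g x :=
  mvfderiv_fun_sub (SmoothFun.mdiff hf x) (SmoothFun.mdiff hg x)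

theorem d_neg (f : M.carrier → ℝ) (x : M.carrier) :
    M.d (fun y => - f y) x = - M.d f x :=
  mvfderiv_fun_neg

theorem d_const (c : ℝ) (x : M.carrier) : M.d (fun _ => c) x = 0 := mvfderiv_const c

theorem d_mul {f g : M.carrier → ℝ} (hf : M.SmoothFun f) (hg : M.SmoothFun g) (x : M.carrier) :
    M.d (fun y => f y * g y) x = f x • M.d g x + g x • M.d f x :=
  mvfderiv_fun_mul (SmoothFun.mdiff hf x) (SmoothFun.mdiff hg x)

theorem d_const_mul (c : ℝ) {f : M.carrier → ℝ} (hf : M.SmoothFun f) (x : M.carrier) :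
    M.d (fun y => c * f y) x = c • M.d f x := by
  rw [d_mul contMDiff_const hf, d_const, smul_zero, add_zero]

theorem smoothFun_sum {ι : Type*} (t : Finset ι) {f : ι → M.carrier → ℝ}
    (hf : ∀ i, M.SmoothFun (f i)) : M.SmoothFun (fun y => ∑ i ∈ t, f i y) :=
  contMDiff_finsetSum fun i _ => hf i

theorem d_sum {ι : Type*} (t : Finset ι) {f : ι → M.carrier → ℝ}
    (hf : ∀ i, M.SmoothFun (f i)) (x : M.carrier) :
    M.d (fun y => ∑ i ∈ t, f i y) x = ∑ i ∈ t, M.d (f i) x := by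
  classical
  induction t using Finset.induction_on with
  | empty => simpa using d_const 0 x
  | insert a t ha ih =>
    simp only [Finset.sum_insert ha]
    rw [d_add (hf a) (smoothFun_sum t hf), ih]

theorem pullCot_d {M N : SmoothManifold.{u}} {φ : M.carrier → N.carrier} (hφ : M.Smooth N φ)
    {f : N.carrier → ℝ} (hf : N.SmoothFun f) (x : M.carrier) :
    M.pullCot N φ x (N.d f (φ x)) = M.d (fun y => f (φ y)) x :=
  (mvfderiv_comp x (SmoothFun.mdiff hf _) (hφ.mdifferentiableAt (by simp))).symm

theorem d_comp_apply {M N : SmoothManifold.{u}} {φ : M.carrier → N.carrier} (hφ : M.Smooth N φ)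
    {f : N.carrier → ℝ} (hf : N.SmoothFun f) (x : M.carrier) (v : M.T x) :
    (M.d (fun y => f (φ y)) x v : ℝ) = N.d f (φ x) (M.D N φ x v) :=
  congrArg (fun a : M.T x →L[ℝ] ℝ => a v) (pullCot_d hφ hf x).symm

theorem exists_d_eq (x : M.carrier) (a : M.Cot x) : ∃ f, M.SmoothFun f ∧ M.d f x = a :=
  exists_smooth_mvfderiv (I := M.model) x a

theorem eq_of_d_eq {x : M.carrier} {v w : M.T x}
    (h : ∀ f, M.SmoothFun f → (M.d f x v : ℝ) = M.d f x w) : v = w :=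
  eq_of_mvfderiv_eq (I := M.model) h

/-- Exact one-forms. -/
def exactForms (M : SmoothManifold.{u}) : Set (∀ x, M.Cot x) := {α | ∃ f, M.SmoothFun f ∧ α = M.d f}

theorem smoothForm_of_mem_exactForms {α : ∀ x, M.Cot x} (h : α ∈ M.exactForms) :
    M.SmoothForm α := by
  obtain ⟨f, hf, rfl⟩ := h
  exact smoothForm_d hf

theorem generatesSections_exactForms :
    GeneratesSections M.model (M.E →L[ℝ] ℝ) (V := M.Cot) M.exactForms := by
  refine generatesSections_of_span (fun s hs => smoothForm_of_mem_exactForms hs) fun x a _ => ?_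
  obtain ⟨f, hf, rfl⟩ := exists_d_eq x a
  exact Submodule.subset_span ⟨_, ⟨f, hf, rfl⟩, rfl⟩

/-! ### The exterior derivative of one-forms -/

theorem contrD_apply (α : ∀ x, M.Cot x) (x : M.carrier) (v w : M.T x) :
    (M.contrD α x v w : ℝ) = mvfderiv M.model (M.formInChart α x) x v (M.chartAtL x w) -
      mvfderiv M.model (M.formInChart α x) x w (M.chartAtL x v) := rfl

theorem formInChart_self (α : ∀ x, M.Cot x) (x : M.carrier) (v : M.T x) :
    M.formInChart α x x (M.chartAtL x v) = α x v := by
  have h : x ∈ (trivializationAt M.E (TangentSpace M.model) x).baseSet :=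
    FiberBundle.mem_baseSet_trivializationAt' x
  change (show M.T x →L[ℝ] ℝ from α x) ((trivializationAt M.E (TangentSpace M.model) x).symmL ℝ x
    ((trivializationAt M.E (TangentSpace M.model) x).continuousLinearMapAt ℝ x v)) = _
  rw [Trivialization.symmL_continuousLinearMapAt _ h]

theorem formInChart_mdifferentiableAt {α : ∀ x, M.Cot x} (hα : M.SmoothForm α) (x : M.carrier) :
    MDifferentiableAt M.model 𝓘(ℝ, M.E →L[ℝ] ℝ) (M.formInChart α x) x := by
  have h := ((contMDiffAt_hom_bundle _).1 (hα x)).2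
  refine ContMDiffAt.mdifferentiableAt (n := ∞) ?_ (by simp)
  refine h.congr_of_eventuallyEq (Filter.Eventually.of_forall fun y => ?_)
  ext v
  simp [ContinuousLinearMap.inCoordinates, formInChart]

theorem contrD_add {α β : ∀ x, M.Cot x} (hα : M.SmoothForm α) (hβ : M.SmoothForm β)
    (x : M.carrier) (v : M.T x) :
    M.contrD (α + β) x v = M.contrD α x v + M.contrD β x v := by
  have h : M.formInChart (α + β) x = fun y => M.formInChart α x y + M.formInChart β x y := rfl
  ext w
  change (M.contrD (α + β) x v w : ℝ) = M.contrD α x v w + M.contrD β x v w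
  simp only [contrD_apply, h]
  rw [mvfderiv_fun_add (formInChart_mdifferentiableAt hα x) (formInChart_mdifferentiableAt hβ x)]
  simp only [add_apply]
  ring

/-- This is `d(fα) = f dα + df ∧ α` after contraction. -/
theorem contrD_smul {f : M.carrier → ℝ} (hf : M.SmoothFun f) {α : ∀ x, M.Cot x}
    (hα : M.SmoothForm α) (x : M.carrier) (v : M.T x) :
    M.contrD (fun y => f y • α y) x v =
      f x • M.contrD α x v + (M.d f x v : ℝ) • α x - (α x v : ℝ) • M.d f x := by
  have h : M.formInChart (fun y => f y • α y) x = fun y => f y • M.formInChart α x y := rfl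
  ext w
  change (M.contrD (fun y => f y • α y) x v w : ℝ) =
    f x * M.contrD α x v w + (M.d f x v : ℝ) * α x w - (α x v : ℝ) * M.d f x w
  simp only [contrD_apply, h]
  rw [mvfderiv_fun_smul (SmoothFun.mdiff hf x) (formInChart_mdifferentiableAt hα x)]
  simp only [add_apply, smul_apply,
    ContinuousLinearMap.smulRight_apply, formInChart_self, smul_eq_mul, d]
  ring

theorem contrD_vec_add (α : ∀ x, M.Cot x) (x : M.carrier) (v w : M.T x) :
    M.contrD α x (v + w) = M.contrD α x v + M.contrD α x w := by
  ext z
  change (M.contrD α x (v + w) z : ℝ) = M.contrD α x v z + M.contrD α x w z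
  simp only [contrD_apply, map_add, add_apply]
  ring

theorem contrD_vec_smul (α : ∀ x, M.Cot x) (x : M.carrier) (c : ℝ) (v : M.T x) :
    M.contrD α x (c • v) = c • M.contrD α x v := by
  ext z
  change (M.contrD α x (c • v) z : ℝ) = c * M.contrD α x v z
  simp only [contrD_apply, map_smul, smul_apply, smul_eq_mul]
  ring

/-- This is `d² = 0`: near `x` the coordinate expression of `df` is the ordinary derivative of `f`
in the chart, and its derivative at `x` is a symmetric bilinear form. -/
theorem contrD_d {f : M.carrier → ℝ} (hf : M.SmoothFun f) (x : M.carrier) (v : M.T x) :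
    M.contrD (M.d f) x v = 0 := by
  set φ := extChartAt M.model x with hφ
  set f' : M.E → ℝ := f ∘ φ.symm with hf'
  have htn : φ.target ∈ 𝓝 (φ x) := extChartAt_target_mem_nhds x
  have hf'smooth : ContDiffAt ℝ ∞ f' (φ x) := by
    have h1 := contMDiffOn_extChartAt_symm (I := M.model) (n := ∞) x
    exact ((hf.comp_contMDiffOn h1).contMDiffAt htn).contDiffAt
  have hloc : M.formInChart (M.d f) x =ᶠ[𝓝 x] fun y => fderiv ℝ f' (φ y) := by
    filter_upwards [(chartAt M.H x).open_source.mem_nhds (mem_chart_source M.H x)] with y hy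
    have hy' : y ∈ φ.source := by rwa [hφ, extChartAt_source]
    have h1 := mvfderiv_extChartAt_symm hf x (φ.map_source hy')
    rw [← hφ, φ.left_inv hy'] at h1
    rw [hf', h1, formInChart, TangentBundle.symmL_trivializationAt hy, M.model.range_eq_univ,
      mfderivWithin_univ]
    rfl
  have hdiff : DifferentiableAt ℝ (fderiv ℝ f') (φ x) :=
    (hf'smooth.fderiv_right (m := 1) (by norm_cast)).differentiableAt (by simp)
  have hφd : MDifferentiableAt M.model 𝓘(ℝ, M.E) φ x :=
    mdifferentiableAt_extChartAt (mem_chart_source M.H x)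
  have hD : ∀ w : M.T x, mvfderiv M.model (M.formInChart (M.d f) x) x w =
      fderiv ℝ (fderiv ℝ f') (φ x) w := by
    intro w
    have h1 : mfderiv M.model 𝓘(ℝ, M.E →L[ℝ] ℝ) (M.formInChart (M.d f) x) x =
        mfderiv M.model 𝓘(ℝ, M.E →L[ℝ] ℝ) (fderiv ℝ f' ∘ φ) x := hloc.mfderiv_eq
    have h2 := mfderiv_comp x hdiff.mdifferentiableAt hφd
    rw [mfderiv_eq_fderiv, hφ, mfderiv_extChartAt_self] at h2
    change mfderiv M.model 𝓘(ℝ, M.E →L[ℝ] ℝ) (M.formInChart (M.d f) x) x w = _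
    rw [h1, h2]
    rfl
  have hc : ∀ w : M.T x, M.chartAtL x w = w := by
    intro w
    rw [chartAtL, TangentBundle.continuousLinearMapAt_trivializationAt (mem_chart_source M.H x),
      mfderiv_extChartAt_self]
    rfl
  ext w
  change (M.contrD (M.d f) x v w : ℝ) = 0
  rw [contrD_apply, hD, hD, hc, hc, sub_eq_zero]
  exact (hf'smooth.isSymmSndFDerivAt (by simpa using ENat.LEInfty.out)) _ _

theorem lieD_d {f : M.carrier → ℝ} (hf : M.SmoothFun f) (X : ∀ x, M.T x) (x : M.carrier) :
    M.lieD X (M.d f) x = M.d (fun y => M.d f y (X y)) x := by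
  rw [lieD, contrD_d hf, zero_add]

theorem smoothVF_smul {f : M.carrier → ℝ} (hf : M.SmoothFun f) {X : ∀ x, M.T x}
    (hX : M.SmoothVF X) : M.SmoothVF (fun x => f x • X x) :=
  ContMDiff.smul_section hf hX

theorem smoothVF_add {X Y : ∀ x, M.T x}
    (hX : M.SmoothVF X) (hY : M.SmoothVF Y) : M.SmoothVF (fun x => X x + Y x) :=
  ContMDiff.add_section hX hY

theorem smoothVF_sum {ι : Type*} (t : Finset ι) {X : ι → ∀ x, M.T x}
    (hX : ∀ i, M.SmoothVF (X i)) : M.SmoothVF (fun x => ∑ i ∈ t, X i x) :=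
  ContMDiff.sum_section fun i _ => hX i

theorem smoothForm_smul {f : M.carrier → ℝ} (hf : M.SmoothFun f) {α : ∀ x, M.Cot x}
    (hα : M.SmoothForm α) : M.SmoothForm (fun x => f x • α x) :=
  ContMDiff.smul_section hf hα

theorem smoothForm_add {α β : ∀ x, M.Cot x}
    (hα : M.SmoothForm α) (hβ : M.SmoothForm β) : M.SmoothForm (fun x => α x + β x) :=
  ContMDiff.add_section hα hβ

theorem smoothForm_sub {α β : ∀ x, M.Cot x}
    (hα : M.SmoothForm α) (hβ : M.SmoothForm β) : M.SmoothForm (fun x => α x - β x) :=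
  ContMDiff.sub_section hα hβ

theorem smoothForm_sum {ι : Type*} (t : Finset ι) {α : ι → ∀ x, M.Cot x}
    (hα : ∀ i, M.SmoothForm (α i)) : M.SmoothForm (fun x => ∑ i ∈ t, α i x) :=
  ContMDiff.sum_section fun i _ => hα i

/-- Together with `eq_of_d_eq` this turns every identity between Lie brackets of vector fields into
one between iterated derivatives of functions. -/
theorem d_mlieBracket {X Y : ∀ x, M.T x} (hX : M.SmoothVF X) (hY : M.SmoothVF Y)
    {f : M.carrier → ℝ} (hf : M.SmoothFun f) (x : M.carrier) :
    (M.d f x (mlieBracket M.model X Y x) : ℝ) =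
      M.d (fun y => M.d f y (Y y)) x (X x) - M.d (fun y => M.d f y (X y)) x (Y x) :=
  mvfderiv_mlieBracket hX hY hf (d_apply_smooth hf hX) (d_apply_smooth hf hY) x

end SmoothManifold

/-! ### Lie algebroid axioms checked on generators. -/

namespace AlgebroidData

variable {A A' : AlgebroidData.{u}}

theorem SmoothSection.add {σ τ : ∀ x, A.V x} (hσ : A.SmoothSection σ) (hτ : A.SmoothSection τ) :
    A.SmoothSection (σ + τ) := ContMDiff.add_section hσ hτ

theorem SmoothSection.neg {σ : ∀ x, A.V x} (hσ : A.SmoothSection σ) :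
    A.SmoothSection (-σ) := ContMDiff.neg_section hσ

theorem SmoothSection.smul {σ : ∀ x, A.V x} (hσ : A.SmoothSection σ) {f : A.base.carrier → ℝ}
    (hf : A.base.SmoothFun f) : A.SmoothSection (fun y => f y • σ y) :=
  ContMDiff.smul_section hf hσ

theorem SmoothSection.sum {ι : Type*} (t : Finset ι) {σ : ι → ∀ x, A.V x}
    (h : ∀ i, A.SmoothSection (σ i)) : A.SmoothSection (fun y => ∑ i ∈ t, σ i y) :=
  ContMDiff.sum_section fun i _ => h i

theorem smoothSection_zero : A.SmoothSection (fun _ => 0) :=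
  contMDiff_zeroSection ℝ A.V

/-- `S` generates the module of smooth sections, locally. -/
structure Generates (A : AlgebroidData.{u}) (S : Set (∀ x, A.V x)) : Prop where
  smooth : ∀ s ∈ S, A.SmoothSection s
  generates : GeneratesSections A.base.model A.F S

theorem generates_of_span {S : Set (∀ x, A.V x)} (hS : ∀ s ∈ S, A.SmoothSection s)
    (hspan : ∀ x, ⊤ ≤ Submodule.span ℝ ((fun s : ∀ x, A.V x => s x) '' S)) : A.Generates S :=
  ⟨hS, generatesSections_of_span hS hspan⟩

theorem Generates.eq_zero {S : Set (∀ x, A.V x)} (hS : A.Generates S)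
    {W : Type*} [AddCommGroup W] [Module ℝ W] (P : (∀ x, A.V x) → W) (x : A.base.carrier)
    (hadd : ∀ σ τ, A.SmoothSection σ → A.SmoothSection τ → P (σ + τ) = P σ + P τ)
    (hsmul : ∀ f σ, A.base.SmoothFun f → A.SmoothSection σ →
      P (fun y => f y • σ y) = f x • P σ)
    (h0 : ∀ s ∈ S, P s = 0) (σ : ∀ x, A.V x) (hσ : A.SmoothSection σ) : P σ = 0 :=
  eq_zero_of_generatesSections hS.generates hS.smooth P x hadd hsmul h0 σ hσ

/-- The axioms of a Lie algebroid that concern the module structure. -/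
structure IsPreLie (A : AlgebroidData.{u}) : Prop where
  anchor_smooth : ∀ σ, A.SmoothSection σ → A.base.SmoothVF (fun x => A.anchor x (σ x))
  bracket_add : ∀ σ τ υ, A.SmoothSection σ → A.SmoothSection τ → A.SmoothSection υ →
    A.bracket σ (τ + υ) = A.bracket σ τ + A.bracket σ υ
  bracket_skew : ∀ σ τ, A.SmoothSection σ → A.SmoothSection τ →
    A.bracket σ τ = - A.bracket τ σ
  leibniz : ∀ (f : A.base.carrier → ℝ) (σ τ), A.base.SmoothFun f → A.SmoothSection σ →
    A.SmoothSection τ → ∀ x, A.bracket σ (fun y => f y • τ y) x =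
      f x • A.bracket σ τ x + (A.base.d f x (A.anchor x (σ x)) : ℝ) • τ x

theorem IsLieAlgebroid.isPreLie (h : A.IsLieAlgebroid) : A.IsPreLie :=
  ⟨h.anchor_smooth, h.bracket_add, h.bracket_skew, h.leibniz⟩

namespace IsPreLie

variable (h : A.IsPreLie)
include h

theorem bracket_add_left {σ τ υ : ∀ x, A.V x} (hσ : A.SmoothSection σ) (hτ : A.SmoothSection τ)
    (hυ : A.SmoothSection υ) :
    A.bracket (σ + τ) υ = A.bracket σ υ + A.bracket τ υ := by
  rw [h.bracket_skew _ _ (hσ.add hτ) hυ, h.bracket_add _ _ _ hυ hσ hτ,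
    h.bracket_skew _ _ hυ hσ, h.bracket_skew _ _ hυ hτ]
  abel

theorem leibniz_left {f : A.base.carrier → ℝ} {σ τ : ∀ x, A.V x} (hf : A.base.SmoothFun f)
    (hσ : A.SmoothSection σ) (hτ : A.SmoothSection τ) (x : A.base.carrier) :
    A.bracket (fun y => f y • σ y) τ x =
      f x • A.bracket σ τ x - (A.base.d f x (A.anchor x (τ x)) : ℝ) • σ x := by
  rw [h.bracket_skew _ _ (hσ.smul hf) hτ, Pi.neg_apply, h.leibniz _ _ _ hf hτ hσ,
    h.bracket_skew _ _ hτ hσ, Pi.neg_apply]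
  module

theorem bracket_zero {σ : ∀ x, A.V x} (hσ : A.SmoothSection σ) :
    A.bracket σ (fun _ => 0) = fun _ => 0 := by
  have h1 := h.bracket_add σ _ _ hσ smoothSection_zero smoothSection_zero
  have h2 : ((fun _ => 0 : ∀ x, A.V x) + fun _ => 0) = fun _ => 0 := add_zero _
  rw [h2] at h1
  exact left_eq_add.1 h1

theorem bracket_sum {ι : Type*} (t : Finset ι) {σ : ∀ x, A.V x} (hσ : A.SmoothSection σ)
    {τ : ι → ∀ x, A.V x} (hτ : ∀ i, A.SmoothSection (τ i)) :
    A.bracket σ (fun y => ∑ i ∈ t, τ i y) = fun y => ∑ i ∈ t, A.bracket σ (τ i) y := by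
  classical
  induction t using Finset.induction_on with
  | empty => simpa using h.bracket_zero hσ
  | insert a t ha ih =>
    simp only [Finset.sum_insert ha]
    have h1 := h.bracket_add σ (τ a) _ hσ (hτ a) (SmoothSection.sum t hτ)
    rw [ih] at h1
    exact h1

theorem bracket_sum_smul {ι : Type*} (t : Finset ι) {σ : ∀ x, A.V x} (hσ : A.SmoothSection σ)
    {u : ι → A.base.carrier → ℝ} (hu : ∀ i, A.base.SmoothFun (u i))
    {τ : ι → ∀ x, A.V x} (hτ : ∀ i, A.SmoothSection (τ i)) (x : A.base.carrier) :
    A.bracket σ (fun y => ∑ i ∈ t, u i y • τ i y) x = ∑ i ∈ t, (u i x • A.bracket σ (τ i) x +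
      (A.base.d (u i) x (A.anchor x (σ x)) : ℝ) • τ i x) := by
  rw [h.bracket_sum t hσ fun i => (hτ i).smul (hu i)]
  exact Finset.sum_congr rfl fun i _ => h.leibniz _ _ _ (hu i) hσ (hτ i) x

/-- The bracket is local in its second argument by the Leibniz rule with a cutoff, and the Leibniz
rule expresses the bracket with a combination of generators by smooth terms. -/
theorem bracket_smooth_of_generates {S : Set (∀ x, A.V x)} (hS : A.Generates S)
    {σ : ∀ x, A.V x} (hσ : A.SmoothSection σ)
    (hb : ∀ s ∈ S, A.SmoothSection (A.bracket σ s)) {τ : ∀ x, A.V x} (hτ : A.SmoothSection τ) :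
    A.SmoothSection (A.bracket σ τ) := by
  intro x
  obtain ⟨n, χ, u, s, hχ, hχ1, hu, hs, heq⟩ := hS.generates τ hτ x
  have hss := fun i => hS.smooth _ (hs i)
  have hsm : A.SmoothSection (fun y => ∑ i, (u i y • A.bracket σ (s i) y +
      (A.base.d (u i) y (A.anchor y (σ y)) : ℝ) • s i y)) :=
    SmoothSection.sum _ fun i => ((hb _ (hs i)).smul (hu i)).add
      ((hss i).smul (SmoothManifold.d_apply_smooth (hu i) (h.anchor_smooth σ hσ)))
  refine (hsm x).congr_of_eventuallyEq ?_
  -- The cutoff must equal `1` on a neighbourhood of `y` and not only at `y`, since `dχ` enters the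
  -- Leibniz rule.
  filter_upwards [hχ1.eventually_nhds] with y hy
  have h0 : A.base.d χ y = 0 := by
    have h1 : mfderiv A.base.model 𝓘(ℝ, ℝ) χ y =
      mfderiv A.base.model 𝓘(ℝ, ℝ) (fun _ => (1 : ℝ)) y := Filter.EventuallyEq.mfderiv_eq hy
    rw [mfderiv_const] at h1
    exact h1
  have h2 := h.leibniz χ σ τ hχ hσ hτ y
  rw [h0, hy.self_of_nhds, funext heq, h.bracket_sum_smul _ hσ hu hss] at h2
  simp only [Pi.one_apply, one_smul] at h2
  have h3 : A.bracket σ τ y = ∑ i, (u i y • A.bracket σ (s i) y +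
      (A.base.d (u i) y (A.anchor y (σ y)) : ℝ) • s i y) := by
    rw [h2]
    exact (add_eq_left.2 (zero_smul ℝ _)).symm
  rw [h3]

end IsPreLie

theorem mlieBracket_smul_of_smooth {M : SmoothManifold.{u}} {f : M.carrier → ℝ}
    {X Y : ∀ x, M.T x} (hf : M.SmoothFun f) (hY : M.SmoothVF Y) (x : M.carrier) :
    mlieBracket M.model X (fun y => f y • Y y) x =
      f x • mlieBracket M.model X Y x + (M.d f x (X x) : ℝ) • Y x := by
  rw [add_comm]
  exact mlieBracket_smul_right (hf.mdifferentiableAt (by simp)) (hY.mdifferentiableAt (by simp))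

/-- The failure of the anchor to preserve brackets is tensorial in each argument by the Leibniz
rule. Once it vanishes, the Jacobiator is tensorial in its last argument, and skew-symmetry carries
this to the other two. -/
theorem isLieAlgebroid_of_generates (h : A.IsPreLie) {S : Set (∀ x, A.V x)} (hS : A.Generates S)
    (hbr : ∀ s ∈ S, ∀ t ∈ S, A.SmoothSection (A.bracket s t))
    (hanchor : ∀ s ∈ S, ∀ t ∈ S, ∀ x, A.anchor x (A.bracket s t x) =
      mlieBracket A.base.model (fun y => A.anchor y (s y)) (fun y => A.anchor y (t y)) x)
    (hjac : ∀ s ∈ S, ∀ t ∈ S, ∀ u ∈ S, ∀ x, A.bracket s (A.bracket t u) x =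
      A.bracket (A.bracket s t) u x + A.bracket t (A.bracket s u) x) :
    A.IsLieAlgebroid := by
  have bsm : ∀ σ τ, A.SmoothSection σ → A.SmoothSection τ → A.SmoothSection (A.bracket σ τ) := by
    intro σ τ hσ hτ
    refine h.bracket_smooth_of_generates hS hσ (fun s hs => ?_) hτ
    rw [h.bracket_skew _ _ hσ (hS.smooth _ hs)]
    exact (h.bracket_smooth_of_generates hS (hS.smooth _ hs) (fun t ht => hbr s hs t ht) hσ).neg
  have hancS : ∀ s ∈ S, ∀ τ, A.SmoothSection τ → ∀ x, A.anchor x (A.bracket s τ x) =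
      mlieBracket A.base.model (fun y => A.anchor y (s y)) (fun y => A.anchor y (τ y)) x := by
    intro s hs τ hτ x
    have hss := hS.smooth _ hs
    rw [← sub_eq_zero]
    refine hS.eq_zero (fun τ => A.anchor x (A.bracket s τ x) -
      mlieBracket A.base.model (fun y => A.anchor y (s y)) (fun y => A.anchor y (τ y)) x) x
      ?_ ?_ ?_ τ hτ
    · intro σ τ hσ hτ
      have h1 : (fun y => A.anchor y ((σ + τ) y)) =
          (fun y => A.anchor y (σ y)) + (fun y => A.anchor y (τ y)) := by
        funext y; simp
      rw [h.bracket_add _ _ _ hss hσ hτ, h1, mlieBracket_add_right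
        ((h.anchor_smooth σ hσ).mdifferentiableAt (by simp))
        ((h.anchor_smooth τ hτ).mdifferentiableAt (by simp)), Pi.add_apply, map_add]
      abel
    · intro f σ hf hσ
      simp only [map_smul]
      rw [mlieBracket_smul_of_smooth hf (h.anchor_smooth σ hσ), h.leibniz _ _ _ hf hss hσ, map_add,
        map_smul, map_smul]
      module
    · intro t ht
      rw [hanchor s hs t ht, sub_self]
  have hanc : ∀ σ τ, A.SmoothSection σ → A.SmoothSection τ → ∀ x, A.anchor x (A.bracket σ τ x) =
      mlieBracket A.base.model (fun y => A.anchor y (σ y)) (fun y => A.anchor y (τ y)) x := by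
    intro σ τ hσ hτ x
    rw [← sub_eq_zero]
    refine hS.eq_zero (fun σ => A.anchor x (A.bracket σ τ x) -
      mlieBracket A.base.model (fun y => A.anchor y (σ y)) (fun y => A.anchor y (τ y)) x) x
      ?_ ?_ ?_ σ hσ
    · intro σ σ' hσ hσ'
      have h1 : (fun y => A.anchor y ((σ + σ') y)) =
          (fun y => A.anchor y (σ y)) + (fun y => A.anchor y (σ' y)) := by
        funext y; simp
      rw [h.bracket_add_left hσ hσ' hτ, h1, mlieBracket_add_left
        ((h.anchor_smooth σ hσ).mdifferentiableAt (by simp))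
        ((h.anchor_smooth σ' hσ').mdifferentiableAt (by simp)), Pi.add_apply, map_add]
      abel
    · intro f σ hf hσ
      simp only [map_smul]
      rw [mlieBracket_swap_apply, mlieBracket_smul_of_smooth hf (h.anchor_smooth σ hσ),
        mlieBracket_swap_apply, h.leibniz_left hf hσ hτ, map_sub, map_smul, map_smul]
      module
    · intro s hs
      rw [hancS s hs τ hτ, sub_self]
  have hcomm : ∀ f σ τ, A.base.SmoothFun f → A.SmoothSection σ → A.SmoothSection τ → ∀ x,
      (A.base.d f x (A.anchor x (A.bracket σ τ x)) : ℝ) =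
        A.base.d (fun y => A.base.d f y (A.anchor y (τ y))) x (A.anchor x (σ x)) -
        A.base.d (fun y => A.base.d f y (A.anchor y (σ y))) x (A.anchor x (τ x)) := by
    intro f σ τ hf hσ hτ x
    rw [hanc σ τ hσ hτ]
    exact SmoothManifold.d_mlieBracket (h.anchor_smooth σ hσ) (h.anchor_smooth τ hτ) hf x
  let J : (∀ x, A.V x) → (∀ x, A.V x) → (∀ x, A.V x) → ∀ x, A.V x := fun σ τ υ x =>
    A.bracket σ (A.bracket τ υ) x - A.bracket (A.bracket σ τ) υ x - A.bracket τ (A.bracket σ υ) x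
  have hten : ∀ σ τ, A.SmoothSection σ → A.SmoothSection τ → ∀ x,
      (∀ s ∈ S, J σ τ s x = 0) → ∀ υ, A.SmoothSection υ → J σ τ υ x = 0 := by
    intro σ τ hσ hτ x h0 υ hυ
    refine hS.eq_zero (fun υ => J σ τ υ x) x ?_ ?_ h0 υ hυ
    · intro υ υ' hυ hυ'
      simp only [J]
      rw [h.bracket_add _ _ _ hτ hυ hυ', h.bracket_add _ _ _ hσ hυ hυ',
        h.bracket_add _ _ _ hσ (bsm _ _ hτ hυ) (bsm _ _ hτ hυ'),
        h.bracket_add _ _ _ hτ (bsm _ _ hσ hυ) (bsm _ _ hσ hυ'),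
        h.bracket_add _ _ _ (bsm _ _ hσ hτ) hυ hυ']
      simp only [Pi.add_apply]
      abel
    · intro f υ hf hυ
      -- The mixed first-order terms are symmetric in the two outer sections and drop out of the
      -- Jacobiator. The second-order terms leave a commutator of derivations of `f`, which `hcomm`
      -- identifies with the derivative along the anchor of the bracket.
      have key : ∀ ρ κ, A.SmoothSection ρ → A.SmoothSection κ →
          A.bracket ρ (A.bracket κ (fun y => f y • υ y)) x =
            f x • A.bracket ρ (A.bracket κ υ) x +
            (A.base.d f x (A.anchor x (ρ x)) : ℝ) • A.bracket κ υ x +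
            ((A.base.d f x (A.anchor x (κ x)) : ℝ) • A.bracket ρ υ x +
            (A.base.d (fun y => A.base.d f y (A.anchor y (κ y))) x (A.anchor x (ρ x)) : ℝ)
              • υ x) := by
        intro ρ κ hρ hκ
        have hdf := SmoothManifold.d_apply_smooth hf (h.anchor_smooth κ hκ)
        have h1 : A.bracket κ (fun y => f y • υ y) = (fun y => f y • A.bracket κ υ y) +
            (fun y => (A.base.d f y (A.anchor y (κ y)) : ℝ) • υ y) := by
          funext y
          exact h.leibniz f κ υ hf hκ hυ y
        rw [h1, h.bracket_add _ _ _ hρ ((bsm _ _ hκ hυ).smul hf) (hυ.smul hdf), Pi.add_apply,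
          h.leibniz _ _ _ hf hρ (bsm _ _ hκ hυ), h.leibniz _ _ _ hdf hρ hυ]
      simp only [J]
      rw [key σ τ hσ hτ, key τ σ hτ hσ, h.leibniz _ _ _ hf (bsm _ _ hσ hτ) hυ,
        hcomm f σ τ hf hσ hτ x]
      module
  have hskew₁ : ∀ σ τ υ, A.SmoothSection σ → A.SmoothSection τ → A.SmoothSection υ → ∀ x,
      J σ τ υ x = - J τ σ υ x := by
    intro σ τ υ hσ hτ hυ x
    simp only [J]
    rw [h.bracket_skew σ τ hσ hτ, h.bracket_skew (- A.bracket τ σ) υ (bsm _ _ hτ hσ).neg hυ,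
      h.bracket_skew (A.bracket τ σ) υ (bsm _ _ hτ hσ) hυ]
    have h1 : A.bracket υ (-A.bracket τ σ) = - A.bracket υ (A.bracket τ σ) := by
      have h2 := h.bracket_add υ _ _ hυ (bsm _ _ hτ hσ) (bsm _ _ hτ hσ).neg
      have h3 : A.bracket τ σ + -A.bracket τ σ = fun _ => 0 := add_neg_cancel _
      rw [h3, h.bracket_zero hυ] at h2
      exact (neg_eq_of_add_eq_zero_right h2.symm).symm
    rw [h1]
    simp only [Pi.neg_apply]
    abel
  have hneg : ∀ υ σ, A.SmoothSection υ → A.SmoothSection σ →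
      A.bracket υ (-σ) = - A.bracket υ σ := by
    intro υ σ hυ hσ
    have h2 := h.bracket_add υ _ _ hυ hσ hσ.neg
    have h3 : σ + -σ = fun _ => 0 := add_neg_cancel _
    rw [h3, h.bracket_zero hυ] at h2
    exact (neg_eq_of_add_eq_zero_right h2.symm).symm
  have hskew₂ : ∀ σ τ υ, A.SmoothSection σ → A.SmoothSection τ → A.SmoothSection υ → ∀ x,
      J σ τ υ x = - J σ υ τ x := by
    intro σ τ υ hσ hτ hυ x
    simp only [J]
    rw [h.bracket_skew τ υ hτ hυ, hneg _ _ hσ (bsm _ _ hυ hτ),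
      h.bracket_skew (A.bracket σ υ) τ (bsm _ _ hσ hυ) hτ,
      h.bracket_skew (A.bracket σ τ) υ (bsm _ _ hσ hτ) hυ]
    simp only [Pi.neg_apply]
    abel
  -- Generators are replaced by arbitrary sections one slot at a time. Each time, skew-symmetry
  -- brings the slot in question to the last place.
  have hJ1 : ∀ s ∈ S, ∀ t ∈ S, ∀ υ, A.SmoothSection υ → ∀ x, J s t υ x = 0 := by
    intro s hs t ht υ hυ x
    refine hten s t (hS.smooth _ hs) (hS.smooth _ ht) x (fun u hu => ?_) υ hυ
    simp only [J]
    rw [hjac s hs t ht u hu x]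
    abel
  have hJ2 : ∀ s ∈ S, ∀ τ υ, A.SmoothSection τ → A.SmoothSection υ → ∀ x, J s τ υ x = 0 := by
    intro s hs τ υ hτ hυ x
    refine hten s τ (hS.smooth _ hs) hτ x (fun u hu => ?_) υ hυ
    rw [hskew₂ _ _ _ (hS.smooth _ hs) hτ (hS.smooth _ hu), hJ1 s hs u hu τ hτ, neg_zero]
  have hJ3 : ∀ σ τ υ, A.SmoothSection σ → A.SmoothSection τ → A.SmoothSection υ →
      ∀ x, J σ τ υ x = 0 := by
    intro σ τ υ hσ hτ hυ x
    refine hten σ τ hσ hτ x (fun u hu => ?_) υ hυ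
    rw [hskew₂ _ _ _ hσ hτ (hS.smooth _ hu), hskew₁ _ _ _ hσ (hS.smooth _ hu) hτ,
      hJ2 u hu σ τ hσ hτ, neg_zero, neg_zero]
  exact
    { anchor_smooth := h.anchor_smooth
      bracket_smooth := bsm
      bracket_add := h.bracket_add
      bracket_skew := h.bracket_skew
      jacobi := fun σ τ υ hσ hτ hυ => by
        funext x
        have := hJ3 σ τ υ hσ hτ hυ x
        simp only [J] at this
        rw [Pi.add_apply, ← sub_eq_zero, ← this]
        abel
      leibniz := h.leibniz
      anchor_bracket := hanc }

end AlgebroidData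

/-! ### Comorphisms checked on generators. -/

namespace BundleComorphism

variable {A A' : AlgebroidData.{u}}

/-- The two derivative terms in the Leibniz rules upstairs and downstairs agree because the anchors
are related by the base map. Hence the defect of the bracket condition is tensorial along that map.
-/
theorem isComorphism_of_generates (hA : A.IsLieAlgebroid) (hA' : A'.IsLieAlgebroid)
    {S : Set (∀ x, A'.V x)} (hS : A'.Generates S) {Ψ : BundleComorphism A A'}
    (hbase : A.base.Smooth A'.base Ψ.base)
    (hpull : ∀ s ∈ S, A.SmoothSection (Ψ.pull s))
    (hanchor : ∀ x (v : A'.V (Ψ.base x)),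
      A.base.D A'.base Ψ.base x (A.anchor x (Ψ.fib x v)) = A'.anchor (Ψ.base x) v)
    (hbr : ∀ s ∈ S, ∀ t ∈ S, ∀ x, Ψ.pull (A'.bracket s t) x = A.bracket (Ψ.pull s) (Ψ.pull t) x) :
    Ψ.IsComorphism := by
  have hps : ∀ σ, A'.SmoothSection σ → A.SmoothSection (Ψ.pull σ) :=
    fun σ hσ => smooth_of_generatesSections hS.generates hbase Ψ.fib hpull σ hσ
  have hadd : ∀ σ τ, Ψ.pull (σ + τ) = Ψ.pull σ + Ψ.pull τ := fun σ τ => by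
    funext x; simp [BundleComorphism.pull]
  have hsmul : ∀ (f : A'.base.carrier → ℝ) σ, Ψ.pull (fun y => f y • σ y) =
      fun x => f (Ψ.base x) • Ψ.pull σ x := fun f σ => by
    funext x; simp [BundleComorphism.pull]
  have hd : ∀ f, A'.base.SmoothFun f → ∀ x (v : A'.V (Ψ.base x)),
      (A.base.d (fun x => f (Ψ.base x)) x (A.anchor x (Ψ.fib x v)) : ℝ) =
        A'.base.d f (Ψ.base x) (A'.anchor (Ψ.base x) v) := by
    intro f hf x v
    rw [SmoothManifold.d_comp_apply hbase hf]
    exact congrArg (fun w : A'.base.T (Ψ.base x) => (A'.base.d f (Ψ.base x) w : ℝ)) (hanchor x v)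
  have hten : ∀ σ, A'.SmoothSection σ → ∀ x, (∀ s ∈ S,
      Ψ.pull (A'.bracket σ s) x - A.bracket (Ψ.pull σ) (Ψ.pull s) x = 0) → ∀ τ,
      A'.SmoothSection τ → Ψ.pull (A'.bracket σ τ) x - A.bracket (Ψ.pull σ) (Ψ.pull τ) x = 0 := by
    intro σ hσ x h0 τ hτ
    refine hS.eq_zero (fun τ => Ψ.pull (A'.bracket σ τ) x - A.bracket (Ψ.pull σ) (Ψ.pull τ) x)
      (Ψ.base x) ?_ ?_ h0 τ hτ
    · intro τ υ hτ hυ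
      rw [hA'.bracket_add _ _ _ hσ hτ hυ, hadd, hadd,
        hA.bracket_add _ _ _ (hps _ hσ) (hps _ hτ) (hps _ hυ)]
      simp only [Pi.add_apply]
      abel
    · intro f τ hf hτ
      rw [hsmul, hA.leibniz (fun x => f (Ψ.base x)) _ _ (hf.comp hbase) (hps _ hσ) (hps _ hτ)]
      have h1 : A'.bracket σ (fun y => f y • τ y) = (fun y => f y • A'.bracket σ τ y) +
          (fun y => (A'.base.d f y (A'.anchor y (σ y)) : ℝ) • τ y) := by
        funext y
        exact hA'.leibniz f σ τ hf hσ hτ y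
      rw [h1, hadd, hsmul, hsmul, Pi.add_apply]
      have h2 := hd f hf x (σ (Ψ.base x))
      simp only [BundleComorphism.pull] at h2 ⊢
      rw [← h2]
      module
  have hneg : ∀ σ, Ψ.pull (-σ) = - Ψ.pull σ := fun σ => by
    funext x; simp [BundleComorphism.pull]
  refine ⟨hbase, hps, hanchor, fun σ τ hσ hτ => ?_⟩
  funext x
  rw [← sub_eq_zero]
  refine hten σ hσ x (fun s hs => ?_) τ hτ
  have h1 := hten s (hS.smooth _ hs) x (fun t ht => by rw [hbr s hs t ht, sub_self]) σ hσ
  rw [hA'.bracket_skew _ _ hσ (hS.smooth _ hs), hneg,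
    hA.bracket_skew _ _ (hps _ hσ) (hpull _ hs), Pi.neg_apply, Pi.neg_apply, ← neg_sub', h1, neg_zero]

end BundleComorphism

namespace SmoothManifold

variable {M N : SmoothManifold.{u}}

/-! ### Product manifolds -/

theorem d_const_apply (c : ℝ) (x : M.carrier) (v : M.T x) : (M.d (fun _ => c) x v : ℝ) = 0 := by
  rw [d_const]; rfl

/-- The inclusion of the tangent space of the first factor. -/
abbrev inlT (M N : SmoothManifold.{u}) (p : M.carrier × N.carrier) : M.T p.1 →L[ℝ] (M.prod N).T p :=
  M.D (M.prod N) (fun x => (x, p.2)) p.1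

/-- The inclusion of the tangent space of the second factor. -/
abbrev inrT (M N : SmoothManifold.{u}) (p : M.carrier × N.carrier) : N.T p.2 →L[ℝ] (M.prod N).T p :=
  N.D (M.prod N) (fun y => (p.1, y)) p.2

theorem smooth_inl (y : N.carrier) : M.Smooth (M.prod N) (fun x => (x, y)) :=
  contMDiff_id.prodMk contMDiff_const

theorem smooth_inr (x : M.carrier) : N.Smooth (M.prod N) (fun y => (x, y)) :=
  contMDiff_const.prodMk contMDiff_id

theorem smooth_fst : (M.prod N).Smooth M Prod.fst := contMDiff_fst

theorem smooth_snd : (M.prod N).Smooth N Prod.snd := contMDiff_snd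

theorem d_inlT {f : M.carrier × N.carrier → ℝ} (hf : (M.prod N).SmoothFun f)
    (p : M.carrier × N.carrier) (v : M.T p.1) :
    ((M.prod N).d f p (M.inlT N p v) : ℝ) = M.d (fun x => f (x, p.2)) p.1 v :=
  (d_comp_apply (smooth_inl p.2) hf p.1 v).symm

theorem d_inrT {f : M.carrier × N.carrier → ℝ} (hf : (M.prod N).SmoothFun f)
    (p : M.carrier × N.carrier) (w : N.T p.2) :
    ((M.prod N).d f p (M.inrT N p w) : ℝ) = N.d (fun y => f (p.1, y)) p.2 w :=
  (d_comp_apply (smooth_inr p.1) hf p.2 w).symm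

theorem smoothFun_fst {f : M.carrier → ℝ} (hf : M.SmoothFun f) :
    (M.prod N).SmoothFun (fun p => f p.1) := hf.comp contMDiff_fst

theorem smoothFun_snd {f : N.carrier → ℝ} (hf : N.SmoothFun f) :
    (M.prod N).SmoothFun (fun p => f p.2) := hf.comp contMDiff_snd

theorem smoothFun_inl {f : M.carrier × N.carrier → ℝ} (hf : (M.prod N).SmoothFun f)
    (y : N.carrier) : M.SmoothFun (fun x => f (x, y)) := hf.comp (smooth_inl y)

theorem smoothFun_inr {f : M.carrier × N.carrier → ℝ} (hf : (M.prod N).SmoothFun f)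
    (x : M.carrier) : N.SmoothFun (fun y => f (x, y)) := hf.comp (smooth_inr x)

theorem inlT_apply (p : M.carrier × N.carrier) (v : M.T p.1) : M.inlT N p v = (v, (0 : N.E)) := by
  have h := mfderiv_prod_left (I := M.model) (I' := N.model) (x₀ := p.1) (y₀ := p.2)
  change mfderiv M.model (M.model.prod N.model) (fun x => (x, p.2)) p.1 v = _
  rw [h]
  rfl

theorem inrT_apply (p : M.carrier × N.carrier) (w : N.T p.2) : M.inrT N p w = ((0 : M.E), w) := by
  have h := mfderiv_prod_right (I := M.model) (I' := N.model) (x₀ := p.1) (y₀ := p.2)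
  change mfderiv N.model (M.model.prod N.model) (fun y => (p.1, y)) p.2 w = _
  rw [h]
  rfl

theorem D_fst_apply (p : M.carrier × N.carrier) (v : (M.prod N).T p) :
    (M.prod N).D M Prod.fst p v = (show M.E × N.E from v).1 := by
  change mfderiv (M.model.prod N.model) M.model Prod.fst p v = _
  rw [mfderiv_fst]
  rfl

theorem D_snd_apply (p : M.carrier × N.carrier) (v : (M.prod N).T p) :
    (M.prod N).D N Prod.snd p v = (show M.E × N.E from v).2 := by
  change mfderiv (M.model.prod N.model) N.model Prod.snd p v = _
  rw [mfderiv_snd]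
  rfl

theorem eq_of_D_fst_of_D_snd {p : M.carrier × N.carrier} {v w : (M.prod N).T p}
    (h₁ : (M.prod N).D M Prod.fst p v = (M.prod N).D M Prod.fst p w)
    (h₂ : (M.prod N).D N Prod.snd p v = (M.prod N).D N Prod.snd p w) : v = w := by
  rw [D_fst_apply, D_fst_apply] at h₁
  rw [D_snd_apply, D_snd_apply] at h₂
  exact Prod.ext (α := M.E) (β := N.E) h₁ h₂

theorem inlT_add_inrT (p : M.carrier × N.carrier) (v : (M.prod N).T p) :
    M.inlT N p ((M.prod N).D M Prod.fst p v) + M.inrT N p ((M.prod N).D N Prod.snd p v) = v := by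
  rw [inlT_apply, inrT_apply, D_fst_apply, D_snd_apply]
  exact Prod.ext (α := M.E) (β := N.E) (add_zero _) (zero_add _)

/-- Functions pulled back from the two factors suffice to detect tangent vectors of a product, and
on such functions the fields coming from the factors act in the simplest way. -/
theorem prod_eq_of_d_eq {p : M.carrier × N.carrier} {v w : (M.prod N).T p}
    (h₁ : ∀ f, M.SmoothFun f →
      ((M.prod N).d (fun p => f p.1) p v : ℝ) = (M.prod N).d (fun p => f p.1) p w)
    (h₂ : ∀ f, N.SmoothFun f →
      ((M.prod N).d (fun p => f p.2) p v : ℝ) = (M.prod N).d (fun p => f p.2) p w) : v = w := by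
  refine eq_of_D_fst_of_D_snd (eq_of_d_eq fun f hf => ?_) (eq_of_d_eq fun f hf => ?_)
  · rw [← d_comp_apply smooth_fst hf, ← d_comp_apply smooth_fst hf]
    exact h₁ f hf
  · rw [← d_comp_apply smooth_snd hf, ← d_comp_apply smooth_snd hf]
    exact h₂ f hf

theorem smoothVF_inlT {X : ∀ x, M.T x} (hX : M.SmoothVF X) :
    (M.prod N).SmoothVF (fun p => M.inlT N p (X p.1)) := by
  have h0 : ContMDiff N.model N.model.tangent ∞ (fun y => (⟨y, 0⟩ : TangentBundle N.model N.carrier)) :=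
    contMDiff_zeroSection ℝ (TangentSpace N.model)
  have h1 : ContMDiff (M.prod N).model (M.model.tangent.prod N.model.tangent) ∞
      (fun p : M.carrier × N.carrier => ((⟨p.1, X p.1⟩ : TangentBundle M.model M.carrier),
        (⟨p.2, 0⟩ : TangentBundle N.model N.carrier))) :=
    (hX.comp contMDiff_fst).prodMk (h0.comp contMDiff_snd)
  have h2 := (contMDiff_equivTangentBundleProd_symm (n := ∞)).comp h1
  exact ContMDiff.congr h2 fun p => congrArg (TotalSpace.mk (F := M.E × N.E)
    (E := TangentSpace (M.model.prod N.model)) p) (inlT_apply p (X p.1))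

theorem smoothVF_inrT {X : ∀ x, N.T x} (hX : N.SmoothVF X) :
    (M.prod N).SmoothVF (fun p => M.inrT N p (X p.2)) := by
  have h0 : ContMDiff M.model M.model.tangent ∞ (fun y => (⟨y, 0⟩ : TangentBundle M.model M.carrier)) :=
    contMDiff_zeroSection ℝ (TangentSpace M.model)
  have h1 : ContMDiff (M.prod N).model (M.model.tangent.prod N.model.tangent) ∞
      (fun p : M.carrier × N.carrier => ((⟨p.1, 0⟩ : TangentBundle M.model M.carrier),
        (⟨p.2, X p.2⟩ : TangentBundle N.model N.carrier))) :=
    (h0.comp contMDiff_fst).prodMk (hX.comp contMDiff_snd)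
  have h2 := (contMDiff_equivTangentBundleProd_symm (n := ∞)).comp h1
  exact ContMDiff.congr h2 fun p => congrArg (TotalSpace.mk (F := M.E × N.E)
    (E := TangentSpace (M.model.prod N.model)) p) (inrT_apply p (X p.2))

theorem d_fst_inlT {f : M.carrier → ℝ} (hf : M.SmoothFun f) (p : M.carrier × N.carrier)
    (v : M.T p.1) : ((M.prod N).d (fun p => f p.1) p (M.inlT N p v) : ℝ) = M.d f p.1 v :=
  d_inlT (smoothFun_fst hf) p v

theorem d_fst_inrT {f : M.carrier → ℝ} (hf : M.SmoothFun f) (p : M.carrier × N.carrier)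
    (w : N.T p.2) : ((M.prod N).d (fun p => f p.1) p (M.inrT N p w) : ℝ) = 0 := by
  rw [d_inrT (smoothFun_fst hf) p w]
  exact d_const_apply _ _ _

theorem d_snd_inrT {f : N.carrier → ℝ} (hf : N.SmoothFun f) (p : M.carrier × N.carrier)
    (w : N.T p.2) : ((M.prod N).d (fun p => f p.2) p (M.inrT N p w) : ℝ) = N.d f p.2 w :=
  d_inrT (smoothFun_snd hf) p w

theorem d_snd_inlT {f : N.carrier → ℝ} (hf : N.SmoothFun f) (p : M.carrier × N.carrier)
    (v : M.T p.1) : ((M.prod N).d (fun p => f p.2) p (M.inlT N p v) : ℝ) = 0 := by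
  rw [d_inlT (smoothFun_snd hf) p v]
  exact d_const_apply _ _ _

theorem D_fst_inlT (p : M.carrier × N.carrier) (v : M.T p.1) :
    (M.prod N).D M Prod.fst p (M.inlT N p v) = v := by
  rw [D_fst_apply]
  exact congrArg (Prod.fst : M.E × N.E → M.E) (inlT_apply p v)

theorem D_fst_inrT (p : M.carrier × N.carrier) (w : N.T p.2) :
    (M.prod N).D M Prod.fst p (M.inrT N p w) = 0 := by
  rw [D_fst_apply]
  exact congrArg (Prod.fst : M.E × N.E → M.E) (inrT_apply p w)

theorem D_snd_inrT (p : M.carrier × N.carrier) (w : N.T p.2) :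
    (M.prod N).D N Prod.snd p (M.inrT N p w) = w := by
  rw [D_snd_apply]
  exact congrArg (Prod.snd : M.E × N.E → N.E) (inrT_apply p w)

theorem D_snd_inlT (p : M.carrier × N.carrier) (v : M.T p.1) :
    (M.prod N).D N Prod.snd p (M.inlT N p v) = 0 := by
  rw [D_snd_apply]
  exact congrArg (Prod.snd : M.E × N.E → N.E) (inlT_apply p v)

theorem mlieBracket_inlT_inlT {X Y : ∀ x, M.T x} (hX : M.SmoothVF X) (hY : M.SmoothVF Y)
    (p : M.carrier × N.carrier) :
    mlieBracket (M.prod N).model (fun p => M.inlT N p (X p.1)) (fun p => M.inlT N p (Y p.1)) p =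
      M.inlT N p (mlieBracket M.model X Y p.1) := by
  refine prod_eq_of_d_eq (fun f hf => ?_) (fun f hf => ?_)
  · rw [d_mlieBracket (smoothVF_inlT hX) (smoothVF_inlT hY) (smoothFun_fst hf), d_fst_inlT hf,
      d_mlieBracket hX hY hf]
    simp only [d_fst_inlT hf]
    rw [d_fst_inlT (d_apply_smooth hf hX), d_fst_inlT (d_apply_smooth hf hY)]
  · rw [d_mlieBracket (smoothVF_inlT hX) (smoothVF_inlT hY) (smoothFun_snd hf), d_snd_inlT hf]
    simp only [d_snd_inlT hf]
    exact (congrArg₂ (· - ·) (d_const_apply _ _ _) (d_const_apply _ _ _)).trans (sub_self _)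

theorem mlieBracket_inrT_inrT {X Y : ∀ x, N.T x} (hX : N.SmoothVF X) (hY : N.SmoothVF Y)
    (p : M.carrier × N.carrier) :
    mlieBracket (M.prod N).model (fun p => M.inrT N p (X p.2)) (fun p => M.inrT N p (Y p.2)) p =
      M.inrT N p (mlieBracket N.model X Y p.2) := by
  refine prod_eq_of_d_eq (fun f hf => ?_) (fun f hf => ?_)
  · rw [d_mlieBracket (smoothVF_inrT hX) (smoothVF_inrT hY) (smoothFun_fst hf), d_fst_inrT hf]
    simp only [d_fst_inrT hf]
    exact (congrArg₂ (· - ·) (d_const_apply _ _ _) (d_const_apply _ _ _)).trans (sub_self _)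
  · rw [d_mlieBracket (smoothVF_inrT hX) (smoothVF_inrT hY) (smoothFun_snd hf), d_snd_inrT hf,
      d_mlieBracket hX hY hf]
    simp only [d_snd_inrT hf]
    rw [d_snd_inrT (d_apply_smooth hf hX), d_snd_inrT (d_apply_smooth hf hY)]

theorem mlieBracket_inlT_inrT {X : ∀ x, M.T x} {Y : ∀ x, N.T x} (hX : M.SmoothVF X)
    (hY : N.SmoothVF Y) (p : M.carrier × N.carrier) :
    mlieBracket (M.prod N).model (fun p => M.inlT N p (X p.1)) (fun p => M.inrT N p (Y p.2)) p =
      0 := by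
  refine prod_eq_of_d_eq (fun f hf => ?_) (fun f hf => ?_)
  · rw [d_mlieBracket (smoothVF_inlT hX) (smoothVF_inrT hY) (smoothFun_fst hf), map_zero]
    simp only [d_fst_inlT hf, d_fst_inrT hf]
    rw [d_fst_inrT (d_apply_smooth hf hX), sub_zero]
    exact d_const_apply _ _ _
  · rw [d_mlieBracket (smoothVF_inlT hX) (smoothVF_inrT hY) (smoothFun_snd hf), map_zero]
    simp only [d_snd_inlT hf, d_snd_inrT hf]
    rw [d_snd_inlT (d_apply_smooth hf hY), zero_sub, neg_eq_zero]
    exact d_const_apply _ _ _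

/-- Differentials of functions pulled back from the factors. -/
def prodExactForms (M N : SmoothManifold.{u}) : Set (∀ p, (M.prod N).Cot p) :=
  {α | ∃ f, M.SmoothFun f ∧ α = (M.prod N).d (fun p => f p.1)} ∪
    {α | ∃ f, N.SmoothFun f ∧ α = (M.prod N).d (fun p => f p.2)}

theorem smoothForm_of_mem_prodExactForms {α : ∀ p, (M.prod N).Cot p}
    (h : α ∈ M.prodExactForms N) : (M.prod N).SmoothForm α := by
  obtain ⟨f, hf, rfl⟩ | ⟨f, hf, rfl⟩ := h
  · exact smoothForm_d (smoothFun_fst hf)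
  · exact smoothForm_d (smoothFun_snd hf)

/-- The two functions realize the restrictions of `a` to the tangent spaces of the factors. -/
theorem exists_prod_d_eq (p : M.carrier × N.carrier) (a : (M.prod N).Cot p) :
    ∃ f g, M.SmoothFun f ∧ N.SmoothFun g ∧
      a = (M.prod N).d (fun p => f p.1) p + (M.prod N).d (fun p => g p.2) p := by
  obtain ⟨f, hf, hfa⟩ := exists_d_eq p.1
    (show M.Cot p.1 from (show (M.prod N).T p →L[ℝ] ℝ from a).comp (M.inlT N p))
  obtain ⟨g, hg, hga⟩ := exists_d_eq p.2
    (show N.Cot p.2 from (show (M.prod N).T p →L[ℝ] ℝ from a).comp (M.inrT N p))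
  refine ⟨f, g, hf, hg, ?_⟩
  ext v
  change (a v : ℝ) = (M.prod N).d (fun p => f p.1) p v + (M.prod N).d (fun p => g p.2) p v
  conv_lhs => rw [← inlT_add_inrT p v]
  rw [d_comp_apply smooth_fst hf, d_comp_apply smooth_snd hg, hfa, hga]
  exact map_add (show (M.prod N).T p →L[ℝ] ℝ from a) _ _

theorem generatesSections_prodExactForms :
    GeneratesSections (M.prod N).model ((M.prod N).E →L[ℝ] ℝ) (V := (M.prod N).Cot)
      (M.prodExactForms N) := by
  refine generatesSections_of_span (fun s hs => smoothForm_of_mem_prodExactForms hs)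
    fun p a _ => ?_
  obtain ⟨f, g, hf, hg, rfl⟩ := exists_prod_d_eq p a
  exact add_mem (Submodule.subset_span ⟨_, Or.inl ⟨f, hf, rfl⟩, rfl⟩)
    (Submodule.subset_span ⟨_, Or.inr ⟨g, hg, rfl⟩, rfl⟩)

end SmoothManifold

namespace AlgebroidData

/-! ### Sections of direct products -/

variable {A B : AlgebroidData.{u}}

/-- The first component of a section of a direct product. -/
def fstSec (σ : ∀ p, (A.prod B).V p) (p : A.base.carrier × B.base.carrier) : A.V p.1 := (σ p).1

/-- The second component of a section of a direct product. -/
def sndSec (σ : ∀ p, (A.prod B).V p) (p : A.base.carrier × B.base.carrier) : B.V p.2 := (σ p).2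

/-- The section of a direct product with given components. -/
def pairSec (a : ∀ p : A.base.carrier × B.base.carrier, A.V p.1)
    (b : ∀ p : A.base.carrier × B.base.carrier, B.V p.2) (p : (A.prod B).base.carrier) :
    (A.prod B).V p := show A.V p.1 × B.V p.2 from (a p, b p)

theorem prodSec_ext {σ τ : ∀ p, (A.prod B).V p} {p : A.base.carrier × B.base.carrier}
    (h₁ : fstSec σ p = fstSec τ p) (h₂ : sndSec σ p = sndSec τ p) : σ p = τ p :=
  Prod.ext (α := A.V p.1) (β := B.V p.2) h₁ h₂

/-- The preferred trivialization of the direct sum of pullbacks is, by definition, the pair of the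
trivializations of `A` and `B` at the projected points. -/
theorem contMDiffAt_prod_section_iff (σ : ∀ p, (A.prod B).V p)
    (p₀ : A.base.carrier × B.base.carrier) :
    ContMDiffAt (A.prod B).base.model ((A.prod B).base.model.prod 𝓘(ℝ, (A.prod B).F)) ∞
      (fun p => TotalSpace.mk' (A.prod B).F p (σ p)) p₀ ↔
    ContMDiffAt (A.base.prod B.base).model 𝓘(ℝ, A.F) ∞
      (fun p : A.base.carrier × B.base.carrier =>
        (trivializationAt A.F A.V p₀.1 ⟨p.1, fstSec σ p⟩).2) p₀ ∧
    ContMDiffAt (A.base.prod B.base).model 𝓘(ℝ, B.F) ∞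
      (fun p : A.base.carrier × B.base.carrier =>
        (trivializationAt B.F B.V p₀.2 ⟨p.2, sndSec σ p⟩).2) p₀ := by
  have h := contMDiffAt_section (F := (A.prod B).F) (E := (A.prod B).V) (IB := (A.prod B).base.model)
    (n := ∞) (s := σ) p₀
  refine Iff.trans h ?_
  exact contMDiffAt_prod_module_iff (I := (A.base.prod B.base).model) (F₁ := A.F) (F₂ := B.F)
    (fun p : A.base.carrier × B.base.carrier =>
      ((trivializationAt A.F A.V p₀.1 ⟨p.1, fstSec σ p⟩).2,
      (trivializationAt B.F B.V p₀.2 ⟨p.2, sndSec σ p⟩).2))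

end AlgebroidData

namespace SmoothManifold

theorem mlieBracket_inlT_add_inrT {M N : SmoothManifold.{u}} {X X' : ∀ x, M.T x} {Y Y' : ∀ y, N.T y}
    (hX : M.SmoothVF X) (hX' : M.SmoothVF X') (hY : N.SmoothVF Y) (hY' : N.SmoothVF Y')
    (p : M.carrier × N.carrier) :
    mlieBracket (M.prod N).model (fun p => M.inlT N p (X p.1) + M.inrT N p (Y p.2))
      (fun p => M.inlT N p (X' p.1) + M.inrT N p (Y' p.2)) p =
      M.inlT N p (mlieBracket M.model X X' p.1) + M.inrT N p (mlieBracket N.model Y Y' p.2) := by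
  have m1 := fun p => (smoothVF_inlT (N := N) hX).mdifferentiableAt (x := p) (by simp)
  have m2 := fun p => (smoothVF_inlT (N := N) hX').mdifferentiableAt (x := p) (by simp)
  have m3 := fun p => (smoothVF_inrT (M := M) hY).mdifferentiableAt (x := p) (by simp)
  have m4 := fun p => (smoothVF_inrT (M := M) hY').mdifferentiableAt (x := p) (by simp)
  have h1 := mlieBracket_add_left (W := fun p => M.inlT N p (X' p.1) + M.inrT N p (Y' p.2))
    (m1 p) (m3 p)
  have h2 := mlieBracket_add_right (V := fun p => M.inlT N p (X p.1)) (m2 p) (m4 p)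
  have h3 := mlieBracket_add_right (V := fun p => M.inrT N p (Y p.2)) (m2 p) (m4 p)
  have h4 : mlieBracket (M.prod N).model (fun p => M.inrT N p (Y p.2))
      (fun p => M.inlT N p (X' p.1)) p = 0 := by
    rw [mlieBracket_swap_apply, mlieBracket_inlT_inrT hX' hY, neg_zero]
  refine h1.trans ((congrArg₂ (· + ·) h2 h3).trans ?_)
  rw [h4, mlieBracket_inlT_inrT hX hY', mlieBracket_inlT_inlT hX hX', mlieBracket_inrT_inrT hY hY',
    add_zero, zero_add]

end SmoothManifold

namespace AlgebroidData

variable {A B : AlgebroidData.{u}}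

/-- `S` consists of smooth sections, and every vector is the value of a section in `S`. -/
structure Attains (A : AlgebroidData.{u}) (S : Set (∀ x, A.V x)) : Prop where
  smooth : ∀ s ∈ S, A.SmoothSection s
  exists_eq : ∀ x v, ∃ s ∈ S, s x = v

theorem Attains.generates {S : Set (∀ x, A.V x)} (h : A.Attains S) : A.Generates S :=
  generates_of_span h.smooth fun x v _ => by
    obtain ⟨s, hs, rfl⟩ := h.exists_eq x v
    exact Submodule.subset_span ⟨s, hs, rfl⟩

theorem attains_smoothSections (A : AlgebroidData.{u}) : A.Attains {σ | A.SmoothSection σ} :=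
  ⟨fun _ h => h, fun x v => by
    obtain ⟨σ, hσ, hv, -⟩ := exists_smooth_section (I := A.base.model) (F := A.F) x v
    exact ⟨σ, hσ, hv⟩⟩

/-! ### Derivatives of maps to a fibre -/

/-- Smoothness of a map to a fibre. -/
def FibreSmooth (A : AlgebroidData.{u}) (N : SmoothManifold.{u}) (x : A.base.carrier)
    (s : N.carrier → A.V x) : Prop :=
  ContMDiff N.model 𝓘(ℝ, A.F) ∞
    (fun y => (trivializationAt A.F A.V x).continuousLinearMapAt ℝ x (s y))

variable {N : SmoothManifold.{u}} {x : A.base.carrier} {s t : N.carrier → A.V x}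

theorem fibreDeriv_eq (s : N.carrier → A.V x) (y : N.carrier) (w : N.T y) :
    A.fibreDeriv N x s y w = (trivializationAt A.F A.V x).symmL ℝ x
      (mvfderiv N.model
        (fun y' => (trivializationAt A.F A.V x).continuousLinearMapAt ℝ x (s y')) y w) :=
  ((trivializationAt A.F A.V x).symmL_apply
    (FiberBundle.mem_baseSet_trivializationAt' x) _).symm

theorem fibreDeriv_const (v : A.V x) (y : N.carrier) (w : N.T y) :
    A.fibreDeriv N x (fun _ => v) y w = 0 := by
  rw [fibreDeriv_eq, mvfderiv_const]
  exact map_zero _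

theorem fibreDeriv_add (hs : A.FibreSmooth N x s) (ht : A.FibreSmooth N x t) (y : N.carrier)
    (w : N.T y) : A.fibreDeriv N x (fun y => s y + t y) y w =
      A.fibreDeriv N x s y w + A.fibreDeriv N x t y w := by
  simp only [fibreDeriv_eq, map_add]
  rw [mvfderiv_fun_add (hs.mdifferentiableAt (by simp)) (ht.mdifferentiableAt (by simp))]
  exact map_add _ _ _

theorem fibreDeriv_smul (hs : A.FibreSmooth N x s) {f : N.carrier → ℝ} (hf : N.SmoothFun f)
    (y : N.carrier) (w : N.T y) : A.fibreDeriv N x (fun y => f y • s y) y w =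
      f y • A.fibreDeriv N x s y w + (N.d f y w : ℝ) • s y := by
  have hx : x ∈ (trivializationAt A.F A.V x).baseSet := FiberBundle.mem_baseSet_trivializationAt' x
  simp only [fibreDeriv_eq, map_smul]
  rw [mvfderiv_fun_smul (hf.mdifferentiableAt (by simp)) (hs.mdifferentiableAt (by simp))]
  simp only [add_apply, smul_apply, ContinuousLinearMap.smulRight_apply]
  rw [map_add, map_smul, map_smul, Trivialization.symmL_continuousLinearMapAt _ hx]
  rfl

theorem fibreDeriv_vec_add (s : N.carrier → A.V x) (y : N.carrier) (w w' : N.T y) :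
    A.fibreDeriv N x s y (w + w') = A.fibreDeriv N x s y w + A.fibreDeriv N x s y w' := by
  simp only [fibreDeriv_eq, map_add]

theorem fibreDeriv_vec_smul (s : N.carrier → A.V x) (y : N.carrier) (c : ℝ) (w : N.T y) :
    A.fibreDeriv N x s y (c • w) = c • A.fibreDeriv N x s y w := by
  simp only [fibreDeriv_eq, map_smul]

/-! ### Brackets along one factor of a product -/

/-- Smoothness of a section of `pr₁^* A` along each factor. -/
structure SlicesSmooth (A : AlgebroidData.{u}) (N : SmoothManifold.{u})
    (a : ∀ x, N.carrier → A.V x) : Prop where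
  slice : ∀ y, A.SmoothSection (fun x => a x y)
  fibre : ∀ x, A.FibreSmooth N x (a x)

/-- One component of the bracket of a direct product. -/
def partialBracket (A : AlgebroidData.{u}) (N : SmoothManifold.{u})
    (a b : ∀ x, N.carrier → A.V x) (v w : ∀ _ : A.base.carrier, ∀ y, N.T y)
    (x : A.base.carrier) (y : N.carrier) : A.V x :=
  A.bracket (fun x => a x y) (fun x => b x y) x + A.fibreDeriv N x (b x) y (v x y)
    - A.fibreDeriv N x (a x) y (w x y)

variable {a b c : ∀ x, N.carrier → A.V x} {v w z : ∀ _ : A.base.carrier, ∀ y, N.T y}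

theorem partialBracket_add (h : A.IsPreLie) (ha : A.SlicesSmooth N a) (hb : A.SlicesSmooth N b)
    (hc : A.SlicesSmooth N c) (x : A.base.carrier) (y : N.carrier) :
    A.partialBracket N a (fun x y => b x y + c x y) v (fun x y => w x y + z x y) x y =
      A.partialBracket N a b v w x y + A.partialBracket N a c v z x y := by
  simp only [partialBracket]
  have h1 := h.bracket_add _ _ _ (ha.slice y) (hb.slice y) (hc.slice y)
  rw [show (fun x => b x y + c x y) = (fun x => b x y) + fun x => c x y from rfl, h1,
    fibreDeriv_add (hb.fibre x) (hc.fibre x), fibreDeriv_vec_add, Pi.add_apply]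
  abel

theorem partialBracket_skew (h : A.IsPreLie) (ha : A.SlicesSmooth N a) (hb : A.SlicesSmooth N b)
    (x : A.base.carrier) (y : N.carrier) :
    A.partialBracket N a b v w x y = - A.partialBracket N b a w v x y := by
  simp only [partialBracket]
  rw [h.bracket_skew _ _ (ha.slice y) (hb.slice y), Pi.neg_apply]
  abel

/-- The derivative of `f` along the anchor of the product arrives in two pieces: one from the
bracket of `A` along a slice, the other from the derivative of the fibre-valued map along `N`. -/
theorem partialBracket_leibniz (h : A.IsPreLie) {f : A.base.carrier × N.carrier → ℝ}
    (hf : (A.base.prod N).SmoothFun f) (ha : A.SlicesSmooth N a) (hb : A.SlicesSmooth N b)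
    (x : A.base.carrier) (y : N.carrier) :
    A.partialBracket N a (fun x y => f (x, y) • b x y) v (fun x y => f (x, y) • w x y) x y =
      f (x, y) • A.partialBracket N a b v w x y +
        (((A.base.d (fun x => f (x, y)) x (A.anchor x (a x y)) : ℝ) +
          (N.d (fun y => f (x, y)) y (v x y) : ℝ))) • b x y := by
  simp only [partialBracket]
  rw [h.leibniz (fun x => f (x, y)) _ _ (SmoothManifold.smoothFun_inl hf y) (ha.slice y)
    (hb.slice y), fibreDeriv_smul (hb.fibre x) (SmoothManifold.smoothFun_inr hf x),
    fibreDeriv_vec_smul]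
  module

theorem partialBracket_const (s t : ∀ x, A.V x) (x : A.base.carrier) (y : N.carrier) :
    A.partialBracket N (fun x _ => s x) (fun x _ => t x) v w x y = A.bracket s t x := by
  simp only [partialBracket, fibreDeriv_const]
  simp

/-! ### Direct products -/

theorem fst_slicesSmooth {σ : ∀ p, (A.prod B).V p} (hσ : (A.prod B).SmoothSection σ) :
    A.SlicesSmooth B.base (fun x y => fstSec σ (x, y)) where
  slice y x := by
    have h := ((contMDiffAt_prod_section_iff σ (x, y)).1 (hσ (x, y))).1
    rw [contMDiffAt_section]
    exact ContMDiffAt.comp (f := fun x' => (x', y)) x h (SmoothManifold.smooth_inl y x)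
  fibre x y := by
    have h := ((contMDiffAt_prod_section_iff σ (x, y)).1 (hσ (x, y))).1
    refine (ContMDiffAt.comp (f := fun y' => (x, y')) y h (SmoothManifold.smooth_inr x y)).congr_of_eventuallyEq
      (Filter.Eventually.of_forall fun y' => ?_)
    exact Trivialization.continuousLinearMapAt_apply_of_mem (R := ℝ)
      (trivializationAt A.F A.V x) (FiberBundle.mem_baseSet_trivializationAt' x) _

theorem snd_slicesSmooth {σ : ∀ p, (A.prod B).V p} (hσ : (A.prod B).SmoothSection σ) :
    B.SlicesSmooth A.base (fun y x => sndSec σ (x, y)) where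
  slice x y := by
    have h := ((contMDiffAt_prod_section_iff σ (x, y)).1 (hσ (x, y))).2
    rw [contMDiffAt_section]
    exact ContMDiffAt.comp (f := fun y' => (x, y')) y h (SmoothManifold.smooth_inr x y)
  fibre y x := by
    have h := ((contMDiffAt_prod_section_iff σ (x, y)).1 (hσ (x, y))).2
    refine (ContMDiffAt.comp (f := fun x' => (x', y)) x h (SmoothManifold.smooth_inl y x)).congr_of_eventuallyEq
      (Filter.Eventually.of_forall fun x' => ?_)
    exact Trivialization.continuousLinearMapAt_apply_of_mem (R := ℝ)
      (trivializationAt B.F B.V y) (FiberBundle.mem_baseSet_trivializationAt' y) _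

theorem fstSec_bracket (σ τ : ∀ p, (A.prod B).V p) (p : A.base.carrier × B.base.carrier) :
    fstSec ((A.prod B).bracket σ τ) p = A.partialBracket B.base (fun x y => fstSec σ (x, y))
      (fun x y => fstSec τ (x, y)) (fun x y => B.anchor y (sndSec σ (x, y)))
      (fun x y => B.anchor y (sndSec τ (x, y))) p.1 p.2 := rfl

theorem sndSec_bracket (σ τ : ∀ p, (A.prod B).V p) (p : A.base.carrier × B.base.carrier) :
    sndSec ((A.prod B).bracket σ τ) p = B.partialBracket A.base (fun y x => sndSec σ (x, y))
      (fun y x => sndSec τ (x, y)) (fun y x => A.anchor x (fstSec σ (x, y)))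
      (fun y x => A.anchor x (fstSec τ (x, y))) p.2 p.1 := rfl

/-- The section of a direct product given by a pair of sections of the factors. -/
def exSec (s : ∀ x, A.V x) (t : ∀ y, B.V y) : ∀ p, (A.prod B).V p :=
  pairSec (fun p => s p.1) (fun p => t p.2)

theorem exSec_smooth {s : ∀ x, A.V x} {t : ∀ y, B.V y} (hs : A.SmoothSection s)
    (ht : B.SmoothSection t) : (A.prod B).SmoothSection (exSec s t) := by
  rintro ⟨x, y⟩
  refine (contMDiffAt_prod_section_iff (exSec s t) (x, y)).2 ⟨?_, ?_⟩
  · exact ContMDiffAt.comp (f := Prod.fst) (x, y) ((contMDiffAt_section _).1 (hs x))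
      (SmoothManifold.smooth_fst (x, y))
  · exact ContMDiffAt.comp (f := Prod.snd) (x, y) ((contMDiffAt_section _).1 (ht y))
      (SmoothManifold.smooth_snd (x, y))

/-- Pairs of sections of the factors. -/
def exSecs (S : Set (∀ x, A.V x)) (T : Set (∀ y, B.V y)) : Set (∀ p, (A.prod B).V p) :=
  {σ | ∃ s ∈ S, ∃ t ∈ T, σ = exSec s t}

theorem Attains.prod {S : Set (∀ x, A.V x)} {T : Set (∀ y, B.V y)} (hS : A.Attains S)
    (hT : B.Attains T) : (A.prod B).Attains (exSecs S T) where
  smooth := by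
    rintro _ ⟨s, hs, t, ht, rfl⟩
    exact exSec_smooth (hS.smooth s hs) (hT.smooth t ht)
  exists_eq p v := by
    obtain ⟨s, hs, h1⟩ := hS.exists_eq (Prod.fst p) (Prod.fst (α := A.V (Prod.fst p)) (β := B.V (Prod.snd p)) v)
    obtain ⟨t, ht, h2⟩ := hT.exists_eq (Prod.snd p) (Prod.snd (α := A.V (Prod.fst p)) (β := B.V (Prod.snd p)) v)
    exact ⟨_, ⟨s, hs, t, ht, rfl⟩, Prod.ext (α := A.V (Prod.fst p)) (β := B.V (Prod.snd p)) h1 h2⟩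

theorem prod_anchor_exSec (s : ∀ x, A.V x) (t : ∀ y, B.V y) (p : A.base.carrier × B.base.carrier) :
    (A.prod B).anchor p (exSec s t p) = A.base.inlT B.base p (A.anchor p.1 (s p.1)) +
      A.base.inrT B.base p (B.anchor p.2 (t p.2)) := rfl

/-- Sections pulled back from one factor are constant along the other, so the derivatives along the
other factor vanish. -/
theorem bracket_exSec (s s' : ∀ x, A.V x) (t t' : ∀ y, B.V y) :
    (A.prod B).bracket (exSec s t) (exSec s' t') = exSec (A.bracket s s') (B.bracket t t') := by
  funext p
  exact prodSec_ext (p := p) ((fstSec_bracket _ _ p).trans (partialBracket_const s s' _ _))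
    ((sndSec_bracket _ _ p).trans (partialBracket_const t t' _ _))

theorem smoothVF_prod_anchor_exSec (hA : A.IsPreLie) (hB : B.IsPreLie) {s : ∀ x, A.V x}
    {t : ∀ y, B.V y} (hs : A.SmoothSection s) (ht : B.SmoothSection t) :
    (A.prod B).base.SmoothVF (fun p => (A.prod B).anchor p (exSec s t p)) :=
  SmoothManifold.smoothVF_add
    (SmoothManifold.smoothVF_inlT (N := B.base) (hA.anchor_smooth s hs))
    (SmoothManifold.smoothVF_inrT (M := A.base) (hB.anchor_smooth t ht))

theorem IsPreLie.prod (hA : A.IsPreLie) (hB : B.IsPreLie) : (A.prod B).IsPreLie where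
  anchor_smooth σ hσ := by
    have h := (A.attains_smoothSections.prod B.attains_smoothSections).generates
    refine smooth_of_generatesSections h.generates (φ := fun p => p) contMDiff_id
      (V' := fun p => (A.prod B).base.T p) (F' := (A.prod B).base.E)
      (fun p => (A.prod B).anchor p) ?_ σ hσ
    rintro _ ⟨s, hs, t, ht, rfl⟩
    exact smoothVF_prod_anchor_exSec hA hB hs ht
  bracket_add σ τ υ hσ hτ hυ := by
    funext p
    refine prodSec_ext (p := p) ?_ ?_
    · have h1 := partialBracket_add hA (fst_slicesSmooth hσ) (fst_slicesSmooth hτ)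
        (fst_slicesSmooth hυ) (v := fun x y => B.anchor y (sndSec σ (x, y)))
        (w := fun x y => B.anchor y (sndSec τ (x, y)))
        (z := fun x y => B.anchor y (sndSec υ (x, y))) (Prod.fst p) (Prod.snd p)
      simp only [← map_add] at h1
      exact h1
    · have h1 := partialBracket_add hB (snd_slicesSmooth hσ) (snd_slicesSmooth hτ)
        (snd_slicesSmooth hυ) (v := fun y x => A.anchor x (fstSec σ (x, y)))
        (w := fun y x => A.anchor x (fstSec τ (x, y)))
        (z := fun y x => A.anchor x (fstSec υ (x, y))) (Prod.snd p) (Prod.fst p)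
      simp only [← map_add] at h1
      exact h1
  bracket_skew σ τ hσ hτ := by
    funext p
    exact prodSec_ext (p := p) (τ := -(A.prod B).bracket τ σ)
      (partialBracket_skew hA (fst_slicesSmooth hσ) (fst_slicesSmooth hτ)
        (v := fun x y => B.anchor y (sndSec σ (x, y))) (w := fun x y => B.anchor y (sndSec τ (x, y))) (Prod.fst p) (Prod.snd p))
      (partialBracket_skew hB (snd_slicesSmooth hσ) (snd_slicesSmooth hτ)
        (v := fun y x => A.anchor x (fstSec σ (x, y))) (w := fun y x => A.anchor x (fstSec τ (x, y))) (Prod.snd p) (Prod.fst p))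
  leibniz f σ τ hf hσ hτ p := by
    have hd : ((A.prod B).base.d f p ((A.prod B).anchor p (σ p)) : ℝ) =
        (A.base.d (fun x => f (x, Prod.snd p)) (Prod.fst p) (A.anchor (Prod.fst p) (fstSec σ p)) : ℝ)
        + (B.base.d (fun y => f (Prod.fst p, y)) (Prod.snd p)
            (B.anchor (Prod.snd p) (sndSec σ p)) : ℝ) :=
      ((show (A.prod B).base.T p →L[ℝ] ℝ from (A.prod B).base.d f p).map_add _ _).trans
        (congrArg₂ (· + ·) (SmoothManifold.d_inlT hf p _) (SmoothManifold.d_inrT hf p _))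
    rw [hd]
    refine prodSec_ext (p := p) (σ := (A.prod B).bracket σ fun y => f y • τ y)
      (τ := fun p => f p • (A.prod B).bracket σ τ p +
        ((A.base.d (fun x => f (x, Prod.snd p)) (Prod.fst p)
          (A.anchor (Prod.fst p) (fstSec σ p)) : ℝ)
        + (B.base.d (fun y => f (Prod.fst p, y)) (Prod.snd p)
            (B.anchor (Prod.snd p) (sndSec σ p)) : ℝ)) • τ p) ?_ ?_
    · have h1 := partialBracket_leibniz hA hf (fst_slicesSmooth hσ) (fst_slicesSmooth hτ)
        (v := fun x y => B.anchor y (sndSec σ (x, y))) (w := fun x y => B.anchor y (sndSec τ (x, y)))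
        (Prod.fst p) (Prod.snd p)
      simp only [← map_smul] at h1
      exact h1
    -- `partialBracket` has the base of its algebroid as the first variable, so for the second
    -- component the two variables of `f` are exchanged.
    · have hf' : (B.base.prod A.base).SmoothFun (fun q => f (q.2, q.1)) :=
        hf.comp (contMDiff_snd.prodMk contMDiff_fst)
      have h1 := partialBracket_leibniz hB hf' (snd_slicesSmooth hσ) (snd_slicesSmooth hτ)
        (v := fun y x => A.anchor x (fstSec σ (x, y))) (w := fun y x => A.anchor x (fstSec τ (x, y)))
        (Prod.snd p) (Prod.fst p)
      rw [add_comm (B.base.d _ _ _ : ℝ)] at h1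
      simp only [← map_smul] at h1
      exact h1

/-- On pairs of sections from the factors each axiom is the pair of the axioms for `A` and `B`, and
such pairs generate. -/
theorem IsLieAlgebroid.prod (hA : A.IsLieAlgebroid) (hB : B.IsLieAlgebroid) :
    (A.prod B).IsLieAlgebroid := by
  refine isLieAlgebroid_of_generates (hA.isPreLie.prod hB.isPreLie)
    (A.attains_smoothSections.prod B.attains_smoothSections).generates ?_ ?_ ?_
  · rintro _ ⟨s, hs, t, ht, rfl⟩ _ ⟨s', hs', t', ht', rfl⟩
    rw [bracket_exSec]
    exact exSec_smooth (hA.bracket_smooth _ _ hs hs') (hB.bracket_smooth _ _ ht ht')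
  · rintro _ ⟨s, hs, t, ht, rfl⟩ _ ⟨s', hs', t', ht', rfl⟩ p
    rw [bracket_exSec]
    refine Eq.trans ?_ (SmoothManifold.mlieBracket_inlT_add_inrT (hA.anchor_smooth s hs)
      (hA.anchor_smooth s' hs') (hB.anchor_smooth t ht) (hB.anchor_smooth t' ht') p).symm
    have h1 := prod_anchor_exSec (A.bracket s s') (B.bracket t t') p
    rw [hA.anchor_bracket s s' hs hs', hB.anchor_bracket t t' ht ht'] at h1
    exact h1
  · rintro _ ⟨s, hs, t, ht, rfl⟩ _ ⟨s', hs', t', ht', rfl⟩ _ ⟨s'', hs'', t'', ht'', rfl⟩ p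
    simp only [bracket_exSec]
    rw [hA.jacobi s s' s'' hs hs' hs'', hB.jacobi t t' t'' ht ht' ht'']
    rfl

end AlgebroidData

namespace SmoothManifold

variable {M N P : SmoothManifold.{u}}

theorem D_prod_eq {φ : P.carrier → M.carrier × N.carrier} (hφ : P.Smooth (M.prod N) φ)
    {x : P.carrier} {v : P.T x} {w : (M.prod N).T (φ x)}
    (h₁ : P.D M (fun x => (φ x).1) x v = (M.prod N).D M Prod.fst (φ x) w)
    (h₂ : P.D N (fun x => (φ x).2) x v = (M.prod N).D N Prod.snd (φ x) w) :
    P.D (M.prod N) φ x v = w :=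
  eq_of_D_fst_of_D_snd
    ((congrArg (fun L : P.T x →L[ℝ] M.T (φ x).1 => L v) (D_comp smooth_fst hφ x)).symm.trans h₁)
    ((congrArg (fun L : P.T x →L[ℝ] N.T (φ x).2 => L v) (D_comp smooth_snd hφ x)).symm.trans h₂)

theorem D_comp_apply {φ : M.carrier → N.carrier} {ψ : N.carrier → P.carrier} (hψ : N.Smooth P ψ)
    (hφ : M.Smooth N φ) (x : M.carrier) (v : M.T x) :
    M.D P (fun x => ψ (φ x)) x v = N.D P ψ (φ x) (M.D N φ x v) :=
  congrArg (fun L : M.T x →L[ℝ] P.T (ψ (φ x)) => L v) (D_comp hψ hφ x)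

theorem D_id_apply (x : M.carrier) (v : M.T x) : M.D M (fun x => x) x v = v := by
  have h : M.D M (fun x => x) x = ContinuousLinearMap.id ℝ (M.T x) := mfderiv_id
  rw [h]; rfl

theorem D_fst_add (p : M.carrier × N.carrier) (v : M.T p.1) (w : N.T p.2) :
    (M.prod N).D M Prod.fst p (M.inlT N p v + M.inrT N p w) = v := by
  rw [map_add, D_fst_inlT, D_fst_inrT, add_zero]

theorem D_snd_add (p : M.carrier × N.carrier) (v : M.T p.1) (w : N.T p.2) :
    (M.prod N).D N Prod.snd p (M.inlT N p v + M.inrT N p w) = w := by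
  rw [map_add, D_snd_inlT, D_snd_inrT, zero_add]

end SmoothManifold

/-! ### The zero Lie algebroid and the coherence comorphisms. -/

namespace AlgebroidData

instance (x : AlgebroidData.unit.{u}.base.carrier) : Subsingleton (AlgebroidData.unit.{u}.V x) :=
  inferInstanceAs (Subsingleton PUnit)

instance (x : AlgebroidData.unit.{u}.base.carrier) : Subsingleton (AlgebroidData.unit.{u}.base.T x) :=
  inferInstanceAs (Subsingleton PUnit)

theorem isLieAlgebroid_unit : AlgebroidData.unit.{u}.IsLieAlgebroid where
  anchor_smooth _ _ := contMDiff_zeroSection ℝ (AlgebroidData.unit.base.T)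
  bracket_smooth σ τ hσ _ := by
    rwa [show AlgebroidData.unit.bracket σ τ = σ from Subsingleton.elim _ _]
  bracket_add _ _ _ _ _ _ := Subsingleton.elim _ _
  bracket_skew _ _ _ _ := Subsingleton.elim _ _
  jacobi _ _ _ _ _ _ := Subsingleton.elim _ _
  leibniz _ _ _ _ _ _ _ := Subsingleton.elim _ _
  anchor_bracket _ _ _ _ _ := Subsingleton.elim _ _

end AlgebroidData

namespace BundleComorphism

open AlgebroidData SmoothManifold

variable {A A' B B' C : AlgebroidData.{u}}

theorem isComorphism_prodMap (hA : A.IsLieAlgebroid) (hA' : A'.IsLieAlgebroid)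
    (hB : B.IsLieAlgebroid) (hB' : B'.IsLieAlgebroid) {Ψ : BundleComorphism A A'}
    {Χ : BundleComorphism B B'} (hΨ : Ψ.IsComorphism) (hΧ : Χ.IsComorphism) :
    (Ψ.prodMap Χ).IsComorphism := by
  have hb : (A.base.prod B.base).Smooth (A'.base.prod B'.base)
      (fun p => (Ψ.base p.1, Χ.base p.2)) := hΨ.base_smooth.prodMap hΧ.base_smooth
  refine isComorphism_of_generates (hA.prod hB) (hA'.prod hB')
    (A'.attains_smoothSections.prod B'.attains_smoothSections).generates hb ?_ ?_ ?_
  · rintro _ ⟨s, hs, t, ht, rfl⟩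
    exact exSec_smooth (hΨ.pull_smooth s hs) (hΧ.pull_smooth t ht)
  · rintro ⟨x, y⟩ v
    refine D_prod_eq (x := (x, y)) hb ?_ ?_
    · refine (D_comp_apply (M := A.base.prod B.base) (φ := Prod.fst) hΨ.base_smooth smooth_fst (x, y) _).trans ?_
      refine Eq.trans ?_ (D_fst_add (Ψ.base x, Χ.base y) _ _).symm
      refine Eq.trans ?_ (hΨ.anchor x _)
      exact congrArg (A.base.D A'.base Ψ.base x) (D_fst_add (x, y) _ _)
    · refine (D_comp_apply (M := A.base.prod B.base) (φ := Prod.snd) hΧ.base_smooth smooth_snd (x, y) _).trans ?_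
      refine Eq.trans ?_ (D_snd_add (Ψ.base x, Χ.base y) _ _).symm
      refine Eq.trans ?_ (hΧ.anchor y _)
      exact congrArg (B.base.D B'.base Χ.base y) (D_snd_add (x, y) _ _)
  · rintro _ ⟨s, hs, t, ht, rfl⟩ _ ⟨s', hs', t', ht', rfl⟩ p
    rw [bracket_exSec]
    have h := bracket_exSec (Ψ.pull s) (Ψ.pull s') (Χ.pull t) (Χ.pull t')
    rw [← hΨ.bracket s s' hs hs', ← hΧ.bracket t t' ht ht'] at h
    exact congrFun h.symm p

/-- On triples of sections from the factors the pullback just regroups them, and `bracket_exSec`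
applies on both sides. The anchor condition is compared in each of the three factors. -/
theorem isComorphism_assocHom (hA : A.IsLieAlgebroid) (hB : B.IsLieAlgebroid)
    (hC : C.IsLieAlgebroid) : (assocHom A B C).IsComorphism := by
  have hb : ((A.base.prod B.base).prod C.base).Smooth (A.base.prod (B.base.prod C.base))
      (fun p => (p.1.1, (p.1.2, p.2))) :=
    (contMDiff_fst.comp contMDiff_fst).prodMk
      ((contMDiff_snd.comp contMDiff_fst).prodMk contMDiff_snd)
  have hb' : ((A.base.prod B.base).prod C.base).Smooth (B.base.prod C.base)
      (fun p => (p.1.2, p.2)) := (contMDiff_snd.comp contMDiff_fst).prodMk contMDiff_snd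
  refine isComorphism_of_generates ((hA.prod hB).prod hC) (hA.prod (hB.prod hC))
    (A.attains_smoothSections.prod
      (B.attains_smoothSections.prod C.attains_smoothSections)).generates hb ?_ ?_ ?_
  · rintro _ ⟨s, hs, _, ⟨t, ht, r, hr, rfl⟩, rfl⟩
    exact exSec_smooth (exSec_smooth hs ht) hr
  · rintro ⟨⟨x, y⟩, z⟩ v
    refine D_prod_eq (x := ((x, y), z)) hb ?_ ?_
    · refine (D_comp_apply (M := (A.base.prod B.base).prod C.base) (N := A.base.prod B.base) (φ := Prod.fst) smooth_fst smooth_fst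
        ((x, y), z) _).trans ?_
      refine Eq.trans ?_ (D_fst_add (N := B.base.prod C.base) (x, (y, z)) _ _).symm
      refine (congrArg ((A.base.prod B.base).D A.base Prod.fst (x, y))
        (D_fst_add (M := A.base.prod B.base) ((x, y), z) _ _)).trans ?_
      exact D_fst_add (x, y) _ _
    · refine Eq.trans ?_ (D_snd_add (N := B.base.prod C.base) (x, (y, z)) _ _).symm
      refine D_prod_eq (x := ((x, y), z)) hb' ?_ ?_
      · refine (D_comp_apply (M := (A.base.prod B.base).prod C.base) (N := A.base.prod B.base) (φ := Prod.fst) smooth_snd smooth_fst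
          ((x, y), z) _).trans ?_
        refine Eq.trans ?_ (D_fst_add (y, z) _ _).symm
        refine (congrArg ((A.base.prod B.base).D B.base Prod.snd (x, y))
          (D_fst_add (M := A.base.prod B.base) ((x, y), z) _ _)).trans ?_
        exact D_snd_add (x, y) _ _
      · refine Eq.trans ?_ (D_snd_add (y, z) _ _).symm
        exact D_snd_add (M := A.base.prod B.base) ((x, y), z) _ _
  · rintro _ ⟨s, hs, _, ⟨t, ht, r, hr, rfl⟩, rfl⟩ _ ⟨s', hs', _, ⟨t', ht', r', hr', rfl⟩, rfl⟩ p
    rw [bracket_exSec, bracket_exSec]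
    have h := bracket_exSec (exSec s t) (exSec s' t') r r'
    rw [bracket_exSec s s' t t'] at h
    exact congrFun h.symm p

theorem isComorphism_assocInv (hA : A.IsLieAlgebroid) (hB : B.IsLieAlgebroid)
    (hC : C.IsLieAlgebroid) : (assocInv A B C).IsComorphism := by
  have hb : (A.base.prod (B.base.prod C.base)).Smooth ((A.base.prod B.base).prod C.base)
      (fun p => ((p.1, p.2.1), p.2.2)) :=
    (contMDiff_fst.prodMk (contMDiff_fst.comp contMDiff_snd)).prodMk
      (contMDiff_snd.comp contMDiff_snd)
  have hb' : (A.base.prod (B.base.prod C.base)).Smooth (A.base.prod B.base)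
      (fun p => (p.1, p.2.1)) := contMDiff_fst.prodMk (contMDiff_fst.comp contMDiff_snd)
  refine isComorphism_of_generates (hA.prod (hB.prod hC)) ((hA.prod hB).prod hC)
    ((A.attains_smoothSections.prod B.attains_smoothSections).prod
      C.attains_smoothSections).generates hb ?_ ?_ ?_
  · rintro _ ⟨_, ⟨s, hs, t, ht, rfl⟩, r, hr, rfl⟩
    exact exSec_smooth hs (exSec_smooth ht hr)
  · rintro ⟨x, ⟨y, z⟩⟩ v
    refine D_prod_eq (x := (x, (y, z))) hb ?_ ?_
    · refine Eq.trans ?_ (D_fst_add (M := A.base.prod B.base) ((x, y), z) _ _).symm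
      refine D_prod_eq (x := (x, (y, z))) hb' ?_ ?_
      · refine Eq.trans ?_ (D_fst_add (x, y) _ _).symm
        exact D_fst_add (N := B.base.prod C.base) (x, (y, z)) _ _
      · refine (D_comp_apply (M := A.base.prod (B.base.prod C.base)) (N := B.base.prod C.base) (φ := Prod.snd) smooth_fst smooth_snd
          (x, (y, z)) _).trans ?_
        refine Eq.trans ?_ (D_snd_add (x, y) _ _).symm
        refine (congrArg ((B.base.prod C.base).D B.base Prod.fst (y, z))
          (D_snd_add (N := B.base.prod C.base) (x, (y, z)) _ _)).trans ?_
        exact D_fst_add (y, z) _ _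
    · refine (D_comp_apply (M := A.base.prod (B.base.prod C.base)) (N := B.base.prod C.base) (φ := Prod.snd) smooth_snd smooth_snd
        (x, (y, z)) _).trans ?_
      refine Eq.trans ?_ (D_snd_add (M := A.base.prod B.base) ((x, y), z) _ _).symm
      refine (congrArg ((B.base.prod C.base).D C.base Prod.snd (y, z))
        (D_snd_add (N := B.base.prod C.base) (x, (y, z)) _ _)).trans ?_
      exact D_snd_add (y, z) _ _
  · rintro _ ⟨_, ⟨s, hs, t, ht, rfl⟩, r, hr, rfl⟩ _ ⟨_, ⟨s', hs', t', ht', rfl⟩, r', hr', rfl⟩ p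
    rw [bracket_exSec, bracket_exSec]
    have h := bracket_exSec s s' (exSec t r) (exSec t' r')
    rw [bracket_exSec t t' r r'] at h
    exact congrFun h.symm p

theorem isComorphism_leftHom (hA : A.IsLieAlgebroid) : (leftHom A).IsComorphism := by
  refine isComorphism_of_generates (isLieAlgebroid_unit.prod hA) hA
    A.attains_smoothSections.generates smooth_snd ?_ ?_ ?_
  · intro s hs
    exact exSec_smooth (A := AlgebroidData.unit) smoothSection_zero hs
  · rintro ⟨x, y⟩ v
    exact D_snd_add (M := AlgebroidData.unit.base) (x, y) _ _
  · intro s hs t ht p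
    have h := bracket_exSec (A := AlgebroidData.unit) (fun _ => 0) (fun _ => 0) s t
    exact congrFun h.symm p

theorem isComorphism_rightHom (hA : A.IsLieAlgebroid) : (rightHom A).IsComorphism := by
  refine isComorphism_of_generates (hA.prod isLieAlgebroid_unit) hA
    A.attains_smoothSections.generates smooth_fst ?_ ?_ ?_
  · intro s hs
    exact exSec_smooth (B := AlgebroidData.unit) hs smoothSection_zero
  · rintro ⟨x, y⟩ v
    exact D_fst_add (N := AlgebroidData.unit.base) (x, y) _ _
  · intro s hs t ht p
    have h := bracket_exSec (B := AlgebroidData.unit) s t (fun _ => 0) (fun _ => 0)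
    exact congrFun h.symm p

theorem isComorphism_leftInv (hA : A.IsLieAlgebroid) : (leftInv A).IsComorphism := by
  have hb : A.base.Smooth (AlgebroidData.unit.base.prod A.base) (fun x => (PUnit.unit, x)) :=
    smooth_inr (M := AlgebroidData.unit.base) PUnit.unit
  refine isComorphism_of_generates hA (isLieAlgebroid_unit.prod hA)
    (AlgebroidData.unit.attains_smoothSections.prod A.attains_smoothSections).generates hb ?_ ?_ ?_
  · rintro _ ⟨s, hs, t, ht, rfl⟩
    exact ht
  · intro x v
    refine D_prod_eq (x := x) hb (Subsingleton.elim (α := AlgebroidData.unit.base.T PUnit.unit) _ _) ?_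
    exact (D_id_apply x _).trans (D_snd_add (M := AlgebroidData.unit.base) (PUnit.unit, x) _ _).symm
  · rintro _ ⟨s, hs, t, ht, rfl⟩ _ ⟨s', hs', t', ht', rfl⟩ p
    rw [bracket_exSec]
    rfl

theorem isComorphism_rightInv (hA : A.IsLieAlgebroid) : (rightInv A).IsComorphism := by
  have hb : A.base.Smooth (A.base.prod AlgebroidData.unit.base) (fun x => (x, PUnit.unit)) :=
    smooth_inl (N := AlgebroidData.unit.base) PUnit.unit
  refine isComorphism_of_generates hA (hA.prod isLieAlgebroid_unit)
    (A.attains_smoothSections.prod AlgebroidData.unit.attains_smoothSections).generates hb ?_ ?_ ?_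
  · rintro _ ⟨s, hs, t, ht, rfl⟩
    exact hs
  · intro x v
    refine D_prod_eq (x := x) hb ?_ (Subsingleton.elim (α := AlgebroidData.unit.base.T PUnit.unit) _ _)
    exact (D_id_apply x _).trans (D_fst_add (N := AlgebroidData.unit.base) (x, PUnit.unit) _ _).symm
  · rintro _ ⟨s, hs, t, ht, rfl⟩ _ ⟨s', hs', t', ht', rfl⟩ p
    rw [bracket_exSec]
    rfl

end BundleComorphism

theorem productWellDefined : ProductWellDefined.{u} where
  prod A B := A.isLie.prod B.isLie
  unit := AlgebroidData.isLieAlgebroid_unit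
  prodMap {A A' B B'} Ψ Χ := BundleComorphism.isComorphism_prodMap A.isLie A'.isLie B.isLie B'.isLie
    Ψ.isComorphism Χ.isComorphism
  assocHom A B C := BundleComorphism.isComorphism_assocHom A.isLie B.isLie C.isLie
  assocInv A B C := BundleComorphism.isComorphism_assocInv A.isLie B.isLie C.isLie
  leftHom A := BundleComorphism.isComorphism_leftHom A.isLie
  leftInv A := BundleComorphism.isComorphism_leftInv A.isLie
  rightHom A := BundleComorphism.isComorphism_rightHom A.isLie
  rightInv A := BundleComorphism.isComorphism_rightInv A.isLie

/-! ### Lie derivatives of one-forms. -/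

namespace SmoothManifold

variable {M : SmoothManifold.{u}}

theorem lieD_add {X : ∀ x, M.T x} (hX : M.SmoothVF X) {α β : ∀ x, M.Cot x} (hα : M.SmoothForm α)
    (hβ : M.SmoothForm β) (x : M.carrier) :
    M.lieD X (α + β) x = M.lieD X α x + M.lieD X β x := by
  rw [lieD, contrD_add hα hβ]
  have h := d_add (form_apply_smooth hα hX) (form_apply_smooth hβ hX) x
  exact (congrArg _ h).trans (add_add_add_comm _ _ _ _)

theorem lieD_smul {X : ∀ x, M.T x} (hX : M.SmoothVF X) {f : M.carrier → ℝ} (hf : M.SmoothFun f)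
    {α : ∀ x, M.Cot x} (hα : M.SmoothForm α) (x : M.carrier) :
    M.lieD X (fun y => f y • α y) x = f x • M.lieD X α x + (M.d f x (X x) : ℝ) • α x := by
  rw [lieD, contrD_smul hf hα, lieD]
  have h := d_mul hf (form_apply_smooth hα hX) x
  have h' : M.d (fun y => ((f y • α y) (X y) : ℝ)) x = f x • M.d (fun y => (α y (X y) : ℝ)) x +
    (α x (X x) : ℝ) • M.d f x := h
  rw [h']
  module

theorem lieD_vec_add {X Y : ∀ x, M.T x} (hX : M.SmoothVF X) (hY : M.SmoothVF Y)
    {α : ∀ x, M.Cot x} (hα : M.SmoothForm α) (x : M.carrier) :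
    M.lieD (X + Y) α x = M.lieD X α x + M.lieD Y α x := by
  have h := d_add (form_apply_smooth hα hX) (form_apply_smooth hα hY) x
  have h' : M.d (fun y => (α y ((X + Y) y) : ℝ)) x = M.d (fun y => (α y (X y) : ℝ)) x +
    M.d (fun y => (α y (Y y) : ℝ)) x := by
    rw [← h]
    congr 1
    funext y
    exact map_add (show M.T y →L[ℝ] ℝ from α y) _ _
  rw [lieD, h', Pi.add_apply, contrD_vec_add, lieD, lieD]
  abel

theorem lieD_vec_const_smul (c : ℝ) {X : ∀ x, M.T x} (hX : M.SmoothVF X)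
    {α : ∀ x, M.Cot x} (hα : M.SmoothForm α) (x : M.carrier) :
    M.lieD (c • X) α x = c • M.lieD X α x := by
  have h := d_const_mul c (form_apply_smooth hα hX) x
  have h' : M.d (fun y => (α y ((c • X) y) : ℝ)) x = c • M.d (fun y => (α y (X y) : ℝ)) x := by
    rw [← h]
    congr 1
    funext y
    exact map_smul (show M.T y →L[ℝ] ℝ from α y) _ _
  rw [lieD, h', Pi.smul_apply, contrD_vec_smul, lieD, smul_add]

end SmoothManifold

/-! ### Dual bases, and the anchor and bracket of `T^*M`. -/

section

variable {EG : Type*} [NormedAddCommGroup EG] [NormedSpace ℝ EG] [FiniteDimensional ℝ EG]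
  {HG : Type*} [TopologicalSpace HG] {IG : ModelWithCorners ℝ EG HG}
  {G : Type*} [TopologicalSpace G] [ChartedSpace HG G] [Group G]

instance : FiniteDimensional ℝ (GroupLieAlgebra IG G) :=
  inferInstanceAs (FiniteDimensional ℝ EG)

namespace InvariantForm

variable (B : InvariantForm IG G)

/-- A basis of the Lie algebra. -/
def basis (_ : InvariantForm IG G) :
    Module.Basis (Fin (Module.finrank ℝ (GroupLieAlgebra IG G))) ℝ (GroupLieAlgebra IG G) :=
  Module.finBasis ℝ (GroupLieAlgebra IG G)

/-- The dual basis. -/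
def dualBasis :
    Module.Basis (Fin (Module.finrank ℝ (GroupLieAlgebra IG G))) ℝ (GroupLieAlgebra IG G) :=
  LinearMap.BilinForm.dualBasis B.form B.nondegenerate B.basis

theorem form_comm (ξ η : GroupLieAlgebra IG G) : B.form ξ η = B.form η ξ :=
  B.symm.eq ξ η

theorem form_sharp (φ : Module.Dual ℝ (GroupLieAlgebra IG G)) (ξ : GroupLieAlgebra IG G) :
    B.form (B.sharp φ) ξ = φ ξ :=
  LinearMap.BilinForm.apply_toDual_symm_apply (hB := B.nondegenerate) φ ξ

theorem ext_form {ξ η : GroupLieAlgebra IG G} (h : ∀ ζ, B.form ξ ζ = B.form η ζ) : ξ = η :=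
  (LinearMap.BilinForm.toDual B.form B.nondegenerate).injective (LinearMap.ext h)

theorem sum_form_basis_smul (ξ : GroupLieAlgebra IG G) :
    ∑ i, B.form ξ (B.basis i) • B.dualBasis i = ξ := by
  conv_rhs => rw [← B.dualBasis.sum_repr ξ]
  simp only [dualBasis, LinearMap.BilinForm.dualBasis_repr_apply]

theorem sum_form_dualBasis_smul (ξ : GroupLieAlgebra IG G) :
    ∑ i, B.form ξ (B.dualBasis i) • B.basis i = ξ := by
  refine B.ext_form fun ζ => ?_
  conv_rhs => rw [← B.sum_form_basis_smul ζ]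
  simp only [map_sum, map_smul, LinearMap.sum_apply, LinearMap.smul_apply, smul_eq_mul]
  refine Finset.sum_congr rfl fun i _ => ?_
  rw [B.form_comm ζ]
  ring

/-- This splits a pairing into products of single coordinates. For `⟨ρ^*α, ρ^*β⟩` the coordinates
are the functions `α(ρ(e_i))` and `β(ρ(e^i))`, which can be shown to be smooth and be
differentiated. -/
theorem form_eq_sum (ξ η : GroupLieAlgebra IG G) :
    B.form ξ η = ∑ i, B.form ξ (B.basis i) * B.form η (B.dualBasis i) := by
  conv_lhs => rw [← B.sum_form_basis_smul ξ]
  simp only [map_sum, map_smul, LinearMap.sum_apply, LinearMap.smul_apply, smul_eq_mul]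
  exact Finset.sum_congr rfl fun i _ => by rw [B.form_comm η]

end InvariantForm

namespace HamData

variable (M : HamData.{u} IG G) (B : InvariantForm IG G)

theorem form_rhoStar (x : M.mfd.carrier) (α : M.mfd.Cot x) (ξ : GroupLieAlgebra IG G) :
    B.form (M.rhoStar B x α) ξ = α (M.action ξ x) := B.form_sharp _ ξ

/-- The value of `ρ^* (df)`. -/
abbrev rhoD (f : M.mfd.carrier → ℝ) (x : M.mfd.carrier) : GroupLieAlgebra IG G :=
  M.rhoStar B x (M.mfd.d f x)

theorem form_rhoD (f : M.mfd.carrier → ℝ) (x : M.mfd.carrier) (ξ : GroupLieAlgebra IG G) :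
    B.form (M.rhoD B f x) ξ = M.act ξ f x := M.form_rhoStar B x _ ξ

theorem form_rhoD' (f : M.mfd.carrier → ℝ) (x : M.mfd.carrier) (ξ : GroupLieAlgebra IG G) :
    B.form ξ (M.rhoD B f x) = M.act ξ f x := by rw [B.form_comm, form_rhoD]

theorem act_add (ξ η : GroupLieAlgebra IG G) (f : M.mfd.carrier → ℝ) (x : M.mfd.carrier) :
    M.act (ξ + η) f x = M.act ξ f x + M.act η f x := by
  simp only [act, map_add, Pi.add_apply]

theorem act_smul (c : ℝ) (ξ : GroupLieAlgebra IG G) (f : M.mfd.carrier → ℝ) (x : M.mfd.carrier) :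
    M.act (c • ξ) f x = c * M.act ξ f x := by
  simp only [act, map_smul, Pi.smul_apply, smul_eq_mul]

/-- The function `{f, g} + ½ ⟨ρ^* df, ρ^* dg⟩`, the derivative of `g` along the anchor of `df`. -/
def ham (f g : M.mfd.carrier → ℝ) (x : M.mfd.carrier) : ℝ :=
  M.poisson f g x + 2⁻¹ * B.form (M.rhoD B f x) (M.rhoD B g x)

/-- The anchor on covectors. -/
def cotAnchor (x : M.mfd.carrier) : M.mfd.Cot x →ₗ[ℝ] M.mfd.T x :=
  M.piSharp x + (2⁻¹ : ℝ) • (M.actionAt x ∘ₗ M.rhoStar B x)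

/-- The bracket of one-forms. -/
def cotBracket (α β : ∀ x, M.mfd.Cot x) (x : M.mfd.carrier) : M.mfd.Cot x :=
  M.mfd.d (M.pi α β) x + M.mfd.contrD β x (M.piSharp x (α x))
    - M.mfd.contrD α x (M.piSharp x (β x))
    + (2⁻¹ : ℝ) • (M.mfd.lieD (M.action (M.rhoStar B x (α x))) β x
        - M.mfd.lieD (M.action (M.rhoStar B x (β x))) α x)

variable {M B}

theorem d_anchor (α : M.mfd.carrier → ℝ) (x : M.mfd.carrier) (a : M.mfd.Cot x) :
    (M.mfd.d α x (M.cotAnchor B x a) : ℝ) =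
      M.mfd.d α x (M.piSharp x a) + 2⁻¹ * B.form (M.rhoStar B x a) (M.rhoD B α x) := by
  rw [form_rhoD']
  exact (map_add (show M.mfd.T x →L[ℝ] ℝ from M.mfd.d α x) _ _).trans
    (congrArg _ (map_smul (show M.mfd.T x →L[ℝ] ℝ from M.mfd.d α x) _ _))

theorem d_anchor_d (f g : M.mfd.carrier → ℝ) (x : M.mfd.carrier) :
    (M.mfd.d g x (M.cotAnchor B x (M.mfd.d f x)) : ℝ) = M.ham B f g x := d_anchor g x _

namespace IsHamiltonian

open SmoothManifold

variable (h : M.IsHamiltonian B)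
include h

theorem act_smooth (ξ : GroupLieAlgebra IG G) {f : M.mfd.carrier → ℝ} (hf : M.mfd.SmoothFun f) :
    M.mfd.SmoothFun (M.act ξ f) := d_apply_smooth hf (h.action_smooth ξ)

theorem pi_apply_smooth {α β : ∀ x, M.mfd.Cot x} (hα : M.mfd.SmoothForm α)
    (hβ : M.mfd.SmoothForm β) : M.mfd.SmoothFun (M.pi α β) :=
  form_apply_smooth hβ (h.pi_smooth α hα)

theorem poisson_smooth {f g : M.mfd.carrier → ℝ} (hf : M.mfd.SmoothFun f)
    (hg : M.mfd.SmoothFun g) : M.mfd.SmoothFun (M.poisson f g) :=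
  h.pi_apply_smooth (smoothForm_d hf) (smoothForm_d hg)

theorem form_rhoStar_smooth {α β : ∀ x, M.mfd.Cot x} (hα : M.mfd.SmoothForm α)
    (hβ : M.mfd.SmoothForm β) :
    M.mfd.SmoothFun (fun x => B.form (M.rhoStar B x (α x)) (M.rhoStar B x (β x))) := by
  have h1 : (fun x => B.form (M.rhoStar B x (α x)) (M.rhoStar B x (β x))) = fun x =>
      ∑ i, (α x (M.action (B.basis i) x) : ℝ) * (β x (M.action (B.dualBasis i) x) : ℝ) := by
    funext x
    rw [B.form_eq_sum]
    simp only [form_rhoStar]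
  rw [h1]
  exact smoothFun_sum _ fun i => ContMDiff.mul (form_apply_smooth hα (h.action_smooth _))
    (form_apply_smooth hβ (h.action_smooth _))

theorem ham_smooth {f g : M.mfd.carrier → ℝ} (hf : M.mfd.SmoothFun f) (hg : M.mfd.SmoothFun g) :
    M.mfd.SmoothFun (M.ham B f g) :=
  (h.poisson_smooth hf hg).add
    (contMDiff_const.mul (h.form_rhoStar_smooth (smoothForm_d hf) (smoothForm_d hg)))

theorem anchor_smooth {α : ∀ x, M.mfd.Cot x} (hα : M.mfd.SmoothForm α) :
    M.mfd.SmoothVF (fun x => M.cotAnchor B x (α x)) := by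
  have h0 : ∀ i, M.mfd.SmoothFun (fun x => 2⁻¹ * (α x (M.action (B.basis i) x) : ℝ)) := fun i =>
    contMDiff_const.mul (form_apply_smooth hα (h.action_smooth _))
  have h1 : M.mfd.SmoothVF (fun x => M.piSharp x (α x) + ∑ i, (2⁻¹ * (α x (M.action (B.basis i) x) : ℝ)) •
      M.action (B.dualBasis i) x) :=
    smoothVF_add (h.pi_smooth α hα) (smoothVF_sum _ fun i => smoothVF_smul
      (h0 i) (h.action_smooth _))
  have h2 : (fun x : M.mfd.carrier => M.cotAnchor B x (α x)) = (fun x => M.piSharp x (α x) +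
      ∑ i, (2⁻¹ * (α x (M.action (B.basis i) x) : ℝ)) • M.action (B.dualBasis i) x) := by
    funext x
    refine congrArg (fun v : M.mfd.T x => M.piSharp x (α x) + v) ?_
    -- The Lie algebra element varies with `x`. The expansion in dual bases displays `ρ(ρ^*α)` as a
    -- combination of fixed fundamental fields with smooth coefficients.
    have h3 : M.actionAt x (M.rhoStar B x (α x)) =
        ∑ i, (α x (M.action (B.basis i) x) : ℝ) • M.action (B.dualBasis i) x := by
      conv_lhs => rw [← B.sum_form_basis_smul (M.rhoStar B x (α x))]
      simp only [map_sum, map_smul, form_rhoStar]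
      rfl
    change (2⁻¹ : ℝ) • M.actionAt x (M.rhoStar B x (α x)) = _
    rw [h3, Finset.smul_sum]
    simp only [mul_smul]
  exact h2 ▸ h1

theorem cotBracket_add {α β γ : ∀ x, M.mfd.Cot x} (hα : M.mfd.SmoothForm α)
    (hβ : M.mfd.SmoothForm β) (hγ : M.mfd.SmoothForm γ) (x : M.mfd.carrier) :
    M.cotBracket B α (β + γ) x = M.cotBracket B α β x + M.cotBracket B α γ x := by
  have e1 : M.mfd.d (M.pi α (β + γ)) x = M.mfd.d (M.pi α β) x + M.mfd.d (M.pi α γ) x :=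
    d_add (h.pi_apply_smooth hα hβ) (h.pi_apply_smooth hα hγ) x
  have e5 := lieD_vec_add (h.action_smooth (M.rhoStar B x (β x)))
    (h.action_smooth (M.rhoStar B x (γ x))) hα x
  simp only [cotBracket]
  rw [e1, contrD_add hβ hγ, lieD_add (h.action_smooth _) hβ hγ, Pi.add_apply, map_add, map_add,
    contrD_vec_add, map_add, e5]
  module

theorem cotBracket_skew (α β : ∀ x, M.mfd.Cot x) (x : M.mfd.carrier) :
    M.cotBracket B α β x = - M.cotBracket B β α x := by
  have e1 : M.mfd.d (M.pi α β) x = - M.mfd.d (M.pi β α) x := by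
    rw [← d_neg]
    congr 1
    funext y
    exact h.pi_skew y _ _
  simp only [cotBracket]
  rw [e1]
  module

/-- The terms `π(α, β) df` coming from `d(π(α, fβ))` and from `d(fβ)` cancel. In the correction term
the element `ρ^*β` is frozen at `x`, so its factor `f` is not differentiated and only `½ df(ρ(ρ^*α))
β` remains. -/
theorem cotBracket_smul {f : M.mfd.carrier → ℝ} (hf : M.mfd.SmoothFun f)
    {α β : ∀ x, M.mfd.Cot x} (hα : M.mfd.SmoothForm α) (hβ : M.mfd.SmoothForm β)
    (x : M.mfd.carrier) :
    M.cotBracket B α (fun y => f y • β y) x = f x • M.cotBracket B α β x +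
      (M.mfd.d f x (M.piSharp x (α x)) + 2⁻¹ * B.form (M.rhoStar B x (α x)) (M.rhoD B f x) : ℝ) •
        β x := by
  have e1 : M.mfd.d (M.pi α (fun y => f y • β y)) x = f x • M.mfd.d (M.pi α β) x +
      (β x (M.piSharp x (α x)) : ℝ) • M.mfd.d f x := d_mul hf (h.pi_apply_smooth hα hβ) x
  have e5 := lieD_vec_const_smul (f x) (h.action_smooth (M.rhoStar B x (β x))) hα x
  simp only [cotBracket]
  rw [e1, contrD_smul hf hβ, lieD_smul (h.action_smooth _) hf hβ, map_smul, map_smul,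
    contrD_vec_smul, map_smul, e5, form_rhoD', act]
  module

theorem isPreLie_cotangent : (M.cotangent B).IsPreLie where
  anchor_smooth _ hα := h.anchor_smooth hα
  bracket_add _ _ _ hα hβ hγ := funext fun x => h.cotBracket_add hα hβ hγ x
  bracket_skew α β _ _ := funext fun x => h.cotBracket_skew α β x
  leibniz f α β hf hα hβ x := (h.cotBracket_smul hf hα hβ x).trans
    (congrArg (fun c : ℝ => f x • M.cotBracket B α β x + c • (show M.mfd.Cot x from β x))
      (d_anchor f x (α x)).symm)

end IsHamiltonian
end HamData
end

/-! ### The function `ham` and the anchor on exact forms. -/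

section

variable {EG : Type*} [NormedAddCommGroup EG] [NormedSpace ℝ EG] [FiniteDimensional ℝ EG]
  {HG : Type*} [TopologicalSpace HG] {IG : ModelWithCorners ℝ EG HG}
  {G : Type*} [TopologicalSpace G] [ChartedSpace HG G] [Group G]

namespace HamData

open SmoothManifold

variable {M : HamData.{u} IG G} {B : InvariantForm IG G}

namespace IsHamiltonian

variable (h : M.IsHamiltonian B)
include h

/-- The linear map `ξ ↦ d (ρ(ξ) f)`. -/
def dAct {f : M.mfd.carrier → ℝ} (hf : M.mfd.SmoothFun f) (x : M.mfd.carrier) :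
    GroupLieAlgebra IG G →ₗ[ℝ] M.mfd.Cot x where
  toFun ξ := M.mfd.d (M.act ξ f) x
  map_add' ξ η := by
    rw [← d_add (h.act_smooth ξ hf) (h.act_smooth η hf)]
    congr 1
    funext y
    exact M.act_add ξ η f y
  map_smul' c ξ := by
    rw [RingHom.id_apply, ← d_const_mul c (h.act_smooth ξ hf)]
    congr 1
    funext y
    exact M.act_smul c ξ f y

theorem dAct_apply {f : M.mfd.carrier → ℝ} (hf : M.mfd.SmoothFun f) (x : M.mfd.carrier)
    (ξ : GroupLieAlgebra IG G) : h.dAct hf x ξ = M.mfd.d (M.act ξ f) x := rfl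

theorem form_rhoD_smooth {f g : M.mfd.carrier → ℝ} (hf : M.mfd.SmoothFun f)
    (hg : M.mfd.SmoothFun g) :
    M.mfd.SmoothFun (fun x => B.form (M.rhoD B f x) (M.rhoD B g x)) :=
  h.form_rhoStar_smooth (smoothForm_d hf) (smoothForm_d hg)

/-- In dual bases the pairing is a sum of products `(ρ(e_i)f)(ρ(e^i)g)`. The product rule
differentiates one factor while the other, frozen at `x`, reassembles to a single Lie algebra
element. -/
theorem d_form_rhoD {f g : M.mfd.carrier → ℝ} (hf : M.mfd.SmoothFun f) (hg : M.mfd.SmoothFun g)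
    (x : M.mfd.carrier) :
    M.mfd.d (fun x => B.form (M.rhoD B f x) (M.rhoD B g x)) x =
      h.dAct hg x (M.rhoD B f x) + h.dAct hf x (M.rhoD B g x) := by
  have h1 : (fun x => B.form (M.rhoD B f x) (M.rhoD B g x)) = fun x =>
      ∑ i, M.act (B.basis i) f x * M.act (B.dualBasis i) g x := by
    funext x
    rw [B.form_eq_sum]
    simp only [form_rhoD]
  have h2 : ∀ i, M.mfd.SmoothFun (fun x => M.act (B.basis i) f x * M.act (B.dualBasis i) g x) :=
    fun i => ContMDiff.mul (h.act_smooth _ hf) (h.act_smooth _ hg)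
  rw [h1, d_sum _ h2]
  conv_rhs => rw [← B.sum_form_basis_smul (M.rhoD B f x),
    ← B.sum_form_dualBasis_smul (M.rhoD B g x)]
  simp only [map_sum, map_smul, dAct_apply, form_rhoD]
  rw [← Finset.sum_add_distrib]
  exact Finset.sum_congr rfl fun i _ => d_mul (h.act_smooth _ hf) (h.act_smooth _ hg) x

theorem act_act (ξ η : GroupLieAlgebra IG G) {f : M.mfd.carrier → ℝ} (hf : M.mfd.SmoothFun f)
    (x : M.mfd.carrier) :
    M.act ξ (M.act η f) x - M.act η (M.act ξ f) x = M.act ⁅ξ, η⁆ f x := by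
  have h1 := d_mlieBracket (h.action_smooth ξ) (h.action_smooth η) hf x
  rw [← h.action_bracket] at h1
  exact h1.symm

theorem poisson_skew (f g : M.mfd.carrier → ℝ) (x : M.mfd.carrier) :
    M.poisson f g x = - M.poisson g f x := h.pi_skew x _ _

theorem d_ham {f g : M.mfd.carrier → ℝ} (hf : M.mfd.SmoothFun f) (hg : M.mfd.SmoothFun g)
    (x : M.mfd.carrier) :
    M.mfd.d (M.ham B f g) x = M.mfd.d (M.poisson f g) x +
      (2⁻¹ : ℝ) • (h.dAct hg x (M.rhoD B f x) + h.dAct hf x (M.rhoD B g x)) := by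
  have h2 := h.form_rhoD_smooth hf hg
  have h3 : M.mfd.SmoothFun (fun x => 2⁻¹ * B.form (M.rhoD B f x) (M.rhoD B g x)) :=
    contMDiff_const.mul h2
  have h1 : M.mfd.d (M.ham B f g) x = M.mfd.d (M.poisson f g) x +
      M.mfd.d (fun x => 2⁻¹ * B.form (M.rhoD B f x) (M.rhoD B g x)) x :=
    d_add (h.poisson_smooth hf hg) h3 x
  rw [h1, d_const_mul _ h2, h.d_form_rhoD hf hg]

theorem d_ham_apply {f g : M.mfd.carrier → ℝ} (hf : M.mfd.SmoothFun f) (hg : M.mfd.SmoothFun g)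
    (x : M.mfd.carrier) (v : M.mfd.T x) :
    (M.mfd.d (M.ham B f g) x v : ℝ) = (M.mfd.d (M.poisson f g) x v : ℝ) +
      2⁻¹ * ((M.mfd.d (M.act (M.rhoD B f x) g) x v : ℝ) +
        (M.mfd.d (M.act (M.rhoD B g x) f) x v : ℝ)) :=
  congrArg (fun a : M.mfd.T x →L[ℝ] ℝ => a v) (h.d_ham hf hg x)

omit h in
theorem lie_swap (ξ η : GroupLieAlgebra IG G) : ⁅ξ, η⁆ = -⁅η, ξ⁆ := by
  rw [GroupLieAlgebra.bracket_def, mlieBracket_swap_apply]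
  rfl

omit h in
theorem form_lie (ξ η ζ : GroupLieAlgebra IG G) : B.form ⁅ξ, η⁆ ζ = - B.form ⁅ξ, ζ⁆ η := by
  rw [lie_swap ξ η, map_neg, LinearMap.neg_apply, B.invariant, B.form_comm η]

omit h in
theorem form_lie_cyclic (ξ η ζ : GroupLieAlgebra IG G) :
    B.form ⁅ξ, η⁆ ζ = B.form ⁅η, ζ⁆ ξ := by
  rw [B.invariant, B.form_comm]

omit h in
theorem act_lie (ξ η : GroupLieAlgebra IG G) (f : M.mfd.carrier → ℝ) (x : M.mfd.carrier) :
    M.act ⁅ξ, η⁆ f x = B.form ⁅ξ, η⁆ (M.rhoD B f x) := (M.form_rhoD' B f x _).symm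

theorem ham_eq (f g : M.mfd.carrier → ℝ) (x : M.mfd.carrier) :
    M.ham B f g x = M.poisson f g x + 2⁻¹ * M.act (M.rhoD B f x) g x := by
  rw [ham, form_rhoD']

theorem ham_eq_swap (f g : M.mfd.carrier → ℝ) (x : M.mfd.carrier) :
    M.ham B f g x = - M.poisson g f x + 2⁻¹ * M.act (M.rhoD B g x) f x := by
  rw [ham, form_rhoD, h.poisson_skew]

theorem ham_swap (f g : M.mfd.carrier → ℝ) (x : M.mfd.carrier) :
    M.ham B f g x = - M.ham B g f x + B.form (M.rhoD B g x) (M.rhoD B f x) := by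
  rw [ham, ham, h.poisson_skew f g, B.form_comm (M.rhoD B f x)]
  ring

/-- For the Poisson part this is invariance of `π`. For the pairing the commutators contribute `⟨[ξ,
ρ^*df], ρ^*dg⟩` and `⟨[ξ, ρ^*dg], ρ^*df⟩`, which cancel by invariance of the form. -/
theorem act_ham {f g : M.mfd.carrier → ℝ} (hf : M.mfd.SmoothFun f) (hg : M.mfd.SmoothFun g)
    (ξ : GroupLieAlgebra IG G) (x : M.mfd.carrier) :
    M.act ξ (M.ham B f g) x = M.ham B (M.act ξ f) g x + M.ham B f (M.act ξ g) x := by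
  have h1 := h.d_ham_apply hf hg x (M.action ξ x)
  have h2 := h.pi_invariant ξ f g hf hg x
  have h3 := h.act_act ξ (M.rhoD B f x) hg x
  have h4 := h.act_act ξ (M.rhoD B g x) hf x
  rw [act_lie (B := B)] at h3 h4
  have h5 := form_lie (B := B) ξ (M.rhoD B f x) (M.rhoD B g x)
  have h6 : M.ham B (M.act ξ f) g x = M.poisson (M.act ξ f) g x +
      2⁻¹ * M.act (M.rhoD B g x) (M.act ξ f) x := by rw [ham, form_rhoD]
  rw [h6, h.ham_eq f]
  simp only [act] at h1 h2 h3 h4 ⊢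
  linarith

/-- The right side is the derivative of `k` along the anchor of `[df, dg]`, so this is the
compatibility of anchor and bracket. Invariance of `π` removes the terms with one Poisson bracket
and one action. Commutators of the action turn the terms with two actions into multiples of
`⟨[ρ^*df, ρ^*dg], ρ^*dk⟩`, which balance the Jacobiator given by `pi_pi`. The last term corrects for
`ham` not being skew. -/
theorem ham_ham {f g k : M.mfd.carrier → ℝ} (hf : M.mfd.SmoothFun f) (hg : M.mfd.SmoothFun g)
    (hk : M.mfd.SmoothFun k) (x : M.mfd.carrier) :
    M.ham B f (M.ham B g k) x - M.ham B g (M.ham B f k) x =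
      M.ham B (M.ham B f g) k x - M.ham B (M.act (M.rhoD B g x) f) k x := by
  obtain ⟨sf, hsf⟩ : ∃ s, s = M.rhoD B f x := ⟨_, rfl⟩
  obtain ⟨sg, hsg⟩ : ∃ s, s = M.rhoD B g x := ⟨_, rfl⟩
  obtain ⟨sk, hsk⟩ : ∃ s, s = M.rhoD B k x := ⟨_, rfl⟩
  -- All Lie algebra elements are frozen at `x`, so that only functions built from `act` by constant
  -- elements and from `poisson` are differentiated.
  have expand : ∀ {a b : M.mfd.carrier → ℝ} (c : M.mfd.carrier → ℝ) (ξ : GroupLieAlgebra IG G)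
      (_ : M.mfd.SmoothFun a) (_ : M.mfd.SmoothFun b),
      M.poisson c (M.ham B a b) x + 2⁻¹ * M.act ξ (M.ham B a b) x =
      M.poisson c (M.poisson a b) x +
        2⁻¹ * (M.poisson c (M.act (M.rhoD B a x) b) x + M.poisson c (M.act (M.rhoD B b x) a) x) +
      2⁻¹ * (M.poisson (M.act ξ a) b x + M.poisson a (M.act ξ b) x +
        2⁻¹ * (M.act ξ (M.act (M.rhoD B a x) b) x + M.act ξ (M.act (M.rhoD B b x) a) x)) := by
    intro a b c ξ ha hb
    have h1 := h.d_ham_apply ha hb x (M.piSharp x (M.mfd.d c x))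
    have h2 := h.d_ham_apply ha hb x (M.action ξ x)
    have h3 := h.pi_invariant ξ a b ha hb x
    simp only [act, poisson, pi] at h1 h2 h3 ⊢
    linarith
  have e1 := expand f sf hg hk
  have e2 := expand g sg hf hk
  rw [← hsg, ← hsk] at e1
  rw [← hsf, ← hsk] at e2
  have e3 : - M.poisson k (M.ham B f g) x + 2⁻¹ * M.act sk (M.ham B f g) x =
      M.poisson k (M.poisson f g) x * (-1) -
        2⁻¹ * (M.poisson k (M.act sf g) x + M.poisson k (M.act sg f) x) +
      2⁻¹ * (M.poisson (M.act sk f) g x + M.poisson f (M.act sk g) x +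
        2⁻¹ * (M.act sk (M.act sf g) x + M.act sk (M.act sg f) x)) := by
    have h1 := h.d_ham_apply hf hg x (M.piSharp x (M.mfd.d k x))
    have h2 := h.d_ham_apply hf hg x (M.action sk x)
    have h3 := h.pi_invariant sk f g hf hg x
    rw [← hsf, ← hsg] at h1 h2
    simp only [act, poisson, pi] at h1 h2 h3 ⊢
    linarith
  -- Each outer `ham` is written so that its composite argument is the one differentiated. The claim
  -- is then linear in the values prepared above and below.
  rw [← hsg, h.ham_eq f, h.ham_eq g, h.ham_eq_swap (M.ham B f g), h.ham_eq_swap (M.act sg f),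
    ← hsf, ← hsg, ← hsk]
  have p1 := h.poisson_skew (M.act sf g) k x
  have p2 := h.poisson_skew (M.act sk f) g x
  have p3 := h.poisson_skew (M.act sg f) k x
  have p4 := h.poisson_skew (M.poisson f g) k x
  have p5 := h.poisson_skew (M.poisson g k) f x
  have p6 := h.poisson_skew (M.poisson k f) g x
  have p7 : M.poisson g (M.poisson k f) x = - M.poisson g (M.poisson f k) x := by
    have h1 : M.poisson k f = fun y => - M.poisson f k y := funext fun y => h.poisson_skew k f y
    have h2 : M.mfd.d (M.poisson k f) x = - M.mfd.d (M.poisson f k) x := by rw [h1, d_neg]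
    exact congrArg (fun a : M.mfd.T x →L[ℝ] ℝ => a (M.piSharp x (M.mfd.d g x))) h2
  have a1 := h.act_act sf sg hk x
  have a2 := h.act_act sf sk hg x
  have a3 := h.act_act sg sk hf x
  have c := h.pi_pi f g k hf hg hk x
  have c' : M.mfd.d f x (M.action ⁅sg, sk⁆ x) = M.act ⁅sg, sk⁆ f x := rfl
  rw [act_lie (B := B), ← hsk] at a1
  rw [act_lie (B := B), ← hsg] at a2
  rw [act_lie (B := B), ← hsf] at a3
  have b1 := form_lie (B := B) sf sk sg
  have b2 := form_lie_cyclic (B := B) sf sg sk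
  have a4 : M.act ⁅sg, sk⁆ f x = B.form ⁅sg, sk⁆ sf := hsf ▸ act_lie _ _ _ _
  change _ = 1 / 2 * (M.mfd.d f x (M.action ⁅M.rhoD B g x, M.rhoD B k x⁆ x) : ℝ) at c
  rw [← hsg, ← hsk] at c
  linarith

/-! ### The Lie algebroid axioms for exact one-forms -/

/-- The contractions vanish by `d² = 0`, and Lie derivatives of exact forms are exact. This leaves
half the difference of two terms, of which `d(ham f g)` contains half the sum. -/
theorem cotBracket_d {f g : M.mfd.carrier → ℝ} (hf : M.mfd.SmoothFun f) (hg : M.mfd.SmoothFun g)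
    (x : M.mfd.carrier) :
    M.cotBracket B (M.mfd.d f) (M.mfd.d g) x =
      M.mfd.d (M.ham B f g) x - h.dAct hf x (M.rhoD B g x) := by
  rw [cotBracket, contrD_d hf, contrD_d hg, lieD_d hf, lieD_d hg, h.d_ham hf hg]
  change M.mfd.d (M.poisson f g) x + 0 - 0 + (2⁻¹ : ℝ) • (h.dAct hg x (M.rhoD B f x) -
    h.dAct hf x (M.rhoD B g x)) = _
  module

theorem dAct_rhoD {f : M.mfd.carrier → ℝ} (hf : M.mfd.SmoothFun f) (g : M.mfd.carrier → ℝ)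
    (x : M.mfd.carrier) :
    h.dAct hf x (M.rhoD B g x) =
      ∑ i, M.act (B.basis i) g x • M.mfd.d (M.act (B.dualBasis i) f) x := by
  conv_lhs => rw [← B.sum_form_basis_smul (M.rhoD B g x)]
  simp only [map_sum, map_smul, dAct_apply, form_rhoD]

theorem cotBracket_d_smooth {f g : M.mfd.carrier → ℝ} (hf : M.mfd.SmoothFun f)
    (hg : M.mfd.SmoothFun g) : M.mfd.SmoothForm (M.cotBracket B (M.mfd.d f) (M.mfd.d g)) := by
  rw [funext (h.cotBracket_d hf hg)]
  simp only [h.dAct_rhoD]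
  exact smoothForm_sub (smoothForm_d (h.ham_smooth hf hg)) (smoothForm_sum _ fun i =>
    smoothForm_smul (h.act_smooth _ hg) (smoothForm_d (h.act_smooth _ hf)))

theorem d_anchor_cotBracket_d {f g k : M.mfd.carrier → ℝ} (hf : M.mfd.SmoothFun f)
    (hg : M.mfd.SmoothFun g) (hk : M.mfd.SmoothFun k) (x : M.mfd.carrier) :
    (M.mfd.d k x (M.cotAnchor B x (M.cotBracket B (M.mfd.d f) (M.mfd.d g) x)) : ℝ) =
      M.ham B f (M.ham B g k) x - M.ham B g (M.ham B f k) x := by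
  rw [h.cotBracket_d hf hg, h.ham_ham hf hg hk, map_sub]
  exact (map_sub (show M.mfd.T x →L[ℝ] ℝ from M.mfd.d k x) _ _).trans
    (congrArg₂ (fun a b : ℝ => a - b) (d_anchor_d _ _ x) (d_anchor_d _ _ x))

/-- Tested on a function `k`, both sides become the commutator of the derivations `ham f` and `ham
g`, by `ham_ham`. -/
theorem anchor_cotBracket_d {f g : M.mfd.carrier → ℝ} (hf : M.mfd.SmoothFun f)
    (hg : M.mfd.SmoothFun g) (x : M.mfd.carrier) :
    M.cotAnchor B x (M.cotBracket B (M.mfd.d f) (M.mfd.d g) x) =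
      mlieBracket M.mfd.model (fun y => M.cotAnchor B y (M.mfd.d f y))
        (fun y => M.cotAnchor B y (M.mfd.d g y)) x := by
  refine eq_of_d_eq fun k hk => ?_
  rw [d_mlieBracket (h.anchor_smooth (smoothForm_d hf)) (h.anchor_smooth (smoothForm_d hg)) hk]
  refine (h.d_anchor_cotBracket_d hf hg hk x).trans ?_
  rw [← d_anchor_d f (M.ham B g k), ← d_anchor_d g (M.ham B f k)]
  have e : ∀ g, (fun y => (M.mfd.d k y (M.cotAnchor B y (M.mfd.d g y)) : ℝ)) =
    M.ham B g k := fun g => funext fun y => d_anchor_d g k y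
  rw [← e f, ← e g]

end IsHamiltonian
end HamData
end

/-! ### The Jacobi identity on exact forms. -/

section

variable {EG : Type*} [NormedAddCommGroup EG] [NormedSpace ℝ EG] [FiniteDimensional ℝ EG]
  {HG : Type*} [TopologicalSpace HG] {IG : ModelWithCorners ℝ EG HG}
  {G : Type*} [TopologicalSpace G] [ChartedSpace HG G] [Group G]

namespace HamData

open SmoothManifold

variable {M : HamData.{u} IG G} {B : InvariantForm IG G}

theorem exactForms_attains : (M.cotangent B).Attains M.mfd.exactForms where
  smooth _ hs := smoothForm_of_mem_exactForms hs
  exists_eq x a := by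
    obtain ⟨f, hf, h⟩ := exists_d_eq (M := M.mfd) x a
    exact ⟨_, ⟨f, hf, rfl⟩, h⟩

namespace IsHamiltonian

variable (h : M.IsHamiltonian B)
include h

/-- The derivative of `ρ^* (df)` along a tangent vector. -/
def rhoDeriv {f : M.mfd.carrier → ℝ} (hf : M.mfd.SmoothFun f) (x : M.mfd.carrier)
    (v : M.mfd.T x) : GroupLieAlgebra IG G :=
  B.sharp
    { toFun := fun ξ => (h.dAct hf x ξ v : ℝ)
      map_add' := fun ξ η => by rw [map_add]; rfl
      map_smul' := fun c ξ => by rw [map_smul]; rfl }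

theorem form_rhoDeriv {f : M.mfd.carrier → ℝ} (hf : M.mfd.SmoothFun f) (x : M.mfd.carrier)
    (v : M.mfd.T x) (ξ : GroupLieAlgebra IG G) :
    B.form (h.rhoDeriv hf x v) ξ = M.mfd.d (M.act ξ f) x v := B.form_sharp _ ξ

/-- The derivative of `ρ^* (df)` along the anchor of `dg`. -/
abbrev hamDeriv {f : M.mfd.carrier → ℝ} (hf : M.mfd.SmoothFun f) (g : M.mfd.carrier → ℝ)
    (x : M.mfd.carrier) : GroupLieAlgebra IG G :=
  h.rhoDeriv hf x (M.cotAnchor B x (M.mfd.d g x))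

theorem form_hamDeriv {f : M.mfd.carrier → ℝ} (hf : M.mfd.SmoothFun f) (g : M.mfd.carrier → ℝ)
    (x : M.mfd.carrier) (ξ : GroupLieAlgebra IG G) :
    B.form (h.hamDeriv hf g x) ξ = M.ham B g (M.act ξ f) x :=
  (h.form_rhoDeriv hf x _ ξ).trans (d_anchor_d _ _ x)

theorem ham_act_add {f : M.mfd.carrier → ℝ} (hf : M.mfd.SmoothFun f) (g : M.mfd.carrier → ℝ)
    (x : M.mfd.carrier) (ξ η : GroupLieAlgebra IG G) :
    M.ham B g (M.act (ξ + η) f) x = M.ham B g (M.act ξ f) x + M.ham B g (M.act η f) x := by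
  simp only [← h.form_hamDeriv hf, map_add]

theorem ham_act_smul {f : M.mfd.carrier → ℝ} (hf : M.mfd.SmoothFun f) (g : M.mfd.carrier → ℝ)
    (x : M.mfd.carrier) (c : ℝ) (ξ : GroupLieAlgebra IG G) :
    M.ham B g (M.act (c • ξ) f) x = c * M.ham B g (M.act ξ f) x := by
  simp only [← h.form_hamDeriv hf, map_smul, smul_eq_mul]

/-- The linear map `ξ ↦ d ({f, ρ(ξ) g} + ½ ⟨ρ^* df, ρ^* d(ρ(ξ) g)⟩)`. -/
def dHamAct {f g : M.mfd.carrier → ℝ} (hf : M.mfd.SmoothFun f) (hg : M.mfd.SmoothFun g)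
    (x : M.mfd.carrier) : GroupLieAlgebra IG G →ₗ[ℝ] M.mfd.Cot x where
  toFun ξ := M.mfd.d (M.ham B f (M.act ξ g)) x
  map_add' ξ η := by
    rw [← d_add (h.ham_smooth hf (h.act_smooth ξ hg)) (h.ham_smooth hf (h.act_smooth η hg))]
    congr 1
    funext y
    exact h.ham_act_add hg f y ξ η
  map_smul' c ξ := by
    rw [RingHom.id_apply, ← d_const_mul c (h.ham_smooth hf (h.act_smooth ξ hg))]
    congr 1
    funext y
    exact h.ham_act_smul hg f y c ξ

/-- The left side is `ρ(ρ^*dg) ρ(ξ) f`. Commuting the two derivations exhibits `ξ` as the argument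
of a linear form, and invariance turns the commutator into a pairing with `[ρ^*df, ρ^*dg]`. -/
theorem act_rhoD_act {f g : M.mfd.carrier → ℝ} (hf : M.mfd.SmoothFun f)
    (x : M.mfd.carrier) (ξ : GroupLieAlgebra IG G) :
    B.form (M.rhoD B g x) (M.rhoD B (M.act ξ f) x) =
      B.form (M.rhoD B (M.act (M.rhoD B g x) f) x + ⁅M.rhoD B f x, M.rhoD B g x⁆) ξ := by
  have h1 := h.act_act (M.rhoD B g x) ξ hf x
  rw [act_lie (B := B), form_lie_cyclic, form_lie_cyclic] at h1
  rw [map_add, LinearMap.add_apply, form_rhoD', form_rhoD]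
  linarith

theorem rhoD_ham {g k : M.mfd.carrier → ℝ} (hg : M.mfd.SmoothFun g) (hk : M.mfd.SmoothFun k)
    (x : M.mfd.carrier) :
    M.rhoD B (M.ham B g k) x = h.hamDeriv hk g x - h.hamDeriv hg k x +
      (M.rhoD B (M.act (M.rhoD B k x) g) x + ⁅M.rhoD B g x, M.rhoD B k x⁆) := by
  refine B.ext_form fun ξ => ?_
  rw [map_add, map_sub, LinearMap.add_apply, LinearMap.sub_apply, ← h.act_rhoD_act hg, form_rhoD,
    form_hamDeriv, form_hamDeriv, h.act_ham hg hk, h.ham_swap (M.act ξ g)]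
  ring

/-- The inner bracket is an exact form plus a combination of exact forms with function coefficients,
so the Leibniz rule and `cotBracket_d` suffice. Summing over the dual bases removes the bases from
the answer. -/
theorem cotBracket_cotBracket_d {f g k : M.mfd.carrier → ℝ} (hf : M.mfd.SmoothFun f)
    (hg : M.mfd.SmoothFun g) (hk : M.mfd.SmoothFun k) (x : M.mfd.carrier) :
    M.cotBracket B (M.mfd.d f) (M.cotBracket B (M.mfd.d g) (M.mfd.d k)) x =
      M.mfd.d (M.ham B f (M.ham B g k)) x
        - h.dAct hf x (h.hamDeriv hk g x) + h.dAct hf x (h.hamDeriv hg k x)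
        - h.dAct hf x ⁅M.rhoD B g x, M.rhoD B k x⁆
        - h.dHamAct hf hg x (M.rhoD B k x) - h.dAct hg x (h.hamDeriv hk f x) := by
  have hham := h.ham_smooth hg hk
  have hu : ∀ i, M.mfd.SmoothFun (fun y => -M.act (B.basis i) k y) :=
    fun i => (h.act_smooth _ hk).neg
  have hτ : ∀ i, M.mfd.SmoothForm (M.mfd.d (M.act (B.dualBasis i) g)) :=
    fun i => smoothForm_d (h.act_smooth _ hg)
  have e0 : M.cotBracket B (M.mfd.d g) (M.mfd.d k) = M.mfd.d (M.ham B g k) +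
      fun y => ∑ i, (-M.act (B.basis i) k y) • M.mfd.d (M.act (B.dualBasis i) g) y := by
    funext y
    rw [h.cotBracket_d hg hk, h.dAct_rhoD, sub_eq_add_neg, Pi.add_apply, ← Finset.sum_neg_distrib]
    exact congrArg (fun a => M.mfd.d (M.ham B g k) y + a)
      (Finset.sum_congr rfl fun i _ => (neg_smul _ _).symm)
  have e1 := h.cotBracket_add (smoothForm_d hf) (smoothForm_d hham)
    (smoothForm_sum Finset.univ fun i => smoothForm_smul (hu i) (hτ i)) x
  have e2 : M.cotBracket B (M.mfd.d f) (fun y => ∑ i, (-M.act (B.basis i) k y) •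
      M.mfd.d (M.act (B.dualBasis i) g) y) x = ∑ i, ((-M.act (B.basis i) k x) •
        M.cotBracket B (M.mfd.d f) (M.mfd.d (M.act (B.dualBasis i) g)) x +
        (M.mfd.d (fun y => -M.act (B.basis i) k y) x (M.cotAnchor B x (M.mfd.d f x)) : ℝ) •
        M.mfd.d (M.act (B.dualBasis i) g) x) :=
    h.isPreLie_cotangent.bracket_sum_smul Finset.univ (smoothForm_d hf) hu hτ x
  have e3 : ∀ i, (-M.act (B.basis i) k x) •
        M.cotBracket B (M.mfd.d f) (M.mfd.d (M.act (B.dualBasis i) g)) x +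
        (M.mfd.d (fun y => -M.act (B.basis i) k y) x (M.cotAnchor B x (M.mfd.d f x)) : ℝ) •
        M.mfd.d (M.act (B.dualBasis i) g) x =
      B.form (M.rhoD B k x) (B.basis i) • h.dAct hf x (M.rhoStar B x (h.dAct hg x (B.dualBasis i)))
      - B.form (M.rhoD B k x) (B.basis i) • h.dHamAct hf hg x (B.dualBasis i)
      - B.form (h.hamDeriv hk f x) (B.basis i) • h.dAct hg x (B.dualBasis i) := by
    intro i
    have e4 : (M.mfd.d (fun y => -M.act (B.basis i) k y) x (M.cotAnchor B x (M.mfd.d f x)) : ℝ) =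
        - B.form (h.hamDeriv hk f x) (B.basis i) := by
      rw [d_neg, form_rhoDeriv]
      rfl
    rw [e4, h.cotBracket_d hf (h.act_smooth _ hg), form_rhoD]
    change (-M.act (B.basis i) k x) • (h.dHamAct hf hg x (B.dualBasis i) -
      h.dAct hf x (M.rhoStar B x (h.dAct hg x (B.dualBasis i)))) + (-_) • h.dAct hg x (B.dualBasis i)
      = _
    module
  rw [e0, e1, e2, Finset.sum_congr rfl fun i _ => e3 i, Finset.sum_sub_distrib,
    Finset.sum_sub_distrib, h.cotBracket_d hf hham, h.rhoD_ham hg hk]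
  simp only [← map_smul, ← map_sum, B.sum_form_basis_smul]
  rw [map_add, map_sub, map_add]
  -- This term also comes, with the opposite sign, from `rhoD_ham` applied to the exact part, and
  -- cancels.
  change _ + (h.dAct hf x (M.rhoD B (M.act (M.rhoD B k x) g) x) - _ - _) = _
  abel

theorem ham_act_left {f k : M.mfd.carrier → ℝ} (hf : M.mfd.SmoothFun f)
    (x : M.mfd.carrier) (ξ : GroupLieAlgebra IG G) :
    M.ham B (M.act ξ f) k x = B.form (-h.hamDeriv hf k x +
      (M.rhoD B (M.act (M.rhoD B k x) f) x + ⁅M.rhoD B f x, M.rhoD B k x⁆)) ξ := by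
  rw [map_add, LinearMap.add_apply, ← h.act_rhoD_act hf, map_neg, LinearMap.neg_apply,
    form_hamDeriv, h.ham_swap]

/-- The linear map `ξ ↦ d ({ρ(ξ) f, k} + ½ ⟨ρ^* d(ρ(ξ) f), ρ^* dk⟩)`. -/
def dHamActLeft {f k : M.mfd.carrier → ℝ} (hf : M.mfd.SmoothFun f) (hk : M.mfd.SmoothFun k)
    (x : M.mfd.carrier) : GroupLieAlgebra IG G →ₗ[ℝ] M.mfd.Cot x where
  toFun ξ := M.mfd.d (M.ham B (M.act ξ f) k) x
  map_add' ξ η := by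
    rw [← d_add (h.ham_smooth (h.act_smooth ξ hf) hk) (h.ham_smooth (h.act_smooth η hf) hk)]
    congr 1
    funext y
    simp only [h.ham_act_left hf, map_add]
  map_smul' c ξ := by
    rw [RingHom.id_apply, ← d_const_mul c (h.ham_smooth (h.act_smooth ξ hf) hk)]
    congr 1
    funext y
    simp only [h.ham_act_left hf, map_smul, smul_eq_mul]

theorem d_ham_swap {f g : M.mfd.carrier → ℝ} (hf : M.mfd.SmoothFun f) (hg : M.mfd.SmoothFun g)
    (x : M.mfd.carrier) :
    M.mfd.d (M.ham B f g) x = - M.mfd.d (M.ham B g f) x +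
      (h.dAct hf x (M.rhoD B g x) + h.dAct hg x (M.rhoD B f x)) := by
  rw [h.d_ham hf hg, h.d_ham hg hf]
  have h1 : M.mfd.d (M.poisson f g) x = - M.mfd.d (M.poisson g f) x := by
    rw [← d_neg]
    congr 1
    funext y
    exact h.poisson_skew f g y
  rw [h1]
  module

theorem dAct_ham {f g : M.mfd.carrier → ℝ} (hf : M.mfd.SmoothFun f) (hg : M.mfd.SmoothFun g)
    (ξ : GroupLieAlgebra IG G) (x : M.mfd.carrier) :
    h.dAct (h.ham_smooth hf hg) x ξ = h.dHamActLeft hf hg x ξ + h.dHamAct hf hg x ξ := by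
  rw [dAct_apply]
  refine Eq.trans ?_ (d_add (h.ham_smooth (h.act_smooth ξ hf) hg)
    (h.ham_smooth hf (h.act_smooth ξ hg)) x)
  congr 1
  funext y
  exact h.act_ham hf hg ξ y

theorem dHamActLeft_eq {f k : M.mfd.carrier → ℝ} (hf : M.mfd.SmoothFun f)
    (hk : M.mfd.SmoothFun k) (x : M.mfd.carrier) (ξ : GroupLieAlgebra IG G) :
    h.dHamActLeft hf hk x ξ = - h.dHamAct hk hf x ξ +
      (h.dAct (h.act_smooth ξ hf) x (M.rhoD B k x) +
        h.dAct hk x (M.rhoD B (M.act ξ f) x)) :=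
  h.d_ham_swap (h.act_smooth ξ hf) hk x

theorem dAct_act {f : M.mfd.carrier → ℝ} (hf : M.mfd.SmoothFun f) (x : M.mfd.carrier)
    (ξ η : GroupLieAlgebra IG G) :
    h.dAct (h.act_smooth η hf) x ξ = h.dAct (h.act_smooth ξ hf) x η + h.dAct hf x ⁅ξ, η⁆ := by
  simp only [dAct_apply]
  rw [← d_add (h.act_smooth η (h.act_smooth ξ hf)) (h.act_smooth _ hf)]
  congr 1
  funext y
  rw [← h.act_act ξ η hf]
  ring

theorem sum_act_ham {f g k : M.mfd.carrier → ℝ} (hf : M.mfd.SmoothFun f) (x : M.mfd.carrier) :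
    ∑ i, M.act (B.basis i) g x * M.ham B (M.act (B.dualBasis i) f) k x =
      M.ham B (M.act (M.rhoD B g x) f) k x := by
  simp only [h.ham_act_left hf]
  conv_rhs => rw [← B.sum_form_basis_smul (M.rhoD B g x)]
  simp only [map_sum, map_smul, form_rhoD, smul_eq_mul]

/-- In the last term of `ham_ham` the Lie algebra element `ρ^*dg` depends on the point. The sum over
dual bases makes the term differentiable, and the second summand on the right is the contribution of
that dependence. -/
theorem d_sum_act_ham {f g k : M.mfd.carrier → ℝ} (hf : M.mfd.SmoothFun f)
    (hg : M.mfd.SmoothFun g) (hk : M.mfd.SmoothFun k) (x : M.mfd.carrier) :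
    M.mfd.d (fun y => ∑ i, M.act (B.basis i) g y * M.ham B (M.act (B.dualBasis i) f) k y) x =
      h.dHamActLeft hf hk x (M.rhoD B g x) + h.dAct hg x (-h.hamDeriv hf k x +
      (M.rhoD B (M.act (M.rhoD B k x) f) x + ⁅M.rhoD B f x, M.rhoD B k x⁆)) := by
  have hq : ∀ i, M.mfd.SmoothFun (M.ham B (M.act (B.dualBasis i) f) k) :=
    fun i => h.ham_smooth (h.act_smooth _ hf) hk
  have hgi : ∀ i, M.mfd.SmoothFun (M.act (B.basis i) g) := fun i => h.act_smooth _ hg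
  have hp : ∀ i, M.mfd.SmoothFun
      (fun y => M.act (B.basis i) g y * M.ham B (M.act (B.dualBasis i) f) k y) :=
    fun i => ContMDiff.mul (hgi i) (hq i)
  rw [d_sum _ hp, Finset.sum_congr rfl fun i _ => d_mul (hgi i) (hq i) x, Finset.sum_add_distrib]
  refine congrArg₂ (fun a b => a + b) ?_ ?_
  · conv_rhs => rw [← B.sum_form_basis_smul (M.rhoD B g x)]
    simp only [map_sum, map_smul, form_rhoD]
    rfl
  · conv_rhs => rw [← B.sum_form_dualBasis_smul (-h.hamDeriv hf k x +
      (M.rhoD B (M.act (M.rhoD B k x) f) x + ⁅M.rhoD B f x, M.rhoD B k x⁆))]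
    simp only [map_sum, map_smul, ← h.ham_act_left hf]
    rfl

theorem d_ham_ham {f g k : M.mfd.carrier → ℝ} (hf : M.mfd.SmoothFun f)
    (hg : M.mfd.SmoothFun g) (hk : M.mfd.SmoothFun k) (x : M.mfd.carrier) :
    M.mfd.d (M.ham B f (M.ham B g k)) x - M.mfd.d (M.ham B g (M.ham B f k)) x =
      - M.mfd.d (M.ham B k (M.ham B f g)) x +
        (h.dAct (h.ham_smooth hf hg) x (M.rhoD B k x) +
          h.dAct hk x (M.rhoD B (M.ham B f g) x)) -
      (h.dHamActLeft hf hk x (M.rhoD B g x) + h.dAct hg x (-h.hamDeriv hf k x +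
      (M.rhoD B (M.act (M.rhoD B k x) f) x + ⁅M.rhoD B f x, M.rhoD B k x⁆))) := by
  have hfg := h.ham_smooth hf hg
  have hp : ∀ i, M.mfd.SmoothFun
      (fun y => M.act (B.basis i) g y * M.ham B (M.act (B.dualBasis i) f) k y) :=
    fun i => ContMDiff.mul (h.act_smooth _ hg) (h.ham_smooth (h.act_smooth _ hf) hk)
  rw [← h.d_sum_act_ham hf hg hk, ← h.d_ham_swap hfg hk,
    ← d_sub (h.ham_smooth hf (h.ham_smooth hg hk)) (h.ham_smooth hg (h.ham_smooth hf hk)),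
    ← d_sub (h.ham_smooth hfg hk) (smoothFun_sum Finset.univ hp)]
  congr 1
  funext y
  rw [h.sum_act_ham hf, h.ham_ham hf hg hk]

/-- After expanding the iterated brackets, the exact parts are compared by the differential of
`ham_ham`. The rest consists of linear maps evaluated on Lie algebra elements; `act_ham` and
`ham_swap`, in differentiated form, and the commutator rule `dAct_act` bring them to a common form
in which they cancel. -/
theorem jacobi_d {f g k : M.mfd.carrier → ℝ} (hf : M.mfd.SmoothFun f)
    (hg : M.mfd.SmoothFun g) (hk : M.mfd.SmoothFun k) (x : M.mfd.carrier) :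
    M.cotBracket B (M.mfd.d f) (M.cotBracket B (M.mfd.d g) (M.mfd.d k)) x =
      M.cotBracket B (M.cotBracket B (M.mfd.d f) (M.mfd.d g)) (M.mfd.d k) x +
      M.cotBracket B (M.mfd.d g) (M.cotBracket B (M.mfd.d f) (M.mfd.d k)) x := by
  have e1 := h.d_ham_ham hf hg hk x
  rw [h.dAct_ham hf hg, h.dHamActLeft_eq hf hg, h.dHamActLeft_eq hf hk, h.rhoD_ham hf hg,
    h.dAct_act hf x (M.rhoD B g x) (M.rhoD B k x)] at e1
  rw [h.cotBracket_skew (M.cotBracket B (M.mfd.d f) (M.mfd.d g)),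
    h.cotBracket_cotBracket_d hf hg hk, h.cotBracket_cotBracket_d hk hf hg,
    h.cotBracket_cotBracket_d hg hf hk, sub_eq_iff_eq_add.1 e1]
  simp only [map_add, map_sub, map_neg]
  abel

theorem isLieAlgebroid_cotangent : (M.cotangent B).IsLieAlgebroid := by
  refine AlgebroidData.isLieAlgebroid_of_generates h.isPreLie_cotangent
    exactForms_attains.generates ?_ ?_ ?_
  · rintro _ ⟨f, hf, rfl⟩ _ ⟨g, hg, rfl⟩
    exact h.cotBracket_d_smooth hf hg
  · rintro _ ⟨f, hf, rfl⟩ _ ⟨g, hg, rfl⟩ x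
    exact h.anchor_cotBracket_d hf hg x
  · rintro _ ⟨f, hf, rfl⟩ _ ⟨g, hg, rfl⟩ _ ⟨k, hk, rfl⟩ x
    exact h.jacobi_d hf hg hk x

end IsHamiltonian

/-! ### Maps that need not preserve moment maps. -/

/-- Smooth maps that preserve the bivector fields and the actions. -/
structure IsQuasiPoissonMap {M N : HamData.{u} IG G} (φ : M.mfd.carrier → N.mfd.carrier) :
    Prop where
  smooth : M.mfd.Smooth N.mfd φ
  pi : ∀ x (α : N.mfd.Cot (φ x)),
    M.mfd.D N.mfd φ x (M.piSharp x (M.mfd.pullCot N.mfd φ x α)) = N.piSharp (φ x) α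
  action : ∀ ξ x, M.mfd.D N.mfd φ x (M.action ξ x) = N.action ξ (φ x)

theorem IsMorphism.toMap {N : HamData.{u} IG G} {φ : M.mfd.carrier → N.mfd.carrier}
    (hφ : IsMorphism (M := M) (N := N) φ) : IsQuasiPoissonMap (M := M) (N := N) φ :=
  ⟨hφ.smooth, hφ.pi, hφ.action⟩

namespace IsQuasiPoissonMap

variable {N : HamData.{u} IG G} {φ : M.mfd.carrier → N.mfd.carrier}

theorem rhoStar_pullCot (hφ : IsQuasiPoissonMap (M := M) (N := N) φ) (x : M.mfd.carrier)
    (a : N.mfd.Cot (φ x)) :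
    M.rhoStar B x (M.mfd.pullCot N.mfd φ x a) = N.rhoStar B (φ x) a := by
  refine B.ext_form fun ξ => ?_
  rw [form_rhoStar, form_rhoStar, ← hφ.action]
  rfl

theorem rhoD_comp (hφ : IsQuasiPoissonMap (M := M) (N := N) φ) {f : N.mfd.carrier → ℝ}
    (hf : N.mfd.SmoothFun f) (x : M.mfd.carrier) :
    M.rhoD B (fun x => f (φ x)) x = N.rhoD B f (φ x) := by
  rw [rhoD, ← pullCot_d hφ.smooth hf, hφ.rhoStar_pullCot]

theorem act_comp (hφ : IsQuasiPoissonMap (M := M) (N := N) φ) {f : N.mfd.carrier → ℝ}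
    (hf : N.mfd.SmoothFun f) (ξ : GroupLieAlgebra IG G) (x : M.mfd.carrier) :
    M.act ξ (fun x => f (φ x)) x = N.act ξ f (φ x) := by
  rw [act, d_comp_apply hφ.smooth hf, hφ.action, act]

theorem poisson_comp (hφ : IsQuasiPoissonMap (M := M) (N := N) φ) {f g : N.mfd.carrier → ℝ}
    (hf : N.mfd.SmoothFun f) (hg : N.mfd.SmoothFun g) (x : M.mfd.carrier) :
    M.poisson (fun x => f (φ x)) (fun x => g (φ x)) x = N.poisson f g (φ x) := by
  have h1 := d_comp_apply hφ.smooth hg x (M.piSharp x (M.mfd.pullCot N.mfd φ x (N.mfd.d f (φ x))))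
  rw [hφ.pi, pullCot_d hφ.smooth hf] at h1
  exact h1

theorem ham_comp (hφ : IsQuasiPoissonMap (M := M) (N := N) φ) {f g : N.mfd.carrier → ℝ}
    (hf : N.mfd.SmoothFun f) (hg : N.mfd.SmoothFun g) (x : M.mfd.carrier) :
    M.ham B (fun x => f (φ x)) (fun x => g (φ x)) x = N.ham B f g (φ x) := by
  rw [ham, ham, hφ.poisson_comp hf hg, hφ.rhoD_comp hf, hφ.rhoD_comp hg]

theorem D_cotAnchor (hφ : IsQuasiPoissonMap (M := M) (N := N) φ) (x : M.mfd.carrier)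
    (a : N.mfd.Cot (φ x)) :
    M.mfd.D N.mfd φ x (M.cotAnchor B x (M.mfd.pullCot N.mfd φ x a)) = N.cotAnchor B (φ x) a := by
  have h1 : M.mfd.D N.mfd φ x (M.cotAnchor B x (M.mfd.pullCot N.mfd φ x a)) =
      M.mfd.D N.mfd φ x (M.piSharp x (M.mfd.pullCot N.mfd φ x a)) + (2⁻¹ : ℝ) •
        M.mfd.D N.mfd φ x (M.action (M.rhoStar B x (M.mfd.pullCot N.mfd φ x a)) x) :=
    (map_add (M.mfd.D N.mfd φ x) _ _).trans
      (congrArg (fun v : N.mfd.T (φ x) => _ + v) (map_smul (M.mfd.D N.mfd φ x) _ _))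
  rw [h1, hφ.pi, hφ.action, hφ.rhoStar_pullCot]
  rfl

theorem pullCot_cotBracket_d (hφ : IsQuasiPoissonMap (M := M) (N := N) φ) (hM : M.IsHamiltonian B)
    (hN : N.IsHamiltonian B) {f g : N.mfd.carrier → ℝ}
    (hf : N.mfd.SmoothFun f) (hg : N.mfd.SmoothFun g) (x : M.mfd.carrier) :
    M.mfd.pullCot N.mfd φ x (N.cotBracket B (N.mfd.d f) (N.mfd.d g) (φ x)) =
      M.cotBracket B (M.mfd.d (fun x => f (φ x))) (M.mfd.d (fun x => g (φ x))) x := by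
  have hf' : M.mfd.SmoothFun (fun x => f (φ x)) := hf.comp hφ.smooth
  have hg' : M.mfd.SmoothFun (fun x => g (φ x)) := hg.comp hφ.smooth
  have e3 : M.mfd.d (M.ham B (fun x => f (φ x)) (fun x => g (φ x))) x =
      M.mfd.pullCot N.mfd φ x (N.mfd.d (N.ham B f g) (φ x)) := by
    rw [pullCot_d hφ.smooth (hN.ham_smooth hf hg)]
    congr 1
    funext y
    exact hφ.ham_comp hf hg y
  have e4 : hM.dAct hf' x (M.rhoD B (fun x => g (φ x)) x) =
      M.mfd.pullCot N.mfd φ x (hN.dAct hf (φ x) (N.rhoD B g (φ x))) := by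
    rw [hφ.rhoD_comp hg, IsHamiltonian.dAct_apply, IsHamiltonian.dAct_apply,
      pullCot_d hφ.smooth (hN.act_smooth _ hf)]
    congr 1
    funext y
    exact hφ.act_comp hf _ y
  rw [hM.cotBracket_d hf' hg', hN.cotBracket_d hf hg, map_sub, ← e3, ← e4]

/-- Anchor and bracket involve only `π` and `ρ`, so moment maps play no role. Hence this also covers
the projections of a fusion product to its factors. -/
theorem isComorphism_cotangentMap (hφ : IsQuasiPoissonMap (M := M) (N := N) φ) (hM : M.IsHamiltonian B)
    (hN : N.IsHamiltonian B) : (cotangentMap (B := B) (M := M) (N := N) φ).IsComorphism := by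
  have hpull : ∀ f, N.mfd.SmoothFun f →
      (cotangentMap (B := B) (M := M) (N := N) φ).pull (N.mfd.d f) =
        M.mfd.d (fun x => f (φ x)) := fun f hf => funext fun x => pullCot_d hφ.smooth hf x
  refine BundleComorphism.isComorphism_of_generates hM.isLieAlgebroid_cotangent
    hN.isLieAlgebroid_cotangent exactForms_attains.generates hφ.smooth ?_ ?_ ?_
  · rintro _ ⟨f, hf, rfl⟩
    rw [hpull f hf]
    exact smoothForm_d (hf.comp hφ.smooth)
  · exact fun x a => hφ.D_cotAnchor x a
  · rintro _ ⟨f, hf, rfl⟩ _ ⟨g, hg, rfl⟩ x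
    rw [hpull f hf, hpull g hg]
    exact hφ.pullCot_cotBracket_d hM hN hf hg x

end IsQuasiPoissonMap
end HamData

theorem cotangentWellDefined (B : InvariantForm IG G) : CotangentWellDefined.{u} B where
  obj M := M.isHamiltonian.isLieAlgebroid_cotangent
  map {M N} f := f.isMorphism.toMap.isComorphism_cotangentMap M.isHamiltonian N.isHamiltonian

end

section

variable {EG : Type*} [NormedAddCommGroup EG] [NormedSpace ℝ EG] [FiniteDimensional ℝ EG]
  {HG : Type*} [TopologicalSpace HG] {IG : ModelWithCorners ℝ EG HG}
  {G : Type*} [TopologicalSpace G] [ChartedSpace HG G] [Group G]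

namespace HamData

open SmoothManifold

variable {M N P : HamData.{u} IG G} {B : InvariantForm IG G}

/-! ### Fusion products: functions -/

theorem d_inlT_add_inrT {M N : SmoothManifold.{u}} {F : M.carrier × N.carrier → ℝ}
    (hF : (M.prod N).SmoothFun F) (p : M.carrier × N.carrier) (v : M.T p.1) (w : N.T p.2) :
    ((M.prod N).d F p (M.inlT N p v + M.inrT N p w) : ℝ) =
      (M.d (fun x => F (x, p.2)) p.1 v : ℝ) + (N.d (fun y => F (p.1, y)) p.2 w : ℝ) := by
  rw [← d_inlT hF, ← d_inrT hF]
  exact map_add (show (M.prod N).T p →L[ℝ] ℝ from (M.prod N).d F p) _ _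

theorem fusion_act {F : M.mfd.carrier × N.mfd.carrier → ℝ} (hF : (M.mfd.prod N.mfd).SmoothFun F)
    (ξ : GroupLieAlgebra IG G) (p : M.mfd.carrier × N.mfd.carrier) :
    (M.fusion B N).act ξ F p = M.act ξ (fun x => F (x, p.2)) p.1 +
      N.act ξ (fun y => F (p.1, y)) p.2 := d_inlT_add_inrT hF p _ _

theorem fusion_rhoStar (p : M.mfd.carrier × N.mfd.carrier) (a : (M.mfd.prod N.mfd).Cot p) :
    (M.fusion B N).rhoStar B p a =
      M.rhoStar B p.1 (M.mfd.pullCot (M.mfd.prod N.mfd) (fun x => (x, p.2)) p.1 a) +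
      N.rhoStar B p.2 (N.mfd.pullCot (M.mfd.prod N.mfd) (fun y => (p.1, y)) p.2 a) := by
  refine B.ext_form fun ξ => ?_
  rw [map_add, LinearMap.add_apply, form_rhoStar, form_rhoStar]
  refine ((M.fusion B N).form_rhoStar B p a ξ).trans ?_
  exact map_add (show (M.mfd.prod N.mfd).T p →L[ℝ] ℝ from a) _ _

theorem fusion_rhoD {F : M.mfd.carrier × N.mfd.carrier → ℝ}
    (hF : (M.mfd.prod N.mfd).SmoothFun F) (p : M.mfd.carrier × N.mfd.carrier) :
    (M.fusion B N).rhoD B F p = M.rhoD B (fun x => F (x, p.2)) p.1 +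
      N.rhoD B (fun y => F (p.1, y)) p.2 := by
  have h := fusion_rhoStar (B := B) (M := M) (N := N) p ((M.mfd.prod N.mfd).d F p)
  rw [pullCot_d (smooth_inl p.2) hF, pullCot_d (smooth_inr p.1) hF] at h
  exact h

theorem fusion_piSharp_d {F : M.mfd.carrier × N.mfd.carrier → ℝ}
    (hF : (M.mfd.prod N.mfd).SmoothFun F) (p : M.mfd.carrier × N.mfd.carrier) :
    (M.fusion B N).piSharp p ((M.mfd.prod N.mfd).d F p) =
      M.mfd.inlT N.mfd p (M.piSharp p.1 (M.mfd.d (fun x => F (x, p.2)) p.1) -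
        (2⁻¹ : ℝ) • M.actionAt p.1 (N.rhoD B (fun y => F (p.1, y)) p.2)) +
      M.mfd.inrT N.mfd p (N.piSharp p.2 (N.mfd.d (fun y => F (p.1, y)) p.2) +
        (2⁻¹ : ℝ) • N.actionAt p.2 (M.rhoD B (fun x => F (x, p.2)) p.1)) := by
  rw [rhoD, rhoD, ← pullCot_d (smooth_inl p.2) hF, ← pullCot_d (smooth_inr p.1) hF]
  rfl

theorem fusion_poisson {F K : M.mfd.carrier × N.mfd.carrier → ℝ}
    (hF : (M.mfd.prod N.mfd).SmoothFun F) (hK : (M.mfd.prod N.mfd).SmoothFun K)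
    (p : M.mfd.carrier × N.mfd.carrier) :
    (M.fusion B N).poisson F K p =
      (M.poisson (fun x => F (x, p.2)) (fun x => K (x, p.2)) p.1 -
        2⁻¹ * M.act (N.rhoD B (fun y => F (p.1, y)) p.2) (fun x => K (x, p.2)) p.1) +
      (N.poisson (fun y => F (p.1, y)) (fun y => K (p.1, y)) p.2 +
        2⁻¹ * N.act (M.rhoD B (fun x => F (x, p.2)) p.1) (fun y => K (p.1, y)) p.2) := by
  have h1 := congrArg (fun v => ((M.mfd.prod N.mfd).d K p v : ℝ)) (fusion_piSharp_d (B := B) hF p)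
  refine h1.trans ((d_inlT_add_inrT hK p _ _).trans (congrArg₂ (fun a b : ℝ => a + b) ?_ ?_))
  · exact (map_sub (show M.mfd.T p.1 →L[ℝ] ℝ from _) _ _).trans
      (congrArg (fun a : ℝ => _ - a) (map_smul (show M.mfd.T p.1 →L[ℝ] ℝ from _) _ _))
  · exact (map_add (show N.mfd.T p.2 →L[ℝ] ℝ from _) _ _).trans
      (congrArg (fun a : ℝ => _ + a) (map_smul (show N.mfd.T p.2 →L[ℝ] ℝ from _) _ _))

theorem rhoD_const (c : ℝ) (x : M.mfd.carrier) : M.rhoD B (fun _ => c) x = 0 := by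
  rw [rhoD, d_const, map_zero]

theorem act_zero (f : M.mfd.carrier → ℝ) (x : M.mfd.carrier) : M.act 0 f x = 0 := by
  have h := M.act_smul 0 0 f x
  rwa [zero_smul, zero_mul] at h

theorem act_const (ξ : GroupLieAlgebra IG G) (c : ℝ) (x : M.mfd.carrier) :
    M.act ξ (fun _ => c) x = 0 := d_const_apply c x _

theorem poisson_const_left (c : ℝ) (f : M.mfd.carrier → ℝ) (x : M.mfd.carrier) :
    M.poisson (fun _ => c) f x = 0 := by
  have h : M.piSharp x (M.mfd.d (fun _ => c) x) = 0 := by rw [d_const, map_zero]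
  exact (congrArg (fun v => (M.mfd.d f x v : ℝ)) h).trans
    (map_zero (show M.mfd.T x →L[ℝ] ℝ from M.mfd.d f x))

theorem poisson_const_right (c : ℝ) (f : M.mfd.carrier → ℝ) (x : M.mfd.carrier) :
    M.poisson f (fun _ => c) x = 0 := d_const_apply c x _

theorem act_const_mul (ξ : GroupLieAlgebra IG G) (c : ℝ) {f : M.mfd.carrier → ℝ}
    (hf : M.mfd.SmoothFun f) (x : M.mfd.carrier) :
    M.act ξ (fun x => c * f x) x = c * M.act ξ f x := by
  rw [act, d_const_mul c hf]; rfl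

theorem poisson_const_mul (c : ℝ) (f : M.mfd.carrier → ℝ) {g : M.mfd.carrier → ℝ}
    (hg : M.mfd.SmoothFun g) (x : M.mfd.carrier) :
    M.poisson f (fun x => c * g x) x = c * M.poisson f g x := by
  rw [poisson, pi, d_const_mul c hg]; rfl

theorem fusion_poisson_fst {f : M.mfd.carrier → ℝ} (hf : M.mfd.SmoothFun f)
    {K : M.mfd.carrier × N.mfd.carrier → ℝ} (hK : (M.mfd.prod N.mfd).SmoothFun K)
    (p : M.mfd.carrier × N.mfd.carrier) :
    (M.fusion B N).poisson (fun p => f p.1) K p = M.poisson f (fun x => K (x, p.2)) p.1 +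
      2⁻¹ * N.act (M.rhoD B f p.1) (fun y => K (p.1, y)) p.2 := by
  refine (fusion_poisson (smoothFun_fst hf) hK p).trans ?_
  have e1 : N.rhoD B (fun _ => f p.1) p.2 = 0 := rhoD_const _ _
  have e2 : N.poisson (fun _ => f p.1) (fun y => K (p.1, y)) p.2 = 0 := poisson_const_left _ _ _
  simp only [e1, e2, act_zero]
  ring

theorem fusion_poisson_snd {f : N.mfd.carrier → ℝ} (hf : N.mfd.SmoothFun f)
    {K : M.mfd.carrier × N.mfd.carrier → ℝ} (hK : (M.mfd.prod N.mfd).SmoothFun K)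
    (p : M.mfd.carrier × N.mfd.carrier) :
    (M.fusion B N).poisson (fun p => f p.2) K p = N.poisson f (fun y => K (p.1, y)) p.2 -
      2⁻¹ * M.act (N.rhoD B f p.2) (fun x => K (x, p.2)) p.1 := by
  refine (fusion_poisson (smoothFun_snd hf) hK p).trans ?_
  have e1 : M.rhoD B (fun _ => f p.2) p.1 = 0 := rhoD_const _ _
  have e2 : M.poisson (fun _ => f p.2) (fun x => K (x, p.2)) p.1 = 0 := poisson_const_left _ _ _
  simp only [e1, e2, act_zero]
  ring

theorem fusion_rhoD_fst {f : M.mfd.carrier → ℝ} (hf : M.mfd.SmoothFun f)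
    (p : M.mfd.carrier × N.mfd.carrier) :
    (M.fusion B N).rhoD B (fun p => f p.1) p = M.rhoD B f p.1 :=
  (fusion_rhoD (smoothFun_fst hf) p).trans
    ((congrArg (fun a => M.rhoD B f p.1 + a) (rhoD_const _ _)).trans (add_zero _))

theorem fusion_rhoD_snd {f : N.mfd.carrier → ℝ} (hf : N.mfd.SmoothFun f)
    (p : M.mfd.carrier × N.mfd.carrier) :
    (M.fusion B N).rhoD B (fun p => f p.2) p = N.rhoD B f p.2 :=
  (fusion_rhoD (smoothFun_snd hf) p).trans
    ((congrArg (fun a => a + N.rhoD B f p.2) (rhoD_const _ _)).trans (zero_add _))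

theorem fusion_act_fst {f : M.mfd.carrier → ℝ} (hf : M.mfd.SmoothFun f)
    (ξ : GroupLieAlgebra IG G) (p : M.mfd.carrier × N.mfd.carrier) :
    (M.fusion B N).act ξ (fun p => f p.1) p = M.act ξ f p.1 :=
  (fusion_act (smoothFun_fst hf) ξ p).trans
    ((congrArg (fun a => M.act ξ f p.1 + a) (act_const _ _ _)).trans (add_zero _))

theorem fusion_act_snd {f : N.mfd.carrier → ℝ} (hf : N.mfd.SmoothFun f)
    (ξ : GroupLieAlgebra IG G) (p : M.mfd.carrier × N.mfd.carrier) :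
    (M.fusion B N).act ξ (fun p => f p.2) p = N.act ξ f p.2 :=
  (fusion_act (smoothFun_snd hf) ξ p).trans
    ((congrArg (fun a => a + N.act ξ f p.2) (act_const _ _ _)).trans (zero_add _))

theorem fusion_poisson_fst_snd {f : M.mfd.carrier → ℝ} (hf : M.mfd.SmoothFun f)
    {g : N.mfd.carrier → ℝ} (hg : N.mfd.SmoothFun g) (p : M.mfd.carrier × N.mfd.carrier) :
    (M.fusion B N).poisson (fun p => f p.1) (fun p => g p.2) p =
      2⁻¹ * B.form (M.rhoD B f p.1) (N.rhoD B g p.2) := by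
  refine (fusion_poisson_fst hf (smoothFun_snd hg) p).trans ?_
  have e : M.poisson f (fun _ => g p.2) p.1 = 0 := poisson_const_right _ _ _
  simp only [e, form_rhoD', zero_add]

theorem fusion_poisson_fst_fst {f g : M.mfd.carrier → ℝ} (hf : M.mfd.SmoothFun f)
    (hg : M.mfd.SmoothFun g) (p : M.mfd.carrier × N.mfd.carrier) :
    (M.fusion B N).poisson (fun p => f p.1) (fun p => g p.1) p = M.poisson f g p.1 := by
  refine (fusion_poisson_fst hf (smoothFun_fst hg) p).trans ?_
  have e : N.act (M.rhoD B f p.1) (fun _ => g p.1) p.2 = 0 := act_const _ _ _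
  simp only [e, mul_zero, add_zero]

theorem fusion_poisson_snd_snd {f g : N.mfd.carrier → ℝ} (hf : N.mfd.SmoothFun f)
    (hg : N.mfd.SmoothFun g) (p : M.mfd.carrier × N.mfd.carrier) :
    (M.fusion B N).poisson (fun p => f p.2) (fun p => g p.2) p = N.poisson f g p.2 := by
  refine (fusion_poisson_snd hf (smoothFun_snd hg) p).trans ?_
  have e : M.act (N.rhoD B f p.2) (fun _ => g p.2) p.1 = 0 := act_const _ _ _
  simp only [e, mul_zero, sub_zero]

/-! ### Morphisms -/

/-- Every covector is the differential of a function, and functions separate tangent vectors. -/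
theorem isQuasiPoissonMap_of_functions {φ : M.mfd.carrier → N.mfd.carrier}
    (hφ : M.mfd.Smooth N.mfd φ)
    (hpi : ∀ f g, N.mfd.SmoothFun f → N.mfd.SmoothFun g → ∀ x,
      M.poisson (fun x => f (φ x)) (fun x => g (φ x)) x = N.poisson f g (φ x))
    (hact : ∀ ξ f, N.mfd.SmoothFun f → ∀ x, M.act ξ (fun x => f (φ x)) x = N.act ξ f (φ x)) :
    IsQuasiPoissonMap (M := M) (N := N) φ where
  smooth := hφ
  pi x α := by
    obtain ⟨f, hf, rfl⟩ := exists_d_eq (M := N.mfd) (φ x) α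
    refine eq_of_d_eq fun g hg => ?_
    rw [← d_comp_apply hφ hg, pullCot_d hφ hf]
    exact hpi f g hf hg x
  action ξ x := by
    refine eq_of_d_eq fun g hg => ?_
    rw [← d_comp_apply hφ hg]
    exact hact ξ g hg x

theorem isMorphism_of_functions {φ : M.mfd.carrier → N.mfd.carrier} (hφ : M.mfd.Smooth N.mfd φ)
    (hpi : ∀ f g, N.mfd.SmoothFun f → N.mfd.SmoothFun g → ∀ x,
      M.poisson (fun x => f (φ x)) (fun x => g (φ x)) x = N.poisson f g (φ x))
    (hact : ∀ ξ f, N.mfd.SmoothFun f → ∀ x, M.act ξ (fun x => f (φ x)) x = N.act ξ f (φ x))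
    (hmom : ∀ x, N.moment (φ x) = M.moment x) : IsMorphism (M := M) (N := N) φ where
  smooth := hφ
  pi := (isQuasiPoissonMap_of_functions hφ hpi hact).pi
  action := (isQuasiPoissonMap_of_functions hφ hpi hact).action
  moment := hmom

theorem IsMorphism.symm {φ : M.mfd.carrier → N.mfd.carrier} {ψ : N.mfd.carrier → M.mfd.carrier}
    (hφ : IsMorphism (M := M) (N := N) φ) (hψ : N.mfd.Smooth M.mfd ψ)
    (hl : ∀ x, ψ (φ x) = x) (hr : ∀ y, φ (ψ y) = y) : IsMorphism (M := N) (N := M) ψ := by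
  refine isMorphism_of_functions hψ ?_ ?_ ?_
  · intro f g hf hg y
    have h := hφ.toMap.poisson_comp (hf.comp hψ) (hg.comp hψ) (ψ y)
    simp only [Function.comp_apply, hl, hr] at h
    exact h.symm
  · intro ξ f hf y
    have h := hφ.toMap.act_comp (hf.comp hψ) ξ (ψ y)
    simp only [Function.comp_apply, hl, hr] at h
    exact h.symm
  · intro y
    rw [← hφ.moment, hr]

theorem isMorphism_fusion_map {M' N' : HamData.{u} IG G} {φ : M.mfd.carrier → M'.mfd.carrier}
    {ψ : N.mfd.carrier → N'.mfd.carrier} (hφ : IsMorphism (M := M) (N := M') φ)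
    (hψ : IsMorphism (M := N) (N := N') ψ) :
    IsMorphism (M := M.fusion B N) (N := M'.fusion B N') (fun p => (φ p.1, ψ p.2)) := by
  have hs : (M.mfd.prod N.mfd).Smooth (M'.mfd.prod N'.mfd) (fun p => (φ p.1, ψ p.2)) :=
    hφ.smooth.prodMap hψ.smooth
  refine isMorphism_of_functions hs ?_ ?_ ?_
  · rintro F K hF hK ⟨x, y⟩
    have hF' : (M'.mfd.prod N'.mfd).SmoothFun F := hF
    have hK' : (M'.mfd.prod N'.mfd).SmoothFun K := hK
    refine (fusion_poisson (hF'.comp hs) (hK'.comp hs) (x, y)).trans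
      (Eq.trans ?_ (fusion_poisson hF' hK' (φ x, ψ y)).symm)
    have f1 := smoothFun_inl hF' (ψ y)
    have f2 := smoothFun_inr hF' (φ x)
    have k1 := smoothFun_inl hK' (ψ y)
    have k2 := smoothFun_inr hK' (φ x)
    have e1 := hφ.toMap.poisson_comp f1 k1 x
    have e2 := hψ.toMap.poisson_comp f2 k2 y
    have e3 := hφ.toMap.act_comp k1 (N'.rhoD B (fun y => F (φ x, y)) (ψ y)) x
    have e4 := hψ.toMap.act_comp k2 (M'.rhoD B (fun x => F (x, ψ y)) (φ x)) y
    rw [← hψ.toMap.rhoD_comp f2] at e3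
    rw [← hφ.toMap.rhoD_comp f1] at e4
    rw [← e1, ← e2, ← hψ.toMap.rhoD_comp f2, ← hφ.toMap.rhoD_comp f1, ← e3, ← e4]
    rfl
  · rintro ξ F hF ⟨x, y⟩
    have hF' : (M'.mfd.prod N'.mfd).SmoothFun F := hF
    refine (fusion_act (hF'.comp hs) ξ (x, y)).trans
      (Eq.trans ?_ (fusion_act hF' ξ (φ x, ψ y)).symm)
    rw [← hφ.toMap.act_comp (smoothFun_inl hF' (ψ y)), ← hψ.toMap.act_comp (smoothFun_inr hF' (φ x))]
    rfl
  · rintro ⟨x, y⟩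
    exact congrArg₂ (fun a b : G => a * b) (hψ.moment y) (hφ.moment x)

theorem smooth_assoc {M N P : SmoothManifold.{u}} :
    ((M.prod N).prod P).Smooth (M.prod (N.prod P)) (fun p => (p.1.1, (p.1.2, p.2))) :=
  (contMDiff_fst.comp contMDiff_fst).prodMk
    ((contMDiff_snd.comp contMDiff_fst).prodMk contMDiff_snd)

theorem smooth_assoc_symm {M N P : SmoothManifold.{u}} :
    (M.prod (N.prod P)).Smooth ((M.prod N).prod P) (fun p => ((p.1, p.2.1), p.2.2)) :=
  (contMDiff_fst.prodMk (contMDiff_fst.comp contMDiff_snd)).prodMk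
    (contMDiff_snd.comp contMDiff_snd)

/-- For either bracketing the bivector is the sum of the three bivectors and of one cross term for
each pair of factors, because `ρ` and `ρ^*` of a fusion product are sums over the factors. The
moment maps agree by associativity in `G`. -/
theorem isMorphism_assoc :
    IsMorphism (M := (M.fusion B N).fusion B P) (N := M.fusion B (N.fusion B P))
      (fun p => (p.1.1, (p.1.2, p.2))) := by
  have hs := smooth_assoc (M := M.mfd) (N := N.mfd) (P := P.mfd)
  refine isMorphism_of_functions hs ?_ ?_ ?_
  · rintro F K hF hK ⟨⟨x, y⟩, z⟩
    have hF' : (M.mfd.prod (N.mfd.prod P.mfd)).SmoothFun F := hF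
    have hK' : (M.mfd.prod (N.mfd.prod P.mfd)).SmoothFun K := hK
    have hFs : ((M.mfd.prod N.mfd).prod P.mfd).SmoothFun (fun p => F (p.1.1, (p.1.2, p.2))) :=
      hF'.comp hs
    have hKs : ((M.mfd.prod N.mfd).prod P.mfd).SmoothFun (fun p => K (p.1.1, (p.1.2, p.2))) :=
      hK'.comp hs
    have fl := smoothFun_inl (M := M.mfd.prod N.mfd) (N := P.mfd) hFs z
    have kl := smoothFun_inl (M := M.mfd.prod N.mfd) (N := P.mfd) hKs z
    have fr := smoothFun_inr (M := M.mfd) (N := N.mfd.prod P.mfd) hF' x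
    have kr := smoothFun_inr (M := M.mfd) (N := N.mfd.prod P.mfd) hK' x
    refine (fusion_poisson (M := M.fusion B N) (N := P) hFs hKs ((x, y), z)).trans
      (Eq.trans ?_ (fusion_poisson (M := M) (N := N.fusion B P) hF' hK' (x, (y, z))).symm)
    have e1 := fusion_poisson (B := B) fl kl (x, y)
    have e2 := fusion_act (B := B) kl (P.rhoD B (fun z => F (x, (y, z))) z) (x, y)
    have e3 := fusion_rhoD (B := B) fl (x, y)
    have e4 := fusion_poisson (B := B) fr kr (y, z)
    have e5 := fusion_act (B := B) kr (M.rhoD B (fun x => F (x, (y, z))) x) (y, z)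
    have e6 := fusion_rhoD (B := B) fr (y, z)
    refine (congrArg₂ (fun a b : ℝ => a + b) (congrArg₂ (fun a b : ℝ => a - 2⁻¹ * b) e1 e2)
      (congrArg (fun η => P.poisson (fun z => F (x, (y, z))) (fun z => K (x, (y, z))) z +
        2⁻¹ * P.act η (fun z => K (x, (y, z))) z) e3)).trans (Eq.trans ?_
      (congrArg₂ (fun a b : ℝ => a + b)
        (congrArg (fun η => M.poisson (fun x => F (x, (y, z))) (fun x => K (x, (y, z))) x -
          2⁻¹ * M.act η (fun x => K (x, (y, z))) x) e6)
        (congrArg₂ (fun a b : ℝ => a + 2⁻¹ * b) e4 e5)).symm)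
    simp only [act_add]
    -- Here `a`, `c`, `g` are the three Poisson brackets, and the other six numbers are the two
    -- halves of each of the three cross terms.
    have key : ∀ a b c d e f g h i : ℝ,
        (a - 2⁻¹ * b + (c + 2⁻¹ * d)) - 2⁻¹ * (e + f) + (g + 2⁻¹ * (h + i)) =
          a - 2⁻¹ * (b + e) + (c - 2⁻¹ * f + (g + 2⁻¹ * i) + 2⁻¹ * (d + h)) := by
      intros; ring
    exact key _ _ _ _ _ _ _ _ _
  · rintro ξ F hF ⟨⟨x, y⟩, z⟩
    have hF' : (M.mfd.prod (N.mfd.prod P.mfd)).SmoothFun F := hF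
    have hFs := hF'.comp hs
    refine (fusion_act (M := M.fusion B N) (N := P) hFs ξ ((x, y), z)).trans
      (Eq.trans ?_ (fusion_act (M := M) (N := N.fusion B P) hF' ξ (x, (y, z))).symm)
    have e1 := fusion_act (B := B)
      (smoothFun_inl (M := M.mfd.prod N.mfd) (N := P.mfd) hFs z) ξ (x, y)
    have e2 := fusion_act (B := B)
      (smoothFun_inr (M := M.mfd) (N := N.mfd.prod P.mfd) hF' x) ξ (y, z)
    exact (congrArg (fun a : ℝ => a + _) e1).trans ((add_assoc _ _ _).trans
      (congrArg (fun a : ℝ => _ + a) e2).symm)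
  · rintro ⟨⟨x, y⟩, z⟩
    exact mul_assoc (P.moment z) (N.moment y) (M.moment x)

/-- The cross term pairs differentials along different factors, so it vanishes on two functions from
one factor. -/
theorem isQuasiPoissonMap_fst : IsQuasiPoissonMap (M := M.fusion B N) (N := M) (fun p => p.1) :=
  isQuasiPoissonMap_of_functions smooth_fst (fun _ _ hf hg p => fusion_poisson_fst_fst hf hg p)
    fun ξ _ hf p => fusion_act_fst hf ξ p

theorem isQuasiPoissonMap_snd : IsQuasiPoissonMap (M := M.fusion B N) (N := N) (fun p => p.2) :=
  isQuasiPoissonMap_of_functions smooth_snd (fun _ _ hf hg p => fusion_poisson_snd_snd hf hg p)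
    fun ξ _ hf p => fusion_act_snd hf ξ p

theorem isMorphism_left :
    IsMorphism (M := HamData.point.fusion B M) (N := M) (fun p => p.2) where
  smooth := isQuasiPoissonMap_snd.smooth
  pi := isQuasiPoissonMap_snd.pi
  action := isQuasiPoissonMap_snd.action
  moment p := (mul_one (M.moment p.2)).symm

theorem isMorphism_right :
    IsMorphism (M := M.fusion B HamData.point) (N := M) (fun p => p.1) where
  smooth := isQuasiPoissonMap_fst.smooth
  pi := isQuasiPoissonMap_fst.pi
  action := isQuasiPoissonMap_fst.action
  moment p := (one_mul (M.moment p.1)).symm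

end HamData
end

section

variable {EG : Type*} [NormedAddCommGroup EG] [NormedSpace ℝ EG] [FiniteDimensional ℝ EG]
  {HG : Type*} [TopologicalSpace HG] {IG : ModelWithCorners ℝ EG HG}
  {G : Type*} [TopologicalSpace G] [ChartedSpace HG G] [Group G]

namespace HamData

open SmoothManifold

variable {M N P Q : HamData.{u} IG G} {B : InvariantForm IG G}

/-! ### Reduction of the axioms to a separating family of functions -/

section Separating

variable {S : Set (Q.mfd.carrier → ℝ)} (hS : ∀ f ∈ S, Q.mfd.SmoothFun f)
  (hsep : ∀ (x) (v w : Q.mfd.T x), (∀ f ∈ S, (Q.mfd.d f x v : ℝ) = Q.mfd.d f x w) → v = w)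
  (hs : ∀ α, Q.mfd.SmoothForm α → Q.mfd.SmoothVF (fun x => Q.piSharp x (α x)))
  (hk : ∀ f g, Q.mfd.SmoothFun f → Q.mfd.SmoothFun g → ∀ x, Q.poisson f g x = - Q.poisson g f x)
include hS hsep hs hk

/-- For fixed `f` the defect is the vector field `[ρ(ξ), π^♯df] - π^♯d(ρ(ξ)f)` applied to `g`, so it
suffices to let `g` run over a separating family. Skew-symmetry then gives the same for `f`. -/
theorem invariant_of_separating {ξ : GroupLieAlgebra IG G} (hξ : Q.mfd.SmoothVF (Q.action ξ))
    (h : ∀ f ∈ S, ∀ g ∈ S, ∀ x,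
      Q.act ξ (Q.poisson f g) x = Q.poisson (Q.act ξ f) g x + Q.poisson f (Q.act ξ g) x)
    (f g : Q.mfd.carrier → ℝ) (hf : Q.mfd.SmoothFun f) (hg : Q.mfd.SmoothFun g)
    (x : Q.mfd.carrier) :
    Q.act ξ (Q.poisson f g) x = Q.poisson (Q.act ξ f) g x + Q.poisson f (Q.act ξ g) x := by
  have ha : ∀ f, Q.mfd.SmoothFun f → Q.mfd.SmoothFun (Q.act ξ f) :=
    fun f hf => d_apply_smooth hf hξ
  have hp : ∀ f g, Q.mfd.SmoothFun f → Q.mfd.SmoothFun g → Q.mfd.SmoothFun (Q.poisson f g) :=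
    fun f g hf hg => d_apply_smooth hg (hs _ (smoothForm_d hf))
  have key : ∀ f, Q.mfd.SmoothFun f → (∀ g ∈ S, ∀ x, Q.act ξ (Q.poisson f g) x =
      Q.poisson (Q.act ξ f) g x + Q.poisson f (Q.act ξ g) x) → ∀ g, Q.mfd.SmoothFun g → ∀ x,
      Q.act ξ (Q.poisson f g) x = Q.poisson (Q.act ξ f) g x + Q.poisson f (Q.act ξ g) x := by
    intro f hf h g hg x
    have e : ∀ g, Q.mfd.SmoothFun g → (Q.mfd.d g x (mlieBracket Q.mfd.model (Q.action ξ)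
        (fun x => Q.piSharp x (Q.mfd.d f x)) x) : ℝ) =
        Q.act ξ (Q.poisson f g) x - Q.poisson f (Q.act ξ g) x :=
      fun g hg => d_mlieBracket hξ (hs _ (smoothForm_d hf)) hg x
    have hv : mlieBracket Q.mfd.model (Q.action ξ) (fun x => Q.piSharp x (Q.mfd.d f x)) x =
        Q.piSharp x (Q.mfd.d (Q.act ξ f) x) :=
      hsep x _ _ fun g hg => (e g (hS g hg)).trans (by rw [h g hg x, add_sub_cancel_right]; rfl)
    have e' := e g hg
    rw [hv] at e'
    exact (sub_eq_iff_eq_add.mp e'.symm)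
  have swap : ∀ f g, Q.mfd.SmoothFun f → Q.mfd.SmoothFun g → (∀ x, Q.act ξ (Q.poisson f g) x =
      Q.poisson (Q.act ξ f) g x + Q.poisson f (Q.act ξ g) x) → ∀ x, Q.act ξ (Q.poisson g f) x =
      Q.poisson (Q.act ξ g) f x + Q.poisson g (Q.act ξ f) x := by
    intro f g hf hg h x
    have e : Q.poisson g f = fun x => (-1) * Q.poisson f g x := by
      funext y
      rw [hk g f hg hf y, neg_one_mul]
    rw [e, act_const_mul _ _ (hp f g hf hg), h, hk _ _ (ha g hg) hf, hk _ _ hg (ha f hf)]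
    ring
  refine key f hf (fun g hg => ?_) g hg x
  exact swap g f (hS g hg) hf (key g (hS g hg) (h g hg) f hf)

/-- For fixed `f` and `g` both sides are vectors applied to `dk`: the Jacobiator comes from `π^♯d{f,
g} - [π^♯df, π^♯dg]`, and the other side can be moved onto `k` by invariance of the form. Cyclic
symmetry then treats the other arguments. -/
theorem jacobi_of_separating
    (h : ∀ f ∈ S, ∀ g ∈ S, ∀ k ∈ S, ∀ x,
      -2 * (Q.poisson (Q.poisson f g) k x + Q.poisson (Q.poisson g k) f x
        + Q.poisson (Q.poisson k f) g x) =
      1 / 2 * (Q.mfd.d f x (Q.action ⁅Q.rhoD B g x, Q.rhoD B k x⁆ x) : ℝ))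
    (f g k : Q.mfd.carrier → ℝ) (hf : Q.mfd.SmoothFun f) (hg : Q.mfd.SmoothFun g)
    (hh : Q.mfd.SmoothFun k) (x : Q.mfd.carrier) :
      -2 * (Q.poisson (Q.poisson f g) k x + Q.poisson (Q.poisson g k) f x
        + Q.poisson (Q.poisson k f) g x) =
      1 / 2 * (Q.mfd.d f x (Q.action ⁅Q.rhoD B g x, Q.rhoD B k x⁆ x) : ℝ) := by
  have hp : ∀ f g, Q.mfd.SmoothFun f → Q.mfd.SmoothFun g → Q.mfd.SmoothFun (Q.poisson f g) :=
    fun f g hf hg => d_apply_smooth hg (hs _ (smoothForm_d hf))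
  let T : (Q.mfd.carrier → ℝ) → (Q.mfd.carrier → ℝ) → (Q.mfd.carrier → ℝ) → Prop :=
    fun f g k => ∀ x, -2 * (Q.poisson (Q.poisson f g) k x + Q.poisson (Q.poisson g k) f x
        + Q.poisson (Q.poisson k f) g x) =
      1 / 2 * (Q.mfd.d f x (Q.action ⁅Q.rhoD B g x, Q.rhoD B k x⁆ x) : ℝ)
  have cyc : ∀ f g k, T f g k → T g k f := by
    intro f g k h x
    have e1 : Q.act ⁅Q.rhoD B k x, Q.rhoD B f x⁆ g x = Q.act ⁅Q.rhoD B g x, Q.rhoD B k x⁆ f x := by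
      rw [IsHamiltonian.act_lie, IsHamiltonian.act_lie, IsHamiltonian.form_lie_cyclic (B := B) (Q.rhoD B g x)]
    refine Eq.trans ?_ ((h x).trans (congrArg (fun a : ℝ => 1 / 2 * a) e1.symm))
    ring
  have neg : ∀ f g k, Q.mfd.SmoothFun f → Q.mfd.SmoothFun g → Q.mfd.SmoothFun k → ∀ x,
      Q.poisson (Q.poisson f g) k x = Q.poisson k (Q.poisson g f) x := by
    intro f g k hf hg hh x
    have e : Q.poisson g f = fun x => (-1) * Q.poisson f g x := by
      funext y
      rw [hk g f hg hf y, neg_one_mul]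
    rw [e, poisson_const_mul _ _ (hp f g hf hg), hk _ _ (hp f g hf hg) hh, neg_one_mul]
  have key : ∀ f g, Q.mfd.SmoothFun f → Q.mfd.SmoothFun g → (∀ k ∈ S, T f g k) →
      ∀ k, Q.mfd.SmoothFun k → T f g k := by
    intro f g hf hg h k hh x
    have e : ∀ k, Q.mfd.SmoothFun k → (Q.mfd.d k x (mlieBracket Q.mfd.model
        (fun x => Q.piSharp x (Q.mfd.d f x)) (fun x => Q.piSharp x (Q.mfd.d g x)) x) : ℝ) =
        Q.poisson f (Q.poisson g k) x - Q.poisson g (Q.poisson f k) x :=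
      fun k hh => d_mlieBracket (hs _ (smoothForm_d hf)) (hs _ (smoothForm_d hg)) hh x
    have e2 : ∀ k, Q.mfd.SmoothFun k → (Q.poisson (Q.poisson f g) k x +
        Q.poisson (Q.poisson g k) f x + Q.poisson (Q.poisson k f) g x) =
        (Q.mfd.d k x (Q.piSharp x (Q.mfd.d (Q.poisson f g) x)) : ℝ) -
        (Q.mfd.d k x (mlieBracket Q.mfd.model
        (fun x => Q.piSharp x (Q.mfd.d f x)) (fun x => Q.piSharp x (Q.mfd.d g x)) x) : ℝ) := by
      intro k hh
      rw [e k hh, neg k f g hh hf hg, hk _ f (hp g k hg hh) hf]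
      change _ = Q.poisson (Q.poisson f g) k x - _
      ring
    have e3 : ∀ k, (Q.mfd.d f x (Q.action ⁅Q.rhoD B g x, Q.rhoD B k x⁆ x) : ℝ) =
        Q.mfd.d k x (Q.action ⁅Q.rhoD B f x, Q.rhoD B g x⁆ x) := fun k => by
      change Q.act _ f x = Q.act _ k x
      rw [IsHamiltonian.act_lie, IsHamiltonian.act_lie, IsHamiltonian.form_lie_cyclic (B := B) (Q.rhoD B f x)]
    have hv : (-2 : ℝ) • (Q.piSharp x (Q.mfd.d (Q.poisson f g) x) - mlieBracket Q.mfd.model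
        (fun x => Q.piSharp x (Q.mfd.d f x)) (fun x => Q.piSharp x (Q.mfd.d g x)) x) =
        (1 / 2 : ℝ) • Q.action ⁅Q.rhoD B f x, Q.rhoD B g x⁆ x := by
      refine hsep x _ _ fun k hh => ?_
      have h1 := h k hh x
      rw [e2 k (hS k hh), e3] at h1
      refine (map_smul (show Q.mfd.T x →L[ℝ] ℝ from Q.mfd.d k x) _ _).trans
        (Eq.trans (congrArg (fun a : ℝ => (-2 : ℝ) * a)
          (map_sub (show Q.mfd.T x →L[ℝ] ℝ from Q.mfd.d k x) _ _)) ?_)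
      exact h1.trans (map_smul (show Q.mfd.T x →L[ℝ] ℝ from Q.mfd.d k x) _ _).symm
    rw [e2 k hh, e3]
    have h1 := congrArg (fun v => (Q.mfd.d k x v : ℝ)) hv
    have h2 := (map_smul (show Q.mfd.T x →L[ℝ] ℝ from Q.mfd.d k x) _ _).symm.trans
      (h1.trans (map_smul (show Q.mfd.T x →L[ℝ] ℝ from Q.mfd.d k x) _ _))
    exact (congrArg (fun a : ℝ => (-2 : ℝ) * a)
      (map_sub (show Q.mfd.T x →L[ℝ] ℝ from Q.mfd.d k x) _ _).symm).trans h2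
  -- The three arguments are freed from `S` one after another, each time rotated into the last
  -- place.
  have h1 : ∀ f ∈ S, ∀ g ∈ S, ∀ k, Q.mfd.SmoothFun k → T f g k := fun f hf g hg =>
    key f g (hS f hf) (hS g hg) (h f hf g hg)
  have h2 : ∀ f ∈ S, ∀ k, Q.mfd.SmoothFun k → ∀ g, Q.mfd.SmoothFun g → T k f g :=
    fun f hf k hh => key k f hh (hS f hf) fun g hg => cyc _ _ _ (cyc _ _ _ (h1 f hf g hg k hh))
  exact key f g hf hg (fun k hh => cyc _ _ _ (cyc _ _ _ (h2 k hh g hg f hf))) k hh x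

end Separating

/-! ### Fusion products: the action and the bivector field -/

theorem fusion_action_smooth (hM : M.IsHamiltonian B) (hN : N.IsHamiltonian B)
    (ξ : GroupLieAlgebra IG G) : (M.mfd.prod N.mfd).SmoothVF ((M.fusion B N).action ξ) :=
  smoothVF_add (smoothVF_inlT (hM.action_smooth ξ)) (smoothVF_inrT (hN.action_smooth ξ))

theorem fusion_action_bracket (hM : M.IsHamiltonian B) (hN : N.IsHamiltonian B)
    (ξ η : GroupLieAlgebra IG G) (p : M.mfd.carrier × N.mfd.carrier) :
    (M.fusion B N).action ⁅ξ, η⁆ p = mlieBracket (M.mfd.prod N.mfd).model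
      (fun p => M.mfd.inlT N.mfd p (M.action ξ p.1) + M.mfd.inrT N.mfd p (N.action ξ p.2))
      (fun p => M.mfd.inlT N.mfd p (M.action η p.1) + M.mfd.inrT N.mfd p (N.action η p.2)) p := by
  refine Eq.trans ?_ (mlieBracket_inlT_add_inrT (hM.action_smooth ξ) (hM.action_smooth η)
    (hN.action_smooth ξ) (hN.action_smooth η) p).symm
  rw [← hM.action_bracket, ← hN.action_bracket]
  rfl

theorem fusion_poisson_skew (hM : M.IsHamiltonian B) (hN : N.IsHamiltonian B)
    {F K : M.mfd.carrier × N.mfd.carrier → ℝ} (hF : (M.mfd.prod N.mfd).SmoothFun F)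
    (hK : (M.mfd.prod N.mfd).SmoothFun K) (p : M.mfd.carrier × N.mfd.carrier) :
    (M.fusion B N).poisson F K p = - (M.fusion B N).poisson K F p := by
  refine (fusion_poisson hF hK p).trans (Eq.trans ?_ (congrArg Neg.neg (fusion_poisson hK hF p)).symm)
  rw [hM.poisson_skew, hN.poisson_skew]
  simp only [← form_rhoD (B := B)]
  rw [B.form_comm (M.rhoD B (fun x => F (x, p.2)) p.1),
    B.form_comm (N.rhoD B (fun y => F (p.1, y)) p.2)]
  ring

theorem fusion_pi_skew (hM : M.IsHamiltonian B) (hN : N.IsHamiltonian B)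
    (p : M.mfd.carrier × N.mfd.carrier) (a b : (M.mfd.prod N.mfd).Cot p) :
    (b ((M.fusion B N).piSharp p a) : ℝ) = - a ((M.fusion B N).piSharp p b) := by
  obtain ⟨F, hF, rfl⟩ := exists_d_eq (M := M.mfd.prod N.mfd) p a
  obtain ⟨K, hK, rfl⟩ := exists_d_eq (M := M.mfd.prod N.mfd) p b
  exact fusion_poisson_skew hM hN hF hK p

/-- The field is a combination of the fundamental fields of `N` with coefficients pulled back from
`M`. -/
theorem IsHamiltonian.actionAt_rhoD_smooth (hN : N.IsHamiltonian B) (hM : M.IsHamiltonian B)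
    {f : M.mfd.carrier → ℝ} (hf : M.mfd.SmoothFun f) (c : ℝ) :
    (M.mfd.prod N.mfd).SmoothVF
      (fun p => M.mfd.inrT N.mfd p (c • N.actionAt p.2 (M.rhoD B f p.1))) := by
  have h1 : (M.mfd.prod N.mfd).SmoothVF (fun p => ∑ i, (c * M.act (B.basis i) f p.1) •
      M.mfd.inrT N.mfd p (N.action (B.dualBasis i) p.2)) := by
    refine smoothVF_sum _ fun i => smoothVF_smul (f := fun p : M.mfd.carrier × N.mfd.carrier =>
      c * M.act (B.basis i) f p.1) ?_ (smoothVF_inrT (hN.action_smooth _))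
    exact contMDiff_const.mul (smoothFun_fst (hM.act_smooth _ hf))
  have h2 : (fun p : M.mfd.carrier × N.mfd.carrier =>
      M.mfd.inrT N.mfd p (c • N.actionAt p.2 (M.rhoD B f p.1))) = fun p =>
      ∑ i, (c * M.act (B.basis i) f p.1) • M.mfd.inrT N.mfd p (N.action (B.dualBasis i) p.2) := by
    funext p
    conv_lhs => rw [← B.sum_form_basis_smul (M.rhoD B f p.1)]
    simp only [map_sum, map_smul, form_rhoD, mul_smul, Finset.smul_sum]
    rfl
  exact h2 ▸ h1

theorem IsHamiltonian.actionAt_rhoD_smooth' (hM : M.IsHamiltonian B) (hN : N.IsHamiltonian B)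
    {f : N.mfd.carrier → ℝ} (hf : N.mfd.SmoothFun f) (c : ℝ) :
    (M.mfd.prod N.mfd).SmoothVF
      (fun p => M.mfd.inlT N.mfd p (c • M.actionAt p.1 (N.rhoD B f p.2))) := by
  have h1 : (M.mfd.prod N.mfd).SmoothVF (fun p => ∑ i, (c * N.act (B.basis i) f p.2) •
      M.mfd.inlT N.mfd p (M.action (B.dualBasis i) p.1)) := by
    refine smoothVF_sum _ fun i => smoothVF_smul (f := fun p : M.mfd.carrier × N.mfd.carrier =>
      c * N.act (B.basis i) f p.2) ?_ (smoothVF_inlT (hM.action_smooth _))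
    exact contMDiff_const.mul (smoothFun_snd (hN.act_smooth _ hf))
  have h2 : (fun p : M.mfd.carrier × N.mfd.carrier =>
      M.mfd.inlT N.mfd p (c • M.actionAt p.1 (N.rhoD B f p.2))) = fun p =>
      ∑ i, (c * N.act (B.basis i) f p.2) • M.mfd.inlT N.mfd p (M.action (B.dualBasis i) p.1) := by
    funext p
    conv_lhs => rw [← B.sum_form_basis_smul (N.rhoD B f p.2)]
    simp only [map_sum, map_smul, form_rhoD, mul_smul, Finset.smul_sum]
    rfl
  exact h2 ▸ h1

theorem fusion_piSharp_fst {f : M.mfd.carrier → ℝ} (hf : M.mfd.SmoothFun f)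
    (p : M.mfd.carrier × N.mfd.carrier) :
    (M.fusion B N).piSharp p ((M.mfd.prod N.mfd).d (fun p => f p.1) p) =
      M.mfd.inlT N.mfd p (M.piSharp p.1 (M.mfd.d f p.1)) +
      M.mfd.inrT N.mfd p ((2⁻¹ : ℝ) • N.actionAt p.2 (M.rhoD B f p.1)) := by
  refine (fusion_piSharp_d (smoothFun_fst hf) p).trans ?_
  have e1 : N.rhoD B (fun _ => f p.1) p.2 = 0 := rhoD_const _ _
  have e2 : N.mfd.d (fun _ => f p.1) p.2 = 0 := d_const _ _
  simp only [e1, e2, map_zero, smul_zero, sub_zero, zero_add]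
  rfl

theorem fusion_piSharp_snd {f : N.mfd.carrier → ℝ} (hf : N.mfd.SmoothFun f)
    (p : M.mfd.carrier × N.mfd.carrier) :
    (M.fusion B N).piSharp p ((M.mfd.prod N.mfd).d (fun p => f p.2) p) =
      M.mfd.inlT N.mfd p ((-2⁻¹ : ℝ) • M.actionAt p.1 (N.rhoD B f p.2)) +
      M.mfd.inrT N.mfd p (N.piSharp p.2 (N.mfd.d f p.2)) := by
  refine (fusion_piSharp_d (smoothFun_snd hf) p).trans ?_
  have e1 : M.rhoD B (fun _ => f p.2) p.1 = 0 := rhoD_const _ _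
  have e2 : M.mfd.d (fun _ => f p.2) p.1 = 0 := d_const _ _
  simp only [e1, e2, map_zero, smul_zero, add_zero, zero_sub, neg_smul]
  rfl

theorem fusion_pi_smooth (hM : M.IsHamiltonian B) (hN : N.IsHamiltonian B)
    (α : ∀ p, (M.mfd.prod N.mfd).Cot p) (hα : (M.mfd.prod N.mfd).SmoothForm α) :
    (M.mfd.prod N.mfd).SmoothVF (fun p => (M.fusion B N).piSharp p (α p)) := by
  refine smooth_of_generatesSections (generatesSections_prodExactForms (M := M.mfd) (N := N.mfd))
    (φ := fun p => p) contMDiff_id (V' := (M.mfd.prod N.mfd).T) (F' := (M.mfd.prod N.mfd).E)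
    (fun p => (M.fusion B N).piSharp p) ?_ α hα
  rintro _ (⟨f, hf, rfl⟩ | ⟨f, hf, rfl⟩)
  · have h1 := smoothVF_add (smoothVF_inlT (N := N.mfd) (hM.pi_smooth _ (smoothForm_d hf)))
      (hN.actionAt_rhoD_smooth hM hf 2⁻¹)
    exact ContMDiff.congr h1 fun p => congrArg (TotalSpace.mk (F := M.mfd.E × N.mfd.E)
      (E := (M.mfd.prod N.mfd).T) p) (fusion_piSharp_fst hf p)
  · have h1 := smoothVF_add (hM.actionAt_rhoD_smooth' hN hf (-2⁻¹))
      (smoothVF_inrT (M := M.mfd) (hN.pi_smooth _ (smoothForm_d hf)))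
    exact ContMDiff.congr h1 fun p => congrArg (TotalSpace.mk (F := M.mfd.E × N.mfd.E)
      (E := (M.mfd.prod N.mfd).T) p) (fusion_piSharp_snd hf p)

end HamData
end

section

variable {EG : Type*} [NormedAddCommGroup EG] [NormedSpace ℝ EG] [FiniteDimensional ℝ EG]
  {HG : Type*} [TopologicalSpace HG] {IG : ModelWithCorners ℝ EG HG}
  {G : Type*} [TopologicalSpace G] [ChartedSpace HG G] [Group G]

namespace HamData

open SmoothManifold

variable {M N P Q : HamData.{u} IG G} {B : InvariantForm IG G}

/-! ### Fusion products: invariance and the Jacobiator -/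

theorem form_rhoD_prod_smooth (hM : M.IsHamiltonian B) (hN : N.IsHamiltonian B)
    {f : M.mfd.carrier → ℝ} (hf : M.mfd.SmoothFun f) {k : N.mfd.carrier → ℝ}
    (hk : N.mfd.SmoothFun k) (c : ℝ) :
    (M.mfd.prod N.mfd).SmoothFun (fun p => c * B.form (M.rhoD B f p.1) (N.rhoD B k p.2)) := by
  have h1 : (fun p : M.mfd.carrier × N.mfd.carrier =>
      c * B.form (M.rhoD B f p.1) (N.rhoD B k p.2)) = fun p =>
      c * ∑ i, M.act (B.basis i) f p.1 * N.act (B.dualBasis i) k p.2 := by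
    funext p
    rw [B.form_eq_sum]
    simp only [form_rhoD]
  rw [h1]
  refine contMDiff_const.mul (smoothFun_sum _ fun i => ?_)
  exact ContMDiff.mul (smoothFun_fst (hM.act_smooth _ hf)) (smoothFun_snd (hN.act_smooth _ hk))

theorem fusion_poisson_snd_fst {f : M.mfd.carrier → ℝ} (hf : M.mfd.SmoothFun f)
    {k : N.mfd.carrier → ℝ} (hk : N.mfd.SmoothFun k) (p : M.mfd.carrier × N.mfd.carrier) :
    (M.fusion B N).poisson (fun p => k p.2) (fun p => f p.1) p =
      (-2⁻¹) * B.form (M.rhoD B f p.1) (N.rhoD B k p.2) := by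
  refine (fusion_poisson_snd hk (smoothFun_fst hf) p).trans ?_
  have e : N.poisson k (fun _ => f p.1) p.2 = 0 := poisson_const_right _ _ _
  simp only [e, form_rhoD, zero_sub, neg_mul]

/-- On each slice one of the two entries of the pairing is a constant Lie algebra element, so that
the pairing is the derivative of a function along one fixed fundamental field. -/
theorem fusion_act_form (hM : M.IsHamiltonian B) (hN : N.IsHamiltonian B)
    {f : M.mfd.carrier → ℝ} (hf : M.mfd.SmoothFun f) {k : N.mfd.carrier → ℝ}
    (hk : N.mfd.SmoothFun k) (c : ℝ) (ξ : GroupLieAlgebra IG G)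
    (p : M.mfd.carrier × N.mfd.carrier) :
    (M.fusion B N).act ξ (fun p => c * B.form (M.rhoD B f p.1) (N.rhoD B k p.2)) p =
      c * (M.act ξ (M.act (N.rhoD B k p.2) f) p.1 + N.act ξ (N.act (M.rhoD B f p.1) k) p.2) := by
  refine (fusion_act (form_rhoD_prod_smooth hM hN hf hk c) ξ p).trans ?_
  have e1 : (fun x => c * B.form (M.rhoD B f x) (N.rhoD B k p.2)) =
      fun x => c * M.act (N.rhoD B k p.2) f x := by simp only [form_rhoD]
  have e2 : (fun y => c * B.form (M.rhoD B f p.1) (N.rhoD B k y)) =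
      fun y => c * N.act (M.rhoD B f p.1) k y := by simp only [form_rhoD']
  dsimp only
  rw [e1, e2]
  rw [act_const_mul _ _ (hM.act_smooth _ hf), act_const_mul _ _ (hN.act_smooth _ hk), mul_add]

theorem fusion_poisson_fst_form (hM : M.IsHamiltonian B) (hN : N.IsHamiltonian B)
    {f g : M.mfd.carrier → ℝ} (hf : M.mfd.SmoothFun f) (hg : M.mfd.SmoothFun g)
    {k : N.mfd.carrier → ℝ} (hk : N.mfd.SmoothFun k) (c : ℝ)
    (p : M.mfd.carrier × N.mfd.carrier) :
    (M.fusion B N).poisson (fun p => f p.1)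
      (fun p => c * B.form (M.rhoD B g p.1) (N.rhoD B k p.2)) p =
      c * (M.poisson f (M.act (N.rhoD B k p.2) g) p.1 +
        2⁻¹ * N.act (M.rhoD B f p.1) (N.act (M.rhoD B g p.1) k) p.2) := by
  refine (fusion_poisson_fst hf (form_rhoD_prod_smooth hM hN hg hk c) p).trans ?_
  have e1 : (fun x => c * B.form (M.rhoD B g x) (N.rhoD B k p.2)) =
      fun x => c * M.act (N.rhoD B k p.2) g x := by simp only [form_rhoD]
  have e2 : (fun y => c * B.form (M.rhoD B g p.1) (N.rhoD B k y)) =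
      fun y => c * N.act (M.rhoD B g p.1) k y := by simp only [form_rhoD']
  dsimp only
  rw [e1, e2]
  rw [poisson_const_mul _ _ (hM.act_smooth _ hg), act_const_mul _ _ (hN.act_smooth _ hk)]
  ring

theorem fusion_poisson_snd_form (hM : M.IsHamiltonian B) (hN : N.IsHamiltonian B)
    {g : M.mfd.carrier → ℝ} (hg : M.mfd.SmoothFun g)
    {k l : N.mfd.carrier → ℝ} (hk : N.mfd.SmoothFun k) (hl : N.mfd.SmoothFun l) (c : ℝ)
    (p : M.mfd.carrier × N.mfd.carrier) :
    (M.fusion B N).poisson (fun p => l p.2)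
      (fun p => c * B.form (M.rhoD B g p.1) (N.rhoD B k p.2)) p =
      c * (N.poisson l (N.act (M.rhoD B g p.1) k) p.2 -
        2⁻¹ * M.act (N.rhoD B l p.2) (M.act (N.rhoD B k p.2) g) p.1) := by
  refine (fusion_poisson_snd hl (form_rhoD_prod_smooth hM hN hg hk c) p).trans ?_
  have e1 : (fun x => c * B.form (M.rhoD B g x) (N.rhoD B k p.2)) =
      fun x => c * M.act (N.rhoD B k p.2) g x := by simp only [form_rhoD]
  have e2 : (fun y => c * B.form (M.rhoD B g p.1) (N.rhoD B k y)) =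
      fun y => c * N.act (M.rhoD B g p.1) k y := by simp only [form_rhoD']
  dsimp only
  rw [e1, e2]
  rw [poisson_const_mul _ _ (hN.act_smooth _ hk), act_const_mul _ _ (hM.act_smooth _ hg)]
  ring

/-- Functions pulled back from the factors. -/
def factorFunctions (M N : HamData.{u} IG G) : Set (M.mfd.carrier × N.mfd.carrier → ℝ) :=
  {F | ∃ f, M.mfd.SmoothFun f ∧ F = fun p => f p.1} ∪
    {F | ∃ f, N.mfd.SmoothFun f ∧ F = fun p => f p.2}

theorem smoothFun_of_mem_factorFunctions {F : M.mfd.carrier × N.mfd.carrier → ℝ}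
    (h : F ∈ factorFunctions M N) : (M.mfd.prod N.mfd).SmoothFun F := by
  obtain ⟨f, hf, rfl⟩ | ⟨f, hf, rfl⟩ := h
  · exact smoothFun_fst hf
  · exact smoothFun_snd hf

theorem eq_of_factorFunctions {p : M.mfd.carrier × N.mfd.carrier} {v w : (M.mfd.prod N.mfd).T p}
    (h : ∀ F ∈ factorFunctions M N, ((M.mfd.prod N.mfd).d F p v : ℝ) = (M.mfd.prod N.mfd).d F p w) :
    v = w :=
  prod_eq_of_d_eq (fun f hf => h _ (Or.inl ⟨f, hf, rfl⟩)) (fun f hf => h _ (Or.inr ⟨f, hf, rfl⟩))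

/-- This is the invariance of the cross term of the bivector. The commutators on the two factors are
`⟨[ξ, ρ^*dk], ρ^*df⟩` and `⟨[ξ, ρ^*df], ρ^*dk⟩`, which add up to zero. -/
theorem fusion_invariant_fst_snd (hM : M.IsHamiltonian B) (hN : N.IsHamiltonian B)
    {f : M.mfd.carrier → ℝ} (hf : M.mfd.SmoothFun f) {k : N.mfd.carrier → ℝ}
    (hk : N.mfd.SmoothFun k) (ξ : GroupLieAlgebra IG G) (p : M.mfd.carrier × N.mfd.carrier) :
    M.act ξ (M.act (N.rhoD B k p.2) f) p.1 + N.act ξ (N.act (M.rhoD B f p.1) k) p.2 =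
      B.form (M.rhoD B (M.act ξ f) p.1) (N.rhoD B k p.2) +
        B.form (M.rhoD B f p.1) (N.rhoD B (N.act ξ k) p.2) := by
  rw [form_rhoD, form_rhoD']
  have h1 := hM.act_act ξ (N.rhoD B k p.2) hf p.1
  have h2 := hN.act_act ξ (M.rhoD B f p.1) hk p.2
  rw [IsHamiltonian.act_lie (B := B)] at h1 h2
  rw [IsHamiltonian.form_lie (B := B) ξ] at h2
  linarith

theorem fusion_pi_invariant (hM : M.IsHamiltonian B) (hN : N.IsHamiltonian B)
    (ξ : GroupLieAlgebra IG G) (F K : M.mfd.carrier × N.mfd.carrier → ℝ)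
    (hF : (M.mfd.prod N.mfd).SmoothFun F) (hK : (M.mfd.prod N.mfd).SmoothFun K)
    (p : M.mfd.carrier × N.mfd.carrier) :
    (M.fusion B N).act ξ ((M.fusion B N).poisson F K) p =
      (M.fusion B N).poisson ((M.fusion B N).act ξ F) K p +
        (M.fusion B N).poisson F ((M.fusion B N).act ξ K) p := by
  refine invariant_of_separating (Q := M.fusion B N) (S := factorFunctions M N)
    (fun F hF => smoothFun_of_mem_factorFunctions hF) (fun p v w h => eq_of_factorFunctions h)
    (fun α hα => fusion_pi_smooth hM hN α hα)
    (fun F K hF hK p => fusion_poisson_skew hM hN hF hK p) (fusion_action_smooth hM hN ξ)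
    ?_ F K hF hK p
  clear hF hK F K p
  have a1 : ∀ f, M.mfd.SmoothFun f → (M.fusion B N).act ξ (fun p => f p.1) =
      fun p => M.act ξ f p.1 := fun f hf => funext fun p => fusion_act_fst hf ξ p
  have a2 : ∀ f, N.mfd.SmoothFun f → (M.fusion B N).act ξ (fun p => f p.2) =
      fun p => N.act ξ f p.2 := fun f hf => funext fun p => fusion_act_snd hf ξ p
  rintro _ (⟨f, hf, rfl⟩ | ⟨f, hf, rfl⟩) _ (⟨g, hg, rfl⟩ | ⟨g, hg, rfl⟩) p
  · refine (congrArg (fun F => (M.fusion B N).act ξ F p)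
      (funext fun p => fusion_poisson_fst_fst hf hg p)).trans ?_
    refine (fusion_act_fst (hM.poisson_smooth hf hg) ξ p).trans
      ((hM.pi_invariant ξ f g hf hg p.1).trans ?_)
    refine congrArg₂ (fun a b : ℝ => a + b) ?_ ?_
    · exact (fusion_poisson_fst_fst (hM.act_smooth ξ hf) hg p).symm.trans
        (congrArg (fun F => (M.fusion B N).poisson F _ p) (a1 f hf).symm)
    · exact (fusion_poisson_fst_fst hf (hM.act_smooth ξ hg) p).symm.trans
        (congrArg (fun F => (M.fusion B N).poisson _ F p) (a1 g hg).symm)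
  · refine (congrArg (fun F => (M.fusion B N).act ξ F p)
      (funext fun p => fusion_poisson_fst_snd hf hg p)).trans ?_
    refine (fusion_act_form hM hN hf hg _ ξ p).trans ?_
    rw [fusion_invariant_fst_snd hM hN hf hg ξ p, mul_add]
    refine congrArg₂ (fun a b : ℝ => a + b) ?_ ?_
    · exact (fusion_poisson_fst_snd (hM.act_smooth ξ hf) hg p).symm.trans
        (congrArg (fun F => (M.fusion B N).poisson F _ p) (a1 f hf).symm)
    · exact (fusion_poisson_fst_snd hf (hN.act_smooth ξ hg) p).symm.trans
        (congrArg (fun F => (M.fusion B N).poisson _ F p) (a2 g hg).symm)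
  · refine (congrArg (fun F => (M.fusion B N).act ξ F p)
      (funext fun p => fusion_poisson_snd_fst hg hf p)).trans ?_
    refine (fusion_act_form hM hN hg hf _ ξ p).trans ?_
    rw [fusion_invariant_fst_snd hM hN hg hf ξ p, mul_add, add_comm]
    refine congrArg₂ (fun a b : ℝ => a + b) ?_ ?_
    · exact (fusion_poisson_snd_fst hg (hN.act_smooth ξ hf) p).symm.trans
        (congrArg (fun F => (M.fusion B N).poisson F _ p) (a2 f hf).symm)
    · exact (fusion_poisson_snd_fst (hM.act_smooth ξ hg) hf p).symm.trans
        (congrArg (fun F => (M.fusion B N).poisson _ F p) (a1 g hg).symm)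
  · refine (congrArg (fun F => (M.fusion B N).act ξ F p)
      (funext fun p => fusion_poisson_snd_snd hf hg p)).trans ?_
    refine (fusion_act_snd (hN.poisson_smooth hf hg) ξ p).trans
      ((hN.pi_invariant ξ f g hf hg p.2).trans ?_)
    refine congrArg₂ (fun a b : ℝ => a + b) ?_ ?_
    · exact (fusion_poisson_snd_snd (hN.act_smooth ξ hf) hg p).symm.trans
        (congrArg (fun F => (M.fusion B N).poisson F _ p) (a2 f hf).symm)
    · exact (fusion_poisson_snd_snd hf (hN.act_smooth ξ hg) p).symm.trans
        (congrArg (fun F => (M.fusion B N).poisson _ F p) (a2 g hg).symm)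

/-- The condition `[π, π] = ρ(φ)` on three functions at a point. -/
def JacobiAt (Q : HamData.{u} IG G) (B : InvariantForm IG G) (f g k : Q.mfd.carrier → ℝ)
    (x : Q.mfd.carrier) : Prop :=
  -2 * (Q.poisson (Q.poisson f g) k x + Q.poisson (Q.poisson g k) f x
      + Q.poisson (Q.poisson k f) g x) = 1 / 2 * Q.act ⁅Q.rhoD B g x, Q.rhoD B k x⁆ f x

/-- The Jacobiator is cyclic by construction, and `⟨[η, ζ], ξ⟩` is cyclic because the form is
invariant. -/
theorem JacobiAt.cyclic {f g k : Q.mfd.carrier → ℝ} {x : Q.mfd.carrier}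
    (h : Q.JacobiAt B f g k x) : Q.JacobiAt B g k f x := by
  have e1 : Q.act ⁅Q.rhoD B k x, Q.rhoD B f x⁆ g x = Q.act ⁅Q.rhoD B g x, Q.rhoD B k x⁆ f x := by
    rw [IsHamiltonian.act_lie, IsHamiltonian.act_lie,
      IsHamiltonian.form_lie_cyclic (B := B) (Q.rhoD B g x)]
  refine Eq.trans ?_ (Eq.trans h (congrArg (fun a : ℝ => 1 / 2 * a) e1.symm))
  ring

variable (hM : M.IsHamiltonian B) (hN : N.IsHamiltonian B)
include hM hN

theorem fusion_poisson_form_fst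
    {f g : M.mfd.carrier → ℝ} (hf : M.mfd.SmoothFun f) (hg : M.mfd.SmoothFun g)
    {k : N.mfd.carrier → ℝ} (hk : N.mfd.SmoothFun k) (c : ℝ)
    (p : M.mfd.carrier × N.mfd.carrier) :
    (M.fusion B N).poisson (fun p => c * B.form (M.rhoD B g p.1) (N.rhoD B k p.2))
      (fun p => f p.1) p =
      -(c * (M.poisson f (M.act (N.rhoD B k p.2) g) p.1 +
        2⁻¹ * N.act (M.rhoD B f p.1) (N.act (M.rhoD B g p.1) k) p.2)) :=
  (fusion_poisson_skew hM hN (form_rhoD_prod_smooth hM hN hg hk c) (smoothFun_fst hf) p).trans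
    (congrArg Neg.neg (fusion_poisson_fst_form hM hN hf hg hk c p))

theorem fusion_poisson_form_snd
    {g : M.mfd.carrier → ℝ} (hg : M.mfd.SmoothFun g)
    {k l : N.mfd.carrier → ℝ} (hk : N.mfd.SmoothFun k) (hl : N.mfd.SmoothFun l) (c : ℝ)
    (p : M.mfd.carrier × N.mfd.carrier) :
    (M.fusion B N).poisson (fun p => c * B.form (M.rhoD B g p.1) (N.rhoD B k p.2))
      (fun p => l p.2) p =
      -(c * (N.poisson l (N.act (M.rhoD B g p.1) k) p.2 -
        2⁻¹ * M.act (N.rhoD B l p.2) (M.act (N.rhoD B k p.2) g) p.1)) :=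
  (fusion_poisson_skew hM hN (form_rhoD_prod_smooth hM hN hg hk c) (smoothFun_snd hl) p).trans
    (congrArg Neg.neg (fusion_poisson_snd_form hM hN hg hk hl c p))

theorem fusion_jacobi_fst {f g k : M.mfd.carrier → ℝ} (hf : M.mfd.SmoothFun f)
    (hg : M.mfd.SmoothFun g) (hk : M.mfd.SmoothFun k) (p : M.mfd.carrier × N.mfd.carrier) :
    (M.fusion B N).JacobiAt B (fun p => f p.1) (fun p => g p.1) (fun p => k p.1) p := by
  have e : ∀ {f g k : M.mfd.carrier → ℝ}, M.mfd.SmoothFun f → M.mfd.SmoothFun g →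
      M.mfd.SmoothFun k → (M.fusion B N).poisson ((M.fusion B N).poisson (fun p => f p.1)
        (fun p => g p.1)) (fun p => k p.1) p = M.poisson (M.poisson f g) k p.1 :=
    fun hf hg hk => (congrArg (fun F => (M.fusion B N).poisson F _ p)
      (funext fun p => fusion_poisson_fst_fst hf hg p)).trans
      (fusion_poisson_fst_fst (hM.poisson_smooth hf hg) hk p)
  refine (congrArg (fun a : ℝ => -2 * a) (congrArg₂ (fun a b : ℝ => a + b)
    (congrArg₂ (fun a b : ℝ => a + b) (e hf hg hk) (e hg hk hf)) (e hk hf hg))).trans ?_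
  refine (hM.pi_pi f g k hf hg hk p.1).trans (congrArg (fun a : ℝ => 1 / 2 * a) ?_)
  exact (fusion_act_fst hf _ p).symm.trans (congrArg (fun ξ => (M.fusion B N).act ξ _ p)
    (congrArg₂ (fun a b => ⁅a, b⁆) (fusion_rhoD_fst hg p) (fusion_rhoD_fst hk p)).symm)

theorem fusion_jacobi_snd {f g k : N.mfd.carrier → ℝ} (hf : N.mfd.SmoothFun f)
    (hg : N.mfd.SmoothFun g) (hk : N.mfd.SmoothFun k) (p : M.mfd.carrier × N.mfd.carrier) :
    (M.fusion B N).JacobiAt B (fun p => f p.2) (fun p => g p.2) (fun p => k p.2) p := by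
  have e : ∀ {f g k : N.mfd.carrier → ℝ}, N.mfd.SmoothFun f → N.mfd.SmoothFun g →
      N.mfd.SmoothFun k → (M.fusion B N).poisson ((M.fusion B N).poisson (fun p => f p.2)
        (fun p => g p.2)) (fun p => k p.2) p = N.poisson (N.poisson f g) k p.2 :=
    fun hf hg hk => (congrArg (fun F => (M.fusion B N).poisson F _ p)
      (funext fun p => fusion_poisson_snd_snd hf hg p)).trans
      (fusion_poisson_snd_snd (hN.poisson_smooth hf hg) hk p)
  refine (congrArg (fun a : ℝ => -2 * a) (congrArg₂ (fun a b : ℝ => a + b)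
    (congrArg₂ (fun a b : ℝ => a + b) (e hf hg hk) (e hg hk hf)) (e hk hf hg))).trans ?_
  refine (hN.pi_pi f g k hf hg hk p.2).trans (congrArg (fun a : ℝ => 1 / 2 * a) ?_)
  exact (fusion_act_snd hf _ p).symm.trans (congrArg (fun ξ => (M.fusion B N).act ξ _ p)
    (congrArg₂ (fun a b => ⁅a, b⁆) (fusion_rhoD_snd hg p) (fusion_rhoD_snd hk p)).symm)

/-- Invariance of `π_M` cancels the terms that contain a bracket on `M`. What remains is `-¼` of the
commutator of the fields of `ρ^*df` and `ρ^*dg` on `N`, applied to `k`; that is the mixed component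
of `φ`. -/
theorem fusion_jacobi_fst_fst_snd {f g : M.mfd.carrier → ℝ} {k : N.mfd.carrier → ℝ}
    (hf : M.mfd.SmoothFun f) (hg : M.mfd.SmoothFun g) (hk : N.mfd.SmoothFun k)
    (p : M.mfd.carrier × N.mfd.carrier) :
    (M.fusion B N).JacobiAt B (fun p => f p.1) (fun p => g p.1) (fun p => k p.2) p := by
  have e1 := (congrArg (fun F => (M.fusion B N).poisson F (fun p => k p.2) p)
      (funext fun p => fusion_poisson_fst_fst (B := B) (N := N) hf hg p)).trans
      (fusion_poisson_fst_snd (hM.poisson_smooth hf hg) hk p)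
  have e2 := (congrArg (fun F => (M.fusion B N).poisson F (fun p => f p.1) p)
      (funext fun p => fusion_poisson_fst_snd (B := B) hg hk p)).trans
      (fusion_poisson_form_fst hM hN hf hg hk _ p)
  have e3 := (congrArg (fun F => (M.fusion B N).poisson F (fun p => g p.1) p)
      (funext fun p => fusion_poisson_snd_fst (B := B) hf hk p)).trans
      (fusion_poisson_form_fst hM hN hg hf hk _ p)
  refine (congrArg (fun a : ℝ => -2 * a) (congrArg₂ (fun a b : ℝ => a + b)
    (congrArg₂ (fun a b : ℝ => a + b) e1 e2) e3)).trans ?_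
  refine Eq.trans ?_ (congrArg (fun a : ℝ => 1 / 2 * a) ((congrArg (fun ξ => (M.fusion B N).act ξ
    (fun p => f p.1) p) (congrArg₂ (fun a b => ⁅a, b⁆) (fusion_rhoD_fst hg p)
      (fusion_rhoD_snd hk p))).trans (fusion_act_fst hf _ p)).symm)
  have h1 := hM.pi_invariant (N.rhoD B k p.2) f g hf hg p.1
  have h2 := hN.act_act (M.rhoD B f p.1) (M.rhoD B g p.1) hk p.2
  rw [hM.poisson_skew (M.act _ f) g] at h1
  rw [IsHamiltonian.act_lie (B := B), IsHamiltonian.form_lie_cyclic] at h2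
  simp only [IsHamiltonian.act_lie (B := B), form_rhoD]
  linarith

/-- The roles of the factors are exchanged: invariance of `π_N` cancels the brackets on `N`, and the
commutator is taken on `M`. -/
theorem fusion_jacobi_fst_snd_snd {f : M.mfd.carrier → ℝ} {g k : N.mfd.carrier → ℝ}
    (hf : M.mfd.SmoothFun f) (hg : N.mfd.SmoothFun g) (hk : N.mfd.SmoothFun k)
    (p : M.mfd.carrier × N.mfd.carrier) :
    (M.fusion B N).JacobiAt B (fun p => f p.1) (fun p => g p.2) (fun p => k p.2) p := by
  have e1 := (congrArg (fun F => (M.fusion B N).poisson F (fun p => k p.2) p)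
      (funext fun p => fusion_poisson_fst_snd (B := B) hf hg p)).trans
      (fusion_poisson_form_snd hM hN hf hg hk _ p)
  have e2 := (congrArg (fun F => (M.fusion B N).poisson F (fun p => f p.1) p)
      (funext fun p => fusion_poisson_snd_snd (B := B) (M := M) hg hk p)).trans
      (fusion_poisson_snd_fst hf (hN.poisson_smooth hg hk) p)
  have e3 := (congrArg (fun F => (M.fusion B N).poisson F (fun p => g p.2) p)
      (funext fun p => fusion_poisson_snd_fst (B := B) hf hk p)).trans
      (fusion_poisson_form_snd hM hN hf hk hg _ p)
  refine (congrArg (fun a : ℝ => -2 * a) (congrArg₂ (fun a b : ℝ => a + b)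
    (congrArg₂ (fun a b : ℝ => a + b) e1 e2) e3)).trans ?_
  refine Eq.trans ?_ (congrArg (fun a : ℝ => 1 / 2 * a) ((congrArg (fun ξ => (M.fusion B N).act ξ
    (fun p => f p.1) p) (congrArg₂ (fun a b => ⁅a, b⁆) (fusion_rhoD_snd hg p)
      (fusion_rhoD_snd hk p))).trans (fusion_act_fst hf _ p)).symm)
  have h1 := hN.pi_invariant (M.rhoD B f p.1) g k hg hk p.2
  have h2 := hM.act_act (N.rhoD B g p.2) (N.rhoD B k p.2) hf p.1
  rw [hN.poisson_skew (N.act _ g) k] at h1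
  rw [form_rhoD']
  linarith

/-- Up to cyclic rotation there are only four distributions of three functions over two factors. -/
theorem fusion_pi_pi (F K L : M.mfd.carrier × N.mfd.carrier → ℝ)
    (hF : (M.mfd.prod N.mfd).SmoothFun F) (hK : (M.mfd.prod N.mfd).SmoothFun K)
    (hL : (M.mfd.prod N.mfd).SmoothFun L) (p : M.mfd.carrier × N.mfd.carrier) :
    (M.fusion B N).JacobiAt B F K L p := by
  refine jacobi_of_separating (Q := M.fusion B N) (S := factorFunctions M N)
    (fun F hF => smoothFun_of_mem_factorFunctions hF) (fun p v w h => eq_of_factorFunctions h)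
    (fun α hα => fusion_pi_smooth hM hN α hα)
    (fun F K hF hK p => fusion_poisson_skew hM hN hF hK p)
    ?_ F K L hF hK hL p
  rintro _ (⟨f, hf, rfl⟩ | ⟨f, hf, rfl⟩) _ (⟨g, hg, rfl⟩ | ⟨g, hg, rfl⟩)
    _ (⟨k, hk, rfl⟩ | ⟨k, hk, rfl⟩) p
  · exact fusion_jacobi_fst hM hN hf hg hk p
  · exact fusion_jacobi_fst_fst_snd hM hN hf hg hk p
  · exact (fusion_jacobi_fst_fst_snd hM hN hk hf hg p).cyclic
  · exact fusion_jacobi_fst_snd_snd hM hN hf hg hk p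
  · exact (fusion_jacobi_fst_fst_snd hM hN hg hk hf p).cyclic.cyclic
  · exact (fusion_jacobi_fst_snd_snd hM hN hg hk hf p).cyclic.cyclic
  · exact (fusion_jacobi_fst_snd_snd hM hN hk hf hg p).cyclic
  · exact fusion_jacobi_snd hM hN hf hg hk p

end HamData
end

section

variable {EG : Type*} [NormedAddCommGroup EG] [NormedSpace ℝ EG] [FiniteDimensional ℝ EG]
  {HG : Type*} [TopologicalSpace HG] {IG : ModelWithCorners ℝ EG HG}
  {G : Type*} [TopologicalSpace G] [ChartedSpace HG G] [Group G]

/-! ### Translations -/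

section Translations

variable [LieGroup IG ∞ G]

theorem mdifferentiable_mul_left' (g : G) : MDifferentiable IG IG (fun k : G => g * k) :=
  (contMDiff_mul_left (I := IG) (n := ∞) (a := g)).mdifferentiable (by simp)

theorem mdifferentiable_mul_right' (g : G) : MDifferentiable IG IG (fun k : G => k * g) :=
  (contMDiff_mul_right (I := IG) (n := ∞) (a := g)).mdifferentiable (by simp)

/-- The derivative of a left translation. -/
def dLeft (g h : G) : TangentSpace IG h →L[ℝ] TangentSpace IG (g * h) :=
  mfderiv IG IG (fun k : G => g * k) h

/-- The derivative of a right translation. -/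
def dRight (g h : G) : TangentSpace IG h →L[ℝ] TangentSpace IG (h * g) :=
  mfderiv IG IG (fun k : G => k * g) h

/-- The derivative of `k ↦ g k h` at the unit. -/
def dLeftRight (g h : G) : GroupLieAlgebra IG G →L[ℝ] TangentSpace IG (g * h) :=
  (show GroupLieAlgebra IG G →L[ℝ] TangentSpace IG (g * h) from
    mfderiv IG IG (fun k : G => g * k * h) (1 : G))

theorem dLeft_mulInvariantVectorField (g h : G) (ξ : GroupLieAlgebra IG G) :
    dLeft g h (mulInvariantVectorField ξ h) = mulInvariantVectorField ξ (g * h) := by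
  have h1 := mfderiv_comp_of_eq (x := (1 : G)) (y := h) (mdifferentiable_mul_left' (IG := IG) g h)
    (mdifferentiable_mul_left' (IG := IG) h 1) (mul_one h)
  have h2 : (fun k : G => g * k) ∘ (fun k : G => h * k) = fun k => (g * h) * k :=
    funext fun k => (mul_assoc g h k).symm
  rw [h2, show h * 1 = h from mul_one h] at h1
  exact congrArg (fun L : EG →L[ℝ] EG => L ξ) h1.symm

theorem dLeft_rightInvariantVectorField (g h : G) (ξ : GroupLieAlgebra IG G) :
    dLeft g h (rightInvariantVectorField ξ h) = dLeftRight g h ξ := by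
  have h1 := mfderiv_comp_of_eq (x := (1 : G)) (y := h) (mdifferentiable_mul_left' (IG := IG) g h)
    (mdifferentiable_mul_right' (IG := IG) h 1) (one_mul h)
  have h2 : (fun k : G => g * k) ∘ (fun k : G => k * h) = fun k => g * k * h :=
    funext fun k => (mul_assoc g k h).symm
  rw [h2, show 1 * h = h from one_mul h] at h1
  exact congrArg (fun L : EG →L[ℝ] EG => L ξ) h1.symm

/-- This is the same vector as in `dLeft_rightInvariantVectorField`. The coincidence makes the inner
terms cancel in the two moment map conditions for a product. -/
theorem dRight_mulInvariantVectorField (g h : G) (ξ : GroupLieAlgebra IG G) :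
    dRight h g (mulInvariantVectorField ξ g) = dLeftRight g h ξ := by
  have h1 := mfderiv_comp_of_eq (x := (1 : G)) (y := g) (mdifferentiable_mul_right' (IG := IG) h g)
    (mdifferentiable_mul_left' (IG := IG) g 1) (mul_one g)
  rw [show g * 1 = g from mul_one g] at h1
  exact congrArg (fun L : EG →L[ℝ] EG => L ξ) h1.symm

theorem dRight_rightInvariantVectorField (g h : G) (ξ : GroupLieAlgebra IG G) :
    dRight h g (rightInvariantVectorField ξ g) = rightInvariantVectorField ξ (g * h) := by
  have h1 := mfderiv_comp_of_eq (x := (1 : G)) (y := g) (mdifferentiable_mul_right' (IG := IG) h g)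
    (mdifferentiable_mul_right' (IG := IG) g 1) (one_mul g)
  have h2 : (fun k : G => k * h) ∘ (fun k : G => k * g) = fun k => k * (g * h) :=
    funext fun k => mul_assoc k g h
  rw [h2, show 1 * g = g from one_mul g] at h1
  exact congrArg (fun L : EG →L[ℝ] EG => L ξ) h1.symm

theorem bStar_apply (g : G) (a : TangentSpace IG g →L[ℝ] ℝ) (ξ : GroupLieAlgebra IG G) :
    bStar g a ξ = 2⁻¹ * (a (mulInvariantVectorField ξ g) + a (rightInvariantVectorField ξ g)) := by
  refine (map_smul a (2⁻¹ : ℝ) _).trans (congrArg (fun c : ℝ => 2⁻¹ * c) ?_)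
  exact map_add a _ _

end Translations

namespace HamData

open SmoothManifold

variable {M N P Q : HamData.{u} IG G} {B : InvariantForm IG G}

/-! ### Fusion products: the moment map -/

section Moment

variable [LieGroup IG ∞ G]

theorem fusion_moment_smooth (hM : M.IsHamiltonian B) (hN : N.IsHamiltonian B) :
    ContMDiff (M.mfd.prod N.mfd).model IG ∞
      (fun p : M.mfd.carrier × N.mfd.carrier => N.moment p.2 * M.moment p.1) :=
  (hN.moment_smooth.comp contMDiff_snd).mul (hM.moment_smooth.comp contMDiff_fst)

/-- The differential of the moment map of a fusion product. -/
def fusionDMoment (M N : HamData.{u} IG G) (p : M.mfd.carrier × N.mfd.carrier) :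
    (M.mfd.prod N.mfd).T p →L[ℝ] TangentSpace IG (N.moment p.2 * M.moment p.1) :=
  mfderiv (M.mfd.prod N.mfd).model IG
    (fun p : M.mfd.carrier × N.mfd.carrier => N.moment p.2 * M.moment p.1) p

theorem fusion_dMoment_inlT (hM : M.IsHamiltonian B) (hN : N.IsHamiltonian B)
    (p : M.mfd.carrier × N.mfd.carrier) (v : M.mfd.T p.1) :
    fusionDMoment M N p (M.mfd.inlT N.mfd p v) =
      dLeft (N.moment p.2) (M.moment p.1) (M.dMoment p.1 v) := by
  have h1 := mfderiv_comp p.1 ((fusion_moment_smooth hM hN).mdifferentiableAt (by simp))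
    ((smooth_inl (M := M.mfd) (N := N.mfd) p.2).mdifferentiableAt (by simp))
  have h2 := mfderiv_comp p.1 (mdifferentiable_mul_left' (IG := IG) (N.moment p.2) (M.moment p.1))
    (hM.moment_smooth.mdifferentiableAt (by simp))
  exact congrArg (fun L : M.mfd.E →L[ℝ] EG => L v) (h1.symm.trans h2)

theorem fusion_dMoment_inrT (hM : M.IsHamiltonian B) (hN : N.IsHamiltonian B)
    (p : M.mfd.carrier × N.mfd.carrier) (w : N.mfd.T p.2) :
    fusionDMoment M N p (M.mfd.inrT N.mfd p w) =
      dRight (M.moment p.1) (N.moment p.2) (N.dMoment p.2 w) := by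
  have h1 := mfderiv_comp p.2 ((fusion_moment_smooth hM hN).mdifferentiableAt (by simp))
    ((smooth_inr (M := M.mfd) (N := N.mfd) p.1).mdifferentiableAt (by simp))
  have h2 := mfderiv_comp p.2 (mdifferentiable_mul_right' (IG := IG) (M.moment p.1) (N.moment p.2))
    (hN.moment_smooth.mdifferentiableAt (by simp))
  exact congrArg (fun L : N.mfd.E →L[ℝ] EG => L w) (h1.symm.trans h2)

/-- Translating `ξ^L - ξ^R` from the two factors gives a telescoping sum, with the middle terms
`dLeftRight` cancelling. -/
theorem fusion_moment_equivariant (hM : M.IsHamiltonian B) (hN : N.IsHamiltonian B)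
    (ξ : GroupLieAlgebra IG G) (p : M.mfd.carrier × N.mfd.carrier) :
    fusionDMoment M N p (M.mfd.inlT N.mfd p (M.action ξ p.1) +
      M.mfd.inrT N.mfd p (N.action ξ p.2)) =
      mulInvariantVectorField ξ (N.moment p.2 * M.moment p.1) -
        rightInvariantVectorField ξ (N.moment p.2 * M.moment p.1) := by
  refine (map_add (fusionDMoment M N p) _ _).trans
    ((congrArg₂ (fun a b : TangentSpace IG (N.moment p.2 * M.moment p.1) => a + b)
    (fusion_dMoment_inlT hM hN p _) (fusion_dMoment_inrT hM hN p _)).trans ?_)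
  rw [hM.moment_equivariant, hN.moment_equivariant, map_sub, map_sub,
    dLeft_mulInvariantVectorField, dLeft_rightInvariantVectorField,
    dRight_mulInvariantVectorField, dRight_rightInvariantVectorField]
  exact sub_add_sub_cancel _ _ _

theorem rhoStar_comp_dMoment (hM : M.IsHamiltonian B) (x : M.mfd.carrier)
    (a : TangentSpace IG (M.moment x) →L[ℝ] ℝ) (ξ : GroupLieAlgebra IG G) :
    B.form (M.rhoStar B x (a.comp (M.dMoment x))) ξ =
      a (mulInvariantVectorField ξ (M.moment x)) - a (rightInvariantVectorField ξ (M.moment x)) := by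
  rw [form_rhoStar, ← map_sub, ← hM.moment_equivariant]
  rfl

/-- Let `L`, `R`, `K` be the values of `a` on `ξ^L`, on `ξ^R` and on the middle vector `dLeftRight`.
The component along `M` is `½(L + K) - ½(K - R)` and that along `N` is `½(K + R) + ½(L - K)`; both
equal `½(L + R)`. The order `Φ_N Φ_M` is what gives the signs that make `K` cancel. -/
theorem fusion_moment_map (hM : M.IsHamiltonian B) (hN : N.IsHamiltonian B)
    (p : M.mfd.carrier × N.mfd.carrier)
    (a : TangentSpace IG (N.moment p.2 * M.moment p.1) →L[ℝ] ℝ) :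
    (M.fusion B N).piSharp p (a.comp (fusionDMoment M N p) : (M.mfd.prod N.mfd).T p →L[ℝ] ℝ) =
      (M.fusion B N).action (B.sharp (bStar (N.moment p.2 * M.moment p.1) a)) p := by
  let a' : TangentSpace IG (N.moment p.2 * M.moment p.1) →L[ℝ] ℝ := a
  let a₁ := a'.comp (dLeft (N.moment p.2) (M.moment p.1))
  let a₂ := a'.comp (dRight (M.moment p.1) (N.moment p.2))
  have r1 : M.mfd.pullCot (M.mfd.prod N.mfd) (fun x => (x, p.2)) p.1
      (a.comp (fusionDMoment M N p)) = a₁.comp (M.dMoment p.1) :=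
    ContinuousLinearMap.ext fun v => congrArg a' (fusion_dMoment_inlT hM hN p v)
  have r2 : N.mfd.pullCot (M.mfd.prod N.mfd) (fun y => (p.1, y)) p.2
      (a.comp (fusionDMoment M N p)) = a₂.comp (N.dMoment p.2) :=
    ContinuousLinearMap.ext fun v => congrArg a' (fusion_dMoment_inrT hM hN p v)
  have l1 : ∀ ξ, a₁ (mulInvariantVectorField ξ (M.moment p.1)) =
      a' (mulInvariantVectorField ξ (N.moment p.2 * M.moment p.1)) := fun ξ =>
    congrArg a' (dLeft_mulInvariantVectorField _ _ ξ)
  have l2 : ∀ ξ, a₁ (rightInvariantVectorField ξ (M.moment p.1)) =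
      a' (dLeftRight (N.moment p.2) (M.moment p.1) ξ) := fun ξ =>
    congrArg a' (dLeft_rightInvariantVectorField _ _ ξ)
  have l3 : ∀ ξ, a₂ (mulInvariantVectorField ξ (N.moment p.2)) =
      a' (dLeftRight (N.moment p.2) (M.moment p.1) ξ) := fun ξ =>
    congrArg a' (dRight_mulInvariantVectorField _ _ ξ)
  have l4 : ∀ ξ, a₂ (rightInvariantVectorField ξ (N.moment p.2)) =
      a' (rightInvariantVectorField ξ (N.moment p.2 * M.moment p.1)) := fun ξ =>
    congrArg a' (dRight_rightInvariantVectorField _ _ ξ)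
  have e1 : B.sharp (bStar (M.moment p.1) a₁) -
      (2⁻¹ : ℝ) • N.rhoStar B p.2 (a₂.comp (N.dMoment p.2)) =
      B.sharp (bStar (N.moment p.2 * M.moment p.1) a') := by
    refine B.ext_form fun ξ => ?_
    rw [map_sub, map_smul, LinearMap.sub_apply, LinearMap.smul_apply, smul_eq_mul,
      rhoStar_comp_dMoment hN, B.form_sharp, B.form_sharp, bStar_apply, bStar_apply, l1, l2, l3, l4]
    ring
  have e2 : B.sharp (bStar (N.moment p.2) a₂) +
      (2⁻¹ : ℝ) • M.rhoStar B p.1 (a₁.comp (M.dMoment p.1)) =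
      B.sharp (bStar (N.moment p.2 * M.moment p.1) a') := by
    refine B.ext_form fun ξ => ?_
    rw [map_add, map_smul, LinearMap.add_apply, LinearMap.smul_apply, smul_eq_mul,
      rhoStar_comp_dMoment hM, B.form_sharp, B.form_sharp, bStar_apply, bStar_apply, l1, l2, l3, l4]
    ring
  have p1 : M.piSharp p.1 (a₁.comp (M.dMoment p.1)) - (2⁻¹ : ℝ) • M.actionAt p.1
      (N.rhoStar B p.2 (a₂.comp (N.dMoment p.2))) =
      M.action (B.sharp (bStar (N.moment p.2 * M.moment p.1) a')) p.1 := by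
    rw [hM.moment_map, ← e1, ← map_smul]
    exact (map_sub (M.actionAt p.1) _ _).symm
  have p2 : N.piSharp p.2 (a₂.comp (N.dMoment p.2)) + (2⁻¹ : ℝ) • N.actionAt p.2
      (M.rhoStar B p.1 (a₁.comp (M.dMoment p.1))) =
      N.action (B.sharp (bStar (N.moment p.2 * M.moment p.1) a')) p.2 := by
    rw [hN.moment_map, ← e2, ← map_smul]
    exact (map_add (N.actionAt p.2) _ _).symm
  rw [← r1, ← r2] at p1 p2
  exact congrArg₂ (fun v w => M.mfd.inlT N.mfd p v + M.mfd.inrT N.mfd p w) p1 p2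

theorem isHamiltonian_fusion (hM : M.IsHamiltonian B) (hN : N.IsHamiltonian B) :
    (M.fusion B N).IsHamiltonian B where
  action_smooth := fusion_action_smooth hM hN
  action_bracket := fusion_action_bracket hM hN
  pi_smooth := fusion_pi_smooth hM hN
  pi_skew := fusion_pi_skew hM hN
  pi_invariant := fusion_pi_invariant hM hN
  pi_pi := fusion_pi_pi hM hN
  moment_smooth := fusion_moment_smooth hM hN
  moment_equivariant := fusion_moment_equivariant hM hN
  moment_map := fusion_moment_map hM hN

instance subsingleton_point_T (x : (HamData.point.{u} : HamData IG G).mfd.carrier) :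
    Subsingleton ((HamData.point.{u} : HamData IG G).mfd.T x) :=
  inferInstanceAs (Subsingleton PUnit)

theorem smoothVF_point_zero : SmoothManifold.point.{u}.SmoothVF (fun _ => 0) :=
  contMDiff_zeroSection ℝ (TangentSpace SmoothManifold.point.model)

theorem isHamiltonian_point : (HamData.point.{u} : HamData IG G).IsHamiltonian B where
  action_smooth _ := smoothVF_point_zero
  action_bracket _ _ _ := Subsingleton.elim _ _
  pi_smooth _ _ := smoothVF_point_zero
  pi_skew x α β := by
    have e : ∀ (a : (HamData.point.{u} : HamData IG G).mfd.Cot x) v, (a v : ℝ) = 0 :=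
      fun a v => (congrArg a (Subsingleton.elim v 0)).trans
        (map_zero (show (HamData.point.{u} : HamData IG G).mfd.T x →L[ℝ] ℝ from a))
    rw [e α, e β, neg_zero]
  pi_invariant ξ f g _ _ x := by
    have e : ∀ f (v : (HamData.point.{u} : HamData IG G).mfd.T x),
        ((HamData.point.{u} : HamData IG G).mfd.d f x v : ℝ) = 0 :=
      fun a v => (congrArg _ (Subsingleton.elim v 0)).trans
        (map_zero (show (HamData.point.{u} : HamData IG G).mfd.T x →L[ℝ] ℝ from _))
    exact (e _ _).trans ((congrArg₂ (fun a b : ℝ => a + b) (e _ _) (e _ _)).trans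
      (add_zero 0)).symm
  pi_pi f g k _ _ _ x := by
    have e : ∀ f (v : (HamData.point.{u} : HamData IG G).mfd.T x),
        ((HamData.point.{u} : HamData IG G).mfd.d f x v : ℝ) = 0 :=
      fun a v => (congrArg _ (Subsingleton.elim v 0)).trans
        (map_zero (show (HamData.point.{u} : HamData IG G).mfd.T x →L[ℝ] ℝ from _))
    simp only [poisson, pi, e]
    ring
  moment_smooth := contMDiff_const
  -- The image is the unit, where left- and right-invariant fields have the same value.
  moment_equivariant ξ x := by
    have e : mulInvariantVectorField ξ (1 : G) = rightInvariantVectorField ξ (1 : G) := by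
      have h : (fun k : G => 1 * k) = fun k => k * 1 := by
        funext k; rw [one_mul, mul_one]
      exact congrArg (fun φ : G → G => (mfderiv IG IG φ 1 : EG →L[ℝ] EG) ξ) h
    refine (congrArg _ (Subsingleton.elim _ 0)).trans ((map_zero _).trans ?_)
    exact (sub_eq_zero.mpr e).symm
  moment_map _ _ := Subsingleton.elim _ _

theorem smooth_left {M : SmoothManifold.{u}} :
    M.Smooth (SmoothManifold.point.prod M) (fun x => (PUnit.unit, x)) :=
  smooth_inr (M := SmoothManifold.point) PUnit.unit

theorem smooth_right {M : SmoothManifold.{u}} :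
    M.Smooth (M.prod SmoothManifold.point) (fun x => (x, PUnit.unit)) :=
  smooth_inl (N := SmoothManifold.point) PUnit.unit

end Moment

end HamData

theorem fusionWellDefined [LieGroup IG ∞ G] (B : InvariantForm IG G) : FusionWellDefined.{u} B where
  fusion M N := HamData.isHamiltonian_fusion M.isHamiltonian N.isHamiltonian
  point := HamData.isHamiltonian_point
  map f g := HamData.isMorphism_fusion_map f.isMorphism g.isMorphism
  assocHom _ _ _ := HamData.isMorphism_assoc
  assocInv _ _ _ := HamData.isMorphism_assoc.symm HamData.smooth_assoc_symm
    (fun _ => rfl) (fun _ => rfl)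
  leftHom _ := HamData.isMorphism_left
  leftInv _ := HamData.isMorphism_left.symm HamData.smooth_left (fun _ => rfl) (fun _ => rfl)
  rightHom _ := HamData.isMorphism_right
  rightInv _ := HamData.isMorphism_right.symm HamData.smooth_right (fun _ => rfl) (fun _ => rfl)

end

/-! ### Derivatives along vector fields -/

theorem contMDiff_mvfderiv_apply {E : Type*} [NormedAddCommGroup E] [NormedSpace ℝ E]
    {H : Type*} [TopologicalSpace H] {I : ModelWithCorners ℝ E H}
    {M : Type*} [TopologicalSpace M] [ChartedSpace H M] [IsManifold I ∞ M]
    {f : M → ℝ} (hf : ContMDiff I 𝓘(ℝ, ℝ) ∞ f) {X : ∀ x : M, TangentSpace I x}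
    (hX : ContMDiff I (I.prod 𝓘(ℝ, E)) ∞ (fun x => TotalSpace.mk' E x (X x))) :
    ContMDiff I 𝓘(ℝ, ℝ) ∞ (fun x => mvfderiv I f x (X x)) := by
  have h1 : ContMDiff I.tangent 𝓘(ℝ, ℝ).tangent ∞ (tangentMap I 𝓘(ℝ, ℝ) f) :=
    hf.contMDiff_tangentMap (m := ∞) (by simp)
  exact (contMDiff_snd_tangentBundle_modelSpace ℝ 𝓘(ℝ, ℝ) (n := ∞)).comp (h1.comp hX)

section

variable {EG : Type*} [NormedAddCommGroup EG] [NormedSpace ℝ EG] [FiniteDimensional ℝ EG]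
  {HG : Type*} [TopologicalSpace HG] {IG : ModelWithCorners ℝ EG HG}
  {G : Type*} [TopologicalSpace G] [ChartedSpace HG G] [Group G]

/-! ### Invariant vector fields -/

/-- All tangent spaces of `G` are the type `EG`, so vectors at points that are only propositionally
equal, such as `g * 1` and `g`, can be compared there. -/
theorem tangentBundle_mk_congr {g h : G} (e : g = h) {v : TangentSpace IG g}
    {w : TangentSpace IG h} (hvw : (show EG from v) = w) :
    (⟨g, v⟩ : TangentBundle IG G) = ⟨h, w⟩ := by
  subst e
  exact congrArg _ hvw

variable [LieGroup IG ∞ G]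

/-- A topological group with closed points is Hausdorff. The cutoff constructions on `G` need this.
-/
theorem t2Space_of_lieGroup (IG : ModelWithCorners ℝ EG HG) (G : Type*) [TopologicalSpace G]
    [ChartedSpace HG G] [Group G] [LieGroup IG ∞ G] : T2Space G := by
  have : IsTopologicalGroup G := topologicalGroup_of_lieGroup IG ∞
  have : T1Space G := IG.t1Space G
  infer_instance

/-- This is the multiplication of the tangent group. Inserting zero vectors or constants gives
smoothness of the invariant vector fields and of the Maurer-Cartan form. -/
theorem contMDiff_tangent_mul {E' : Type*} [NormedAddCommGroup E'] [NormedSpace ℝ E']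
    {H' : Type*} [TopologicalSpace H'] {I' : ModelWithCorners ℝ E' H'}
    {K : Type*} [TopologicalSpace K] [ChartedSpace H' K] {fu fv : K → TangentBundle IG G}
    (hu : ContMDiff I' IG.tangent ∞ fu) (hv : ContMDiff I' IG.tangent ∞ fv) :
    ContMDiff I' IG.tangent ∞ (fun g => (⟨(fu g).1 * (fv g).1,
      dRight (fv g).1 (fu g).1 (fu g).2 + dLeft (fu g).1 (fv g).1 (fv g).2⟩ :
        TangentBundle IG G)) := by
  have h3 : ContMDiff (IG.prod IG).tangent IG.tangent ∞
      (tangentMap (IG.prod IG) IG (fun p : G × G => p.1 * p.2)) :=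
    (contMDiff_mul IG ∞).contMDiff_tangentMap (m := ∞) (by simp)
  have h2 := h3.comp ((contMDiff_equivTangentBundleProd_symm (n := ∞)).comp (hu.prodMk hv))
  refine ContMDiff.congr h2 fun g => ?_
  exact congrArg (TotalSpace.mk (F := EG) (E := TangentSpace IG) ((fu g).1 * (fv g).1))
    (mfderiv_prod_eq_add_apply (p := ((fu g).1, (fv g).1)) (v := show EG × EG from ((fu g).2, (fv g).2))
      ((contMDiff_mul IG ∞).mdifferentiableAt (by simp))).symm

theorem contMDiff_tangent_zero :
    ContMDiff IG IG.tangent ∞ (fun g : G => (⟨g, 0⟩ : TangentBundle IG G)) :=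
  contMDiff_zeroSection ℝ (TangentSpace IG)

theorem contMDiff_mulInvariantVectorField' (ξ : GroupLieAlgebra IG G) :
    ContMDiff IG IG.tangent ∞
      (fun g : G => (⟨g, mulInvariantVectorField ξ g⟩ : TangentBundle IG G)) := by
  have h := contMDiff_tangent_mul (contMDiff_tangent_zero (IG := IG) (G := G))
    (contMDiff_const (c := (⟨1, ξ⟩ : TangentBundle IG G)))
  refine ContMDiff.congr h fun g => tangentBundle_mk_congr (mul_one g).symm ?_
  change _ = (dRight 1 g 0 + dLeft g 1 ξ : TangentSpace IG (g * 1))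
  rw [map_zero, zero_add]
  rfl

theorem contMDiff_rightInvariantVectorField (ξ : GroupLieAlgebra IG G) :
    ContMDiff IG IG.tangent ∞
      (fun g : G => (⟨g, rightInvariantVectorField ξ g⟩ : TangentBundle IG G)) := by
  have h := contMDiff_tangent_mul (contMDiff_const (c := (⟨1, ξ⟩ : TangentBundle IG G)))
    (contMDiff_tangent_zero (IG := IG) (G := G))
  refine ContMDiff.congr h fun g => tangentBundle_mk_congr (one_mul g).symm ?_
  change _ = (dRight g 1 ξ + dLeft 1 g 0 : TangentSpace IG (1 * g))
  rw [map_zero, add_zero]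
  rfl

/-- The derivative of a function along a left-invariant vector field. -/
def leftAct (ξ : GroupLieAlgebra IG G) (F : G → ℝ) (g : G) : ℝ :=
  mvfderiv IG F g (mulInvariantVectorField ξ g)

/-- The derivative of a function along a right-invariant vector field. -/
def rightAct (ξ : GroupLieAlgebra IG G) (F : G → ℝ) (g : G) : ℝ :=
  mvfderiv IG F g (rightInvariantVectorField ξ g)

theorem leftAct_smooth (ξ : GroupLieAlgebra IG G) {F : G → ℝ} (hF : ContMDiff IG 𝓘(ℝ, ℝ) ∞ F) :
    ContMDiff IG 𝓘(ℝ, ℝ) ∞ (leftAct ξ F) :=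
  contMDiff_mvfderiv_apply hF (contMDiff_mulInvariantVectorField' ξ)

theorem rightAct_smooth (ξ : GroupLieAlgebra IG G) {F : G → ℝ} (hF : ContMDiff IG 𝓘(ℝ, ℝ) ∞ F) :
    ContMDiff IG 𝓘(ℝ, ℝ) ∞ (rightAct ξ F) :=
  contMDiff_mvfderiv_apply hF (contMDiff_rightInvariantVectorField ξ)

theorem leftAct_leftAct [IG.Boundaryless] (ξ η : GroupLieAlgebra IG G) {F : G → ℝ}
    (hF : ContMDiff IG 𝓘(ℝ, ℝ) ∞ F) (g : G) :
    leftAct ξ (leftAct η F) g - leftAct η (leftAct ξ F) g = leftAct ⁅ξ, η⁆ F g := by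
  have := t2Space_of_lieGroup IG G
  have : LieGroup IG (minSmoothness ℝ 3) G := by
    rw [minSmoothness_of_isRCLikeNormedField]
    infer_instance
  have h1 := mvfderiv_mlieBracket (contMDiff_mulInvariantVectorField' ξ)
    (contMDiff_mulInvariantVectorField' η) hF (leftAct_smooth ξ hF) (leftAct_smooth η hF) g
  have : CompleteSpace EG := FiniteDimensional.complete ℝ EG
  rw [← mulInvariantVector_mlieBracket] at h1
  exact h1.symm

/-- The right-invariant vector field on the first factor of `G × G`. -/
def rightField (ξ : GroupLieAlgebra IG G) (p : G × G) : TangentSpace (IG.prod IG) p :=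
  (show EG × EG from (rightInvariantVectorField ξ p.1, 0))

/-- The left-invariant vector field on the second factor of `G × G`. -/
def leftField (ξ : GroupLieAlgebra IG G) (p : G × G) : TangentSpace (IG.prod IG) p :=
  (show EG × EG from (0, mulInvariantVectorField ξ p.2))

theorem rightField_smooth (ξ : GroupLieAlgebra IG G) :
    ContMDiff (IG.prod IG) (IG.prod IG).tangent ∞
      (fun p : G × G => (⟨p, rightField ξ p⟩ : TangentBundle (IG.prod IG) (G × G))) :=
  (contMDiff_equivTangentBundleProd_symm (n := ∞)).comp
    (((contMDiff_rightInvariantVectorField ξ).comp contMDiff_fst).prodMk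
      (contMDiff_tangent_zero.comp contMDiff_snd))

theorem leftField_smooth (ξ : GroupLieAlgebra IG G) :
    ContMDiff (IG.prod IG) (IG.prod IG).tangent ∞
      (fun p : G × G => (⟨p, leftField ξ p⟩ : TangentBundle (IG.prod IG) (G × G))) :=
  (contMDiff_equivTangentBundleProd_symm (n := ∞)).comp
    ((contMDiff_tangent_zero.comp contMDiff_fst).prodMk
      ((contMDiff_mulInvariantVectorField' ξ).comp contMDiff_snd))

theorem mvfderiv_comp_fst {F : G → ℝ} (hF : ContMDiff IG 𝓘(ℝ, ℝ) ∞ F) (p : G × G)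
    (v : TangentSpace (IG.prod IG) p) :
    mvfderiv (IG.prod IG) (fun p : G × G => F p.1) p v =
      mvfderiv IG F p.1 (show EG × EG from v).1 := by
  have h := mvfderiv_comp p (I := IG) (I' := IG.prod IG) (g := F) (f := Prod.fst) (hF.mdifferentiableAt (by simp))
    (mdifferentiableAt_fst (I := IG) (I' := IG) (x := p))
  rw [mfderiv_fst] at h
  exact congrArg (fun L : EG × EG →L[ℝ] ℝ => L v) h

theorem mvfderiv_comp_snd {F : G → ℝ} (hF : ContMDiff IG 𝓘(ℝ, ℝ) ∞ F) (p : G × G)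
    (v : TangentSpace (IG.prod IG) p) :
    mvfderiv (IG.prod IG) (fun p : G × G => F p.2) p v =
      mvfderiv IG F p.2 (show EG × EG from v).2 := by
  have h := mvfderiv_comp p (I := IG) (I' := IG.prod IG) (g := F) (f := Prod.snd) (hF.mdifferentiableAt (by simp))
    (mdifferentiableAt_snd (I := IG) (I' := IG) (x := p))
  rw [mfderiv_snd] at h
  exact congrArg (fun L : EG × EG →L[ℝ] ℝ => L v) h

theorem mvfderiv_comp_mul {F : G → ℝ} (hF : ContMDiff IG 𝓘(ℝ, ℝ) ∞ F) (p : G × G)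
    (v : TangentSpace (IG.prod IG) p) :
    mvfderiv (IG.prod IG) (fun p : G × G => F (p.1 * p.2)) p v =
      mvfderiv IG F (p.1 * p.2) (dRight p.2 p.1 (show EG × EG from v).1 +
        dLeft p.1 p.2 (show EG × EG from v).2) := by
  have hm := (contMDiff_mul IG ∞ (G := G)).mdifferentiableAt (x := p) (by simp)
  have h := mvfderiv_comp p (I := IG) (I' := IG.prod IG) (g := F) (f := fun p : G × G => p.1 * p.2)
    (hF.mdifferentiableAt (by simp)) hm
  have h2 := mfderiv_prod_eq_add_apply (p := p) (v := v) hm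
  exact (congrArg (fun L : EG × EG →L[ℝ] ℝ => L v) h).trans
    (congrArg (mvfderiv IG F (p.1 * p.2)) h2)

theorem mlieBracket_rightField_leftField [IG.Boundaryless] (ξ η : GroupLieAlgebra IG G)
    (p : G × G) : mlieBracket (IG.prod IG) (rightField ξ) (leftField η) p = 0 := by
  have := t2Space_of_lieGroup IG G
  have hr := rightField_smooth (IG := IG) ξ
  have hl := leftField_smooth (IG := IG) η
  have c : ∀ (c : ℝ) (p : G × G) v, mvfderiv (IG.prod IG) (fun _ : G × G => c) p v = 0 :=
    fun c p v => by rw [mvfderiv_const]; rfl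
  refine Prod.ext (α := EG) (β := EG) ?_ ?_
  · refine eq_of_mvfderiv_eq (I := IG) (x := p.1) fun F hF => ?_
    have hF' : ContMDiff (IG.prod IG) 𝓘(ℝ, ℝ) ∞ (fun p : G × G => F p.1) := hF.comp contMDiff_fst
    have h := mvfderiv_mlieBracket hr hl hF' (contMDiff_mvfderiv_apply hF' hr)
      (contMDiff_mvfderiv_apply hF' hl) p
    have e1 : (fun q : G × G => mvfderiv (IG.prod IG) (fun p : G × G => F p.1) q (leftField η q)) =
        fun _ => 0 := funext fun q => (mvfderiv_comp_fst hF q _).trans (map_zero _)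
    have e2 : (fun q : G × G => mvfderiv (IG.prod IG) (fun p : G × G => F p.1) q (rightField ξ q)) =
        fun q => rightAct ξ F q.1 := funext fun q => mvfderiv_comp_fst hF q _
    rw [e1, e2, c, mvfderiv_comp_fst (rightAct_smooth ξ hF), mvfderiv_comp_fst hF] at h
    refine h.trans (Eq.trans ?_ (map_zero _).symm)
    exact (congrArg (fun a : ℝ => 0 - a) (map_zero _)).trans (sub_zero 0)
  · refine eq_of_mvfderiv_eq (I := IG) (x := p.2) fun F hF => ?_
    have hF' : ContMDiff (IG.prod IG) 𝓘(ℝ, ℝ) ∞ (fun p : G × G => F p.2) := hF.comp contMDiff_snd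
    have h := mvfderiv_mlieBracket hr hl hF' (contMDiff_mvfderiv_apply hF' hr)
      (contMDiff_mvfderiv_apply hF' hl) p
    have e1 : (fun q : G × G => mvfderiv (IG.prod IG) (fun p : G × G => F p.2) q (rightField ξ q)) =
        fun _ => 0 := funext fun q => (mvfderiv_comp_snd hF q _).trans (map_zero _)
    have e2 : (fun q : G × G => mvfderiv (IG.prod IG) (fun p : G × G => F p.2) q (leftField η q)) =
        fun q => leftAct η F q.2 := funext fun q => mvfderiv_comp_snd hF q _
    rw [e1, e2, c, mvfderiv_comp_snd (leftAct_smooth η hF), mvfderiv_comp_snd hF] at h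
    refine h.trans (Eq.trans ?_ (map_zero _).symm)
    exact (congrArg (fun a : ℝ => a - 0) (map_zero _)).trans (sub_zero 0)

theorem mvfderiv_comp_mul_rightField {F : G → ℝ} (hF : ContMDiff IG 𝓘(ℝ, ℝ) ∞ F)
    (ξ : GroupLieAlgebra IG G) (p : G × G) :
    mvfderiv (IG.prod IG) (fun p : G × G => F (p.1 * p.2)) p (rightField ξ p) =
      rightAct ξ F (p.1 * p.2) := by
  refine (mvfderiv_comp_mul hF p _).trans (congrArg (mvfderiv IG F (p.1 * p.2)) ?_)
  exact (congrArg₂ (fun a b : TangentSpace IG (p.1 * p.2) => a + b)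
    (dRight_rightInvariantVectorField p.1 p.2 ξ) (map_zero _)).trans (add_zero _)

theorem mvfderiv_comp_mul_leftField {F : G → ℝ} (hF : ContMDiff IG 𝓘(ℝ, ℝ) ∞ F)
    (ξ : GroupLieAlgebra IG G) (p : G × G) :
    mvfderiv (IG.prod IG) (fun p : G × G => F (p.1 * p.2)) p (leftField ξ p) =
      leftAct ξ F (p.1 * p.2) := by
  refine (mvfderiv_comp_mul hF p _).trans (congrArg (mvfderiv IG F (p.1 * p.2)) ?_)
  exact (congrArg₂ (fun a b : TangentSpace IG (p.1 * p.2) => a + b)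
    (map_zero _) (dLeft_mulInvariantVectorField p.1 p.2 ξ)).trans (zero_add _)

/-- Under multiplication `G × G → G` the right-invariant field is the image of a field on the first
factor and the left-invariant one of a field on the second. Fields on different factors commute, and
the point `(g, 1)` lies over `g`. -/
theorem rightAct_leftAct [IG.Boundaryless] (ξ η : GroupLieAlgebra IG G) {F : G → ℝ}
    (hF : ContMDiff IG 𝓘(ℝ, ℝ) ∞ F) (g : G) :
    rightAct ξ (leftAct η F) g = leftAct η (rightAct ξ F) g := by
  have := t2Space_of_lieGroup IG G
  have hr := rightField_smooth (IG := IG) ξ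
  have hl := leftField_smooth (IG := IG) η
  have hF' : ContMDiff (IG.prod IG) 𝓘(ℝ, ℝ) ∞ (fun p : G × G => F (p.1 * p.2)) :=
    hF.comp (contMDiff_mul IG ∞)
  have h := mvfderiv_mlieBracket hr hl hF' (contMDiff_mvfderiv_apply hF' hr)
    (contMDiff_mvfderiv_apply hF' hl) (g, 1)
  have e1 := funext fun q => mvfderiv_comp_mul_rightField hF ξ q
  have e2 := funext fun q => mvfderiv_comp_mul_leftField hF η q
  rw [e1, e2, mlieBracket_rightField_leftField, map_zero,
    mvfderiv_comp_mul_rightField (leftAct_smooth η hF),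
    mvfderiv_comp_mul_leftField (rightAct_smooth ξ hF)] at h
  have h1 := sub_eq_zero.1 h.symm
  simp only [mul_one] at h1
  exact h1

/-! ### The Maurer-Cartan form -/

/-- The inverse of a left translation is the translation by the inverse. Both sides are viewed as
maps of `EG` because the target points `1` and `g⁻¹ * g` differ definitionally. -/
theorem thetaL_eq (g : G) : (show EG →L[ℝ] EG from thetaL (IG := IG) g) = dLeft (IG := IG) g⁻¹ g := by
  have : LieGroup IG (minSmoothness ℝ 3) G := by
    rw [minSmoothness_of_isRCLikeNormedField]
    infer_instance
  have h := inverse_mfderiv_mul_left (I := IG) (g := g) (h := (1 : G))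
  rw [mul_one] at h
  exact h

theorem dLeft_dLeft (g h k : G) (v : TangentSpace IG k) :
    (show EG from dLeft g (h * k) (dLeft h k v)) = dLeft (g * h) k v := by
  have h1 := mfderiv_comp k (mdifferentiable_mul_left' (IG := IG) g (h * k))
    (mdifferentiable_mul_left' (IG := IG) h k)
  have h2 : (fun k : G => g * k) ∘ (fun k : G => h * k) = fun k => (g * h) * k :=
    funext fun k => (mul_assoc g h k).symm
  rw [h2] at h1
  exact congrArg (fun L : EG →L[ℝ] EG => L v) h1.symm

theorem dLeft_one (k : G) (v : TangentSpace IG k) : (show EG from dLeft 1 k v) = v := by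
  have h2 : (fun k : G => 1 * k) = id := funext fun k => one_mul k
  have h3 : (show EG →L[ℝ] EG from mfderiv IG IG (fun k : G => 1 * k) k) =
      ContinuousLinearMap.id ℝ EG := by
    rw [h2, mfderiv_id]
    rfl
  exact congrArg (fun L : EG →L[ℝ] EG => L v) h3

theorem thetaL_mulInvariantVectorField (ξ : GroupLieAlgebra IG G) (g : G) :
    thetaL g (mulInvariantVectorField ξ g) = ξ := by
  have h := dLeft_mulInvariantVectorField g⁻¹ g ξ
  refine (congrArg (fun L : EG →L[ℝ] EG => L (mulInvariantVectorField ξ g)) (thetaL_eq g)).trans ?_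
  refine h.trans ?_
  rw [inv_mul_cancel]
  exact dLeft_one (1 : G) ξ

theorem mulInvariantVectorField_thetaL (g : G) (v : TangentSpace IG g) :
    mulInvariantVectorField (thetaL g v) g = v := by
  have e := congrArg (fun L : EG →L[ℝ] EG => L v) (thetaL_eq (IG := IG) g)
  have h := dLeft_dLeft (IG := IG) g g⁻¹ g v
  rw [inv_mul_cancel, mul_inv_cancel] at h
  exact (congrArg (fun w : EG => (mfderiv IG IG (fun k : G => g * k) 1 : EG →L[ℝ] EG) w) e).trans
    (h.trans (dLeft_one g v))

/-- With `a = ⟨ξ, ·⟩`, such a function makes `d(F∘Φ)` equal to `i(ξ)` at a chosen point. -/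
theorem exists_leftAct_eq (g : G) (a : GroupLieAlgebra IG G →L[ℝ] ℝ) :
    ∃ F : G → ℝ, ContMDiff IG 𝓘(ℝ, ℝ) ∞ F ∧ ∀ ξ, leftAct ξ F g = a ξ := by
  have := t2Space_of_lieGroup IG G
  obtain ⟨F, hF, hd⟩ := exists_smooth_mvfderiv (I := IG) g (a.comp (thetaL g))
  refine ⟨F, hF, fun ξ => ?_⟩
  rw [leftAct, hd]
  exact congrArg a (thetaL_mulInvariantVectorField ξ g)

end

section

variable {EG : Type*} [NormedAddCommGroup EG] [NormedSpace ℝ EG] [FiniteDimensional ℝ EG]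
  {HG : Type*} [TopologicalSpace HG] {IG : ModelWithCorners ℝ EG HG}
  {G : Type*} [TopologicalSpace G] [ChartedSpace HG G] [Group G] [LieGroup IG ∞ G]

/-! ### The one-forms `i(ξ)` -/

section

variable {ι V : Type*} [Fintype ι] [AddCommGroup V] [Module ℝ V]

theorem sum_sub_smul_cancel (l r a : ι → ℝ) (v w : ι → V) :
    - ∑ i, (a i • w i + r i • v i) - ∑ i, (l i - r i) • v i =
      - ∑ i, l i • v i - ∑ i, a i • w i := by
  simp only [sub_smul, Finset.sum_add_distrib, Finset.sum_sub_distrib]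
  abel

theorem sum_neg_sum_smul (a : ι → ℝ) (m : ι → ι → ℝ) (v : ι → V) {c : ι → ℝ}
    (hc : ∀ i, c i = - ∑ k, a k * m i k) :
    ∑ i, c i • v i = - ∑ k, a k • ∑ i, m i k • v i := by
  simp only [hc, neg_smul, Finset.sum_smul, Finset.smul_sum, Finset.sum_neg_distrib, mul_smul]
  rw [Finset.sum_comm]

end

theorem leftAct_eq_sum (B : InvariantForm IG G) (ξ : GroupLieAlgebra IG G) (F : G → ℝ) (g : G) :
    leftAct ξ F g = ∑ i, B.form ξ (B.dualBasis i) * leftAct (B.basis i) F g := by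
  have h : ∀ η, leftAct η F g = ((mvfderiv IG F g).comp (leftTranslation g) :
    GroupLieAlgebra IG G →L[ℝ] ℝ) η := fun η => rfl
  conv_lhs => rw [← B.sum_form_dualBasis_smul ξ]
  simp only [h, map_sum, map_smul, smul_eq_mul]

theorem rightAct_eq_sum (B : InvariantForm IG G) (ξ : GroupLieAlgebra IG G) (F : G → ℝ) (g : G) :
    rightAct ξ F g = ∑ i, B.form ξ (B.dualBasis i) * rightAct (B.basis i) F g := by
  have h : ∀ η, rightAct η F g = ((mvfderiv IG F g).comp
    (show GroupLieAlgebra IG G →L[ℝ] TangentSpace IG g from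
      mfderiv IG IG (fun h : G => h * g) (1 : G)) : GroupLieAlgebra IG G →L[ℝ] ℝ) η := fun η => rfl
  conv_lhs => rw [← B.sum_form_dualBasis_smul ξ]
  simp only [h, map_sum, map_smul, smul_eq_mul]

theorem mvfderiv_leftAct (F : G → ℝ) (g : G) (v : TangentSpace IG g) :
    mvfderiv IG F g v = leftAct (thetaL g v) F g := by
  rw [leftAct, mulInvariantVectorField_thetaL]

namespace HamData

open SmoothManifold

variable {M N P Q : HamData.{u} IG G} {B : InvariantForm IG G}

theorem iForm_apply (x : M.mfd.carrier) (ξ : GroupLieAlgebra IG G) (v : M.mfd.T x) :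
    (M.iForm B x ξ v : ℝ) = B.form ξ (thetaL (M.moment x) (M.dMoment x v)) := rfl

theorem iForm_eq_sum (x : M.mfd.carrier) (ξ : GroupLieAlgebra IG G) :
    M.iForm B x ξ = ∑ i, B.form ξ (B.basis i) • M.iForm B x (B.dualBasis i) := by
  conv_lhs => rw [← B.sum_form_basis_smul ξ]
  simp only [map_sum, map_smul]

namespace IsHamiltonian

variable (h : M.IsHamiltonian B)
include h

theorem comp_moment_smooth {F : G → ℝ} (hF : ContMDiff IG 𝓘(ℝ, ℝ) ∞ F) :
    M.mfd.SmoothFun (fun y => F (M.moment y)) := hF.comp h.moment_smooth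

theorem d_comp_moment {F : G → ℝ} (hF : ContMDiff IG 𝓘(ℝ, ℝ) ∞ F) (x : M.mfd.carrier) :
    M.mfd.d (fun y => F (M.moment y)) x =
      (show M.mfd.T x →L[ℝ] ℝ from (mvfderiv IG F (M.moment x)).comp (M.dMoment x)) :=
  mvfderiv_comp x (I := IG) (I' := M.mfd.model) (g := F) (f := M.moment)
    (hF.mdifferentiableAt (by simp)) (h.moment_smooth.mdifferentiableAt (by simp))

/-- The `i(ξ)` need not be closed, whereas brackets are known on exact forms. This expansion
transfers information from the exact forms `d(F∘Φ)` to the `i(e^i)`. -/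
theorem d_comp_moment_eq_sum {F : G → ℝ} (hF : ContMDiff IG 𝓘(ℝ, ℝ) ∞ F) (x : M.mfd.carrier) :
    M.mfd.d (fun y => F (M.moment y)) x =
      ∑ i, leftAct (B.basis i) F (M.moment x) • M.iForm B x (B.dualBasis i) := by
  rw [h.d_comp_moment hF]
  refine ContinuousLinearMap.ext fun v => ?_
  refine (mvfderiv_leftAct F _ (M.dMoment x v)).trans ?_
  rw [leftAct_eq_sum B]
  refine Eq.trans ?_ (sum_apply _ _ _).symm
  refine Finset.sum_congr rfl fun i _ => ?_
  refine (mul_comm _ _).trans (congrArg (fun c : ℝ => leftAct (B.basis i) F (M.moment x) * c) ?_)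
  exact B.form_comm _ _

theorem iForm_smooth (ξ : GroupLieAlgebra IG G) : M.mfd.SmoothForm (fun x => M.iForm B x ξ) := by
  refine smoothForm_of_apply fun X hX => ?_
  have h1 : ContMDiff M.mfd.model IG.tangent ∞
      (fun x => (⟨M.moment x, M.dMoment x (X x)⟩ : TangentBundle IG G)) :=
    (h.moment_smooth.contMDiff_tangentMap (m := ∞) (by simp)).comp hX
  have h2 : ContMDiff M.mfd.model IG.tangent ∞
      (fun x => (⟨(M.moment x)⁻¹, 0⟩ : TangentBundle IG G)) :=
    contMDiff_tangent_zero.comp (h.moment_smooth.inv)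
  -- Multiplying `dΦ(X)` by the zero vector at `Φ⁻¹` translates it to the unit, which is the value
  -- of `θ^L`.
  have h3 := contMDiff_tangent_mul h2 h1
  have h4 : ContMDiff M.mfd.model IG.tangent ∞
      (fun x => (⟨1, thetaL (M.moment x) (M.dMoment x (X x))⟩ : TangentBundle IG G)) := by
    refine ContMDiff.congr h3 fun x => tangentBundle_mk_congr (inv_mul_cancel _).symm ?_
    refine (congrArg (fun L : EG →L[ℝ] EG => L (M.dMoment x (X x)))
      (thetaL_eq (IG := IG) (M.moment x))).trans ?_
    change _ = (dRight (M.moment x) (M.moment x)⁻¹ 0 +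
      dLeft (M.moment x)⁻¹ (M.moment x) (M.dMoment x (X x)) :
        TangentSpace IG ((M.moment x)⁻¹ * M.moment x))
    rw [map_zero, zero_add]
    rfl
  have := t2Space_of_lieGroup IG G
  -- The tangent map of a function with this differential at `1` pairs tangent vectors at the unit
  -- with `ξ` in a smooth way.
  obtain ⟨F, hF, hd⟩ := exists_smooth_mvfderiv (I := IG) (1 : G) (B.flat ξ)
  have h5 : ContMDiff IG.tangent 𝓘(ℝ, ℝ).tangent ∞ (tangentMap IG 𝓘(ℝ, ℝ) F) :=
    hF.contMDiff_tangentMap (m := ∞) (by simp)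
  have h6 := (contMDiff_snd_tangentBundle_modelSpace ℝ 𝓘(ℝ, ℝ) (n := ∞)).comp (h5.comp h4)
  refine ContMDiff.congr h6 fun x => ?_
  exact congrArg (fun a : GroupLieAlgebra IG G →L[ℝ] ℝ =>
    a (thetaL (M.moment x) (M.dMoment x (X x)))) hd.symm

theorem act_comp_moment {F : G → ℝ} (hF : ContMDiff IG 𝓘(ℝ, ℝ) ∞ F) (ξ : GroupLieAlgebra IG G)
    (x : M.mfd.carrier) :
    M.act ξ (fun y => F (M.moment y)) x = leftAct ξ F (M.moment x) - rightAct ξ F (M.moment x) := by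
  rw [act, h.d_comp_moment hF]
  refine (congrArg (mvfderiv IG F (M.moment x)) (h.moment_equivariant ξ x)).trans ?_
  exact map_sub (mvfderiv IG F (M.moment x)) _ _

/-- The moment map condition contributes `½(ξ^L + ξ^R)`, and by equivariance `½ρ∘ρ^*` contributes
`½(ξ^L - ξ^R)`. Only the left-invariant part survives, which is why `i` is defined with `θ^L`. -/
theorem cotAnchor_comp_dMoment (x : M.mfd.carrier) (a : TangentSpace IG (M.moment x) →L[ℝ] ℝ)
    (ζ : GroupLieAlgebra IG G)
    (hζ : ∀ ξ, B.form ζ ξ = a (mulInvariantVectorField ξ (M.moment x))) :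
    M.cotAnchor B x (show M.mfd.T x →L[ℝ] ℝ from a.comp (M.dMoment x)) = M.action ζ x := by
  have e : ζ = B.sharp (bStar (M.moment x) a) + (2⁻¹ : ℝ) •
      M.rhoStar B x (show M.mfd.T x →L[ℝ] ℝ from a.comp (M.dMoment x)) := by
    refine B.ext_form fun ξ => ?_
    rw [map_add, LinearMap.add_apply, B.form_sharp, bStar_apply, map_smul, LinearMap.smul_apply,
      rhoStar_comp_dMoment h, hζ, smul_eq_mul]
    ring
  have h1 := h.moment_map x a
  rw [e]
  change _ = M.actionAt x _
  rw [map_add, map_smul]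
  exact congrArg (fun v : M.mfd.T x => v + _) h1

theorem cotAnchor_iForm (x : M.mfd.carrier) (ξ : GroupLieAlgebra IG G) :
    M.cotAnchor B x (M.iForm B x ξ) = M.action ξ x := by
  refine h.cotAnchor_comp_dMoment x ((B.flat ξ).comp (thetaL (M.moment x))) ξ fun η => ?_
  exact (congrArg (B.form ξ) (thetaL_mulInvariantVectorField η (M.moment x))).symm

theorem ham_comp_moment_left {F : G → ℝ} (hF : ContMDiff IG 𝓘(ℝ, ℝ) ∞ F) (g : M.mfd.carrier → ℝ)
    (x : M.mfd.carrier) :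
    M.ham B (fun y => F (M.moment y)) g x = leftAct (M.rhoD B g x) F (M.moment x) := by
  rw [← d_anchor_d, h.d_comp_moment_eq_sum hF, leftAct_eq_sum B, map_sum]
  refine (map_sum (show M.mfd.T x →L[ℝ] ℝ from M.mfd.d g x) _ _).trans ?_
  refine Finset.sum_congr rfl fun i _ => ?_
  rw [map_smul, h.cotAnchor_iForm, form_rhoD]
  exact (map_smul (show M.mfd.T x →L[ℝ] ℝ from M.mfd.d g x) _ _).trans (mul_comm _ _)

/-- Exchanging the arguments of `ham` adds the pairing, which is the left minus the right derivative
by equivariance. The left derivatives cancel. -/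
theorem ham_comp_moment_right {F : G → ℝ} (hF : ContMDiff IG 𝓘(ℝ, ℝ) ∞ F) (g : M.mfd.carrier → ℝ)
    (x : M.mfd.carrier) :
    M.ham B g (fun y => F (M.moment y)) x = - rightAct (M.rhoD B g x) F (M.moment x) := by
  rw [h.ham_swap, h.ham_comp_moment_left hF, form_rhoD, h.act_comp_moment hF]
  ring

theorem cotBracket_sum_smul {ι : Type*} (t : Finset ι) {σ : ∀ x, M.mfd.Cot x}
    (hσ : M.mfd.SmoothForm σ) {u : ι → M.mfd.carrier → ℝ} (hu : ∀ i, M.mfd.SmoothFun (u i))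
    {τ : ι → ∀ x, M.mfd.Cot x} (hτ : ∀ i, M.mfd.SmoothForm (τ i)) (x : M.mfd.carrier) :
    M.cotBracket B σ (fun y => ∑ i ∈ t, u i y • τ i y) x =
      ∑ i ∈ t, (u i x • M.cotBracket B σ (τ i) x +
        (M.mfd.d (u i) x (M.cotAnchor B x (σ x)) : ℝ) • τ i x) :=
  h.isPreLie_cotangent.bracket_sum_smul t hσ hu hτ x

theorem cotBracket_iForm_eq_sum {σ : ∀ x, M.mfd.Cot x} (hσ : M.mfd.SmoothForm σ)
    (ξ : GroupLieAlgebra IG G) (x : M.mfd.carrier) :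
    M.cotBracket B σ (fun y => M.iForm B y ξ) x = ∑ i, B.form ξ (B.basis i) •
      M.cotBracket B σ (fun y => M.iForm B y (B.dualBasis i)) x := by
  rw [funext fun y => M.iForm_eq_sum (B := B) y ξ, h.cotBracket_sum_smul _ hσ
    (fun i => contMDiff_const) fun i => h.iForm_smooth _]
  refine Finset.sum_congr rfl fun i _ => ?_
  rw [d_const]
  exact (congrArg _ (zero_smul ℝ _)).trans (add_zero _)

theorem cotBracket_comp_moment {σ : ∀ x, M.mfd.Cot x} (hσ : M.mfd.SmoothForm σ)
    {F : G → ℝ} (hF : ContMDiff IG 𝓘(ℝ, ℝ) ∞ F) (x : M.mfd.carrier) :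
    M.cotBracket B σ (M.mfd.d (fun y => F (M.moment y))) x =
      ∑ i, leftAct (B.basis i) F (M.moment x) •
        M.cotBracket B σ (fun y => M.iForm B y (B.dualBasis i)) x +
      ∑ i, (M.mfd.d (fun y => leftAct (B.basis i) F (M.moment y)) x
        (M.cotAnchor B x (σ x)) : ℝ) • M.iForm B x (B.dualBasis i) := by
  rw [funext (h.d_comp_moment_eq_sum hF), h.cotBracket_sum_smul _ hσ
    (fun i => h.comp_moment_smooth (leftAct_smooth _ hF)) fun i => h.iForm_smooth _,
    Finset.sum_add_distrib]

variable [IG.Boundaryless]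

theorem cotBracket_d_comp_moment {g : M.mfd.carrier → ℝ} (hg : M.mfd.SmoothFun g)
    {F : G → ℝ} (hF : ContMDiff IG 𝓘(ℝ, ℝ) ∞ F) (x : M.mfd.carrier) :
    M.cotBracket B (M.mfd.d g) (M.mfd.d (fun y => F (M.moment y))) x =
      - ∑ i, leftAct (B.basis i) F (M.moment x) • M.mfd.d (M.act (B.dualBasis i) g) x
      - ∑ i, M.act (B.dualBasis i) g x •
        M.mfd.d (fun y => rightAct (B.basis i) F (M.moment y)) x := by
  have hR := fun i => h.comp_moment_smooth (rightAct_smooth (B.basis i) hF)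
  have e1 : M.ham B g (fun y => F (M.moment y)) = fun y => - ∑ i, M.act (B.dualBasis i) g y *
      rightAct (B.basis i) F (M.moment y) := by
    funext y
    rw [h.ham_comp_moment_right hF, rightAct_eq_sum B]
    simp only [form_rhoD]
  have e2 : h.dAct hg x (M.rhoD B (fun y => F (M.moment y)) x) =
      ∑ i, (leftAct (B.basis i) F (M.moment x) - rightAct (B.basis i) F (M.moment x)) •
        M.mfd.d (M.act (B.dualBasis i) g) x := by
    rw [h.dAct_rhoD]
    simp only [h.act_comp_moment hF]
  have e3 := fun i => d_mul (h.act_smooth (B.dualBasis i) hg) (hR i) x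
  have hs : ∀ i, M.mfd.SmoothFun (fun y => M.act (B.dualBasis i) g y *
    rightAct (B.basis i) F (M.moment y)) := fun i =>
      ContMDiff.mul (h.act_smooth (B.dualBasis i) hg) (hR i)
  rw [h.cotBracket_d hg (h.comp_moment_smooth hF), e1, e2, d_neg, d_sum _ hs]
  simp only [e3]
  exact sum_sub_smul_cancel _ _ _ _ _

/-- The bracket `[dg, d(F∘Φ)]` is computed from the function formula, and again by the Leibniz rule
from the expansion in the `i(e^i)`. The derivatives of the coefficients match because left- and
right-invariant fields commute, so only the brackets `[dg, i(e^i)]` are left. -/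
theorem cotBracket_d_iForm {g : M.mfd.carrier → ℝ} (hg : M.mfd.SmoothFun g)
    (ξ : GroupLieAlgebra IG G) (x : M.mfd.carrier) :
    M.cotBracket B (M.mfd.d g) (fun y => M.iForm B y ξ) x = - M.mfd.d (M.act ξ g) x := by
  -- `F` is adapted to the single point `x`: the coefficients of `d(F∘Φ)` at `x` become the
  -- coordinates of `ξ`.
  obtain ⟨F, hF, hd⟩ := exists_leftAct_eq (IG := IG) (M.moment x) (B.flat ξ)
  have hd' : ∀ η, leftAct η F (M.moment x) = B.form ξ η := hd
  have h1 := h.cotBracket_d_comp_moment hg hF x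
  rw [h.cotBracket_comp_moment (smoothForm_d hg) hF] at h1
  have e1 : ∑ i, (M.mfd.d (fun y => leftAct (B.basis i) F (M.moment y)) x
        (M.cotAnchor B x (M.mfd.d g x)) : ℝ) • M.iForm B x (B.dualBasis i) =
      - ∑ i, M.act (B.dualBasis i) g x •
        M.mfd.d (fun y => rightAct (B.basis i) F (M.moment y)) x := by
    have e2 : ∀ i, (M.mfd.d (fun y => leftAct (B.basis i) F (M.moment y)) x
        (M.cotAnchor B x (M.mfd.d g x)) : ℝ) = - ∑ k, M.act (B.dualBasis k) g x *
          leftAct (B.basis i) (rightAct (B.basis k) F) (M.moment x) := fun i => by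
      refine (d_anchor_d g _ x).trans ?_
      rw [h.ham_comp_moment_right (leftAct_smooth _ hF), rightAct_eq_sum B]
      simp only [form_rhoD, rightAct_leftAct _ _ hF]
    simp only [fun i => h.d_comp_moment_eq_sum (rightAct_smooth (B.basis i) hF) x]
    exact sum_neg_sum_smul (V := M.mfd.Cot x) _ _ _ e2
  rw [e1, ← sub_eq_add_neg, sub_left_inj] at h1
  simp only [hd'] at h1
  rw [h.cotBracket_iForm_eq_sum (smoothForm_d hg), h1, neg_inj]
  have h2 := congrArg (h.dAct hg x) (B.sum_form_basis_smul ξ)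
  simp only [map_sum, map_smul, dAct_apply] at h2
  exact h2

/-- The bracket of `i(ζ)` with `d(F∘Φ)` is again computed in two ways, the first now being
`cotBracket_d_iForm`. The right-invariant terms cancel, and the rest is a commutator of
left-invariant derivations of `F`. -/
theorem cotBracket_iForm_iForm (ζ ξ : GroupLieAlgebra IG G) (x : M.mfd.carrier) :
    M.cotBracket B (fun y => M.iForm B y ζ) (fun y => M.iForm B y ξ) x = M.iForm B x ⁅ζ, ξ⁆ := by
  obtain ⟨F, hF, hd⟩ := exists_leftAct_eq (IG := IG) (M.moment x) (B.flat ξ)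
  have hd' : ∀ η, leftAct η F (M.moment x) = B.form ξ η := hd
  have hl := leftAct_smooth ζ hF
  have hr := rightAct_smooth ζ hF
  have h1 := h.cotBracket_comp_moment (h.iForm_smooth ζ) hF x
  rw [h.cotBracket_skew, h.cotBracket_d_iForm (h.comp_moment_smooth hF), neg_neg,
    funext (h.act_comp_moment hF ζ), d_sub (h.comp_moment_smooth hl) (h.comp_moment_smooth hr),
    h.d_comp_moment_eq_sum hl, h.d_comp_moment_eq_sum hr, h.cotAnchor_iForm] at h1
  have e2 : ∀ i, (M.mfd.d (fun y => leftAct (B.basis i) F (M.moment y)) x (M.action ζ x) : ℝ) =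
      leftAct ζ (leftAct (B.basis i) F) (M.moment x) -
        leftAct (B.basis i) (rightAct ζ F) (M.moment x) := fun i => by
    rw [← rightAct_leftAct _ _ hF]
    exact h.act_comp_moment (leftAct_smooth _ hF) ζ x
  simp only [hd', e2] at h1
  rw [h.cotBracket_iForm_eq_sum (h.iForm_smooth ζ), eq_sub_of_add_eq h1.symm,
    ← Finset.sum_sub_distrib, ← Finset.sum_sub_distrib, M.iForm_eq_sum (B := B) x ⁅ζ, ξ⁆]
  refine Finset.sum_congr rfl fun i _ => ?_
  have e3 := leftAct_leftAct (B.basis i) ζ hF (M.moment x)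
  have e4 : B.form ξ ⁅B.basis i, ζ⁆ = B.form ⁅ζ, ξ⁆ (B.basis i) := by
    rw [B.form_comm, form_lie_cyclic]
  rw [hd', e4] at e3
  have key : ∀ (a b c : ℝ) (v : M.mfd.Cot x), a • v - b • v - (c - b) • v = (a - c) • v :=
    fun a b c v => by module
  exact (key _ _ _ _).trans (congrArg (fun c : ℝ => c • M.iForm B x (B.dualBasis i)) e3)

end IsHamiltonian
end HamData
end

/-! ### Forms pulled back from the factors of a product. -/

namespace SmoothManifold

/-- The inclusion of the covectors of the first factor of a product. -/
abbrev fstPull (M N : SmoothManifold.{u}) (p : M.carrier × N.carrier) :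
    M.Cot p.1 →ₗ[ℝ] (M.prod N).Cot p := (M.prod N).pullCot M Prod.fst p

/-- The inclusion of the covectors of the second factor of a product. -/
abbrev sndPull (M N : SmoothManifold.{u}) (p : M.carrier × N.carrier) :
    N.Cot p.2 →ₗ[ℝ] (M.prod N).Cot p := (M.prod N).pullCot N Prod.snd p

variable {M N : SmoothManifold.{u}}

theorem fstPull_d {f : M.carrier → ℝ} (hf : M.SmoothFun f) (p : M.carrier × N.carrier) :
    M.fstPull N p (M.d f p.1) = (M.prod N).d (fun p => f p.1) p := pullCot_d smooth_fst hf p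

theorem sndPull_d {f : N.carrier → ℝ} (hf : N.SmoothFun f) (p : M.carrier × N.carrier) :
    M.sndPull N p (N.d f p.2) = (M.prod N).d (fun p => f p.2) p := pullCot_d smooth_snd hf p

theorem sndPull_smooth {β : ∀ y, N.Cot y} (hβ : N.SmoothForm β) :
    (M.prod N).SmoothForm (fun p => M.sndPull N p (β p.2)) :=
  smooth_of_generatesSections (V := N.Cot) (V' := (M.prod N).Cot) generatesSections_exactForms
    (smooth_snd (M := M) (N := N)) (M.sndPull N) (by
      rintro _ ⟨f, hf, rfl⟩
      have h := smoothForm_d (smoothFun_snd (M := M) hf)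
      exact ContMDiff.congr h fun p => congrArg (TotalSpace.mk (F := (M.prod N).E →L[ℝ] ℝ)
        (E := (M.prod N).Cot) p) (sndPull_d hf p)) β hβ

end SmoothManifold

section

variable {EG : Type*} [NormedAddCommGroup EG] [NormedSpace ℝ EG] [FiniteDimensional ℝ EG]
  {HG : Type*} [TopologicalSpace HG] {IG : ModelWithCorners ℝ EG HG}
  {G : Type*} [TopologicalSpace G] [ChartedSpace HG G] [Group G] [LieGroup IG ∞ G]

namespace HamData

open SmoothManifold

variable {M N P Q : HamData.{u} IG G} {B : InvariantForm IG G}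

/-! ### The Lie algebroid of a fusion product -/

variable (B M N) in
/-- The anchor of the Lie algebroid of a fusion product. -/
def fusionAnchor (p : M.mfd.carrier × N.mfd.carrier) :
    (M.mfd.prod N.mfd).Cot p →ₗ[ℝ] (M.mfd.prod N.mfd).T p := (M.fusion B N).cotAnchor B p

variable (B M N) in
/-- The bracket of the Lie algebroid of a fusion product. -/
def fusionBracket (α β : ∀ p, (M.mfd.prod N.mfd).Cot p) (p : M.mfd.carrier × N.mfd.carrier) :
    (M.mfd.prod N.mfd).Cot p := (M.fusion B N).cotBracket B α β p

theorem d_fst_fusionAnchor_fst {k : M.mfd.carrier → ℝ} (hk : M.mfd.SmoothFun k)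
    (p : M.mfd.carrier × N.mfd.carrier) (a : M.mfd.Cot p.1) :
    ((M.mfd.prod N.mfd).d (fun p => k p.1) p
      (fusionAnchor M N B p (M.mfd.fstPull N.mfd p a)) : ℝ) = M.mfd.d k p.1 (M.cotAnchor B p.1 a) :=
  (d_comp_apply smooth_fst hk p _).trans (congrArg (fun v => (M.mfd.d k p.1 v : ℝ))
    ((isQuasiPoissonMap_fst (M := M) (N := N) (B := B)).D_cotAnchor p a))

theorem d_snd_fusionAnchor_snd {k : N.mfd.carrier → ℝ} (hk : N.mfd.SmoothFun k)
    (p : M.mfd.carrier × N.mfd.carrier) (b : N.mfd.Cot p.2) :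
    ((M.mfd.prod N.mfd).d (fun p => k p.2) p
      (fusionAnchor M N B p (M.mfd.sndPull N.mfd p b)) : ℝ) = N.mfd.d k p.2 (N.cotAnchor B p.2 b) :=
  (d_comp_apply smooth_snd hk p _).trans (congrArg (fun v => (N.mfd.d k p.2 v : ℝ))
    ((isQuasiPoissonMap_snd (M := M) (N := N) (B := B)).D_cotAnchor p b))

/-- Half of the pairing comes from the cross bivector and half from `½ρ∘ρ^*`. -/
theorem fusion_ham_fst_snd {f : M.mfd.carrier → ℝ} (hf : M.mfd.SmoothFun f)
    {g : N.mfd.carrier → ℝ} (hg : N.mfd.SmoothFun g) (p : M.mfd.carrier × N.mfd.carrier) :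
    (M.fusion B N).ham B (fun p => f p.1) (fun p => g p.2) p =
      B.form (M.rhoD B f p.1) (N.rhoD B g p.2) := by
  have h1 := fusion_poisson_fst_snd (B := B) hf hg p
  have h2 := fusion_rhoD_fst (B := B) (N := N) hf p
  have h3 := fusion_rhoD_snd (B := B) (M := M) hg p
  have h4 := congrArg₂ (fun a b => B.form a b) h2 h3
  have key : ∀ {a b c : ℝ}, a = 2⁻¹ * c → b = c → a + 2⁻¹ * b = c := fun h h' => by
    rw [h, h']; ring
  exact key h1 h4

theorem d_snd_fusionAnchor_fst {k : N.mfd.carrier → ℝ} (hk : N.mfd.SmoothFun k)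
    (p : M.mfd.carrier × N.mfd.carrier) (a : M.mfd.Cot p.1) :
    ((M.mfd.prod N.mfd).d (fun p => k p.2) p
      (fusionAnchor M N B p (M.mfd.fstPull N.mfd p a)) : ℝ) =
      N.act (M.rhoStar B p.1 a) k p.2 := by
  obtain ⟨f, hf, rfl⟩ := exists_d_eq p.1 a
  rw [fstPull_d hf, ← N.form_rhoD' B]
  refine (d_anchor_d (M := M.fusion B N) (B := B) (fun p => f p.1) (fun p => k p.2) p).trans ?_
  exact fusion_ham_fst_snd hf hk p

section Hamiltonian

variable (hM : M.IsHamiltonian B) (hN : N.IsHamiltonian B)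
include hM hN

/-- In this order the two halves have opposite signs. So the anchors of forms from `N` are tangent
to `N`, while those of forms from `M` also move `N` through `ρ_N`; this asymmetry is what `J`
corrects. -/
theorem d_fst_fusionAnchor_snd {k : M.mfd.carrier → ℝ} (hk : M.mfd.SmoothFun k)
    (p : M.mfd.carrier × N.mfd.carrier) (b : N.mfd.Cot p.2) :
    ((M.mfd.prod N.mfd).d (fun p => k p.1) p
      (fusionAnchor M N B p (M.mfd.sndPull N.mfd p b)) : ℝ) = 0 := by
  obtain ⟨f, hf, rfl⟩ := exists_d_eq p.2 b
  rw [sndPull_d hf]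
  refine (d_anchor_d (M := M.fusion B N) (B := B) (fun p => f p.2) (fun p => k p.1) p).trans ?_
  refine ((isHamiltonian_fusion hM hN).ham_swap _ _ p).trans ?_
  have h1 := fusion_ham_fst_snd (B := B) hk hf p
  have h4 := congrArg₂ (fun a b => B.form a b) (fusion_rhoD_fst (B := B) (N := N) hk p)
    (fusion_rhoD_snd (B := B) (M := M) hf p)
  have key : ∀ {a b c : ℝ}, a = c → b = c → -a + b = 0 := fun h h' => by rw [h, h']; ring
  exact key h1 h4

theorem fusionBracket_skew (α β : ∀ p, (M.mfd.prod N.mfd).Cot p)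
    (p : M.mfd.carrier × N.mfd.carrier) :
    fusionBracket M N B α β p = - fusionBracket M N B β α p :=
  (isHamiltonian_fusion hM hN).cotBracket_skew α β p

theorem fusionBracket_add {α β γ : ∀ p, (M.mfd.prod N.mfd).Cot p}
    (hα : (M.mfd.prod N.mfd).SmoothForm α) (hβ : (M.mfd.prod N.mfd).SmoothForm β)
    (hγ : (M.mfd.prod N.mfd).SmoothForm γ) (p : M.mfd.carrier × N.mfd.carrier) :
    fusionBracket M N B α (fun p => β p + γ p) p =
      fusionBracket M N B α β p + fusionBracket M N B α γ p :=
  (isHamiltonian_fusion hM hN).cotBracket_add hα hβ hγ p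

theorem fusionBracket_sum_smul {ι : Type*} (t : Finset ι) {σ : ∀ p, (M.mfd.prod N.mfd).Cot p}
    (hσ : (M.mfd.prod N.mfd).SmoothForm σ) {u : ι → M.mfd.carrier × N.mfd.carrier → ℝ}
    (hu : ∀ i, (M.mfd.prod N.mfd).SmoothFun (u i))
    {τ : ι → ∀ p, (M.mfd.prod N.mfd).Cot p} (hτ : ∀ i, (M.mfd.prod N.mfd).SmoothForm (τ i))
    (p : M.mfd.carrier × N.mfd.carrier) :
    fusionBracket M N B σ (fun y => ∑ i ∈ t, u i y • τ i y) p =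
      ∑ i ∈ t, (u i p • fusionBracket M N B σ (τ i) p +
        ((M.mfd.prod N.mfd).d (u i) p (fusionAnchor M N B p (σ p)) : ℝ) • τ i p) :=
  (isHamiltonian_fusion hM hN).cotBracket_sum_smul t hσ hu hτ p

theorem fusionBracket_smul {σ τ : ∀ p, (M.mfd.prod N.mfd).Cot p}
    (hσ : (M.mfd.prod N.mfd).SmoothForm σ) {f : M.mfd.carrier × N.mfd.carrier → ℝ}
    (hf : (M.mfd.prod N.mfd).SmoothFun f) (hτ : (M.mfd.prod N.mfd).SmoothForm τ)
    (p : M.mfd.carrier × N.mfd.carrier) :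
    fusionBracket M N B σ (fun y => f y • τ y) p = f p • fusionBracket M N B σ τ p +
        ((M.mfd.prod N.mfd).d f p (fusionAnchor M N B p (σ p)) : ℝ) • τ p :=
  (isHamiltonian_fusion hM hN).isPreLie_cotangent.leibniz f σ τ hf hσ hτ p

theorem fusionBracket_fst_fst {f g : M.mfd.carrier → ℝ} (hf : M.mfd.SmoothFun f)
    (hg : M.mfd.SmoothFun g) (p : M.mfd.carrier × N.mfd.carrier) :
    fusionBracket M N B ((M.mfd.prod N.mfd).d (fun p => f p.1))
      ((M.mfd.prod N.mfd).d (fun p => g p.1)) p =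
      M.mfd.fstPull N.mfd p (M.cotBracket B (M.mfd.d f) (M.mfd.d g) p.1) :=
  ((isQuasiPoissonMap_fst (M := M) (N := N) (B := B)).pullCot_cotBracket_d
    (isHamiltonian_fusion hM hN) hM hf hg p).symm

theorem fusionBracket_snd_snd {α β : ∀ y, N.mfd.Cot y} (hα : N.mfd.SmoothForm α)
    (hβ : N.mfd.SmoothForm β) (p : M.mfd.carrier × N.mfd.carrier) :
    fusionBracket M N B (fun p => M.mfd.sndPull N.mfd p (α p.2))
      (fun p => M.mfd.sndPull N.mfd p (β p.2)) p =
      M.mfd.sndPull N.mfd p (N.cotBracket B α β p.2) :=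
  (congrFun (((isQuasiPoissonMap_snd (M := M) (N := N) (B := B)).isComorphism_cotangentMap
    (isHamiltonian_fusion hM hN) hN).bracket α β hα hβ) p).symm

/-- Here `ham` is the full pairing, whose differential has two terms by `d_form_rhoD`. The bracket
formula subtracts the one in which `f` is differentiated twice. -/
theorem fusionBracket_fst_d_snd {f : M.mfd.carrier → ℝ} (hf : M.mfd.SmoothFun f)
    {g : N.mfd.carrier → ℝ} (hg : N.mfd.SmoothFun g) (p : M.mfd.carrier × N.mfd.carrier) :
    fusionBracket M N B ((M.mfd.prod N.mfd).d (fun p => f p.1))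
      ((M.mfd.prod N.mfd).d (fun p => g p.2)) p =
      M.mfd.sndPull N.mfd p (N.mfd.d (N.act (M.rhoD B f p.1) g) p.2) := by
  have hK := isHamiltonian_fusion hM hN
  have hf' := smoothFun_fst (N := N.mfd) hf
  have hg' := smoothFun_snd (M := M.mfd) hg
  have e1 : (M.fusion B N).ham B (fun p => f p.1) (fun p => g p.2) = fun p =>
      B.form ((M.fusion B N).rhoD B (fun p => f p.1) p) ((M.fusion B N).rhoD B (fun p => g p.2) p) :=
    funext fun p => (fusion_ham_fst_snd hf hg p).trans
      (congrArg₂ (fun a b => B.form a b) (fusion_rhoD_fst (B := B) (N := N) hf p)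
        (fusion_rhoD_snd (B := B) (M := M) hg p)).symm
  have e2 := (congrArg (fun F => (M.fusion B N).mfd.d F p) e1).trans (hK.d_form_rhoD hf' hg' p)
  have e3 := hK.cotBracket_d hf' hg' p
  have e4 : hK.dAct hg' p ((M.fusion B N).rhoD B (fun p => f p.1) p) =
      M.mfd.sndPull N.mfd p (N.mfd.d (N.act (M.rhoD B f p.1) g) p.2) := by
    refine (congrArg (hK.dAct hg' p) (fusion_rhoD_fst hf p)).trans ?_
    rw [sndPull_d (hN.act_smooth _ hg)]
    exact congrArg (fun F => (M.mfd.prod N.mfd).d F p) (funext fun q => fusion_act_snd hg _ q)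
  have key : ∀ {a b c d : (M.mfd.prod N.mfd).Cot p}, a = b - c → b = d + c → a = d :=
    fun h h' => by rw [h, h', add_sub_cancel_right]
  exact (key e3 e2).trans e4

variable [IG.Boundaryless]

/-- As operators on forms from `N`, both sides satisfy the Leibniz rule with the same derivation of
functions, the field `ρ_N(ρ_M^*df)`. They agree on exact forms by `cotBracket_d_iForm`. The element
`ρ_M^*df` is frozen at the first coordinate of `p`. -/
theorem fusionBracket_fst_snd {f : M.mfd.carrier → ℝ} (hf : M.mfd.SmoothFun f)
    {β : ∀ y, N.mfd.Cot y} (hβ : N.mfd.SmoothForm β) (p : M.mfd.carrier × N.mfd.carrier) :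
    fusionBracket M N B ((M.mfd.prod N.mfd).d (fun p => f p.1))
      (fun p => M.mfd.sndPull N.mfd p (β p.2)) p =
      M.mfd.sndPull N.mfd p
        (N.cotBracket B (fun y => N.iForm B y (M.rhoD B f p.1)) β p.2) := by
  have hf' := smoothForm_d (smoothFun_fst (N := N.mfd) hf)
  have hi := hN.iForm_smooth (M.rhoD B f p.1)
  rw [← sub_eq_zero]
  refine (exactForms_attains (M := N) (B := B)).generates.eq_zero
    (fun β : ∀ y, N.mfd.Cot y => fusionBracket M N B ((M.mfd.prod N.mfd).d (fun p => f p.1))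
      (fun p => M.mfd.sndPull N.mfd p (β p.2)) p - M.mfd.sndPull N.mfd p
        (N.cotBracket B (fun y => N.iForm B y (M.rhoD B f p.1)) β p.2)) p.2 ?_ ?_ ?_ β hβ
  · intro σ τ hσ hτ
    have e1 := fusionBracket_add hM hN hf' (sndPull_smooth (M := M.mfd) hσ) (sndPull_smooth hτ) p
    have e2 := congrArg (M.mfd.sndPull N.mfd p) (hN.cotBracket_add hi hσ hτ p.2)
    have key : ∀ {a b c d e f : (M.mfd.prod N.mfd).Cot p}, a = b + c → d = e + f →
        a - d = (b - e) + (c - f) := fun h h' => by rw [h, h']; abel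
    exact key e1 (e2.trans (map_add _ _ _))
  · intro k σ hk hσ
    have e1 := fusionBracket_smul hM hN hf' (smoothFun_snd hk) (sndPull_smooth hσ) p
    have e2 := congrArg (M.mfd.sndPull N.mfd p)
      (hN.isPreLie_cotangent.leibniz k _ σ hk hi hσ p.2)
    have e3 : ((M.mfd.prod N.mfd).d (fun p => k p.2) p (fusionAnchor M N B p
        ((M.mfd.prod N.mfd).d (fun p => f p.1) p)) : ℝ) =
        N.mfd.d k p.2 (N.cotAnchor B p.2 (N.iForm B p.2 (M.rhoD B f p.1))) := by
      rw [← fstPull_d hf, d_snd_fusionAnchor_fst hk, hN.cotAnchor_iForm]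
      rfl
    have key : ∀ {c d d' : ℝ} {a b s x y : (M.mfd.prod N.mfd).Cot p}, a = c • x + d • s →
        b = c • y + d' • s → d = d' → a - b = c • (x - y) := fun h h' h'' => by
      rw [h, h', h'']; module
    exact key e1 (e2.trans ((map_add _ _ _).trans (congrArg₂ _ (map_smul _ _ _) (map_smul _ _ _)))) e3
  · rintro _ ⟨g, hg, rfl⟩
    have e1 : N.cotBracket B (fun y => N.iForm B y (M.rhoD B f p.1)) (N.mfd.d g) p.2 =
        N.mfd.d (N.act (M.rhoD B f p.1) g) p.2 := by
      rw [hN.cotBracket_skew, hN.cotBracket_d_iForm hg, neg_neg]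
    have e2 := fusionBracket_fst_d_snd hM hN hf hg p
    rw [← e1, ← funext (fun p => sndPull_d (M := M.mfd) hg p)] at e2
    exact sub_eq_zero.2 e2

end Hamiltonian
end HamData
end

/-! ### Brackets of the lifts `J(df, 0)`. -/

section

variable {EG : Type*} [NormedAddCommGroup EG] [NormedSpace ℝ EG] [FiniteDimensional ℝ EG]
  {HG : Type*} [TopologicalSpace HG] {IG : ModelWithCorners ℝ EG HG}
  {G : Type*} [TopologicalSpace G] [ChartedSpace HG G] [Group G] [LieGroup IG ∞ G]

namespace HamData

open SmoothManifold

variable {M N P Q : HamData.{u} IG G} {B : InvariantForm IG G}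

/-- This says on exact forms that `ρ^*` is a Lie algebroid morphism to `𝔤`: the values are bracketed
and differentiated along the anchors. It follows by pairing with `ξ` from the invariance `act_ham`.
-/
theorem IsHamiltonian.rhoStar_cotBracket_d (h : M.IsHamiltonian B) {f g : M.mfd.carrier → ℝ}
    (hf : M.mfd.SmoothFun f) (hg : M.mfd.SmoothFun g) (x : M.mfd.carrier) :
    M.rhoStar B x (M.cotBracket B (M.mfd.d f) (M.mfd.d g) x) =
      ⁅M.rhoD B f x, M.rhoD B g x⁆ + h.hamDeriv hg f x - h.hamDeriv hf g x := by
  refine B.ext_form fun ξ => ?_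
  have e1 : B.form (M.rhoStar B x (M.cotBracket B (M.mfd.d f) (M.mfd.d g) x)) ξ =
      M.act ξ (M.ham B f g) x - M.act ξ (M.act (M.rhoD B g x) f) x := by
    rw [form_rhoStar, h.cotBracket_d hf hg]
    rfl
  have e2 := h.act_ham hf hg ξ x
  have e3 := h.ham_swap (M.act ξ f) g x
  rw [form_rhoD'] at e3
  have e3' : B.form (M.rhoD B g x) (M.rhoD B (M.act ξ f) x) = M.act (M.rhoD B g x) (M.act ξ f) x :=
    M.form_rhoD' B _ x _
  have e4 := h.act_act (M.rhoD B g x) ξ hf x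
  rw [act_lie (B := B), form_lie_cyclic, form_lie_cyclic] at e4
  rw [map_sub, map_add, LinearMap.sub_apply, LinearMap.add_apply, h.form_hamDeriv hg,
    h.form_hamDeriv hf, e1]
  linarith

variable (B M N) in
/-- The one-form `J(df, 0)` on a fusion product. -/
def fusionLift (f : M.mfd.carrier → ℝ) (p : M.mfd.carrier × N.mfd.carrier) :
    (M.mfd.prod N.mfd).Cot p :=
  (M.mfd.prod N.mfd).d (fun p => f p.1) p + ∑ i, (-M.act (B.basis i) f p.1) •
    M.mfd.sndPull N.mfd p (N.iForm B p.2 (B.dualBasis i))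

theorem sum_act_smul_iForm (f : M.mfd.carrier → ℝ) (p : M.mfd.carrier × N.mfd.carrier) :
    ∑ i, M.act (B.basis i) f p.1 • M.mfd.sndPull N.mfd p (N.iForm B p.2 (B.dualBasis i)) =
      M.mfd.sndPull N.mfd p (N.iForm B p.2 (M.rhoD B f p.1)) := by
  rw [N.iForm_eq_sum p.2 (M.rhoD B f p.1), map_sum]
  refine Finset.sum_congr rfl fun i _ => ?_
  rw [map_smul, form_rhoD]

theorem fusionLift_eq {f : M.mfd.carrier → ℝ} (hf : M.mfd.SmoothFun f)
    (p : M.mfd.carrier × N.mfd.carrier) :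
    fusionLift M N B f p = M.mfd.fstPull N.mfd p (M.mfd.d f p.1) -
      M.mfd.sndPull N.mfd p (N.iForm B p.2 (M.rhoD B f p.1)) := by
  rw [← sum_act_smul_iForm, fstPull_d hf, sub_eq_add_neg, ← Finset.sum_neg_distrib]
  refine congrArg (fun a => (M.mfd.prod N.mfd).d (fun p => f p.1) p + a) ?_
  exact Finset.sum_congr rfl fun i _ => neg_smul (M.act (B.basis i) f p.1)
    (M.mfd.sndPull N.mfd p (N.iForm B p.2 (B.dualBasis i)))

section Hamiltonian

variable (hM : M.IsHamiltonian B) (hN : N.IsHamiltonian B)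
include hM hN

theorem iPull_smooth (ξ : GroupLieAlgebra IG G) : (M.mfd.prod N.mfd).SmoothForm
    (fun p => M.mfd.sndPull N.mfd p (N.iForm B p.2 ξ)) := sndPull_smooth (hN.iForm_smooth ξ)

theorem neg_act_smooth (ξ : GroupLieAlgebra IG G) {f : M.mfd.carrier → ℝ}
    (hf : M.mfd.SmoothFun f) :
    M.mfd.SmoothFun (fun x => -M.act ξ f x) := (hM.act_smooth ξ hf).neg

theorem fusionLift_smooth {f : M.mfd.carrier → ℝ} (hf : M.mfd.SmoothFun f) :
    (M.mfd.prod N.mfd).SmoothForm (fusionLift M N B f) :=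
  smoothForm_add (smoothForm_d (smoothFun_fst hf)) (smoothForm_sum _ fun i => smoothForm_smul
    (smoothFun_fst (neg_act_smooth hM hN (B.basis i) hf)) (iPull_smooth hM hN _))

theorem d_fst_fusionAnchor_lift {k f : M.mfd.carrier → ℝ} (hk : M.mfd.SmoothFun k)
    (hf : M.mfd.SmoothFun f) (p : M.mfd.carrier × N.mfd.carrier) :
    ((M.mfd.prod N.mfd).d (fun p => k p.1) p (fusionAnchor M N B p (fusionLift M N B f p)) : ℝ) =
      M.ham B f k p.1 := by
  have e1 := d_fst_fusionAnchor_fst (N := N) (B := B) hk p (M.mfd.d f p.1)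
  have e2 := d_fst_fusionAnchor_snd hM hN hk p (N.iForm B p.2 (M.rhoD B f p.1))
  rw [fusionLift_eq hf, map_sub]
  refine (map_sub (show (M.mfd.prod N.mfd).T p →L[ℝ] ℝ from
    (M.mfd.prod N.mfd).d (fun p => k p.1) p) _ _).trans ?_
  exact (congrArg₂ (fun a b : ℝ => a - b) (e1.trans (d_anchor_d f k p.1)) e2).trans (sub_zero _)

theorem fusionBracket_lift {σ : ∀ p, (M.mfd.prod N.mfd).Cot p}
    (hσ : (M.mfd.prod N.mfd).SmoothForm σ) {f : M.mfd.carrier → ℝ} (hf : M.mfd.SmoothFun f)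
    (p : M.mfd.carrier × N.mfd.carrier) :
    fusionBracket M N B σ (fusionLift M N B f) p =
      fusionBracket M N B σ ((M.mfd.prod N.mfd).d (fun p => f p.1)) p +
      ∑ i, ((-M.act (B.basis i) f p.1) • fusionBracket M N B σ
        (fun p => M.mfd.sndPull N.mfd p (N.iForm B p.2 (B.dualBasis i))) p +
        ((M.mfd.prod N.mfd).d (fun p => -M.act (B.basis i) f p.1) p
          (fusionAnchor M N B p (σ p)) : ℝ) •
          M.mfd.sndPull N.mfd p (N.iForm B p.2 (B.dualBasis i))) := by
  have h1 := fun i => smoothFun_fst (N := N.mfd) (neg_act_smooth hM hN (B.basis i) hf)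
  have h2 := fun i => iPull_smooth hM hN (B.dualBasis i)
  rw [← fusionBracket_sum_smul hM hN _ hσ h1 h2]
  exact fusionBracket_add hM hN hσ (smoothForm_d (smoothFun_fst hf))
    (smoothForm_sum _ fun i => smoothForm_smul (h1 i) (h2 i)) p

variable [IG.Boundaryless]

/-- The form `pr₁^*df` and the subtracted form `i_N(ρ_M^*df)` have the same bracket with a form from
`N`. The coefficients of the latter are functions on `M`, which the anchor of a form from `N` does
not differentiate. -/
theorem fusionBracket_snd_lift {β : ∀ y, N.mfd.Cot y} (hβ : N.mfd.SmoothForm β)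
    {f : M.mfd.carrier → ℝ} (hf : M.mfd.SmoothFun f) (p : M.mfd.carrier × N.mfd.carrier) :
    fusionBracket M N B (fun p => M.mfd.sndPull N.mfd p (β p.2)) (fusionLift M N B f) p = 0 := by
  have e1 : fusionBracket M N B (fun p => M.mfd.sndPull N.mfd p (β p.2))
      ((M.mfd.prod N.mfd).d (fun p => f p.1)) p = M.mfd.sndPull N.mfd p
        (N.cotBracket B β (fun y => N.iForm B y (M.rhoD B f p.1)) p.2) := by
    rw [fusionBracket_skew hM hN, fusionBracket_fst_snd hM hN hf hβ,
      hN.cotBracket_skew β, map_neg]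
  have e2 : ∀ i, ((M.mfd.prod N.mfd).d (fun p => -M.act (B.basis i) f p.1) p
      (fusionAnchor M N B p (M.mfd.sndPull N.mfd p (β p.2))) : ℝ) = 0 := fun i =>
    d_fst_fusionAnchor_snd hM hN (neg_act_smooth hM hN (B.basis i) hf) p _
  have e3 := fun i => fusionBracket_snd_snd hM hN hβ (hN.iForm_smooth (B.dualBasis i)) p
  rw [fusionBracket_lift hM hN (sndPull_smooth hβ) hf, e1, hN.cotBracket_iForm_eq_sum hβ, map_sum,
    ← Finset.sum_add_distrib]
  refine Finset.sum_eq_zero fun i _ => ?_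
  have key : ∀ {a b : ℝ} {v x y z : (M.mfd.prod N.mfd).Cot p}, b = 0 → x = v → z = a • x →
      z + ((-a) • v + b • y) = 0 := fun h h' h'' => by rw [h, h'', h']; module
  refine key (e2 i) (e3 i).symm ?_
  rw [map_smul, form_rhoD]

theorem fusionBracket_fst_lift {f g : M.mfd.carrier → ℝ} (hf : M.mfd.SmoothFun f)
    (hg : M.mfd.SmoothFun g) (p : M.mfd.carrier × N.mfd.carrier) :
    fusionBracket M N B ((M.mfd.prod N.mfd).d (fun p => g p.1)) (fusionLift M N B f) p =
      M.mfd.fstPull N.mfd p (M.cotBracket B (M.mfd.d g) (M.mfd.d f) p.1) -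
      M.mfd.sndPull N.mfd p (N.iForm B p.2
        (⁅M.rhoD B g p.1, M.rhoD B f p.1⁆ + hM.hamDeriv hf g p.1)) := by
  have e2 : ∀ i, ((M.mfd.prod N.mfd).d (fun p => -M.act (B.basis i) f p.1) p
      (fusionAnchor M N B p ((M.mfd.prod N.mfd).d (fun p => g p.1) p)) : ℝ) =
      -B.form (hM.hamDeriv hf g p.1) (B.basis i) := fun i => by
    rw [← fstPull_d hg]
    refine (d_fst_fusionAnchor_fst (neg_act_smooth hM hN (B.basis i) hf) p _).trans ?_
    rw [d_neg, hM.form_hamDeriv hf]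
    exact congrArg (fun a : ℝ => -a) (d_anchor_d g _ p.1)
  have e3 := fun i => fusionBracket_fst_snd hM hN hg (hN.iForm_smooth (B.dualBasis i)) p
  rw [fusionBracket_lift hM hN (smoothForm_d (smoothFun_fst hg)) hf,
    fusionBracket_fst_fst hM hN hg hf, sub_eq_add_neg]
  refine congrArg (fun a => M.mfd.fstPull N.mfd p
    (M.cotBracket B (M.mfd.d g) (M.mfd.d f) p.1) + a) ?_
  rw [map_add, ← hN.cotBracket_iForm_iForm, hN.cotBracket_iForm_eq_sum (hN.iForm_smooth _),
    N.iForm_eq_sum p.2 (hM.hamDeriv hf g p.1), ← Finset.sum_add_distrib, map_sum,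
    ← Finset.sum_neg_distrib]
  refine Finset.sum_congr rfl fun i _ => ?_
  rw [e3, map_add, map_smul, map_smul, form_rhoD]
  have key : ∀ {a b c : ℝ} {v w : (M.mfd.prod N.mfd).Cot p}, c = -b →
      (-a) • v + c • w = -(a • v + b • w) := fun h => by rw [h]; module
  exact key (e2 i)

/-- Expanding the second lift, the forms from `N` commute with the first lift, so they contribute
only through the derivatives of their coefficients. The total correction is `i_N` of the right side
of `rhoStar_cotBracket_d`. -/
theorem fusionBracket_lift_lift {f g : M.mfd.carrier → ℝ} (hf : M.mfd.SmoothFun f)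
    (hg : M.mfd.SmoothFun g) (p : M.mfd.carrier × N.mfd.carrier) :
    fusionBracket M N B (fusionLift M N B f) (fusionLift M N B g) p =
      M.mfd.fstPull N.mfd p (M.cotBracket B (M.mfd.d f) (M.mfd.d g) p.1) -
      M.mfd.sndPull N.mfd p (N.iForm B p.2
        (M.rhoStar B p.1 (M.cotBracket B (M.mfd.d f) (M.mfd.d g) p.1))) := by
  have e2 : ∀ i, ((M.mfd.prod N.mfd).d (fun p => -M.act (B.basis i) g p.1) p
      (fusionAnchor M N B p (fusionLift M N B f p)) : ℝ) =
      -B.form (hM.hamDeriv hg f p.1) (B.basis i) := fun i => by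
    refine (d_fst_fusionAnchor_lift hM hN (neg_act_smooth hM hN (B.basis i) hg) hf p).trans ?_
    rw [hM.form_hamDeriv hg, ← d_anchor_d, d_neg]
    exact congrArg (fun a : ℝ => -a) (d_anchor_d f _ p.1)
  have e3 : ∀ i, fusionBracket M N B (fusionLift M N B f)
      (fun p => M.mfd.sndPull N.mfd p (N.iForm B p.2 (B.dualBasis i))) p = 0 := fun i => by
    rw [fusionBracket_skew hM hN, fusionBracket_snd_lift hM hN (hN.iForm_smooth _) hf, neg_zero]
  have e4 : ∑ i, ((-M.act (B.basis i) g p.1) • fusionBracket M N B (fusionLift M N B f)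
        (fun p => M.mfd.sndPull N.mfd p (N.iForm B p.2 (B.dualBasis i))) p +
        ((M.mfd.prod N.mfd).d (fun p => -M.act (B.basis i) g p.1) p
          (fusionAnchor M N B p (fusionLift M N B f p)) : ℝ) •
          M.mfd.sndPull N.mfd p (N.iForm B p.2 (B.dualBasis i))) =
      - M.mfd.sndPull N.mfd p (N.iForm B p.2 (hM.hamDeriv hg f p.1)) := by
    rw [N.iForm_eq_sum p.2 (hM.hamDeriv hg f p.1), map_sum, ← Finset.sum_neg_distrib]
    refine Finset.sum_congr rfl fun i _ => ?_
    rw [map_smul]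
    have key : ∀ {a b c : ℝ} {v w : (M.mfd.prod N.mfd).Cot p}, v = 0 → c = -b →
      (-a) • v + c • w = -(b • w) := fun h h' => by rw [h, h']; module
    exact key (e3 i) (e2 i)
  rw [fusionBracket_lift hM hN (fusionLift_smooth hM hN hf) hg, e4, fusionBracket_skew hM hN,
    fusionBracket_fst_lift hM hN hf hg, hM.rhoStar_cotBracket_d hf hg,
    hM.cotBracket_skew (M.mfd.d g), IsHamiltonian.lie_swap (M.rhoD B g p.1)]
  simp only [map_add, map_sub, map_neg]
  abel

end Hamiltonian
end HamData
end

section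

variable {EG : Type*} [NormedAddCommGroup EG] [NormedSpace ℝ EG] [FiniteDimensional ℝ EG]
  {HG : Type*} [TopologicalSpace HG] {IG : ModelWithCorners ℝ EG HG}
  {G : Type*} [TopologicalSpace G] [ChartedSpace HG G] [Group G] [LieGroup IG ∞ G]

namespace HamData

open SmoothManifold AlgebroidData

variable {M N P Q : HamData.{u} IG G} {B : InvariantForm IG G}

/-! ### The isomorphism `J` -/

theorem J_apply (p : M.mfd.carrier × N.mfd.carrier) (a : M.mfd.Cot p.1) (b : N.mfd.Cot p.2) :
    J B M N p (a, b) = M.mfd.fstPull N.mfd p a +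
      M.mfd.sndPull N.mfd p (b - N.iForm B p.2 (M.rhoStar B p.1 a)) := rfl

theorem J_d_apply {f : M.mfd.carrier → ℝ} (hf : M.mfd.SmoothFun f)
    (p : M.mfd.carrier × N.mfd.carrier) (b : N.mfd.Cot p.2) :
    J B M N p (M.mfd.d f p.1, b) = fusionLift M N B f p + M.mfd.sndPull N.mfd p b := by
  rw [J_apply, fusionLift_eq hf, map_sub]
  abel

theorem J_zero_apply (p : M.mfd.carrier × N.mfd.carrier) (b : N.mfd.Cot p.2) :
    J B M N p (M.mfd.d (fun _ => 0) p.1, b) = M.mfd.sndPull N.mfd p b := by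
  rw [J_apply, d_const, map_zero, map_zero, map_zero, sub_zero, zero_add]

theorem J_d_zero {f : M.mfd.carrier → ℝ} (hf : M.mfd.SmoothFun f)
    (p : M.mfd.carrier × N.mfd.carrier) :
    J B M N p (M.mfd.d f p.1, N.mfd.d (fun _ => 0) p.2) = fusionLift M N B f p := by
  rw [J_d_apply hf, d_const, map_zero, add_zero]

theorem fusionLift_add_sum {f : M.mfd.carrier → ℝ} (hf : M.mfd.SmoothFun f)
    (p : M.mfd.carrier × N.mfd.carrier) :
    fusionLift M N B f p + ∑ i, M.act (B.basis i) f p.1 •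
      M.mfd.sndPull N.mfd p (N.iForm B p.2 (B.dualBasis i)) =
      (M.mfd.prod N.mfd).d (fun p => f p.1) p := by
  rw [sum_act_smul_iForm, fusionLift_eq hf, sub_add_cancel, fstPull_d hf]

theorem fstPull_inlT (p : M.mfd.carrier × N.mfd.carrier) (a : M.mfd.Cot p.1) (v : M.mfd.T p.1) :
    (M.mfd.fstPull N.mfd p a (M.mfd.inlT N.mfd p v) : ℝ) = a v :=
  congrArg (fun v => (a v : ℝ)) (D_fst_inlT p v)

theorem fstPull_inrT (p : M.mfd.carrier × N.mfd.carrier) (a : M.mfd.Cot p.1) (w : N.mfd.T p.2) :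
    (M.mfd.fstPull N.mfd p a (M.mfd.inrT N.mfd p w) : ℝ) = 0 :=
  (congrArg (fun v => (a v : ℝ)) (D_fst_inrT p w)).trans
    (map_zero (show M.mfd.T p.1 →L[ℝ] ℝ from a))

theorem sndPull_inlT (p : M.mfd.carrier × N.mfd.carrier) (b : N.mfd.Cot p.2) (v : M.mfd.T p.1) :
    (M.mfd.sndPull N.mfd p b (M.mfd.inlT N.mfd p v) : ℝ) = 0 :=
  (congrArg (fun v => (b v : ℝ)) (D_snd_inlT p v)).trans
    (map_zero (show N.mfd.T p.2 →L[ℝ] ℝ from b))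

theorem sndPull_inrT (p : M.mfd.carrier × N.mfd.carrier) (b : N.mfd.Cot p.2) (w : N.mfd.T p.2) :
    (M.mfd.sndPull N.mfd p b (M.mfd.inrT N.mfd p w) : ℝ) = b w :=
  congrArg (fun v => (b v : ℝ)) (D_snd_inrT p w)

theorem prod_cot_ext {p : M.mfd.carrier × N.mfd.carrier} {c c' : (M.mfd.prod N.mfd).Cot p}
    (h₁ : ∀ v, (c (M.mfd.inlT N.mfd p v) : ℝ) = c' (M.mfd.inlT N.mfd p v))
    (h₂ : ∀ w, (c (M.mfd.inrT N.mfd p w) : ℝ) = c' (M.mfd.inrT N.mfd p w)) : c = c' := by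
  refine ContinuousLinearMap.ext fun v => ?_
  rw [← inlT_add_inrT p v]
  refine (map_add (show (M.mfd.prod N.mfd).T p →L[ℝ] ℝ from c) _ _).trans
    (Eq.trans ?_ (map_add (show (M.mfd.prod N.mfd).T p →L[ℝ] ℝ from c') _ _).symm)
  exact congrArg₂ (fun a b : ℝ => a + b) (h₁ _) (h₂ _)

theorem J_inlT (p : M.mfd.carrier × N.mfd.carrier) (a : M.mfd.Cot p.1) (b : N.mfd.Cot p.2)
    (v : M.mfd.T p.1) : (J B M N p (a, b) (M.mfd.inlT N.mfd p v) : ℝ) = a v :=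
  (congrArg₂ (fun a b : ℝ => a + b) (fstPull_inlT p a v) (sndPull_inlT p _ v)).trans (add_zero _)

theorem J_inrT (p : M.mfd.carrier × N.mfd.carrier) (a : M.mfd.Cot p.1) (b : N.mfd.Cot p.2)
    (w : N.mfd.T p.2) : (J B M N p (a, b) (M.mfd.inrT N.mfd p w) : ℝ) =
      b w - N.iForm B p.2 (M.rhoStar B p.1 a) w :=
  (congrArg₂ (fun a b : ℝ => a + b) (fstPull_inrT p a w) (sndPull_inrT p _ w)).trans (zero_add _)

/-- `J` is triangular with identities on the diagonal: the restriction to `M` recovers `α`, and then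
the restriction to `N` recovers `β`. -/
theorem J_bijective (p : M.mfd.carrier × N.mfd.carrier) : Function.Bijective (J B M N p) := by
  constructor
  · rintro ⟨a, b⟩ ⟨a', b'⟩ h
    have h1 : a = a' := ContinuousLinearMap.ext fun v => (J_inlT (B := B) p a b v).symm.trans
      ((congrArg (fun c : (M.mfd.prod N.mfd).Cot p => (c (M.mfd.inlT N.mfd p v) : ℝ)) h).trans
        (J_inlT p a' b' v))
    subst h1
    have h2 : b = b' := ContinuousLinearMap.ext fun w => sub_left_injective
      ((J_inrT (B := B) p a b w).symm.trans
      ((congrArg (fun c : (M.mfd.prod N.mfd).Cot p => (c (M.mfd.inrT N.mfd p w) : ℝ)) h).trans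
        (J_inrT p a b' w)))
    rw [h2]
  · intro c
    let a : M.mfd.Cot p.1 := (show (M.mfd.prod N.mfd).T p →L[ℝ] ℝ from c).comp (M.mfd.inlT N.mfd p)
    let b : N.mfd.Cot p.2 := (show (M.mfd.prod N.mfd).T p →L[ℝ] ℝ from c).comp (M.mfd.inrT N.mfd p)
    refine ⟨(a, b + N.iForm B p.2 (M.rhoStar B p.1 a)), prod_cot_ext (fun v => J_inlT p _ _ v)
      fun w => (J_inrT p _ _ w).trans ?_⟩
    exact add_sub_cancel_right (b w : ℝ) _

variable (B M N) in
/-- The map `J`, as a comorphism. -/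
abbrev comorphismJ : BundleComorphism ((M.fusion B N).cotangent B)
    ((M.cotangent B).prod (N.cotangent B)) where
  base := fun p => p
  fib := J B M N

theorem comorphismJ_pull_exSec {f : M.mfd.carrier → ℝ} (hf : M.mfd.SmoothFun f)
    (β : ∀ y, N.mfd.Cot y) :
    (comorphismJ M N B).pull (exSec (A := M.cotangent B) (B := N.cotangent B) (M.mfd.d f) β) =
      fun p : M.mfd.carrier × N.mfd.carrier =>
        fusionLift M N B f p + M.mfd.sndPull N.mfd p (β p.2) :=
  funext fun p => J_d_apply hf p (β p.2)

variable (B M N) in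
theorem attains_exSecs : ((M.cotangent B).prod (N.cotangent B)).Attains
    (exSecs M.mfd.exactForms N.mfd.exactForms) :=
  exactForms_attains.prod exactForms_attains

section Hamiltonian

variable (hM : M.IsHamiltonian B) (hN : N.IsHamiltonian B)
include hM hN

/-- The motion of `N` caused by a form from `M` is `ρ_N(ρ_M^*a)`, which is the anchor of the
subtracted form `i_N(ρ_M^*a)`. -/
theorem fusionAnchor_J (p : M.mfd.carrier × N.mfd.carrier) (a : M.mfd.Cot p.1)
    (b : N.mfd.Cot p.2) :
    fusionAnchor M N B p (J B M N p (a, b)) = M.mfd.inlT N.mfd p (M.cotAnchor B p.1 a) +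
      M.mfd.inrT N.mfd p (N.cotAnchor B p.2 b) := by
  have hadd : ∀ (c : (M.mfd.prod N.mfd).Cot p) v w, (c (v + w) : ℝ) = (c v : ℝ) + c w :=
    fun c v w => map_add (show (M.mfd.prod N.mfd).T p →L[ℝ] ℝ from c) v w
  rw [J_apply, map_add]
  refine prod_eq_of_d_eq (fun k hk => ?_) (fun k hk => ?_)
  · refine (hadd _ _ _).trans (Eq.trans ?_ (hadd _ _ _).symm)
    exact congrArg₂ (fun a b : ℝ => a + b)
      ((d_fst_fusionAnchor_fst hk p a).trans (d_fst_inlT hk p _).symm)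
      ((d_fst_fusionAnchor_snd hM hN hk p _).trans (d_fst_inrT hk p _).symm)
  · refine (hadd _ _ _).trans (Eq.trans ?_ (hadd _ _ _).symm)
    have e1 := d_snd_fusionAnchor_fst (B := B) hk p a
    have e0 : N.cotAnchor B p.2 (b - N.iForm B p.2 (M.rhoStar B p.1 a)) =
        N.cotAnchor B p.2 b - N.action (M.rhoStar B p.1 a) p.2 := by
      rw [map_sub, hN.cotAnchor_iForm]
    have e2 := (d_snd_fusionAnchor_snd (B := B) hk p
      (b - N.iForm B p.2 (M.rhoStar B p.1 a))).trans (congrArg (fun v => (N.mfd.d k p.2 v : ℝ)) e0)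
    have e3 : (N.mfd.d k p.2 (N.cotAnchor B p.2 b - N.action (M.rhoStar B p.1 a) p.2) : ℝ) =
        (N.mfd.d k p.2 (N.cotAnchor B p.2 b) : ℝ) - N.act (M.rhoStar B p.1 a) k p.2 :=
      map_sub (show N.mfd.T p.2 →L[ℝ] ℝ from N.mfd.d k p.2) _ _
    have key : ∀ {x y z w l r : ℝ}, x = z → y = w → w = r - z → l = 0 → x + y = l + r :=
      fun h h' h'' h''' => by rw [h, h', h'', h''']; ring
    refine key e1 e2 (e3.trans ?_) (d_snd_inlT hk p _)
    rw [d_snd_inrT hk]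

variable [IG.Boundaryless]

theorem fusionBracket_J {f f' : M.mfd.carrier → ℝ} {g g' : N.mfd.carrier → ℝ}
    (hf : M.mfd.SmoothFun f) (hf' : M.mfd.SmoothFun f') (hg : N.mfd.SmoothFun g)
    (hg' : N.mfd.SmoothFun g') (p : M.mfd.carrier × N.mfd.carrier) :
    fusionBracket M N B
        (fun p => fusionLift M N B f p + M.mfd.sndPull N.mfd p (N.mfd.d g p.2))
        (fun p => fusionLift M N B f' p + M.mfd.sndPull N.mfd p (N.mfd.d g' p.2)) p =
      J B M N p (M.cotBracket B (M.mfd.d f) (M.mfd.d f') p.1,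
        N.cotBracket B (N.mfd.d g) (N.mfd.d g') p.2) := by
  have l := fusionLift_smooth hM hN hf
  have l' := fusionLift_smooth hM hN hf'
  have s := sndPull_smooth (M := M.mfd) (smoothForm_d hg)
  have s' := sndPull_smooth (M := M.mfd) (smoothForm_d hg')
  have e1 := fusionBracket_lift_lift hM hN hf hf' p
  have e2 := fusionBracket_snd_snd hM hN (smoothForm_d hg) (smoothForm_d hg') p
  have e3 := fusionBracket_snd_lift hM hN (smoothForm_d hg) hf' p
  have e4 := fusionBracket_snd_lift hM hN (smoothForm_d hg') hf p
  rw [fusionBracket_add hM hN (smoothForm_add l s) l' s',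
    fusionBracket_skew hM hN _ (fusionLift M N B f'),
    fusionBracket_skew hM hN _ (fun p => M.mfd.sndPull N.mfd p (N.mfd.d g' p.2)),
    fusionBracket_add hM hN l' l s, fusionBracket_add hM hN s' l s, e4,
    fusionBracket_skew hM hN (fusionLift M N B f'), e1,
    fusionBracket_skew hM hN (fusionLift M N B f'), e3,
    fusionBracket_skew hM hN (fun p => M.mfd.sndPull N.mfd p (N.mfd.d g' p.2)), e2, J_apply,
    map_sub]
  abel

theorem isComorphism_J : (comorphismJ M N B).IsComorphism := by
  have hK := isHamiltonian_fusion hM hN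
  refine BundleComorphism.isComorphism_of_generates hK.isLieAlgebroid_cotangent
    (hM.isLieAlgebroid_cotangent.prod hN.isLieAlgebroid_cotangent)
    (attains_exSecs M N B).generates contMDiff_id ?_ ?_ ?_
  · rintro _ ⟨_, ⟨f, hf, rfl⟩, _, ⟨g, hg, rfl⟩, rfl⟩
    rw [comorphismJ_pull_exSec hf]
    exact smoothForm_add (fusionLift_smooth hM hN hf) (sndPull_smooth (smoothForm_d hg))
  · exact fun p v => (D_id_apply (M := M.mfd.prod N.mfd) p _).trans (fusionAnchor_J hM hN p v.1 v.2)
  · rintro _ ⟨_, ⟨f, hf, rfl⟩, _, ⟨g, hg, rfl⟩, rfl⟩ _ ⟨_, ⟨f', hf', rfl⟩, _, ⟨g', hg', rfl⟩, rfl⟩ p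
    refine (congrArg (fun s => (comorphismJ M N B).pull s p)
      (bracket_exSec (A := M.cotangent B) (B := N.cotangent B) _ _ _ _)).trans ((fusionBracket_J hM hN hf hf' hg hg' p).symm.trans ?_)
    exact congrArg₂ (fun s t => ((M.fusion B N).cotangent B).bracket s t p)
      (comorphismJ_pull_exSec hf _).symm (comorphismJ_pull_exSec hf' _).symm

/-- It is enough to find smooth preimages of generators: `pr₁^*df` comes from `(df, i_N(ρ_M^*df))`
and `pr₂^*dg` from `(0, dg)`. -/
theorem smoothSection_of_J {σ : ∀ p, ((M.cotangent B).prod (N.cotangent B)).V p}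
    {τ : ∀ p, (M.mfd.prod N.mfd).Cot p}
    (hστ : ∀ p : M.mfd.carrier × N.mfd.carrier, J B M N p (σ p) = τ p)
    (hτ : (M.mfd.prod N.mfd).SmoothForm τ) :
    ((M.cotangent B).prod (N.cotangent B)).SmoothSection σ := by
  let e := fun p => LinearEquiv.ofBijective (J B M N p) (J_bijective p)
  have he : ∀ p v c, J B M N p v = c → (e p).symm c = v := fun p v c h => by
    rw [← h]
    exact (e p).symm_apply_apply v
  have hσ : σ = fun p => (e p).symm (τ p) := funext fun p => (he p _ _ (hστ p)).symm
  -- The zero form is written as the differential of a constant, in the form in which `J_zero_apply`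
  -- and `J_d_zero` expect it.
  have zM : M.mfd.SmoothForm (M.mfd.d fun _ => 0) := smoothForm_d contMDiff_const
  have zN : N.mfd.SmoothForm (N.mfd.d fun _ => 0) := smoothForm_d contMDiff_const
  rw [hσ]
  refine smooth_of_generatesSections (V := (M.mfd.prod N.mfd).Cot)
    (V' := ((M.cotangent B).prod (N.cotangent B)).V)
    (M' := ((M.cotangent B).prod (N.cotangent B)).base.carrier)
    (I' := ((M.cotangent B).prod (N.cotangent B)).base.model) generatesSections_prodExactForms
    (φ := fun p => p) (by exact contMDiff_id) (fun p => (e p).symm.toLinearMap) ?_ τ hτ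
  rintro _ (⟨f, hf, rfl⟩ | ⟨g, hg, rfl⟩)
  · have h1 : ((M.cotangent B).prod (N.cotangent B)).SmoothSection (fun p =>
        exSec (A := M.cotangent B) (B := N.cotangent B) (M.mfd.d f) (N.mfd.d fun _ => 0) p +
        ∑ i, M.act (B.basis i) f (Prod.fst p) • exSec (A := M.cotangent B) (B := N.cotangent B)
          (M.mfd.d fun _ => 0) (fun y => N.iForm B y (B.dualBasis i)) p) :=
      SmoothSection.add (exSec_smooth (smoothForm_d hf) zN) (SmoothSection.sum _ fun i =>
        SmoothSection.smul
          (exSec_smooth (A := M.cotangent B) (B := N.cotangent B) zM (hN.iForm_smooth _))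
          (smoothFun_fst (hM.act_smooth _ hf)))
    refine ContMDiff.congr h1 fun p => congrArg (TotalSpace.mk
      (F := ((M.cotangent B).prod (N.cotangent B)).F)
      (E := ((M.cotangent B).prod (N.cotangent B)).V) p) (he p _ _ ?_)
    refine (map_add (J B M N p) _ _).trans ?_
    refine (congrArg₂ (fun a b : (M.mfd.prod N.mfd).Cot p => a + b) (J_d_zero hf p)
      ((map_sum (J B M N p) _ _).trans (Finset.sum_congr rfl fun i _ =>
        (map_smul (J B M N p) _ _).trans (congrArg _ (J_zero_apply p _))))).trans ?_
    exact fusionLift_add_sum hf p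
  · have h1 := exSec_smooth (A := M.cotangent B) (B := N.cotangent B) zM (smoothForm_d hg)
    refine ContMDiff.congr h1 fun p => congrArg (TotalSpace.mk
      (F := ((M.cotangent B).prod (N.cotangent B)).F)
      (E := ((M.cotangent B).prod (N.cotangent B)).V) p) (he p _ _ ?_)
    exact (J_zero_apply p _).trans (sndPull_d hg p)

theorem isLieAlgebroidIso_J :
    IsLieAlgebroidIso (A := (M.cotangent B).prod (N.cotangent B))
      (B := (M.fusion B N).cotangent B)
      (Diffeomorph.refl (M.mfd.prod N.mfd).model (M.mfd.prod N.mfd).carrier ∞) (J B M N) where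
  bijective p := J_bijective p
  smooth σ τ h := by
    refine ⟨fun hσ => ?_, fun hτ => smoothSection_of_J hM hN h hτ⟩
    have h1 := (isComorphism_J hM hN).pull_smooth σ hσ
    have h2 : (comorphismJ M N B).pull σ = τ := funext h
    exact h2 ▸ h1
  anchor p v := (D_id_apply (M := M.mfd.prod N.mfd) p _).trans (fusionAnchor_J hM hN p v.1 v.2).symm
  bracket σ₁ σ₂ τ₁ τ₂ h₁ h₂ e₁ e₂ p := by
    have h := congrFun ((isComorphism_J hM hN).bracket σ₁ σ₂ h₁ h₂) p
    have h3 : (comorphismJ M N B).pull σ₁ = τ₁ := funext e₁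
    have h4 : (comorphismJ M N B).pull σ₂ = τ₂ := funext e₂
    rw [h3, h4] at h
    exact h

end Hamiltonian
end HamData
end

section

variable {EG : Type*} [NormedAddCommGroup EG] [NormedSpace ℝ EG] [FiniteDimensional ℝ EG]
  {HG : Type*} [TopologicalSpace HG] {IG : ModelWithCorners ℝ EG HG}
  {G : Type*} [TopologicalSpace G] [ChartedSpace HG G] [Group G] [LieGroup IG ∞ G]

namespace HamData

open SmoothManifold AlgebroidData

variable {M N P Q : HamData.{u} IG G} {B : InvariantForm IG G}

/-! ### The Maurer-Cartan form under translations. -/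

theorem thetaL_dLeft (g h : G) (v : TangentSpace IG h) :
    thetaL (g * h) (dLeft g h v) = thetaL h v := by
  conv_lhs => rw [← mulInvariantVectorField_thetaL h v, dLeft_mulInvariantVectorField]
  exact thetaL_mulInvariantVectorField _ _

/-- Right translation by `h` acts on `θ^L` by `Ad(h⁻¹)`, expressed here through right-invariant
fields. -/
theorem thetaL_dRight (g h : G) (v : TangentSpace IG g) :
    thetaL (g * h) (dRight h g v) = thetaL h (rightInvariantVectorField (thetaL g v) h) := by
  conv_lhs => rw [← mulInvariantVectorField_thetaL g v, dRight_mulInvariantVectorField,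
    ← dLeft_rightInvariantVectorField]
  exact thetaL_dLeft g h _

/-! ### The forms `i(ξ)` on fusion products -/

theorem fusion_iForm_inlT (hM : M.IsHamiltonian B) (hN : N.IsHamiltonian B)
    (p : M.mfd.carrier × N.mfd.carrier) (ξ : GroupLieAlgebra IG G) (v : M.mfd.T p.1) :
    ((M.fusion B N).iForm B p ξ (M.mfd.inlT N.mfd p v) : ℝ) = M.iForm B p.1 ξ v :=
  (congrArg (fun w => B.form ξ (thetaL (N.moment p.2 * M.moment p.1) w))
    (fusion_dMoment_inlT hM hN p v)).trans (congrArg (B.form ξ) (thetaL_dLeft _ _ _))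

theorem form_rhoStar_iForm (hM : M.IsHamiltonian B) (x : M.mfd.carrier)
    (ξ η : GroupLieAlgebra IG G) :
    B.form (M.rhoStar B x (M.iForm B x ξ)) η =
      B.form ξ η - B.form ξ (thetaL (M.moment x) (rightInvariantVectorField η (M.moment x))) := by
  refine (rhoStar_comp_dMoment hM x ((B.flat ξ).comp (thetaL (M.moment x))) η).trans ?_
  exact congrArg (fun ζ => B.form ξ ζ - B.form ξ (thetaL (M.moment x)
    (rightInvariantVectorField η (M.moment x)))) (thetaL_mulInvariantVectorField η (M.moment x))

/-- By `form_rhoStar_iForm` the defect of `ξ` under the adjoint action of `Φ_M` is `ρ_M^* i_M(ξ)`.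
Together with `fusion_iForm_inlT` this identifies `i(ξ)` on the fusion product with `J(i_M(ξ),
i_N(ξ))`. -/
theorem fusion_iForm_inrT (hM : M.IsHamiltonian B) (hN : N.IsHamiltonian B)
    (p : M.mfd.carrier × N.mfd.carrier) (ξ : GroupLieAlgebra IG G) (w : N.mfd.T p.2) :
    ((M.fusion B N).iForm B p ξ (M.mfd.inrT N.mfd p w) : ℝ) =
      N.iForm B p.2 ξ w - N.iForm B p.2 (M.rhoStar B p.1 (M.iForm B p.1 ξ)) w := by
  refine (congrArg (fun w => B.form ξ (thetaL (N.moment p.2 * M.moment p.1) w))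
    (fusion_dMoment_inrT hM hN p w)).trans ((congrArg (B.form ξ) (thetaL_dRight _ _ _)).trans ?_)
  rw [iForm_apply, iForm_apply, form_rhoStar_iForm hM, sub_sub_cancel]

theorem pullCot_iForm (hN : N.IsHamiltonian B) {f : M.mfd.carrier → N.mfd.carrier}
    (hf : IsMorphism (M := M) (N := N) f) (x : M.mfd.carrier) (ξ : GroupLieAlgebra IG G) :
    M.mfd.pullCot N.mfd f x (N.iForm B (f x) ξ) = M.iForm B x ξ := by
  refine ContinuousLinearMap.ext fun v => ?_
  have h1 := mfderiv_comp x (hN.moment_smooth.mdifferentiableAt (by simp))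
    (hf.smooth.mdifferentiableAt (by simp))
  have h2 : N.moment ∘ f = M.moment := funext hf.moment
  -- The equality of the two moment maps changes the point at which `θ^L` is taken, so the map is
  -- made a variable before substituting.
  have h3 : ∀ μ : M.mfd.carrier → G, μ = M.moment →
      B.form ξ (thetaL (μ x) (mfderiv M.mfd.model IG μ x v)) = (M.iForm B x ξ v : ℝ) := by
    rintro _ rfl
    rfl
  exact (congrArg (fun L : M.mfd.E →L[ℝ] EG =>
    B.form ξ (thetaL (N.moment (f x)) (show EG from L v))) h1.symm).trans (h3 _ h2)

/-! ### Naturality and coherence of `J` -/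

/-- Pullback along a morphism preserves `ρ^*` because the actions are related, and it preserves the
forms `i(ξ)` because the moment maps are. -/
theorem J_natural (hQ : Q.IsHamiltonian B)
    {f : M.mfd.carrier → P.mfd.carrier} {g : N.mfd.carrier → Q.mfd.carrier}
    (hf : IsMorphism (M := M) (N := P) f) (hg : IsMorphism (M := N) (N := Q) g)
    (p : M.mfd.carrier × N.mfd.carrier) (a : P.mfd.Cot (f p.1)) (b : Q.mfd.Cot (g p.2)) :
    J B M N p (M.mfd.pullCot P.mfd f p.1 a, N.mfd.pullCot Q.mfd g p.2 b) =
      (M.mfd.prod N.mfd).pullCot (P.mfd.prod Q.mfd) (fun p => (f p.1, g p.2)) p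
        (J B P Q (f p.1, g p.2) (a, b)) := by
  have hfg : (M.mfd.prod N.mfd).Smooth (P.mfd.prod Q.mfd) (fun p => (f p.1, g p.2)) :=
    (hf.smooth.comp contMDiff_fst).prodMk (hg.smooth.comp contMDiff_snd)
  have h1 : ∀ c : P.mfd.Cot (f p.1), M.mfd.fstPull N.mfd p (M.mfd.pullCot P.mfd f p.1 c) =
      (M.mfd.prod N.mfd).pullCot (P.mfd.prod Q.mfd) (fun p => (f p.1, g p.2)) p
        (P.mfd.fstPull Q.mfd (f p.1, g p.2) c) := fun c =>
    (pullCot_comp hf.smooth (smooth_fst (M := M.mfd) (N := N.mfd)) p c).symm.trans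
      (pullCot_comp (smooth_fst (M := P.mfd) (N := Q.mfd)) hfg p c)
  have h2 : ∀ c : Q.mfd.Cot (g p.2), M.mfd.sndPull N.mfd p (N.mfd.pullCot Q.mfd g p.2 c) =
      (M.mfd.prod N.mfd).pullCot (P.mfd.prod Q.mfd) (fun p => (f p.1, g p.2)) p
        (P.mfd.sndPull Q.mfd (f p.1, g p.2) c) := fun c =>
    (pullCot_comp hg.smooth (smooth_snd (M := M.mfd) (N := N.mfd)) p c).symm.trans
      (pullCot_comp (smooth_snd (M := P.mfd) (N := Q.mfd)) hfg p c)
  rw [J_apply, hf.toMap.rhoStar_pullCot, ← pullCot_iForm hQ hg, ← map_sub, h1]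
  refine (congrArg _ (h2 _)).trans ?_
  rw [← map_add]
  rfl

theorem rhoStar_J (p : M.mfd.carrier × N.mfd.carrier) (a : M.mfd.Cot p.1) (b : N.mfd.Cot p.2) :
    (M.fusion B N).rhoStar B p (J B M N p (a, b)) =
      M.rhoStar B p.1 a + N.rhoStar B p.2 (b - N.iForm B p.2 (M.rhoStar B p.1 a)) := by
  refine (fusion_rhoStar p _).trans (congrArg₂ (fun ξ η => M.rhoStar B p.1 ξ + N.rhoStar B p.2 η)
    (ContinuousLinearMap.ext fun v => J_inlT p a b v)
    (ContinuousLinearMap.ext fun w => J_inrT p a b w))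

/-- Reassociation. -/
abbrev assocMap (M N P : SmoothManifold.{u}) (p : (M.carrier × N.carrier) × P.carrier) :
    M.carrier × N.carrier × P.carrier := (p.1.1, p.1.2, p.2)

theorem smooth_assocMap (M N P : SmoothManifold.{u}) :
    ((M.prod N).prod P).Smooth (M.prod (N.prod P)) (assocMap M N P) :=
  (contMDiff_fst.comp contMDiff_fst).prodMk ((contMDiff_snd.comp contMDiff_fst).prodMk contMDiff_snd)

theorem D_assocMap_inlT_inlT {M N P : SmoothManifold.{u}}
    (p : (M.carrier × N.carrier) × P.carrier) (v : M.T p.1.1) :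
    ((M.prod N).prod P).D (M.prod (N.prod P)) (assocMap M N P) p
      ((M.prod N).inlT P p (M.inlT N p.1 v)) = M.inlT (N.prod P) (assocMap M N P p) v := by
  have h1 := D_comp (smooth_assocMap M N P) (smooth_inl (M := M.prod N) (N := P) p.2) p.1
  have h2 := D_comp ((smooth_assocMap M N P).comp (smooth_inl (M := M.prod N) (N := P) p.2))
    (smooth_inl (M := M) (N := N) p.1.2) p.1.1
  refine (congrArg (fun L : M.E × N.E →L[ℝ] M.E × N.E × P.E => L (M.inlT N p.1 v)) h1.symm).trans ?_
  exact congrArg (fun L : M.E →L[ℝ] M.E × N.E × P.E => L v) h2.symm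

theorem D_assocMap_inlT_inrT {M N P : SmoothManifold.{u}}
    (p : (M.carrier × N.carrier) × P.carrier) (v : N.T p.1.2) :
    ((M.prod N).prod P).D (M.prod (N.prod P)) (assocMap M N P) p
      ((M.prod N).inlT P p (M.inrT N p.1 v)) =
        M.inrT (N.prod P) (assocMap M N P p) (N.inlT P (p.1.2, p.2) v) := by
  have h1 := D_comp (smooth_assocMap M N P) (smooth_inl (M := M.prod N) (N := P) p.2) p.1
  have h2 := D_comp ((smooth_assocMap M N P).comp (smooth_inl (M := M.prod N) (N := P) p.2))
    (smooth_inr (M := M) (N := N) p.1.1) p.1.2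
  have h3 := D_comp (smooth_inr (M := M) (N := N.prod P) p.1.1)
    (smooth_inl (M := N) (N := P) p.2) p.1.2
  refine (congrArg (fun L : M.E × N.E →L[ℝ] M.E × N.E × P.E => L (M.inrT N p.1 v)) h1.symm).trans ?_
  exact congrArg (fun L : N.E →L[ℝ] M.E × N.E × P.E => L v) (h2.symm.trans h3)

theorem D_assocMap_inrT {M N P : SmoothManifold.{u}}
    (p : (M.carrier × N.carrier) × P.carrier) (v : P.T p.2) :
    ((M.prod N).prod P).D (M.prod (N.prod P)) (assocMap M N P) p ((M.prod N).inrT P p v) =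
      M.inrT (N.prod P) (assocMap M N P p) (N.inrT P (p.1.2, p.2) v) := by
  have h1 := D_comp (smooth_assocMap M N P) (smooth_inr (M := M.prod N) (N := P) p.1) p.2
  have h3 := D_comp (smooth_inr (M := M) (N := N.prod P) p.1.1)
    (smooth_inr (M := N) (N := P) p.1.2) p.2
  exact congrArg (fun L : P.E →L[ℝ] M.E × N.E × P.E => L v) (h1.symm.trans h3)

/-- The covectors are compared on the three factors. On `M` both give `a`, and on `N` both subtract
`i_N(ρ_M^*a)`. On `P` one side subtracts `i_P` of `ρ^*J(a, b)`, the other subtracts in two stages;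
they agree by `rhoStar_J` and `fusion_iForm_inrT`. -/
theorem J_assoc (hN : N.IsHamiltonian B) (hP : P.IsHamiltonian B)
    (p : (M.mfd.carrier × N.mfd.carrier) × P.mfd.carrier) (a : M.mfd.Cot p.1.1)
    (b : N.mfd.Cot p.1.2) (c : P.mfd.Cot p.2) :
    J B (M.fusion B N) P p (J B M N p.1 (a, b), c) =
      ((M.mfd.prod N.mfd).prod P.mfd).pullCot (M.mfd.prod (N.mfd.prod P.mfd))
        (assocMap M.mfd N.mfd P.mfd) p
        (J B M (N.fusion B P) (assocMap M.mfd N.mfd P.mfd p) (a, J B N P (p.1.2, p.2) (b, c))) := by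
  let R : (M.mfd.prod (N.mfd.prod P.mfd)).Cot (assocMap M.mfd N.mfd P.mfd p) :=
    J B M (N.fusion B P) (assocMap M.mfd N.mfd P.mfd p) (a, J B N P (p.1.2, p.2) (b, c))
  have hR : ∀ {v w}, v = w → (R v : ℝ) = R w := fun h => congrArg (fun v => (R v : ℝ)) h
  refine prod_cot_ext (M := M.fusion B N) (N := P) (p := p) (fun v => ?_) fun w => ?_
  · refine (J_inlT (M := M.fusion B N) (B := B) p _ c v).trans ?_
    -- On directions tangent to the first two factors, both sides are covectors on `M × N`, which
    -- are again compared factor by factor.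
    refine congrArg (fun e : (M.mfd.prod N.mfd).Cot p.1 => (e v : ℝ)) (a₂ :=
      (show ((M.mfd.prod N.mfd).prod P.mfd).T p →L[ℝ] ℝ from
        ((M.mfd.prod N.mfd).prod P.mfd).pullCot (M.mfd.prod (N.mfd.prod P.mfd))
        (assocMap M.mfd N.mfd P.mfd) p R).comp ((M.mfd.prod N.mfd).inlT P.mfd p)) ?_
    refine prod_cot_ext (M := M) (N := N) (fun v => ?_) fun w => ?_
    · exact (J_inlT p.1 a b v).trans ((hR (D_assocMap_inlT_inlT p v)).trans
        (J_inlT (N := N.fusion B P) (B := B) (assocMap M.mfd N.mfd P.mfd p) a _ v)).symm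
    · refine (J_inrT p.1 a b w).trans ((hR (D_assocMap_inlT_inrT p w)).trans
        ((J_inrT (N := N.fusion B P) (B := B) (assocMap M.mfd N.mfd P.mfd p) a _ _).trans ?_)).symm
      exact congrArg₂ (fun x y : ℝ => x - y) (J_inlT (p.1.2, p.2) b c w)
        (fusion_iForm_inlT hN hP (p.1.2, p.2) _ w)
  · refine (J_inrT (M := M.fusion B N) (B := B) p _ c w).trans ((hR (D_assocMap_inrT p w)).trans
        ((J_inrT (N := N.fusion B P) (B := B) (assocMap M.mfd N.mfd P.mfd p) a _ _).trans ?_)).symm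
    refine (congrArg₂ (fun x y : ℝ => x - y) (J_inrT (p.1.2, p.2) b c w)
        (fusion_iForm_inrT hN hP (p.1.2, p.2) _ w)).trans ?_
    refine Eq.trans ?_ (congrArg (fun ξ => (c w : ℝ) - P.iForm B p.2 ξ w) (rhoStar_J p.1 a b)).symm
    have key : ∀ ξ η ζ : GroupLieAlgebra IG G, (P.iForm B p.2 (ξ + (η - ζ)) w : ℝ) =
        (P.iForm B p.2 ξ w : ℝ) + (P.iForm B p.2 η w - P.iForm B p.2 ζ w) := fun ξ η ζ => by
      rw [map_add, map_sub]
      rfl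
    have e : ∀ {c x y z t : ℝ}, t = x + (y - z) → c - y - (x - z) = c - t := fun h => by
      rw [h]; ring
    refine e (Eq.trans ?_ (key _ _ _))
    rw [map_sub]

end HamData
end

section

variable {EG : Type*} [NormedAddCommGroup EG] [NormedSpace ℝ EG] [FiniteDimensional ℝ EG]
  {HG : Type*} [TopologicalSpace HG] {IG : ModelWithCorners ℝ EG HG}
  {G : Type*} [TopologicalSpace G] [ChartedSpace HG G] [Group G] [LieGroup IG ∞ G]

namespace HamData

open SmoothManifold AlgebroidData

variable {M N P Q : HamData.{u} IG G} {B : InvariantForm IG G}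

/-! ### The monoidal structure on the cotangent functor -/

variable (M N B) in
/-- The inverse of `J`, as a comorphism. -/
def comorphismJInv : BundleComorphism ((M.cotangent B).prod (N.cotangent B))
    ((M.fusion B N).cotangent B) where
  base := fun p => p
  fib := fun p => (LinearEquiv.ofBijective (J B M N p) (J_bijective p)).symm.toLinearMap

theorem J_comorphismJInv (p : M.mfd.carrier × N.mfd.carrier) (c : (M.mfd.prod N.mfd).Cot p) :
    J B M N p ((comorphismJInv M N B).fib p c) = c :=
  (LinearEquiv.ofBijective (J B M N p) (J_bijective p)).apply_symm_apply c

theorem comorphismJInv_J (p : M.mfd.carrier × N.mfd.carrier) (v : M.mfd.Cot p.1 × N.mfd.Cot p.2) :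
    (comorphismJInv M N B).fib p (J B M N p v) = v :=
  (LinearEquiv.ofBijective (J B M N p) (J_bijective p)).symm_apply_apply v

theorem isComorphism_JInv [IG.Boundaryless] (hM : M.IsHamiltonian B) (hN : N.IsHamiltonian B) :
    (comorphismJInv M N B).IsComorphism where
  base_smooth := contMDiff_id
  pull_smooth σ hσ := smoothSection_of_J hM hN (fun p => J_comorphismJInv p (σ p)) hσ
  anchor p c := by
    have h1 := fusionAnchor_J hM hN p ((comorphismJInv M N B).fib p c).1
      ((comorphismJInv M N B).fib p c).2
    have h2 : fusionAnchor M N B p (J B M N p ((comorphismJInv M N B).fib p c)) =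
        fusionAnchor M N B p c := congrArg (fusionAnchor M N B p) (J_comorphismJInv p c)
    exact (D_id_apply (M := M.mfd.prod N.mfd) p _).trans (h1.symm.trans h2)
  bracket σ τ hσ hτ := by
    have s := smoothSection_of_J hM hN (fun p => J_comorphismJInv p (σ p)) hσ
    have t := smoothSection_of_J hM hN (fun p => J_comorphismJInv p (τ p)) hτ
    have h := (isComorphism_J hM hN).bracket _ _ s t
    have hσ' : (comorphismJ M N B).pull ((comorphismJInv M N B).pull σ) = σ :=
      funext fun p => J_comorphismJInv p (σ p)
    have hτ' : (comorphismJ M N B).pull ((comorphismJInv M N B).pull τ) = τ :=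
      funext fun p => J_comorphismJInv p (τ p)
    have h' := h.trans (congrArg₂ ((M.fusion B N).cotangent B).bracket hσ' hτ')
    funext p
    exact (congrArg ((comorphismJInv M N B).fib p) (congrFun h' p).symm).trans
      (comorphismJInv_J p _)

instance subsingleton_point_Cot (x : (HamData.point.{u} : HamData IG G).mfd.carrier) :
    Subsingleton ((HamData.point.{u} : HamData IG G).mfd.Cot x) :=
  ⟨fun a b => ContinuousLinearMap.ext fun v => by
    refine (congrArg (fun v => (a v : ℝ)) (Subsingleton.elim v 0)).trans ?_
    refine ((map_zero (show (HamData.point.{u} : HamData IG G).mfd.T x →L[ℝ] ℝ from a)).trans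
      (map_zero (show (HamData.point.{u} : HamData IG G).mfd.T x →L[ℝ] ℝ from b)).symm).trans ?_
    exact congrArg (fun v => (b v : ℝ)) (Subsingleton.elim 0 v)⟩

theorem J_point_left (x : M.mfd.carrier) (b : M.mfd.Cot x) :
    M.mfd.pullCot (SmoothManifold.point.prod M.mfd) (fun x => (PUnit.unit, x)) x
      (J B HamData.point M (PUnit.unit, x) (0, b)) = b := by
  refine ContinuousLinearMap.ext fun w => ?_
  refine (J_inrT (M := HamData.point) (N := M) (B := B) (PUnit.unit, x) 0 b w).trans ?_
  rw [map_zero, map_zero]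
  exact sub_zero _

theorem J_point_right (x : M.mfd.carrier) (a : M.mfd.Cot x) :
    M.mfd.pullCot (M.mfd.prod SmoothManifold.point) (fun x => (x, PUnit.unit)) x
      (J B M HamData.point (x, PUnit.unit) (a, 0)) = a :=
  ContinuousLinearMap.ext fun v =>
    J_inlT (M := M) (N := HamData.point) (B := B) (x, PUnit.unit) a 0 v

variable (B) in
/-- The comorphism from the cotangent bundle of a point to the zero Lie algebroid. -/
def pointToUnit : BundleComorphism ((HamData.point.{u} : HamData IG G).cotangent B)
    AlgebroidData.unit.{u} where
  base := fun x => x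
  fib _ := 0

variable (B) in
/-- The comorphism from the zero Lie algebroid to the cotangent bundle of a point. -/
def unitToPoint : BundleComorphism AlgebroidData.unit.{u}
    ((HamData.point.{u} : HamData IG G).cotangent B) where
  base := fun x => x
  fib _ := 0

theorem isComorphism_pointToUnit : (pointToUnit.{u} B).IsComorphism where
  base_smooth := contMDiff_id
  pull_smooth _ _ := contMDiff_zeroSection ℝ ((HamData.point.{u} : HamData IG G).cotangent B).V
  anchor _ _ := Subsingleton.elim (α := AlgebroidData.unit.base.T PUnit.unit) _ _
  bracket _ _ _ _ := funext fun x => subsingleton_point_Cot (IG := IG) (G := G) x |>.elim _ _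

theorem isComorphism_unitToPoint : (unitToPoint.{u} B).IsComorphism where
  base_smooth := contMDiff_id
  pull_smooth _ _ := contMDiff_zeroSection ℝ AlgebroidData.unit.{u}.V
  anchor x _ := subsingleton_point_T (IG := IG) (G := G) x |>.elim _ _
  bracket _ _ _ _ := rfl

end HamData

/-- With the base map shared definitionally, equality is a fibrewise statement and no heterogeneous
equality of fibre maps arises. -/
theorem Comorphism.ext_fib {A A' : LieAlgebroid.{u}} {φ : A.data.base.carrier → A'.data.base.carrier}
    {L L' : ∀ x, A'.data.V (φ x) →ₗ[ℝ] A.data.V x} {h : BundleComorphism.IsComorphism ⟨φ, L⟩}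
    {h' : BundleComorphism.IsComorphism ⟨φ, L'⟩} (e : ∀ x v, L x v = L' x v) :
    (⟨⟨φ, L⟩, h⟩ : Comorphism A A') = ⟨⟨φ, L'⟩, h'⟩ := by
  obtain rfl : L = L' := funext fun x => LinearMap.ext (e x)
  rfl

open SmoothManifold HamData MonoidalCategory

variable {B : InvariantForm IG G}

/-- `J`, as an isomorphism of Lie algebroids. -/
def isoJ [IG.Boundaryless] (hF : FusionWellDefined.{u} B) (hP : ProductWellDefined.{u})
    (hT : CotangentWellDefined.{u} B) (M N : HamQPoisson.{u} B) :
    (⟨(M.data.fusion B N.data).cotangent B, hT.obj ⟨_, hF.fusion M N⟩⟩ : LieAlgebroid.{u}) ≅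
      ⟨(M.data.cotangent B).prod (N.data.cotangent B), hP.prod ⟨_, hT.obj M⟩ ⟨_, hT.obj N⟩⟩ where
  hom := ⟨comorphismJ M.data N.data B, isComorphism_J M.isHamiltonian N.isHamiltonian⟩
  inv := ⟨comorphismJInv M.data N.data B, isComorphism_JInv M.isHamiltonian N.isHamiltonian⟩
  hom_inv_id := Comorphism.ext_fib fun p c => J_comorphismJInv p c
  inv_hom_id := Comorphism.ext_fib fun p v => comorphismJInv_J p v

/-- The cotangent bundle of a point is the zero Lie algebroid. -/
def isoUnit (hF : FusionWellDefined.{u} B) (hP : ProductWellDefined.{u})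
    (hT : CotangentWellDefined.{u} B) :
    (⟨(HamData.point.{u} : HamData IG G).cotangent B, hT.obj ⟨_, hF.point⟩⟩ : LieAlgebroid.{u}) ≅
      ⟨AlgebroidData.unit, hP.unit⟩ where
  hom := ⟨pointToUnit B, isComorphism_pointToUnit⟩
  inv := ⟨unitToPoint B, isComorphism_unitToPoint⟩
  hom_inv_id := Comorphism.ext_fib fun p _ => (subsingleton_point_Cot p).elim _ _
  inv_hom_id := rfl

/-- The oplax monoidal structure on the cotangent functor given by `J`. -/
abbrev cotangentOplax [IG.Boundaryless] (hF : FusionWellDefined.{u} B)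
    (hP : ProductWellDefined.{u}) (hT : CotangentWellDefined.{u} B) :
    letI : MonoidalCategory (HamQPoisson.{u} B) := fusionMonoidal hF
    letI : MonoidalCategory LieAlgebroid.{u} := productMonoidal hP
    (cotangentFunctor hT).OplaxMonoidal :=
  letI : MonoidalCategory (HamQPoisson.{u} B) := fusionMonoidal hF
  letI : MonoidalCategory LieAlgebroid.{u} := productMonoidal hP
  { η := (isoUnit hF hP hT).hom
    δ := fun M N => (isoJ hF hP hT M N).hom
    -- Whiskering is the product with an identity morphism, so the pullback along the identity is
    -- inserted to apply `J_natural`.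
    δ_natural_left := fun {M M'} f N => Comorphism.ext_fib fun p v =>
      (congrArg (fun b => J B M.data N.data p (M.data.mfd.pullCot M'.data.mfd f.toFun p.1 v.1, b))
        (N.data.mfd.pullCot_id p.2 v.2).symm).trans
      (J_natural N.isHamiltonian f.isMorphism N.data.isMorphism_id p v.1 v.2)
    δ_natural_right := fun {N N'} M g => Comorphism.ext_fib fun p v =>
      (congrArg (fun a => J B M.data N.data p (a, N.data.mfd.pullCot N'.data.mfd g.toFun p.2 v.2))
        (M.data.mfd.pullCot_id p.1 v.1).symm).trans
      (J_natural N'.isHamiltonian M.data.isMorphism_id g.isMorphism p v.1 v.2)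
    oplax_associativity := fun M N P => Comorphism.ext_fib fun p v =>
      J_assoc (M := M.data) N.isHamiltonian P.isHamiltonian p v.1 v.2.1 v.2.2
    oplax_left_unitality := fun M => Comorphism.ext_fib fun x v =>
      (J_point_left (M := M.data) x v.2).symm
    oplax_right_unitality := fun M => Comorphism.ext_fib fun x v =>
      (J_point_right (M := M.data) x v.1).symm }

/-- The strong monoidal structure on the cotangent functor given by `J`. -/
theorem exists_monoidal_cotangentFunctor [IG.Boundaryless] (hF : FusionWellDefined.{u} B)
    (hP : ProductWellDefined.{u}) (hT : CotangentWellDefined.{u} B) :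
    letI : MonoidalCategory (HamQPoisson.{u} B) := fusionMonoidal hF
    letI : MonoidalCategory LieAlgebroid.{u} := productMonoidal hP
    ∃ _ : (cotangentFunctor hT).Monoidal, ∀ M N : HamQPoisson.{u} B,
      (Functor.OplaxMonoidal.δ (cotangentFunctor hT) M N).toBundle =
        { base := fun p => p, fib := J B M.data N.data } := by
  let : MonoidalCategory (HamQPoisson.{u} B) := fusionMonoidal hF
  let : MonoidalCategory LieAlgebroid.{u} := productMonoidal hP
  let := cotangentOplax hF hP hT
  -- An oplax structure whose unit and product comparisons are invertible is strong.
  have : IsIso (Functor.OplaxMonoidal.η (cotangentFunctor hT)) :=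
    inferInstanceAs (IsIso (isoUnit hF hP hT).hom)
  have : ∀ M N : HamQPoisson.{u} B, IsIso (Functor.OplaxMonoidal.δ (cotangentFunctor hT) M N) :=
    fun M N => inferInstanceAs (IsIso (isoJ hF hP hT M N).hom)
  exact ⟨Functor.Monoidal.ofOplaxMonoidal (cotangentFunctor hT), fun M N => rfl⟩

end

end QuasiPoisson

end

open QuasiPoisson CategoryTheory in
open scoped Manifold ContDiff in
theorem proposition1p14
    {EG : Type*} [NormedAddCommGroup EG] [NormedSpace ℝ EG] [FiniteDimensional ℝ EG]
    {HG : Type*} [TopologicalSpace HG] (IG : ModelWithCorners ℝ EG HG) [IG.Boundaryless]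
    (G : Type*) [TopologicalSpace G] [ChartedSpace HG G] [Group G] [LieGroup IG ∞ G]
    (B : InvariantForm IG G) :
    ∃ (hF : FusionWellDefined.{u} B) (hP : ProductWellDefined.{u})
      (hT : CotangentWellDefined.{u} B),
      letI : MonoidalCategory (HamQPoisson.{u} B) := fusionMonoidal hF
      letI : MonoidalCategory LieAlgebroid.{u} := productMonoidal hP
      (∀ M N : HamQPoisson.{u} B,
        IsLieAlgebroidIso (A := (M.data.cotangent B).prod (N.data.cotangent B))
          (B := (M.data.fusion B N.data).cotangent B)
          (Diffeomorph.refl (M.data.mfd.prod N.data.mfd).model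
            (M.data.mfd.prod N.data.mfd).carrier ∞)
          (J B M.data N.data)) ∧
      ∃ _ : (cotangentFunctor hT).Monoidal, ∀ M N : HamQPoisson.{u} B,
        (Functor.OplaxMonoidal.δ (cotangentFunctor hT) M N).toBundle =
          { base := fun p => p, fib := J B M.data N.data } := by
  refine ⟨fusionWellDefined B, productWellDefined, cotangentWellDefined B, fun M N => ?_, ?_⟩
  · exact HamData.isLieAlgebroidIso_J M.isHamiltonian N.isHamiltonian
  · exact exists_monoidal_cotangentFunctor _ _ _
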